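/- Let $N$ be a Kähler–Einstein surface: a (Hausdorff, second countable) complex manifold of complex dimension $2$ with complex structure $J$ and a smooth hermitian Riemannian metric $g$ whose fundamental form $\omega$, $\omega(v,w)=g(Jv,w)$ (so $\omega(v,Jw)=g(v,w)$), is closed, and such that $\mathrm{Ric}=c\,g$ for a constant $c\in\mathbb{R}$. Let $\Sigma$ be a compact smooth surface without boundary and let $\ell:\Sigma\to N$ be a branched lagrangian immersion, that is: $\ell$ is smooth, $\ell^*\omega=0$, and each $p\in\Sigma$ is either a point where $d\ell_p$ is injective or a branch point, meaning that there are an integer $m\ge 2$, a smooth complex coordinate $z$ on $\Sigma$ centred at $p$ and, in coordinates of $N$ around $\ell(p)$, linearly independent vectors $a,b$ with $$\ell=\ell(p)+\mathrm{Re}(z^m)\,a+\mathrm{Im}(z^m)\,b+o(|z|^m).$$ A smooth variation of $\ell$ is a smooth map $L:(-\varepsilon,\varepsilon)\times\Sigma\to N$, $\varepsilon>0$, with $\ell_0=\ell$, where $\ell_t=L(t,\cdot)$. Let $A(\ell_t)$ be the area of $\ell_t$, the integral over $\Sigma$ of $\sqrt{\det\langle\partial_i\ell_t,\partial_j\ell_t\rangle}$.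 Call $\ell$ stationary if $t\mapsto A(\ell_t)$ is differentiable at $t=0$ with derivative $0$ for every smooth variation of $\ell$, and lagrangian stationary if this holds for every smooth variation of $\ell$ all of whose maps $\ell_t$ are branched lagrangian immersions. Then $\ell$ is stationary if and only if it is lagrangian stationary. Moreover, $\ell$ is stationary if and only if it is minimal, i.e. its mean curvature vector $H$ (the trace of the second fundamental form) vanishes at every point where $d\ell$ is injective. -/

import Mathlib

set_option maxSynthPendingDepth 3

open Set Filter Topology MeasureTheory Manifold
open scoped ContDiff

noncomputable section

namespace KESurface

/-! ## Local Riemannian geometry in a coordinate domain -/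

section Local

variable {E : Type*} [NormedAddCommGroup E] [NormedSpace ℝ E]

/-- The Christoffel symbols of the first kind of a metric field `G` on a coordinate domain:
`K(u,v,w) = (1/2) (D_u G(v,w) + D_v G(u,w) - D_w G(u,v))`. -/
def christoffelFirst (G : E → E →L[ℝ] E →L[ℝ] ℝ) (y : E) : E →L[ℝ] E →L[ℝ] E →L[ℝ] ℝ :=
  (1 / 2 : ℝ) • (fderiv ℝ G y + (fderiv ℝ G y).flip -
    ((ContinuousLinearMap.flipₗᵢ ℝ E E ℝ).toContinuousLinearEquiv :
      (E →L[ℝ] E →L[ℝ] ℝ) →L[ℝ] (E →L[ℝ] E →L[ℝ] ℝ)).comp (fderiv ℝ G y).flip)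

theorem christoffelFirst_apply (G : E → E →L[ℝ] E →L[ℝ] ℝ) (y u v w : E) :
    christoffelFirst G y u v w =
      (1 / 2 : ℝ) * (fderiv ℝ G y u v w + fderiv ℝ G y v u w - fderiv ℝ G y w u v) := by
  simp [christoffelFirst]

/-- The Christoffel symbols (of the second kind) of `G`, that is, the Levi-Civita connection in
coordinates, `∇_u V = D_u V + Γ(u, V)`: the bilinear map `Γ` with `G(Γ(u,v), w) = K(u,v,w)`. -/
def christoffel (G : E → E →L[ℝ] E →L[ℝ] ℝ) (y : E) : E →L[ℝ] E →L[ℝ] E :=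
  (ContinuousLinearMap.compL ℝ E (E →L[ℝ] ℝ) E (G y).inverse).comp (christoffelFirst G y)

theorem christoffel_apply (G : E → E →L[ℝ] E →L[ℝ] ℝ) (y u v : E) :
    christoffel G y u v = (G y).inverse (christoffelFirst G y u v) := by
  simp [christoffel]

/-- The curvature tensor in coordinates, `R(u,v)w = ∇_u ∇_v w - ∇_v ∇_u w` for constant coordinate
fields `u, v, w`. -/
def curvature (G : E → E →L[ℝ] E →L[ℝ] ℝ) (y u v w : E) : E :=
  fderiv ℝ (christoffel G) y u v w - fderiv ℝ (christoffel G) y v u w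
    + christoffel G y u (christoffel G y v w) - christoffel G y v (christoffel G y u w)

/-- The Ricci tensor in coordinates: `Ric(v,w)` is the trace of `u ↦ R(u,v)w`. -/
def ricci (G : E → E →L[ℝ] E →L[ℝ] ℝ) (y v w : E) : ℝ :=
  LinearMap.trace ℝ E
    { toFun := fun u => curvature G y u v w
      map_add' := fun u u' => by
        simp only [curvature, map_add, add_apply]; abel
      map_smul' := fun c u => by
        simp only [curvature, map_smul, smul_apply, RingHom.id_apply, smul_add, smul_sub] }

end Local

/-! ## Complex surfaces with a Riemannian metric -/

section Kahler

variable {E : Type*} [NormedAddCommGroup E] [NormedSpace ℂ E]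
  {N : Type*} [TopologicalSpace N] [ChartedSpace E N]

/-- The real manifold underlying a complex manifold. -/
instance isManifold_real [IsManifold 𝓘(ℂ, E) ω N] : IsManifold 𝓘(ℝ, E) ω N := by
  apply isManifold_of_contDiffOn
  intro e e' he he'
  have h := (contDiffGroupoid ω 𝓘(ℂ, E)).compatible he he'
  rw [contDiffGroupoid, mem_groupoid_of_pregroupoid] at h
  have h1 := h.1
  simp only [contDiffPregroupoid] at h1
  exact h1.restrict_scalars ℝ

/-- Multiplication by `i` on the real tangent spaces of a complex manifold (the derivatives of
holomorphic coordinate changes are complex linear, so any chart may be used). -/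
def complexStructure (x : N) : TangentSpace 𝓘(ℝ, E) x →L[ℝ] TangentSpace 𝓘(ℝ, E) x :=
  (Complex.I • ContinuousLinearMap.id ℝ E : E →L[ℝ] E)

/-- The pullback `(v, w) ↦ B(Av, Aw)` of a bilinear form by a linear map. -/
def pullbackForm (B : E →L[ℝ] E →L[ℝ] ℝ) (A : E →L[ℝ] E) : E →L[ℝ] E →L[ℝ] ℝ :=
  ContinuousLinearMap.bilinearComp B A A

/-- The expression of a field of bilinear forms in the chart `e`, at a point `y` of its target. -/
def inChart (B : ∀ x : N, TangentSpace 𝓘(ℝ, E) x →L[ℝ] TangentSpace 𝓘(ℝ, E) x →L[ℝ] ℝ)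
    (e : OpenPartialHomeomorph N E) (y : E) : E →L[ℝ] E →L[ℝ] ℝ :=
  pullbackForm (B (e.symm y)) (mfderiv 𝓘(ℝ, E) 𝓘(ℝ, E) e.symm y)

variable [IsManifold 𝓘(ℂ, E) ω N]

variable (N) in
/-- Smooth Riemannian metrics on the complex manifold `N`. -/
abbrev Metric : Type _ :=
  Bundle.ContMDiffRiemannianMetric 𝓘(ℝ, E) ∞ E (fun x : N => TangentSpace 𝓘(ℝ, E) x)

/-- The fundamental form `ω(v, w) = g(Jv, w)`, equivalently `ω(v, Jw) = g(v, w)`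
when `g` is hermitian. -/
def fundamentalForm (g : Metric (E := E) N) (x : N) :
    TangentSpace 𝓘(ℝ, E) x →L[ℝ] TangentSpace 𝓘(ℝ, E) x →L[ℝ] ℝ :=
  (g.inner x).comp (complexStructure x)

/-- `g` is a Kähler metric: it is hermitian and its fundamental form is closed. -/
structure IsKahler (g : Metric (E := E) N) : Prop where
  hermitian : ∀ (x : N) (v w : TangentSpace 𝓘(ℝ, E) x),
    g.inner x (complexStructure x v) (complexStructure x w) = g.inner x v w
  closed : ∀ e ∈ atlas E N, ∀ y ∈ e.target, ∀ u v w : E,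
    fderiv ℝ (inChart (fundamentalForm g) e) y u v w
      + fderiv ℝ (inChart (fundamentalForm g) e) y v w u
      + fderiv ℝ (inChart (fundamentalForm g) e) y w u v = 0

/-- `g` is an Einstein metric: `Ric = c g` for a constant `c`. -/
def IsEinstein (g : Metric (E := E) N) : Prop :=
  ∃ c : ℝ, ∀ e ∈ atlas E N, ∀ y ∈ e.target, ∀ v w : E,
    ricci (inChart g.inner e) y v w = c * inChart g.inner e y v w

end Kahler

/-! ## Branched lagrangian immersions of surfaces -/

/-- The model space of real surfaces. -/
abbrev Plane : Type := EuclideanSpace ℝ (Fin 2)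

/-- The complex coordinate of the plane. -/
def toComplex (y : Plane) : ℂ := ⟨y 0, y 1⟩

/-- The standard basis vectors of the plane. -/
def basisVec (i : Fin 2) : Plane := EuclideanSpace.single i 1

section Maps

variable {E : Type*} [NormedAddCommGroup E] [NormedSpace ℂ E]
  {N : Type*} [TopologicalSpace N] [ChartedSpace E N]
  {S : Type*} [TopologicalSpace S] [ChartedSpace Plane S]

/-- `ℓ` is immersive at `p`. -/
def IsImmersedAt (ℓ : S → N) (p : S) : Prop :=
  Function.Injective (mfderiv (𝓡 2) 𝓘(ℝ, E) ℓ p)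

/-- `p` is a branch point of `ℓ`: for some integer `m ≥ 2`, some smooth complex coordinate `z` of
the surface centred at `p` and some linearly independent vectors `a`, `b`, the map has the expansion
`ℓ = ℓ(p) + Re(z^m) a + Im(z^m) b + o(|z|^m)` in coordinates around `ℓ(p)`. -/
def IsBranchPoint (ℓ : S → N) (p : S) : Prop :=
  ∃ e ∈ IsManifold.maximalAtlas (𝓡 2) ∞ S, p ∈ e.source ∧
    ∃ (m : ℕ) (a b : E), 2 ≤ m ∧ LinearIndependent ℝ ![a, b] ∧
      (fun y : Plane =>
        chartAt E (ℓ p) (ℓ (e.symm y)) - chartAt E (ℓ p) (ℓ p)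
          - (((toComplex (y - e p)) ^ m).re • a + ((toComplex (y - e p)) ^ m).im • b))
        =o[𝓝 (e p)] (fun y : Plane => ‖y - e p‖ ^ m)

/-- A smooth map that is immersive at every point which is not a branch point. -/
structure IsBranchedImmersion (ℓ : S → N) : Prop where
  smooth : ContMDiff (𝓡 2) 𝓘(ℝ, E) ∞ ℓ
  immersed_or_branch : ∀ p : S, IsImmersedAt (E := E) ℓ p ∨ IsBranchPoint (E := E) ℓ p

/-- `L` is a smooth variation of `ℓ`: it is smooth on `(-ε, ε) × S` and `L 0 = ℓ`. -/
def IsVariation (ε : ℝ) (ℓ : S → N) (L : ℝ → S → N) : Prop :=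
  0 < ε ∧ L 0 = ℓ ∧
    ContMDiffOn (𝓘(ℝ, ℝ).prod (𝓡 2)) 𝓘(ℝ, E) ∞ (fun q : ℝ × S => L q.1 q.2)
      (Ioo (-ε) ε ×ˢ univ)

variable [IsManifold 𝓘(ℂ, E) ω N]

/-- `ℓ^* ω = 0`. -/
def IsLagrangian (g : Metric (E := E) N) (ℓ : S → N) : Prop :=
  ∀ (p : S) (u v : TangentSpace (𝓡 2) p),
    fundamentalForm g (ℓ p) (mfderiv (𝓡 2) 𝓘(ℝ, E) ℓ p u) (mfderiv (𝓡 2) 𝓘(ℝ, E) ℓ p v) = 0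

/-- A branched immersion that is lagrangian. -/
structure IsBranchedLagrangianImmersion (g : Metric (E := E) N) (ℓ : S → N) : Prop where
  branched : IsBranchedImmersion (E := E) ℓ
  lagrangian : IsLagrangian g ℓ

/-- The entries `⟨∂_i ℓ, ∂_j ℓ⟩` of the metric induced by `ℓ`, in the chart `e` of the surface. -/
def inducedMetric (g : Metric (E := E) N) (ℓ : S → N) (e : OpenPartialHomeomorph S Plane)
    (y : Plane) (i j : Fin 2) : ℝ :=
  g.inner (ℓ (e.symm y))
    (mfderiv (𝓡 2) 𝓘(ℝ, E) (fun y' : Plane => ℓ (e.symm y')) y (basisVec i))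
    (mfderiv (𝓡 2) 𝓘(ℝ, E) (fun y' : Plane => ℓ (e.symm y')) y (basisVec j))

/-- The area density `√ det ⟨∂_i ℓ, ∂_j ℓ⟩` of `ℓ` in the chart `e`. -/
def areaDensity (g : Metric (E := E) N) (ℓ : S → N) (e : OpenPartialHomeomorph S Plane)
    (y : Plane) : ℝ :=
  √(inducedMetric g ℓ e y 0 0 * inducedMetric g ℓ e y 1 1 - inducedMetric g ℓ e y 0 1 ^ 2)

section Area

variable (S) [T2Space S] [SigmaCompactSpace S] [IsManifold (𝓡 2) ∞ S]

/-- A smooth partition of unity of the surface subordinate to its charts. -/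
def chartPartition : SmoothPartitionOfUnity S (𝓡 2) S univ :=
  (SmoothPartitionOfUnity.exists_isSubordinate_chartAt_source (𝓡 2) S).choose

theorem chartPartition_isSubordinate :
    (chartPartition S).IsSubordinate fun p => (chartAt Plane p).source :=
  (SmoothPartitionOfUnity.exists_isSubordinate_chartAt_source (𝓡 2) S).choose_spec

variable {S}

/-- The area of a smooth map from a compact surface: the integral over the surface of the area
density, computed in charts by means of a partition of unity (on which it does not depend).
The sum has finitely many nonzero terms since the surface is compact. -/
def area (g : Metric (E := E) N) (ℓ : S → N) : ℝ :=
  ∑ᶠ p : S, ∫ y in (chartAt Plane p).target,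
    chartPartition S p ((chartAt Plane p).symm y) * areaDensity g ℓ (chartAt Plane p) y

/-- The area is critical at `ℓ` for all smooth variations. -/
def IsStationary (g : Metric (E := E) N) (ℓ : S → N) : Prop :=
  ∀ (ε : ℝ) (L : ℝ → S → N), IsVariation (E := E) ε ℓ L →
    HasDerivAt (fun t => area g (L t)) 0 0

/-- The area is critical at `ℓ` for all smooth variations through branched lagrangian
immersions. -/
def IsLagrangianStationary (g : Metric (E := E) N) (ℓ : S → N) : Prop :=
  ∀ (ε : ℝ) (L : ℝ → S → N), IsVariation (E := E) ε ℓ L →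
    (∀ t ∈ Ioo (-ε) ε, IsBranchedLagrangianImmersion g (L t)) →
    HasDerivAt (fun t => area g (L t)) 0 0

end Area

/-! ## The mean curvature vector -/

/-- `ℓ` in the preferred charts around `p` and `ℓ p`. -/
def localRep (ℓ : S → N) (p : S) (y : Plane) : E :=
  chartAt E (ℓ p) (ℓ ((chartAt Plane p).symm y))

/-- The inverse of the induced metric at `p`, in the preferred chart around `p`. -/
def inducedInverse (g : Metric (E := E) N) (ℓ : S → N) (p : S) : Matrix (Fin 2) (Fin 2) ℝ :=
  (Matrix.of (inducedMetric g ℓ (chartAt Plane p) (chartAt Plane p p)))⁻¹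

/-- `∇_{∂_i} ∂_j ℓ` at `p`, where `∇` is the Levi-Civita connection of `g`, computed in the
preferred charts. -/
def hessian (g : Metric (E := E) N) (ℓ : S → N) (p : S) (i j : Fin 2) : E :=
  fderiv ℝ (fderiv ℝ (localRep (E := E) ℓ p)) (chartAt Plane p p) (basisVec i) (basisVec j)
    + christoffel (inChart g.inner (chartAt E (ℓ p))) (chartAt E (ℓ p) (ℓ p))
        (fderiv ℝ (localRep (E := E) ℓ p) (chartAt Plane p p) (basisVec i))
        (fderiv ℝ (localRep (E := E) ℓ p) (chartAt Plane p p) (basisVec j))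

/-- The component of `v` normal to the tangent plane of `ℓ` at an immersed point `p`:
`v - h^{ij} ⟨v, ∂_i ℓ⟩ ∂_j ℓ`. -/
def normalPart (g : Metric (E := E) N) (ℓ : S → N) (p : S) (v : E) : E :=
  v - ∑ i, ∑ j,
    (inducedInverse g ℓ p i j *
      inChart g.inner (chartAt E (ℓ p)) (chartAt E (ℓ p) (ℓ p)) v
        (fderiv ℝ (localRep (E := E) ℓ p) (chartAt Plane p p) (basisVec i))) •
      fderiv ℝ (localRep (E := E) ℓ p) (chartAt Plane p p) (basisVec j)

/-- The mean curvature vector `H` of `ℓ` at an immersed point `p`, the trace of the second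
fundamental form `B(∂_i, ∂_j) = (∇_{∂_i} ∂_j ℓ)^⊥`, as a vector in the preferred chart
around `ℓ p`. -/
def meanCurvature (g : Metric (E := E) N) (ℓ : S → N) (p : S) : E :=
  ∑ i, ∑ j, inducedInverse g ℓ p i j • normalPart g ℓ p (hessian g ℓ p i j)

end Maps

end KESurface

end

/-! Write `η = ω(X, dℓ ·)` for a variation with velocity `X`, and `σ = ω(H, dℓ ·)` for the mean
curvature vector `H`, a one-form on the immersed part of the surface. The normal space of a
lagrangian surface is `J` times its tangent space, so `⟨X, H⟩ = ⟨η, σ⟩` and `H` vanishes where `σ`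
does. The area density therefore changes by the divergence of the tangential part of `X` minus `⟨η,
σ⟩ dA` (`firstVariation`, `areaVariation_eq`). The whole statement reduces to two implications:
lagrangian stationary implies minimal, and minimal implies stationary.

The Einstein condition enters through `σ` being closed. If `ζ` is the complex determinant of the two
coordinate tangent vectors and `τ` is the imaginary part of the trace of the Levi-Civita connection,
then `σ = -(d arg ζ + ℓ^*τ)` (`meanCurv_form_eq`). The form `dτ` is the Ricci form up to sign, hence
a constant multiple of `ω`, and pulls back to zero by a lagrangian map (`fderiv_tauForm_sub`). So
`σ` is locally exact.

Conversely every locally exact `η` vanishing near the branch points is realised by a variation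
through branched lagrangian immersions (`exists_lagrangian_variation`). A primitive of `η` is
extended to a germ of a function on `N` by a foot point retraction, and its Hamiltonian flow, which
is symplectic, moves `ℓ`. The extensions at neighbouring points differ by constants, so the flows
agree and glue. Hence `∫ ⟨η, σ⟩ = 0` for all such `η` when `ℓ` is lagrangian stationary.

One would like to take `η = σ`, but `σ` must be cut off at the branch points. There the coordinate
frame is a rotation and dilation, by `m z^(m-1)`, of a frame converging to `(a, b)`. A rotation and
dilation multiplies `ζ` by a positive number, so `arg ζ` converges and `σ = dβ` with `β → 0` at the
branch point. With a cutoff `χ` at scale `r` the form `η = d((1 - χ)² β / 2)` is admissible, and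
completing a square gives `⟨η, σ⟩ ≥ (1 - χ)² |σ|² / 4 - |β dχ|²`. In dimension two the energy of `χ`
is conformally invariant and bounded independently of `r`. The conformal class of the induced metric
stays bounded at a branch point, and `β → 0` makes the error small. In the limit `σ = 0`
(`minimal_of_isLagrangianStationary`).

If `ℓ` is minimal, the derivative of the density is a pure divergence away from the branch points.
Tested against `1 - χ` it leaves the integral of `⟨dχ, ξ⟩` with `ξ = g(X, dℓ ·)` bounded, which is
of order `r^(-1) r²` (`isStationary_of_minimal`).

Differentiability of the area itself is not obvious, since the density is the square root of a
function with zeros. Glaeser's inequality makes the square root Lipschitz in time, uniformly in the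
point, and the zeros at time `0` are finitely many, so differentiation under the integral is allowed
(`hasDerivAt_integral_sqrt`). -/

namespace KESurface

noncomputable section

/-! ## Smooth dependence of solutions of ordinary differential equations -/

section Superposition

universe u

variable {K : Type*} [TopologicalSpace K] [CompactSpace K]

/-- Pointwise application of a continuous family of linear maps. -/
noncomputable def pointwiseApply (K : Type*) [TopologicalSpace K] [CompactSpace K]
    (E F : Type*) [NormedAddCommGroup E] [NormedSpace ℝ E]
    [NormedAddCommGroup F] [NormedSpace ℝ F] :
    C(K, E →L[ℝ] F) →L[ℝ] C(K, E) →L[ℝ] C(K, F) :=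
  LinearMap.mkContinuous₂
    (LinearMap.mk₂ ℝ (fun (A : C(K, E →L[ℝ] F)) (h : C(K, E)) =>
        (⟨fun k => A k (h k), by fun_prop⟩ : C(K, F)))
      (fun A B h => by ext; simp) (fun c A h => by ext; simp)
      (fun A h h' => by ext; simp) (fun c A h => by ext; simp)) 1
    (fun A h => by
      rw [ContinuousMap.norm_le _ (by positivity)]
      intro k
      simp only [LinearMap.mk₂_apply, ContinuousMap.coe_mk, one_mul]
      exact (A k).le_of_opNorm_le_of_le (A.norm_coe_le_norm k) (h.norm_coe_le_norm k))

theorem pointwiseApply_apply {E F : Type*} [NormedAddCommGroup E] [NormedSpace ℝ E]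
    [NormedAddCommGroup F] [NormedSpace ℝ F] (A : C(K, E →L[ℝ] F)) (h : C(K, E)) (k : K) :
    pointwiseApply K E F A h k = A k (h k) := rfl

/-- The remainder is estimated at each `k` by the mean value inequality on the segment from `γ k` to
`γ k + h k`. The estimate is uniform in `k` because postcomposition with `v'` is continuous for the
sup norm. -/
theorem hasFDerivAt_postcomp {E F : Type*} [NormedAddCommGroup E] [NormedSpace ℝ E]
    [NormedAddCommGroup F] [NormedSpace ℝ F] {v : E → F} {v' : C(E, E →L[ℝ] F)}
    (hv : ∀ x, HasFDerivAt v (v' x) x) (hc : Continuous v) (γ : C(K, E)) :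
    HasFDerivAt (fun γ : C(K, E) => (⟨v, hc⟩ : C(E, F)).comp γ)
      (pointwiseApply K E F (v'.comp γ)) γ := by
  rw [hasFDerivAt_iff_isLittleO_nhds_zero, Asymptotics.isLittleO_iff]
  intro ε hε
  have h1 := (ContinuousMap.continuous_postcomp (X := K) v').continuousAt (x := γ)
  rw [Metric.continuousAt_iff] at h1
  obtain ⟨δ, hδ, h1⟩ := h1 ε hε
  filter_upwards [Metric.ball_mem_nhds (0 : C(K, E)) hδ] with h hh
  rw [ContinuousMap.norm_le _ (by positivity)]
  intro k
  have h2 : ∀ z ∈ segment ℝ (γ k) (γ k + h k), ‖v' z - v' (γ k)‖ ≤ ε := by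
    intro z hz
    rw [segment_eq_image'] at hz
    obtain ⟨s, hs, rfl⟩ := hz
    have h3 := @h1 (γ + s • h) (by
      rw [dist_eq_norm, add_sub_cancel_left, norm_smul, Real.norm_of_nonneg hs.1]
      have : ‖h‖ < δ := by simpa using hh
      nlinarith [norm_nonneg h, hs.2])
    rw [dist_eq_norm] at h3
    have h4 := ((v'.comp (γ + s • h) - v'.comp γ).norm_coe_le_norm k).trans h3.le
    simpa using h4
  have h5 := (convex_segment (𝕜 := ℝ) (γ k) (γ k + h k)).norm_image_sub_le_of_norm_hasFDerivWithin_le'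
    (fun z _ => (hv z).hasFDerivWithinAt) h2 (left_mem_segment ℝ _ _) (right_mem_segment ℝ _ _)
  simp only [add_sub_cancel_left] at h5
  calc _ = ‖v (γ k + h k) - v (γ k) - v' (γ k) (h k)‖ := by simp [pointwiseApply_apply]
    _ ≤ ε * ‖h k‖ := h5
    _ ≤ ε * ‖h‖ := by gcongr; exact h.norm_coe_le_norm k

/-- The derivative of superposition by `v` is superposition by `fderiv ℝ v` followed by a fixed
continuous linear map, so one induction on the order suffices. The target `F` varies in the
induction, which is why it shares the universe of `E`. -/
theorem contDiff_postcomp_nat {E : Type u} [NormedAddCommGroup E] [NormedSpace ℝ E] (n : ℕ) :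
    ∀ {F : Type u} [NormedAddCommGroup F] [NormedSpace ℝ F] {v : E → F} (hv : ContDiff ℝ ∞ v),
    ContDiff ℝ n (fun γ : C(K, E) => (⟨v, hv.continuous⟩ : C(E, F)).comp γ) := by
  induction n with
  | zero =>
    intro F _ _ v hv
    exact contDiff_zero.2 (ContinuousMap.continuous_postcomp _)
  | succ n ih =>
    intro F _ _ v hv
    have hd : ContDiff ℝ ∞ (fderiv ℝ v) := hv.fderiv_right (by simp)
    rw [Nat.cast_succ, contDiff_succ_iff_hasFDerivAt]
    refine ⟨fun γ => pointwiseApply K E F ((⟨fderiv ℝ v, hd.continuous⟩ : C(E, E →L[ℝ] F)).comp γ),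
      (pointwiseApply K E F).contDiff.comp (ih (F := E →L[ℝ] F) hd), fun γ => ?_⟩
    exact hasFDerivAt_postcomp (fun x => (hv.differentiable (by simp) x).hasFDerivAt) _ γ

/-- Superposition by a smooth map is a smooth map between spaces of continuous functions. -/
theorem contDiff_postcomp {E F : Type u} [NormedAddCommGroup E] [NormedSpace ℝ E]
    [NormedAddCommGroup F] [NormedSpace ℝ F] {v : E → F} (hv : ContDiff ℝ ∞ v) :
    ContDiff ℝ ∞ (fun γ : C(K, E) => (⟨v, hv.continuous⟩ : C(E, F)).comp γ) :=
  contDiff_infty.2 fun n => contDiff_postcomp_nat n hv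

end Superposition

/-! ### The implicit function theorem -/

section ImplicitFunction

theorem isOpen_setOf_isInvertible {E F : Type*} [NormedAddCommGroup E] [NormedSpace ℝ E]
    [CompleteSpace E] [NormedAddCommGroup F] [NormedSpace ℝ F] :
    IsOpen {A : E →L[ℝ] F | A.IsInvertible} := by
  rw [isOpen_iff_mem_nhds]
  rintro _ ⟨e, rfl⟩
  filter_upwards [e.nhds] with A ⟨e', he'⟩
  exact ⟨e', he'⟩

/-- The implicit function theorem for smooth maps, with an implicit function that is smooth on
a neighbourhood. -/
theorem exists_smooth_implicitFunction {E₁ E₂ F : Type*} [NormedAddCommGroup E₁] [NormedSpace ℝ E₁]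
    [CompleteSpace E₁] [NormedAddCommGroup E₂] [NormedSpace ℝ E₂] [CompleteSpace E₂]
    [NormedAddCommGroup F] [NormedSpace ℝ F] [CompleteSpace F] {f : E₁ × E₂ → F} {u : E₁ × E₂}
    (hf : ∀ᶠ v in 𝓝 u, ContDiffAt ℝ ∞ f v) (hi : (fderiv ℝ f u ∘L .inr ℝ E₁ E₂).IsInvertible) :
    ∃ ψ : E₁ → E₂, ψ u.1 = u.2 ∧ (∀ᶠ x in 𝓝 u.1, ContDiffAt ℝ ∞ ψ x) ∧
      (∀ᶠ v in 𝓝 u, f v = f u ↔ ψ v.1 = v.2) ∧ ∀ᶠ x in 𝓝 u.1, f (x, ψ x) = f u := by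
  have cdf := hf.self_of_nhds
  have hne : (∞ : ℕ∞ω) ≠ 0 := by simp
  set ψ := cdf.implicitFunction hne hi with hψ
  have h1 : ψ u.1 = u.2 := cdf.implicitFunction_apply_self hne hi
  have h2 := cdf.eventually_apply_eq_iff_implicitFunction hne hi
  have h3 := cdf.eventually_apply_implicitFunction hne hi
  refine ⟨ψ, h1, ?_, h2, h3⟩
  have hcψ : ContDiffAt ℝ 1 ψ u.1 :=
    (cdf.contDiffAt_implicitFunction hne hi).of_le (by exact_mod_cast le_top)
  have hcont : ∀ᶠ x in 𝓝 u.1, ContinuousAt ψ x := by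
    filter_upwards [hcψ.eventually (by simp)] with x hx using hx.continuousAt
  have hcd : ContinuousAt (fun v => fderiv ℝ f v ∘L .inr ℝ E₁ E₂) u := by
    have : ContinuousAt (fderiv ℝ f) u :=
      (cdf.fderiv_right (m := 0) (by simp)).continuousAt
    fun_prop
  have hinv : ∀ᶠ v in 𝓝 u, (fderiv ℝ f v ∘L .inr ℝ E₁ E₂).IsInvertible :=
    hcd.eventually (isOpen_setOf_isInvertible.mem_nhds hi)
  have hgr : Tendsto (fun x => (x, ψ x)) (𝓝 u.1) (𝓝 u) := by
    have : ContinuousAt (fun x => (x, ψ x)) u.1 := continuousAt_id.prodMk hcψ.continuousAt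
    simpa [ContinuousAt, h1] using this
  -- Being smooth at one point does not by itself give smoothness nearby for the order `∞`. So the
  -- theorem is applied again at each nearby point `(x, ψ x)` of the graph, and local uniqueness
  -- identifies `ψ` with the function found there.
  filter_upwards [hcont.eventually_nhds, hgr.eventually hf, hgr.eventually hinv,
    h3.eventually_nhds, (hgr.eventually h2.eventually_nhds), h3] with x hx1 hx2 hx3 hx4 hx5 hx6
  set ψ' := hx2.implicitFunction hne hx3 with hψ'
  have h1' : ContDiffAt ℝ ∞ ψ' x := hx2.contDiffAt_implicitFunction hne hx3
  have h2' := hx2.eventually_apply_eq_iff_implicitFunction hne hx3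
  have hgr' : Tendsto (fun x => (x, ψ x)) (𝓝 x) (𝓝 (x, ψ x)) :=
    (continuousAt_id.prodMk hx1.self_of_nhds)
  refine h1'.congr_of_eventuallyEq ?_
  filter_upwards [hx4, hgr'.eventually h2'] with y hy1 hy2
  exact (hy2.1 (hy1.trans hx6.symm)).symm

end ImplicitFunction

/-! ### Local flows of smooth vector fields -/

section Flow

variable {E : Type*} [NormedAddCommGroup E] [NormedSpace ℝ E] [CompleteSpace E]

/-- The primitive `τ ↦ ∫₀^τ γ` of a curve on `[-1, 1]`. -/
noncomputable def primitiveCLM (E : Type*) [NormedAddCommGroup E] [NormedSpace ℝ E] :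
    C(Icc (-1 : ℝ) 1, E) →L[ℝ] C(Icc (-1 : ℝ) 1, E) :=
  LinearMap.mkContinuous
    { toFun := fun γ => ⟨fun τ => ∫ s in (0 : ℝ)..τ, γ (projIcc (-1) 1 (by norm_num) s), by
        have : Continuous fun τ : ℝ => ∫ s in (0 : ℝ)..τ, γ (projIcc (-1) 1 (by norm_num) s) :=
          intervalIntegral.continuous_primitive
            (fun a b => (by fun_prop : Continuous fun s : ℝ =>
              γ (projIcc (-1) 1 (by norm_num) s)).intervalIntegrable a b) 0
        exact this.comp continuous_subtype_val⟩
      map_add' := fun γ γ' => by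
        ext τ
        simp only [ContinuousMap.add_apply, ContinuousMap.coe_mk]
        exact intervalIntegral.integral_add
          ((by fun_prop : Continuous fun s : ℝ =>
              γ (projIcc (-1) 1 (by norm_num) s)).intervalIntegrable _ _)
          ((by fun_prop : Continuous fun s : ℝ =>
              γ' (projIcc (-1) 1 (by norm_num) s)).intervalIntegrable _ _)
      map_smul' := fun c γ => by
        ext τ
        simp } 1
    (fun γ => by
      rw [ContinuousMap.norm_le _ (by positivity)]
      intro τ
      have h := intervalIntegral.norm_integral_le_of_norm_le_const (a := (0 : ℝ)) (b := τ)
        (C := ‖γ‖) (f := fun s => γ (projIcc (-1) 1 (by norm_num) s))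
        (fun s _ => γ.norm_coe_le_norm _)
      have h2 : |(τ : ℝ) - 0| ≤ 1 := by
        rw [sub_zero, abs_le]; exact τ.2
      calc _ ≤ ‖γ‖ * |(τ : ℝ) - 0| := h
        _ ≤ ‖γ‖ * 1 := by gcongr
        _ = 1 * ‖γ‖ := by ring)

theorem primitiveCLM_apply (γ : C(Icc (-1 : ℝ) 1, E)) (τ : Icc (-1 : ℝ) 1) :
    primitiveCLM E γ τ = ∫ s in (0 : ℝ)..τ, γ (projIcc (-1) 1 (by norm_num) s) := rfl

/-- The rescaling `τ ↦ γ (θ τ)` of a curve on `[-1, 1]`. -/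
noncomputable def rescaleCurve (γ : C(Icc (-1 : ℝ) 1, E)) (θ : ℝ) : C(Icc (-1 : ℝ) 1, E) :=
  ⟨fun τ => γ (projIcc (-1) 1 (by norm_num) (θ * τ)), by fun_prop⟩

/-- The local flow of a smooth vector field is smooth. -/
theorem exists_smooth_flow {v : E → E} (hv : ContDiff ℝ ∞ v) (x₀ : E) :
    ∃ φ : ℝ × E → E, (∀ᶠ q in 𝓝 ((0 : ℝ), x₀), ContDiffAt ℝ ∞ φ q) ∧ (∀ᶠ x in 𝓝 x₀, φ (0, x) = x) ∧
      ∀ᶠ q in 𝓝 ((0 : ℝ), x₀), HasDerivAt (fun t => φ (t, q.2)) (v (φ q)) q.1 := by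
  set K := Icc (-1 : ℝ) 1
  let N : C(K, E) → C(K, E) := fun γ => (⟨v, hv.continuous⟩ : C(E, E)).comp γ
  have hN : ContDiff ℝ ∞ N := contDiff_postcomp hv
  let c : E →L[ℝ] C(K, E) := ContinuousLinearMap.const ℝ K
  -- Time is rescaled to make it a parameter: a zero `γ` of `f ((x, t), ·)` satisfies `γ τ = x + t
  -- ∫₀^τ v(γ)` on the fixed interval `[-1, 1]`, and the flow at time `t` is `γ 1`. At `t = 0` the
  -- derivative in `γ` is the identity, so the implicit function theorem in the Banach space of
  -- curves applies.
  let f : (E × ℝ) × C(K, E) → C(K, E) := fun q => q.2 - c q.1.1 - q.1.2 • primitiveCLM E (N q.2)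
  have hf : ContDiff ℝ ∞ f := by
    have h1 : ContDiff ℝ ∞ fun q : (E × ℝ) × C(K, E) => primitiveCLM E (N q.2) :=
      (primitiveCLM E).contDiff.comp (hN.comp contDiff_snd)
    have h2 : ContDiff ℝ ∞ fun q : (E × ℝ) × C(K, E) => c q.1.1 :=
      c.contDiff.comp (contDiff_fst.comp contDiff_fst)
    exact (contDiff_snd.sub h2).sub ((contDiff_snd.comp contDiff_fst).smul h1)
  set u : (E × ℝ) × C(K, E) := ((x₀, 0), c x₀)
  have hfu : f u = 0 := by simp [f, u]
  have hinv : (fderiv ℝ f u ∘L .inr ℝ (E × ℝ) C(K, E)).IsInvertible := by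
    have h1 : HasFDerivAt (fun γ : C(K, E) => f ((x₀, 0), γ))
        (fderiv ℝ f u ∘L .inr ℝ (E × ℝ) C(K, E)) (c x₀) :=
      ((hf.differentiable (by simp) u).hasFDerivAt).comp (c x₀) (hasFDerivAt_prodMk_right _ _)
    have h2 : HasFDerivAt (fun γ : C(K, E) => f ((x₀, 0), γ))
        (ContinuousLinearMap.id ℝ C(K, E)) (c x₀) := by
      have : (fun γ : C(K, E) => f ((x₀, 0), γ)) = fun γ => γ - c x₀ := by
        ext γ; simp [f]
      rw [this]
      exact (hasFDerivAt_id _).sub_const _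
    rw [h1.unique h2]
    exact ⟨ContinuousLinearEquiv.refl ℝ _, rfl⟩
  obtain ⟨ψ, hψ0, hψs, hψi, hψe⟩ := exists_smooth_implicitFunction
    (Eventually.of_forall fun q => hf.contDiffAt) hinv
  rw [hfu] at hψi hψe
  have hψc : ContinuousAt ψ (x₀, 0) := hψs.self_of_nhds.continuousAt
  -- uniformize the neighbourhoods
  obtain ⟨ε, hε, hε'⟩ := Metric.eventually_nhds_iff_ball.1 hψi
  have hψ0' : ψ (x₀, 0) = c x₀ := hψ0
  have hclose : ∀ᶠ q in 𝓝 (x₀, (0 : ℝ)), dist (ψ q) (c x₀) < ε := by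
    have := hψc.eventually (Metric.ball_mem_nhds _ hε)
    simpa [hψ0'] using this
  obtain ⟨δ, hδ, hδ'⟩ := Metric.eventually_nhds_iff_ball.1
    ((hclose.and hψe).and hψs)
  have hmem : ∀ (x : E) (t : ℝ), x ∈ Metric.ball x₀ δ → |t| < δ →
      (x, t) ∈ Metric.ball (x₀, (0 : ℝ)) δ := by
    intro x t hx ht
    rw [← ball_prod_same]
    exact ⟨hx, by simpa using ht⟩
  set s := min δ ε / 2 with hs
  have hs0 : 0 < s := by positivity
  have hsδ : s < δ := by have := min_le_left δ ε; have := lt_min hδ hε; linarith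
  have hsε : s < ε := by have := min_le_right δ ε; have := lt_min hδ hε; linarith
  have one_mem : (1 : ℝ) ∈ K := by simp [K]
  -- the integral equation
  have hint : ∀ x ∈ Metric.ball x₀ δ, ∀ t : ℝ, |t| < δ → ∀ τ : K,
      ψ (x, t) τ = x + t • ∫ σ in (0 : ℝ)..τ, v (ψ (x, t) (projIcc (-1) 1 (by norm_num) σ)) := by
    intro x hx t ht τ
    have h := (hδ' _ (hmem x t hx ht)).1.2
    have h' := DFunLike.congr_fun h τ
    simp only [f, ContinuousMap.sub_apply, ContinuousMap.smul_apply, primitiveCLM_apply,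
      ContinuousMap.zero_apply, sub_sub, sub_eq_zero] at h'
    exact h'
  -- The rescaled curve `τ ↦ ψ (x, s) (θ τ)` solves the equation for time `s θ` and stays near the
  -- constant curve, so uniqueness makes it `ψ (x, s θ)`. All small times are thereby read off one
  -- fixed curve, whose derivative comes from the fundamental theorem of calculus.
  have hresc : ∀ x ∈ Metric.ball x₀ (min δ ε), ∀ θ : ℝ, |θ| ≤ 1 →
      ψ (x, s * θ) = rescaleCurve (ψ (x, s)) θ := by
    intro x hx θ hθ
    have hxδ : x ∈ Metric.ball x₀ δ := Metric.ball_subset_ball (min_le_left _ _) hx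
    have hxε : x ∈ Metric.ball x₀ ε := Metric.ball_subset_ball (min_le_right _ _) hx
    have hmul : |s * θ| ≤ s := by
      rw [abs_mul, abs_of_pos hs0]; nlinarith
    have hmemK : ∀ τ : K, θ * τ ∈ Icc (-1 : ℝ) 1 := by
      intro τ
      refine abs_le.1 ?_
      rw [abs_mul]
      exact mul_le_one₀ hθ (abs_nonneg _) (abs_le.2 τ.2)
    have hball : ((x, s * θ), rescaleCurve (ψ (x, s)) θ) ∈ Metric.ball u ε := by
      rw [Metric.mem_ball, Prod.dist_eq, Prod.dist_eq, max_lt_iff, max_lt_iff]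
      refine ⟨⟨hxε, ?_⟩, ?_⟩
      · simpa [u] using hmul.trans_lt hsε
      · rw [ContinuousMap.dist_lt_iff hε]
        intro τ
        have h1 := (hδ' _ (hmem x s hxδ (by rwa [abs_of_pos hs0]))).1.1
        exact (ContinuousMap.dist_apply_le_dist (f := ψ (x, s)) (g := c x₀)
          (projIcc (-1) 1 (by norm_num) (θ * τ))).trans_lt h1
    refine (hε' _ hball).1 ?_
    ext τ
    simp only [f, ContinuousMap.sub_apply, ContinuousMap.smul_apply, primitiveCLM_apply,
      ContinuousMap.zero_apply, sub_sub, sub_eq_zero]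
    have h2 := hint x hxδ s (by rwa [abs_of_pos hs0]) ⟨θ * τ, hmemK τ⟩
    have h3 : rescaleCurve (ψ (x, s)) θ τ = ψ (x, s) ⟨θ * τ, hmemK τ⟩ := by
      simp [rescaleCurve, projIcc_of_mem _ (hmemK τ)]
    rw [h3, h2]
    congr 1
    rw [mul_smul]
    congr 1
    have h4 := intervalIntegral.smul_integral_comp_mul_left (a := 0) (b := (τ : ℝ))
      (fun σ => v (ψ (x, s) (projIcc (-1) 1 (by norm_num) σ))) θ
    rw [mul_zero] at h4
    rw [← h4]
    congr 1
    refine intervalIntegral.integral_congr fun σ hσ => ?_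
    have hσ' : σ ∈ Icc (-1 : ℝ) 1 := by
      have h5 : (0 : ℝ) ∈ Icc (-1 : ℝ) 1 := by simp
      exact uIcc_subset_Icc h5 τ.2 hσ
    simp only [N, rescaleCurve, ContinuousMap.comp_apply, ContinuousMap.coe_mk,
      projIcc_of_mem _ hσ']
  refine ⟨fun q => ψ (q.2, q.1) ⟨1, one_mem⟩, ?_, ?_, ?_⟩
  · have h1 : Tendsto (fun q : ℝ × E => (q.2, q.1)) (𝓝 (0, x₀)) (𝓝 (x₀, 0)) :=
      (continuous_snd.prodMk continuous_fst).tendsto _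
    filter_upwards [h1.eventually hψs] with q hq
    have h2 : ContDiffAt ℝ ∞ (fun q : ℝ × E => ψ (q.2, q.1)) q :=
      ContDiffAt.comp q (f := fun q : ℝ × E => (q.2, q.1)) hq
        (contDiff_snd.prodMk contDiff_fst).contDiffAt
    exact (ContinuousMap.evalCLM ℝ (⟨1, one_mem⟩ : K)).contDiff.contDiffAt.comp q h2
  · filter_upwards [Metric.ball_mem_nhds x₀ hδ] with x hx
    have := hint x hx 0 (by simpa using hδ) ⟨1, one_mem⟩
    simpa using this
  · have hmin : 0 < min δ ε := lt_min hδ hε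
    filter_upwards [prod_mem_nhds (Ioo_mem_nhds (neg_lt_zero.2 hs0) hs0)
      (Metric.ball_mem_nhds x₀ hmin)] with q hq
    obtain ⟨t, x⟩ := q
    obtain ⟨ht, hx⟩ := hq
    simp only at ht hx ⊢
    have hxδ : x ∈ Metric.ball x₀ δ := Metric.ball_subset_ball (min_le_left _ _) hx
    have habs : ∀ t' ∈ Ioo (-s) s, |t' / s| ≤ 1 ∧ t' / s ∈ Icc (-1 : ℝ) 1 := by
      intro t' ht'
      have : |t' / s| ≤ 1 := by
        rw [abs_div, abs_of_pos hs0, div_le_one hs0]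
        exact (abs_lt.2 ht').le
      exact ⟨this, abs_le.1 this⟩
    have hform : ∀ t' ∈ Ioo (-s) s, ψ (x, t') ⟨1, one_mem⟩ =
        x + s • ∫ σ in (0 : ℝ)..(t' / s), v (ψ (x, s) (projIcc (-1) 1 (by norm_num) σ)) := by
      intro t' ht'
      have h1 := hresc x hx (t' / s) (habs t' ht').1
      rw [mul_div_cancel₀ _ hs0.ne'] at h1
      rw [h1, ← hint x hxδ s (by rwa [abs_of_pos hs0]) ⟨t' / s, (habs t' ht').2⟩]
      simp [rescaleCurve, projIcc_of_mem _ (habs t' ht').2]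
    have hval : ψ (x, t) ⟨1, one_mem⟩ =
        ψ (x, s) (projIcc (-1) 1 (by norm_num) (t / s)) := by
      have h1 := hresc x hx (t / s) (habs t ht).1
      rw [mul_div_cancel₀ _ hs0.ne'] at h1
      rw [h1]
      simp [rescaleCurve]
    have hcont : Continuous fun σ : ℝ => v (ψ (x, s) (projIcc (-1) 1 (by norm_num) σ)) := by
      have := hv.continuous
      fun_prop
    have hd := (intervalIntegral.integral_hasDerivAt_right (hcont.intervalIntegrable 0 (t / s))
      (hcont.stronglyMeasurableAtFilter _ _) hcont.continuousAt)
    have hd2 : HasDerivAt (fun t' : ℝ => t' / s) (1 / s) t := (hasDerivAt_id t).div_const s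
    have hd3 := ((HasDerivAt.scomp t hd hd2).const_smul s).const_add x
    have hd4 : s • (1 / s) • v (ψ (x, s) (projIcc (-1) 1 (by norm_num) (t / s))) =
        v (ψ (x, t) ⟨1, one_mem⟩) := by
      rw [smul_smul, mul_one_div_cancel hs0.ne', one_smul, hval]
    rw [hd4] at hd3
    refine hd3.congr_of_eventuallyEq ?_
    filter_upwards [Ioo_mem_nhds ht.1 ht.2] with t' ht'
    exact hform t' ht'

end Flow

/-! ## Derivatives of smooth functions vanishing to high order -/

section Vanishing

open Asymptotics

variable {E F : Type*} [NormedAddCommGroup E] [NormedSpace ℝ E]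
  [NormedAddCommGroup F] [NormedSpace ℝ F]

theorem isBigO_sub_taylor [CompleteSpace F] {f : E → F} (hf : ContDiffAt ℝ ∞ f 0) (n : ℕ) :
    (fun y => f y - ∑ k ∈ Finset.range (n + 1),
      (k.factorial : ℝ)⁻¹ • iteratedFDeriv ℝ k f 0 (fun _ => y)) =O[𝓝 0]
      fun y => ‖y‖ ^ (n + 1) := by
  have h1 : ∀ᶠ z in 𝓝 (0 : E), ContDiffAt ℝ ((n + 1 : ℕ) : ℕ∞ω) f z :=
    (hf.of_le (by exact_mod_cast le_top)).eventually (by simp)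
  have h2 : ContinuousAt (iteratedFDeriv ℝ (n + 1) f) 0 :=
    (hf.iteratedFDeriv_right (i := n + 1) (m := 0)
      (by exact_mod_cast le_top)).continuousAt
  have h3 : ∀ᶠ z in 𝓝 (0 : E), ‖iteratedFDeriv ℝ (n + 1) f z‖ <
      ‖iteratedFDeriv ℝ (n + 1) f 0‖ + 1 :=
    h2.norm.eventually_lt_const (lt_add_one _)
  obtain ⟨δ, hδ, hball⟩ := Metric.eventually_nhds_iff_ball.1 (h1.and h3)
  set C := ‖iteratedFDeriv ℝ (n + 1) f 0‖ + 1
  refine IsBigO.of_bound ((n.factorial : ℝ)⁻¹ * C) ?_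
  filter_upwards [Metric.ball_mem_nhds (0 : E) hδ] with y hy
  have hseg : ∀ t ∈ Icc (0 : ℝ) 1, (0 : E) + t • y ∈ Metric.ball (0 : E) δ := by
    intro t ht
    rw [zero_add, mem_ball_zero_iff, norm_smul, Real.norm_of_nonneg ht.1]
    rw [mem_ball_zero_iff] at hy
    nlinarith [norm_nonneg y, ht.2]
  have h4 := map_add_eq_sum_add_integral_iteratedFDeriv (x := (0 : E)) (y := y) (n := n) (f := f)
    (fun t ht => by simpa using (hball _ (hseg t ht)).1)
  rw [zero_add] at h4
  rw [h4, add_sub_cancel_left, norm_smul, norm_inv, Real.norm_natCast, norm_pow, norm_norm,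
    mul_assoc]
  gcongr
  have h5 := intervalIntegral.norm_integral_le_of_norm_le_const (a := (0 : ℝ)) (b := 1)
    (C := C * ‖y‖ ^ (n + 1))
    (f := fun t => (1 - t) ^ n • iteratedFDeriv ℝ (n + 1) f (0 + t • y) (fun _ => y)) (by
      intro t ht
      rw [uIoc_of_le zero_le_one] at ht
      have ht' : t ∈ Icc (0 : ℝ) 1 := ⟨ht.1.le, ht.2⟩
      have ha : ‖(1 - t) ^ n‖ ≤ 1 := by
        rw [norm_pow, Real.norm_of_nonneg (by linarith [ht.2])]
        exact pow_le_one₀ (by linarith [ht.2]) (by linarith [ht.1])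
      have hb : ‖iteratedFDeriv ℝ (n + 1) f (0 + t • y) (fun _ => y)‖ ≤ C * ‖y‖ ^ (n + 1) := by
        refine (ContinuousMultilinearMap.le_opNorm _ _).trans ?_
        rw [Finset.prod_const, Finset.card_univ, Fintype.card_fin]
        gcongr
        exact (hball _ (hseg t ht')).2.le
      rw [norm_smul]
      calc _ ≤ 1 * (C * ‖y‖ ^ (n + 1)) := by gcongr
        _ = _ := one_mul _)
  simpa using h5

/-- On the ray through `y` both sides are homogeneous of degree `n`, so the factor `t ^ n` cancels
and the value is smaller than any multiple of `‖y‖ ^ n`. -/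
theorem multilinear_apply_eq_zero_of_isLittleO {n : ℕ}
    {p : ContinuousMultilinearMap ℝ (fun _ : Fin n => E) F}
    (h : (fun y => p fun _ => y) =o[𝓝 0] fun y => ‖y‖ ^ n) (y : E) : (p fun _ => y) = 0 := by
  by_contra hne
  have hpos : 0 < ‖p fun _ => y‖ := norm_pos_iff.2 hne
  set c : ℝ := ‖p fun _ => y‖ / (2 * (‖y‖ ^ n + 1)) with hc
  have hden : 0 < ‖y‖ ^ n + 1 := by positivity
  have h1 := isLittleO_iff.1 h (c := c) (by positivity)
  have h2 : Tendsto (fun t : ℝ => t • y) (𝓝[>] 0) (𝓝 0) := by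
    have : Tendsto (fun t : ℝ => t • y) (𝓝 0) (𝓝 ((0 : ℝ) • y)) :=
      (continuous_id.smul continuous_const).tendsto 0
    rw [zero_smul] at this
    exact this.mono_left nhdsWithin_le_nhds
  obtain ⟨t, ht1, ht2⟩ := ((h2.eventually h1).and self_mem_nhdsWithin).exists
  have ht : 0 < t := ht2
  have h3 : (p fun _ => t • y) = t ^ n • p fun _ => y := by
    have := p.map_smul_univ (fun _ => t) (fun _ => y)
    simpa using this
  rw [h3, norm_smul, norm_pow, norm_pow, norm_norm, norm_smul,
    Real.norm_of_nonneg ht.le, mul_pow] at ht1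
  have h4 : ‖p fun _ => y‖ ≤ c * ‖y‖ ^ n := by
    have : 0 < t ^ n := by positivity
    nlinarith
  have h5 : c * ‖y‖ ^ n ≤ ‖p fun _ => y‖ / 2 := by
    rw [hc]
    have h6 : ‖y‖ ^ n / (‖y‖ ^ n + 1) ≤ 1 := by rw [div_le_one hden]; linarith
    calc _ = ‖p fun _ => y‖ / 2 * (‖y‖ ^ n / (‖y‖ ^ n + 1)) := by field_simp
      _ ≤ ‖p fun _ => y‖ / 2 * 1 := by gcongr
      _ = _ := mul_one _
  linarith

theorem isBigO_pow_of_le {m n : ℕ} (h : m ≤ n) :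
    (fun y : E => ‖y‖ ^ n) =O[𝓝 0] fun y => ‖y‖ ^ m := by
  refine IsBigO.of_bound 1 ?_
  filter_upwards [Metric.ball_mem_nhds (0 : E) one_pos] with y hy
  rw [one_mul, norm_pow, norm_pow, norm_norm]
  exact pow_le_pow_of_le_one (norm_nonneg _) (by simpa using (mem_ball_zero_iff.1 hy).le) h

theorem isLittleO_pow_of_lt {m n : ℕ} (h : m < n) :
    (fun y : E => ‖y‖ ^ n) =o[𝓝 0] fun y => ‖y‖ ^ m := by
  have h1 : (fun y : E => ‖y‖ ^ n) =O[𝓝 0] fun y => ‖y‖ ^ (m + 1) := isBigO_pow_of_le h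
  refine h1.trans_isLittleO ?_
  have h2 : (fun y : E => ‖y‖) =o[𝓝 0] fun _ => (1 : ℝ) := by
    rw [isLittleO_one_iff]
    simpa using (continuous_norm (E := E)).tendsto 0
  have h3 := (isBigO_refl (fun y : E => ‖y‖ ^ m) (𝓝 0)).mul_isLittleO h2
  simpa [pow_succ] using h3

/-- A smooth function which is `o(‖y‖^n)` is `O(‖y‖^(n+1))`. -/
theorem isBigO_of_isLittleO_of_contDiffAt [CompleteSpace F] {f : E → F}
    (hf : ContDiffAt ℝ ∞ f 0) {n : ℕ} (h : f =o[𝓝 0] fun y => ‖y‖ ^ n) :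
    f =O[𝓝 0] fun y => ‖y‖ ^ (n + 1) := by
  -- The Taylor terms vanish one after another: once those below order `k` are gone, the term of
  -- order `k` is itself `o(‖y‖^k)`.
  have hz : ∀ k ≤ n, ∀ y, iteratedFDeriv ℝ k f 0 (fun _ => y) = 0 := by
    intro k
    induction k using Nat.strong_induction_on with
    | _ k ih =>
      intro hk
      refine multilinear_apply_eq_zero_of_isLittleO ?_
      have h1 := isBigO_sub_taylor hf k
      have h2 : (fun y => f y - ∑ i ∈ Finset.range (k + 1),
          (i.factorial : ℝ)⁻¹ • iteratedFDeriv ℝ i f 0 (fun _ => y)) =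
          fun y => f y - (k.factorial : ℝ)⁻¹ • iteratedFDeriv ℝ k f 0 (fun _ => y) := by
        funext y
        rw [Finset.sum_range_succ, Finset.sum_eq_zero, zero_add]
        intro i hi
        rw [ih i (Finset.mem_range.1 hi) ((Finset.mem_range.1 hi).le.trans hk), smul_zero]
      rw [h2] at h1
      have h3 := h1.trans_isLittleO (isLittleO_pow_of_lt (E := E) (Nat.lt_succ_self k))
      have h4 := (h.trans_isBigO (isBigO_pow_of_le hk)).sub h3
      have h5 := h4.const_smul_left ((k.factorial : ℝ))
      refine h5.congr_left fun y => ?_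
      simp only [Pi.smul_apply]
      rw [sub_sub_cancel, smul_smul, mul_inv_cancel₀ (by positivity), one_smul]
  refine (isBigO_sub_taylor hf n).congr_left fun y => ?_
  rw [Finset.sum_eq_zero, sub_zero]
  intro i hi
  rw [hz i (Nat.lt_succ_iff.1 (Finset.mem_range.1 hi)), smul_zero]

/-- Interpolation between `w` and its second derivative on the ball of radius `s = ε ‖y‖` about `y`:
the first derivative is at most `sup |w| / s + s sup |w''|` up to constants. With `|w|` below `ε²
‖y‖^(k+2)` both terms are of order `ε ‖y‖^(k+1)`. -/
theorem fderiv_isLittleO_of_interpolation {w : E → F} {k : ℕ}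
    (hd : ∀ᶠ z in 𝓝 (0 : E), DifferentiableAt ℝ w z)
    (hd2 : ∀ᶠ z in 𝓝 (0 : E), DifferentiableAt ℝ (fderiv ℝ w) z)
    (h0 : w =o[𝓝 0] fun y => ‖y‖ ^ (k + 2)) (h2 : fderiv ℝ (fderiv ℝ w) =O[𝓝 0] fun y => ‖y‖ ^ k) :
    fderiv ℝ w =o[𝓝 0] fun y => ‖y‖ ^ (k + 1) := by
  obtain ⟨C, hC, h2⟩ := h2.exists_pos
  rw [isBigOWith_iff] at h2
  rw [isLittleO_iff]
  intro η hη
  -- parameters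
  set A : ℝ := C * 2 ^ k + 2 ^ (k + 3) with hA
  have hApos : 0 < A := by positivity
  -- `A` collects the constants at points of norm at most `2 ‖y‖`: `C 2^k` from the second
  -- derivative, and `2 · 2^(k+2)` from the two values of `w`. The bound `ε ≤ 1` keeps the small
  -- ball inside the one of radius `2 ‖y‖`.
  set ε : ℝ := min 1 (η / A) with hεdef
  have hε : 0 < ε := by positivity
  have hε1 : ε ≤ 1 := min_le_left _ _
  have hεA : ε * A ≤ η := by
    have : ε ≤ η / A := min_le_right _ _
    rwa [le_div_iff₀ hApos] at this
  obtain ⟨δ, hδ, hb⟩ := Metric.eventually_nhds_iff_ball.1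
    (((hd.and hd2).and h2).and (isLittleO_iff.1 h0 (c := ε ^ 2) (by positivity)))
  filter_upwards [Metric.ball_mem_nhds (0 : E) (half_pos hδ)] with y hy
  rw [mem_ball_zero_iff] at hy
  rw [norm_pow, norm_norm]
  set r := ‖y‖ with hr
  have hr0 : 0 ≤ r := norm_nonneg _
  rcases hr0.eq_or_lt with h00 | hrpos
  · have hy0 : y = 0 := norm_eq_zero.1 (by rw [← hr, ← h00])
    -- at the origin
    have hw : HasFDerivAt w (0 : E →L[ℝ] F) 0 := by
      have hb0 := (hb 0 (Metric.mem_ball_self hδ)).2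
      have hw0 : w 0 = 0 := by simpa using hb0
      rw [hasFDerivAt_iff_isLittleO_nhds_zero]
      simp only [zero_add, hw0, sub_zero, zero_apply]
      have h5 : (fun y : E => ‖y‖ ^ (k + 2)) =O[𝓝 0] fun y => y := by
        have := isBigO_pow_of_le (E := E) (m := 1) (n := k + 2) (by omega)
        simp only [pow_one] at this
        exact this.of_norm_right
      exact h0.trans_isBigO h5
    rw [hy0, hw.fderiv, norm_zero]
    positivity
  set s := ε * r with hs
  have hspos : 0 < s := by positivity
  have hsr : s ≤ r := by nlinarith
  have hin : ∀ z, ‖z - y‖ ≤ s → ‖z‖ ≤ 2 * r ∧ z ∈ Metric.ball (0 : E) δ := by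
    intro z hz
    have : ‖z‖ ≤ ‖z - y‖ + ‖y‖ := by simpa using norm_add_le (z - y) y
    refine ⟨by linarith, ?_⟩
    rw [mem_ball_zero_iff]
    linarith
  have key : ∀ e : E, ‖e‖ = s → ‖fderiv ℝ w y e‖ ≤ η * r ^ (k + 1) * ‖e‖ := by
    intro e he
    have hball : ∀ z ∈ Metric.closedBall y s, ‖z - y‖ ≤ s := fun z hz => by
      simpa [dist_eq_norm] using hz
    have hD : ∀ z ∈ Metric.closedBall y s,
        ‖fderiv ℝ w z - fderiv ℝ w y‖ ≤ C * (2 * r) ^ k * s := by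
      intro z hz
      have h3 := (convex_closedBall y s).norm_image_sub_le_of_norm_hasFDerivWithin_le
        (f := fderiv ℝ w) (C := C * (2 * r) ^ k)
        (fun x hx => ((hb x (hin x (hball x hx)).2).1.1.2.hasFDerivAt).hasFDerivWithinAt)
        (fun x hx => by
          have h4 := (hb x (hin x (hball x hx)).2).1.2
          rw [norm_pow, norm_norm] at h4
          refine h4.trans ?_
          gcongr
          exact (hin x (hball x hx)).1)
        (Metric.mem_closedBall_self hspos.le) hz
      refine h3.trans ?_
      gcongr
      exact hball z hz
    have hye : y + e ∈ Metric.closedBall y s := by simp [he]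
    have h5 := (convex_closedBall y s).norm_image_sub_le_of_norm_hasFDerivWithin_le'
      (f := w) (φ := fderiv ℝ w y) (C := C * (2 * r) ^ k * s)
      (fun x hx => ((hb x (hin x (hball x hx)).2).1.1.1.hasFDerivAt).hasFDerivWithinAt)
      hD (Metric.mem_closedBall_self hspos.le) hye
    rw [add_sub_cancel_left] at h5
    have h6 : ∀ z ∈ Metric.closedBall y s, ‖w z‖ ≤ ε ^ 2 * (2 * r) ^ (k + 2) := by
      intro z hz
      have h7 := (hb z (hin z (hball z hz)).2).2
      rw [norm_pow, norm_norm] at h7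
      refine h7.trans ?_
      gcongr
      exact (hin z (hball z hz)).1
    have h8 : ‖fderiv ℝ w y e‖ ≤ ‖w (y + e) - w y - fderiv ℝ w y e‖ + ‖w (y + e)‖ + ‖w y‖ := by
      have : fderiv ℝ w y e = -(w (y + e) - w y - fderiv ℝ w y e) + w (y + e) - w y := by abel
      calc ‖fderiv ℝ w y e‖ = ‖-(w (y + e) - w y - fderiv ℝ w y e) + w (y + e) - w y‖ := by
            rw [← this]
        _ ≤ _ := by
            refine (norm_sub_le _ _).trans ?_
            gcongr
            refine (norm_add_le _ _).trans ?_
            rw [norm_neg]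
    have h9 := h6 _ hye
    have h10 := h6 _ (Metric.mem_closedBall_self hspos.le)
    rw [he] at h5 ⊢
    calc ‖fderiv ℝ w y e‖ ≤ C * (2 * r) ^ k * s * s + ε ^ 2 * (2 * r) ^ (k + 2)
            + ε ^ 2 * (2 * r) ^ (k + 2) := by linarith
      _ = ε * A * r ^ (k + 1) * s := by
          rw [hA, hs]; ring
      _ ≤ η * r ^ (k + 1) * s := by gcongr
  refine ContinuousLinearMap.opNorm_le_bound _ (by positivity) fun v => ?_
  rcases eq_or_ne v 0 with rfl | hv
  · simp
  have hvpos : 0 < ‖v‖ := norm_pos_iff.2 hv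
  have h11 := key ((s / ‖v‖) • v) (by
    rw [norm_smul, Real.norm_of_nonneg (by positivity), div_mul_cancel₀ _ hvpos.ne'])
  rw [map_smul, norm_smul, norm_smul, Real.norm_of_nonneg (by positivity : 0 ≤ s / ‖v‖)] at h11
  have h12 : 0 < s / ‖v‖ := by positivity
  have h13 : s / ‖v‖ * ‖fderiv ℝ w y v‖ ≤ s / ‖v‖ * (η * r ^ (k + 1) * ‖v‖) := by
    calc _ ≤ _ := h11
      _ = _ := by ring
  exact le_of_mul_le_mul_left h13 h12

end Vanishing

section VanishingDeriv

open Asymptotics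

universe u

/-- The derivative of a smooth function which is `o(‖y‖^(n+1))` is `o(‖y‖^n)`. -/
theorem fderiv_isLittleO_of_contDiffAt {E : Type u} [NormedAddCommGroup E] [NormedSpace ℝ E]
    (n : ℕ) : ∀ {F : Type u} [NormedAddCommGroup F] [NormedSpace ℝ F] [CompleteSpace F]
      {f : E → F}, ContDiffAt ℝ ∞ f 0 → (f =o[𝓝 0] fun y => ‖y‖ ^ (n + 1)) →
      fderiv ℝ f =o[𝓝 0] fun y => ‖y‖ ^ n := by
  induction n using Nat.strong_induction_on with
  | _ n ih =>
    intro F _ _ _ f hf h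
    have hdf : ContDiffAt ℝ ∞ (fderiv ℝ f) 0 := hf.fderiv_right (by simp)
    have hddf : ContDiffAt ℝ ∞ (fderiv ℝ (fderiv ℝ f)) 0 := hdf.fderiv_right (by simp)
    have hd : ∀ {G : Type u} [NormedAddCommGroup G] [NormedSpace ℝ G] {f : E → G},
        ContDiffAt ℝ ∞ f 0 → ∀ᶠ z in 𝓝 (0 : E), DifferentiableAt ℝ f z := by
      intro G _ _ f hf
      have h1 : ContDiffAt ℝ 1 f 0 := hf.of_le (by exact_mod_cast le_top)
      filter_upwards [h1.eventually (by simp)] with z hz using hz.differentiableAt (by simp)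
    rcases n with - | k
    · have hw : HasFDerivAt f (0 : E →L[ℝ] F) 0 := by
        simp only [zero_add, pow_one] at h
        have h0 : f 0 = 0 := by
          have := (isLittleO_iff.1 h one_pos).self_of_nhds
          simpa using this
        rw [hasFDerivAt_iff_isLittleO_nhds_zero]
        simp only [zero_add, h0, sub_zero, zero_apply]
        exact h.of_norm_right
      simp only [pow_zero]
      rw [isLittleO_one_iff]
      have := hdf.continuousAt.tendsto
      rwa [hw.fderiv] at this
    -- The interpolation needs a bound on the second derivative. Two uses of the induction
    -- hypothesis make it little-o of one power less than wanted, and smoothness regains that power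
    -- as a big-O.
    · refine fderiv_isLittleO_of_interpolation (hd hf) (hd hdf) h ?_
      rcases k with - | k
      · simp only [pow_zero]
        exact hddf.continuousAt.tendsto.isBigO_one ℝ
      · refine isBigO_of_isLittleO_of_contDiffAt hddf ?_
        refine ih k (by omega) hdf ?_
        exact ih (k + 1) (by omega) hf (h.trans_isBigO (isBigO_pow_of_le (by omega)))

end VanishingDeriv

/-! ## Square roots of nonnegative functions and derivatives of integrals of them -/

section Glaeser

/-- Glaeser's inequality. The upper bound `f t + h f' t + M h²` for `f (t + h)` is smallest at `h =
-f' t / (2 M)`, where nonnegativity of `f` gives the claim. The bound on `f'` keeps this point in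
the interval. -/
theorem sq_deriv_le_of_nonneg {f f' : ℝ → ℝ} {M δ : ℝ} (hM : 0 < M) (hδ : 0 < δ)
    (hf : ∀ t ∈ Ioo (-(2 * δ)) (2 * δ), HasDerivAt f (f' t) t)
    (hL : ∀ s ∈ Ioo (-(2 * δ)) (2 * δ), ∀ t ∈ Ioo (-(2 * δ)) (2 * δ), |f' s - f' t| ≤ M * |s - t|)
    (hb : ∀ t ∈ Ioo (-(2 * δ)) (2 * δ), |f' t| ≤ M * δ)
    (h0 : ∀ t ∈ Ioo (-(2 * δ)) (2 * δ), 0 ≤ f t) {t : ℝ} (ht : t ∈ Ioo (-δ) δ) :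
    f' t ^ 2 ≤ 4 * M * f t := by
  have htI : t ∈ Ioo (-(2 * δ)) (2 * δ) := ⟨by linarith [ht.1], by linarith [ht.2]⟩
  set h := -(f' t) / (2 * M) with hh
  have hh1 : |h| < δ := by
    rw [hh, abs_div, abs_neg, abs_of_pos (by positivity : 0 < 2 * M), div_lt_iff₀ (by positivity)]
    have := hb t htI
    nlinarith
  have hth : t + h ∈ Ioo (-(2 * δ)) (2 * δ) := by
    rw [abs_lt] at hh1
    exact ⟨by linarith [ht.1, hh1.1], by linarith [ht.2, hh1.2]⟩
  have hseg : ∀ x ∈ uIcc t (t + h), x ∈ Ioo (-(2 * δ)) (2 * δ) := fun x hx =>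
    ordConnected_Ioo.uIcc_subset htI hth hx
  have hle : ∀ x ∈ uIcc t (t + h), |x - t| ≤ |h| := by
    intro x hx
    have := abs_sub_left_of_mem_uIcc hx
    simpa using this
  have h1 := (convex_uIcc t (t + h)).norm_image_sub_le_of_norm_hasFDerivWithin_le'
    (f := f) (f' := fun x => ContinuousLinearMap.toSpanSingleton ℝ (f' x))
    (φ := ContinuousLinearMap.toSpanSingleton ℝ (f' t)) (C := M * |h|)
    (fun x hx => (hf x (hseg x hx)).hasFDerivAt.hasFDerivWithinAt)
    (fun x hx => by
      refine ContinuousLinearMap.opNorm_le_bound _ (by positivity) fun v => ?_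
      have h2 := (hL x (hseg x hx) t htI).trans
        (mul_le_mul_of_nonneg_left (hle x hx) hM.le)
      simp only [sub_apply, ContinuousLinearMap.toSpanSingleton_apply, smul_eq_mul,
        Real.norm_eq_abs]
      rw [← mul_sub, abs_mul, mul_comm]
      gcongr)
    left_mem_uIcc right_mem_uIcc
  simp only [add_sub_cancel_left, ContinuousLinearMap.toSpanSingleton_apply, smul_eq_mul,
    Real.norm_eq_abs] at h1
  have h2 := h0 _ hth
  have h3 := (abs_le.1 h1).2
  have h4 : M * |h| * |h| = M * h ^ 2 := by rw [mul_assoc, abs_mul_abs_self]; ring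
  rw [h4] at h3
  have h5 : 0 ≤ f t + h * f' t + M * h ^ 2 := by linarith
  have h6 : h * f' t + M * h ^ 2 = -(f' t) ^ 2 / (4 * M) := by
    rw [hh]; field_simp; ring
  have h7 : f' t ^ 2 / (4 * M) ≤ f t := by
    have : -(f' t) ^ 2 / (4 * M) = -(f' t ^ 2 / (4 * M)) := by ring
    linarith
  rw [div_le_iff₀ (by positivity)] at h7
  linarith

theorem abs_div_sqrt_le {a b M : ℝ} (hM : 0 ≤ M) (h : a ^ 2 ≤ 4 * M * b) : |a / (2 * √b)| ≤ √M := by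
  rw [abs_div, abs_of_nonneg (by positivity : 0 ≤ 2 * √b)]
  have h1 : |a| ≤ 2 * (√M * √b) := by
    rw [← Real.sqrt_mul hM, ← Real.sqrt_sq_eq_abs]
    have : (2 : ℝ) = √4 := by
      rw [show (4 : ℝ) = 2 ^ 2 by norm_num, Real.sqrt_sq (by norm_num)]
    rw [this, ← Real.sqrt_mul (by norm_num)]
    exact Real.sqrt_le_sqrt (by linarith)
  refine div_le_of_le_mul₀ (by positivity) (by positivity) ?_
  linarith

/-- The root of `f` need not be differentiable at zeros, but `√(f + κ)` is, with derivative at most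
`√M` by Glaeser's inequality. Let `κ` tend to `0`. -/
theorem abs_sqrt_sub_sqrt_le {f f' : ℝ → ℝ} {M δ : ℝ} (hM : 0 < M) (hδ : 0 < δ)
    (hf : ∀ t ∈ Ioo (-(2 * δ)) (2 * δ), HasDerivAt f (f' t) t)
    (hL : ∀ s ∈ Ioo (-(2 * δ)) (2 * δ), ∀ t ∈ Ioo (-(2 * δ)) (2 * δ), |f' s - f' t| ≤ M * |s - t|)
    (hb : ∀ t ∈ Ioo (-(2 * δ)) (2 * δ), |f' t| ≤ M * δ)
    (h0 : ∀ t ∈ Ioo (-(2 * δ)) (2 * δ), 0 ≤ f t) {s t : ℝ} (hs : s ∈ Ioo (-δ) δ)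
    (ht : t ∈ Ioo (-δ) δ) : |√(f s) - √(f t)| ≤ √M * |s - t| := by
  have hI : ∀ x ∈ Ioo (-δ) δ, x ∈ Ioo (-(2 * δ)) (2 * δ) := fun x hx =>
    ⟨by linarith [hx.1], by linarith [hx.2]⟩
  have key : ∀ κ : ℝ, 0 < κ → |√(f s + κ) - √(f t + κ)| ≤ √M * |s - t| := by
    intro κ hκ
    have h1 : ∀ x ∈ Ioo (-δ) δ, HasDerivWithinAt (fun x => √(f x + κ))
        (f' x / (2 * √(f x + κ))) (Ioo (-δ) δ) x := by
      intro x hx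
      have hpos : 0 < f x + κ := add_pos_of_nonneg_of_pos (h0 x (hI x hx)) hκ
      exact (((hf x (hI x hx)).add_const κ).sqrt hpos.ne').hasDerivWithinAt
    have h2 : ∀ x ∈ Ioo (-δ) δ, ‖f' x / (2 * √(f x + κ))‖ ≤ √M := by
      intro x hx
      have h3 := sq_deriv_le_of_nonneg hM hδ hf hL hb h0 hx
      exact abs_div_sqrt_le hM.le (by nlinarith)
    exact (convex_Ioo (-δ) δ).norm_image_sub_le_of_norm_hasDerivWithin_le h1 h2 ht hs
  have hlim : ∀ x : ℝ, Tendsto (fun κ : ℝ => √(x + κ)) (𝓝[>] 0) (𝓝 (√x)) := by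
    intro x
    have : ContinuousAt (fun κ : ℝ => √(x + κ)) 0 := by fun_prop
    have h := this.tendsto
    rw [add_zero] at h
    exact h.mono_left nhdsWithin_le_nhds
  refine le_of_tendsto ((hlim (f s)).sub (hlim (f t))).abs ?_
  filter_upwards [self_mem_nhdsWithin] with κ hκ using key κ hκ

variable {P : Type*} [NormedAddCommGroup P] [NormedSpace ℝ P]
  [MeasurableSpace P] [BorelSpace P]

/-- Differentiation under the integral sign for `∫ ρ √f`, where `f ≥ 0` is smooth and has a
negligible set of zeros at time `0`. -/
theorem hasDerivAt_integral_sqrt {μ : Measure P} [IsFiniteMeasureOnCompacts μ] {f : ℝ × P → ℝ}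
    {ε : ℝ} (hε : 0 < ε) {U K : Set P} (hU : IsOpen U) (hK : IsCompact K) (hKU : K ⊆ U)
    (hf : ContDiffOn ℝ ∞ f (Ioo (-ε) ε ×ˢ U)) (hf0 : ∀ q ∈ Ioo (-ε) ε ×ˢ U, 0 ≤ f q)
    {ρ : P → ℝ} (hρ : ContinuousOn ρ U) (hρK : ∀ y ∈ U, y ∉ K → ρ y = 0)
    (hnull : ∀ᵐ y ∂μ, y ∈ U → f (0, y) ≠ 0) :
    (∃ C : ℝ, 0 ≤ C ∧ ∀ y ∈ K, |fderiv ℝ f (0, y) (1, 0) / (2 * √(f (0, y)))| ≤ C) ∧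
    IntegrableOn (fun y => ρ y * (fderiv ℝ f (0, y) (1, 0) / (2 * √(f (0, y))))) U μ ∧
    HasDerivAt (fun t => ∫ y in U, ρ y * √(f (t, y)) ∂μ)
      (∫ y in U, ρ y * (fderiv ℝ f (0, y) (1, 0) / (2 * √(f (0, y)))) ∂μ) 0 := by
  set W : Set (ℝ × P) := Ioo (-ε) ε ×ˢ U with hWdef
  have hW : IsOpen W := isOpen_Ioo.prod hU
  set g₁ : ℝ × P → ℝ := fun q => fderiv ℝ f q (1, 0) with hg₁
  have hg₁s : ContDiffOn ℝ ∞ g₁ W :=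
    (hf.fderiv_of_isOpen hW (m := ∞) (by simp)).clm_apply contDiffOn_const
  set g₂ : ℝ × P → ℝ := fun q => fderiv ℝ g₁ q (1, 0) with hg₂
  have hg₂s : ContDiffOn ℝ ∞ g₂ W :=
    (hg₁s.fderiv_of_isOpen hW (m := ∞) (by simp)).clm_apply contDiffOn_const
  have hline : ∀ {g : ℝ × P → ℝ}, ContDiffOn ℝ ∞ g W → ∀ t y, (t, y) ∈ W →
      HasDerivAt (fun t => g (t, y)) (fderiv ℝ g (t, y) (1, 0)) t := by
    intro g hg t y hty
    have h1 : HasFDerivAt g (fderiv ℝ g (t, y)) (t, y) :=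
      ((hg.contDiffAt (hW.mem_nhds hty)).differentiableAt (by simp)).hasFDerivAt
    exact h1.comp_hasDerivAt t ((hasDerivAt_id t).prodMk (hasDerivAt_const t y))
  set Q : Set (ℝ × P) := Icc (-(ε / 2)) (ε / 2) ×ˢ K with hQdef
  have hQ : IsCompact Q := isCompact_Icc.prod hK
  have hQW : Q ⊆ W := prod_mono (Icc_subset_Ioo (by linarith) (by linarith)) hKU
  obtain ⟨C₁, hC₁⟩ := hQ.exists_bound_of_continuousOn (hg₁s.continuousOn.mono hQW)
  obtain ⟨C₂, hC₂⟩ := hQ.exists_bound_of_continuousOn (hg₂s.continuousOn.mono hQW)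
  set δ := ε / 4 with hδdef
  have hδ : 0 < δ := by positivity
  -- `M` bounds the second time derivative, and `M δ` the first one, as the inequality for square
  -- roots requires.
  set M := |C₂| + |C₁| / δ + 1 with hMdef
  have hM : 0 < M := by positivity
  have hmemQ : ∀ t ∈ Ioo (-(2 * δ)) (2 * δ), ∀ y ∈ K, (t, y) ∈ Q := fun t ht y hy =>
    ⟨⟨by rw [hδdef] at ht; linarith [ht.1], by rw [hδdef] at ht; linarith [ht.2]⟩, hy⟩
  have hmemW : ∀ t ∈ Ioo (-(2 * δ)) (2 * δ), ∀ y ∈ K, (t, y) ∈ W := fun t ht y hy =>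
    hQW (hmemQ t ht y hy)
  have hd : ∀ y ∈ K, ∀ t ∈ Ioo (-(2 * δ)) (2 * δ),
      HasDerivAt (fun t => f (t, y)) (g₁ (t, y)) t :=
    fun y hy t ht => hline hf t y (hmemW t ht y hy)
  have hL : ∀ y ∈ K, ∀ s ∈ Ioo (-(2 * δ)) (2 * δ), ∀ t ∈ Ioo (-(2 * δ)) (2 * δ),
      |g₁ (s, y) - g₁ (t, y)| ≤ M * |s - t| := by
    intro y hy s hs t ht
    refine (convex_Ioo (-(2 * δ)) (2 * δ)).norm_image_sub_le_of_norm_hasDerivWithin_le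
      (f := fun t => g₁ (t, y)) (f' := fun t => g₂ (t, y))
      (fun x hx => (hline hg₁s x y (hmemW x hx y hy)).hasDerivWithinAt)
      (fun x hx => (hC₂ _ (hmemQ x hx y hy)).trans ?_) ht hs
    have : 0 ≤ |C₁| / δ := by positivity
    linarith [le_abs_self C₂]
  have hb : ∀ y ∈ K, ∀ t ∈ Ioo (-(2 * δ)) (2 * δ), |g₁ (t, y)| ≤ M * δ := by
    intro y hy t ht
    have h1 := hC₁ _ (hmemQ t ht y hy)
    rw [Real.norm_eq_abs] at h1
    have h2 : M * δ = (|C₂| + 1) * δ + |C₁| := by rw [hMdef]; field_simp; ring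
    have h3 : 0 ≤ (|C₂| + 1) * δ := by positivity
    linarith [le_abs_self C₁]
  have h0 : ∀ y ∈ K, ∀ t ∈ Ioo (-(2 * δ)) (2 * δ), 0 ≤ f (t, y) :=
    fun y hy t ht => hf0 _ (hmemW t ht y hy)
  have hzero : (0 : ℝ) ∈ Ioo (-δ) δ := by simp [hδ]
  have hzero' : (0 : ℝ) ∈ Ioo (-ε) ε := by simp [hε]
  have hρint : IntegrableOn ρ U μ := by
    have h1 : IntegrableOn ρ K μ := (hρ.mono hKU).integrableOn_compact hK
    refine h1.of_ae_sdiff_eq_zero hU.measurableSet.nullMeasurableSet ?_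
    exact Eventually.of_forall fun y hy => hρK y hy.1 hy.2
  have hcont : ∀ t ∈ Ioo (-ε) ε, ContinuousOn (fun y => ρ y * √(f (t, y))) U := by
    intro t ht
    refine hρ.mul (ContinuousOn.sqrt (hf.continuousOn.comp (by fun_prop) fun y hy => ⟨ht, hy⟩))
  have hF'cont : AEStronglyMeasurable
      (fun y => ρ y * (g₁ (0, y) / (2 * √(f (0, y))))) (μ.restrict U) := by
    have h1 : AEStronglyMeasurable ρ (μ.restrict U) :=
      hρ.aestronglyMeasurable hU.measurableSet
    have h2 : AEStronglyMeasurable (fun y => g₁ (0, y)) (μ.restrict U) :=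
      (hg₁s.continuousOn.comp (by fun_prop) fun y hy => ⟨hzero', hy⟩).aestronglyMeasurable
        hU.measurableSet
    have h3 : AEStronglyMeasurable (fun y => 2 * √(f (0, y))) (μ.restrict U) :=
      (continuousOn_const.mul (ContinuousOn.sqrt
        (hf.continuousOn.comp (by fun_prop) fun y hy => ⟨hzero', hy⟩))).aestronglyMeasurable
        hU.measurableSet
    exact h1.mul (h2.aemeasurable.div h3.aemeasurable).aestronglyMeasurable
  refine ⟨⟨√M, by positivity, fun y hy => abs_div_sqrt_le hM.le
    (sq_deriv_le_of_nonneg (f := fun t => f (t, y)) (f' := fun t => g₁ (t, y)) hM hδ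
    (hd y hy) (hL y hy) (hb y hy) (h0 y hy) hzero)⟩, ?_⟩
  -- The Lipschitz bound `√M |ρ|` dominates the difference quotients also where `f` vanishes. The
  -- pointwise derivative is wanted only almost everywhere, which excludes the zeros at time `0`.
  refine hasDerivAt_integral_of_dominated_loc_of_lip (𝕜 := ℝ) (s := Ioo (-δ) δ)
    (bound := fun y => √M * |ρ y|)
    (F := fun t y => ρ y * √(f (t, y)))
    (Ioo_mem_nhds hzero.1 hzero.2) ?_ ?_ hF'cont ?_ ?_ ?_
  · filter_upwards [Ioo_mem_nhds hzero'.1 hzero'.2] with t ht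
    exact (hcont t ht).aestronglyMeasurable hU.measurableSet
  · have h1 : IntegrableOn (fun y => ρ y * √(f (0, y))) K μ :=
      ((hcont 0 hzero').mono hKU).integrableOn_compact hK
    refine h1.of_ae_sdiff_eq_zero hU.measurableSet.nullMeasurableSet ?_
    exact Eventually.of_forall fun y hy => by simp [hρK y hy.1 hy.2]
  · refine (ae_restrict_iff' hU.measurableSet).2 (Eventually.of_forall fun y hy => ?_)
    by_cases hyK : y ∈ K
    · refine LipschitzOnWith.of_dist_le_mul fun s hs t ht => ?_
      have h1 := abs_sqrt_sub_sqrt_le (f := fun t => f (t, y)) (f' := fun t => g₁ (t, y)) hM hδ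
        (hd y hyK) (hL y hyK) (hb y hyK) (h0 y hyK) hs ht
      rw [Real.dist_eq, Real.dist_eq, ← mul_sub, abs_mul, Real.coe_nnabs, abs_mul, abs_abs,
        abs_of_nonneg (Real.sqrt_nonneg M)]
      calc _ ≤ |ρ y| * (√M * |s - t|) := by gcongr
        _ = _ := by ring
    · simp only [hρK y hy hyK, zero_mul]
      exact LipschitzOnWith.of_dist_le_mul fun s hs t ht => by simp
  · exact hρint.abs.const_mul _
  · refine (ae_restrict_iff' hU.measurableSet).2 ?_
    filter_upwards [hnull] with y hy hyU
    have h1 := hline hf 0 y ⟨hzero', hyU⟩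
    exact (h1.sqrt (hy hyU)).const_mul _

end Glaeser

theorem two_le_infty : (2 : ℕ∞ω) ≤ ∞ := by
  have h : ∀ n : ℕ, (n : ℕ∞ω) ≤ ∞ := fun n => by exact_mod_cast le_top
  exact h 2

/-! ## The Levi-Civita connection in coordinates -/

section LeviCivita

variable {E : Type*} [NormedAddCommGroup E] [NormedSpace ℝ E]

/-- `G` is a smooth Riemannian metric on the open set `U`. -/
structure IsMetricOn (G : E → E →L[ℝ] E →L[ℝ] ℝ) (U : Set E) : Prop where
  isOpen : IsOpen U
  smooth : ContDiffOn ℝ ∞ G U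
  symm : ∀ y ∈ U, ∀ v w, G y v w = G y w v
  pos : ∀ y ∈ U, ∀ v, v ≠ 0 → 0 < G y v v

namespace IsMetricOn

variable {G : E → E →L[ℝ] E →L[ℝ] ℝ} {U : Set E} (hG : IsMetricOn G U)
include hG

theorem contDiffAt {y : E} (hy : y ∈ U) : ContDiffAt ℝ ∞ G y :=
  hG.smooth.contDiffAt (hG.isOpen.mem_nhds hy)

theorem differentiableAt {y : E} (hy : y ∈ U) : DifferentiableAt ℝ G y :=
  (hG.contDiffAt hy).differentiableAt (by simp)

theorem eq_of_forall {y : E} (hy : y ∈ U) {v v' : E} (h : ∀ w, G y v w = G y v' w) : v = v' := by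
  by_contra hne
  have h1 := hG.pos y hy (v - v') (sub_ne_zero.2 hne)
  have h2 : G y (v - v') (v - v') = 0 := by
    have h3 : G y (v - v') (v - v') = G y v (v - v') - G y v' (v - v') := by simp
    rw [h3, h, sub_self]
  exact h1.ne' h2

theorem fderiv_symm {y : E} (hy : y ∈ U) (u v w : E) : fderiv ℝ G y u v w = fderiv ℝ G y u w v := by
  have h1 : ∀ v w, HasFDerivAt (fun z => G z v w)
      (((fderiv ℝ G y).flip v).flip w) y := by
    intro v w
    have h := (hG.differentiableAt hy).hasFDerivAt
    exact (h.clm_apply (hasFDerivAt_const v y)).clm_apply (hasFDerivAt_const w y) |>.congr_fderiv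
      (by ext; simp)
  have h2 : (fun z => G z v w) =ᶠ[𝓝 y] fun z => G z w v := by
    filter_upwards [hG.isOpen.mem_nhds hy] with z hz using hG.symm z hz v w
  have h3 := (h1 v w).unique ((h1 w v).congr_of_eventuallyEq h2)
  have := DFunLike.congr_fun h3 u
  simpa using this

variable [FiniteDimensional ℝ E]

theorem isInvertible {y : E} (hy : y ∈ U) : (G y).IsInvertible := by
  have hinj : Function.Injective (G y).toLinearMap := fun v v' h =>
    hG.eq_of_forall hy fun w => by
      have := DFunLike.congr_fun h w
      simpa using this
  have hdim : Module.finrank ℝ E = Module.finrank ℝ (E →L[ℝ] ℝ) := by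
    rw [← (LinearMap.toContinuousLinearMap (𝕜 := ℝ) (E := E) (F' := ℝ)).finrank_eq]
    exact (Subspace.dual_finrank_eq (K := ℝ) (V := E)).symm
  let e : E ≃ₗ[ℝ] (E →L[ℝ] ℝ) := LinearEquiv.ofInjectiveOfFinrankEq (G y).toLinearMap hinj hdim
  refine ⟨e.toContinuousLinearEquiv, ?_⟩
  ext v w
  rfl

theorem apply_inverse {y : E} (hy : y ∈ U) (φ : E →L[ℝ] ℝ) : G y ((G y).inverse φ) = φ := by
  obtain ⟨e, he⟩ := hG.isInvertible hy
  rw [← he, ContinuousLinearMap.inverse_equiv]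
  simp

theorem contDiffAt_inverse {y : E} (hy : y ∈ U) : ContDiffAt ℝ ∞ (fun z => (G z).inverse) y := by
  obtain ⟨e, he⟩ := hG.isInvertible hy
  have h1 : ContDiffAt ℝ ∞ (ContinuousLinearMap.inverse :
      (E →L[ℝ] E →L[ℝ] ℝ) → (E →L[ℝ] ℝ) →L[ℝ] E) (G y) := by
    rw [← he]; exact contDiffAt_map_inverse e
  exact h1.comp y (hG.contDiffAt hy)

theorem christoffel_spec {y : E} (hy : y ∈ U) (u v w : E) : G y (christoffel G y u v) w =
      (1 / 2 : ℝ) * (fderiv ℝ G y u v w + fderiv ℝ G y v u w - fderiv ℝ G y w u v) := by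
  rw [christoffel_apply, hG.apply_inverse hy, christoffelFirst_apply]

theorem christoffel_symm {y : E} (hy : y ∈ U) (u v : E) :
    christoffel G y u v = christoffel G y v u := by
  refine hG.eq_of_forall hy fun w => ?_
  rw [hG.christoffel_spec hy, hG.christoffel_spec hy, hG.fderiv_symm hy w u v]
  ring

theorem fderiv_eq {y : E} (hy : y ∈ U) (u v w : E) :
    fderiv ℝ G y u v w = G y (christoffel G y u v) w + G y v (christoffel G y u w) := by
  rw [hG.symm y hy v, hG.christoffel_spec hy, hG.christoffel_spec hy, hG.fderiv_symm hy u w v]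
  ring

theorem contDiffAt_christoffel {y : E} (hy : y ∈ U) : ContDiffAt ℝ ∞ (christoffel G) y := by
  have hd : ContDiffAt ℝ ∞ (fderiv ℝ G) y := (hG.contDiffAt hy).fderiv_right (by simp)
  have hflip : ContDiffAt ℝ ∞ (fun z => (fderiv ℝ G z).flip) y :=
    (ContinuousLinearMap.flipₗᵢ ℝ E E (E →L[ℝ] ℝ)).toContinuousLinearEquiv.contDiff.contDiffAt.comp
      y hd
  have h1 : ContDiffAt ℝ ∞ (christoffelFirst G) y := by
    unfold christoffelFirst
    exact (contDiffAt_const (c := (1 / 2 : ℝ))).smul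
      ((hd.add hflip).sub (contDiffAt_const.clm_comp hflip))
  unfold christoffel
  have h2 : ContDiffAt ℝ ∞
      (fun z => ContinuousLinearMap.compL ℝ E (E →L[ℝ] ℝ) E (G z).inverse) y :=
    (ContinuousLinearMap.compL ℝ E (E →L[ℝ] ℝ) E).contDiff.contDiffAt.comp y
      (hG.contDiffAt_inverse hy)
  exact h2.clm_comp h1

end IsMetricOn

/-- The transformation law of the Christoffel symbols. -/
theorem christoffel_transform [FiniteDimensional ℝ E] {G G' : E → E →L[ℝ] E →L[ℝ] ℝ} {U U' : Set E}
    (hG : IsMetricOn G U) (hG' : IsMetricOn G' U') {Φ : E → E} {x : E} (hx : x ∈ U)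
    (hx' : Φ x ∈ U') (hΦ : ContDiffAt ℝ ∞ Φ x) (hsurj : Function.Surjective (fderiv ℝ Φ x))
    (h : ∀ᶠ z in 𝓝 x, ∀ v w, G z v w = G' (Φ z) (fderiv ℝ Φ z v) (fderiv ℝ Φ z w)) (v w : E) :
    fderiv ℝ Φ x (christoffel G x v w) =
      christoffel G' (Φ x) (fderiv ℝ Φ x v) (fderiv ℝ Φ x w) + fderiv ℝ (fderiv ℝ Φ) x v w := by
  have hdΦ : HasFDerivAt Φ (fderiv ℝ Φ x) x := (hΦ.differentiableAt (by simp)).hasFDerivAt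
  have hd2 : HasFDerivAt (fderiv ℝ Φ) (fderiv ℝ (fderiv ℝ Φ) x) x :=
    ((hΦ.fderiv_right (m := ∞) (by simp)).differentiableAt (by simp)).hasFDerivAt
  have hsym : ∀ a b, fderiv ℝ (fderiv ℝ Φ) x a b = fderiv ℝ (fderiv ℝ Φ) x b a := by
    intro a b
    have h1 : IsSymmSndFDerivAt ℝ Φ x := hΦ.isSymmSndFDerivAt (by simpa using two_le_infty)
    exact h1.eq a b
  have hD : ∀ a v w, fderiv ℝ G x a v w =
      fderiv ℝ G' (Φ x) (fderiv ℝ Φ x a) (fderiv ℝ Φ x v) (fderiv ℝ Φ x w)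
      + G' (Φ x) (fderiv ℝ (fderiv ℝ Φ) x a v) (fderiv ℝ Φ x w)
      + G' (Φ x) (fderiv ℝ Φ x v) (fderiv ℝ (fderiv ℝ Φ) x a w) := by
    intro a v w
    have h1 := ((hG.differentiableAt hx).hasFDerivAt.clm_apply
      (hasFDerivAt_const v x)).clm_apply (hasFDerivAt_const w x)
    have h2 := (((hG'.differentiableAt hx').hasFDerivAt.comp x hdΦ).clm_apply
      (hd2.clm_apply (hasFDerivAt_const v x))).clm_apply
        (hd2.clm_apply (hasFDerivAt_const w x))
    have h3 : (fun z => G z v w) =ᶠ[𝓝 x]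
        fun z => G' (Φ z) (fderiv ℝ Φ z v) (fderiv ℝ Φ z w) := by
      filter_upwards [h] with z hz using hz v w
    have h4 := DFunLike.congr_fun (h1.unique (h2.congr_of_eventuallyEq h3)) a
    simp at h4
    linarith
  refine hG'.eq_of_forall hx' fun w' => ?_
  obtain ⟨b, rfl⟩ := hsurj w'
  rw [← h.self_of_nhds, hG.christoffel_spec hx, map_add, add_apply, hG'.christoffel_spec hx',
    hD, hD, hD, hsym b v, hsym b w, hsym w v,
    hG'.symm _ hx' (fderiv ℝ Φ x w) (fderiv ℝ (fderiv ℝ Φ) x v b)]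
  ring

end LeviCivita

/-! ## The mean curvature vector in coordinates -/

section MeanCurv

variable {E : Type*} [NormedAddCommGroup E] [NormedSpace ℝ E]

/-- The coordinate vector `∂_i u`. -/
def partialVec (u : Plane → E) (y : Plane) (i : Fin 2) : E := fderiv ℝ u y (basisVec i)

/-- The metric induced by `u`. -/
def gram (G : E → E →L[ℝ] E →L[ℝ] ℝ) (u : Plane → E) (y : Plane) (i j : Fin 2) : ℝ :=
  G (u y) (partialVec u y i) (partialVec u y j)

/-- The determinant of the induced metric. -/
def gramDet (G : E → E →L[ℝ] E →L[ℝ] ℝ) (u : Plane → E) (y : Plane) : ℝ :=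
  gram G u y 0 0 * gram G u y 1 1 - gram G u y 0 1 ^ 2

/-- The inverse of the metric induced by `u`. -/
def gramInv (G : E → E →L[ℝ] E →L[ℝ] ℝ) (u : Plane → E) (y : Plane) : Matrix (Fin 2) (Fin 2) ℝ :=
  (Matrix.of (gram G u y))⁻¹

/-- The vector `∇_{∂_i} ∂_j u`. -/
def covHess (G : E → E →L[ℝ] E →L[ℝ] ℝ) (u : Plane → E) (y : Plane) (i j : Fin 2) : E :=
  fderiv ℝ (fderiv ℝ u) y (basisVec i) (basisVec j)
    + christoffel G (u y) (partialVec u y i) (partialVec u y j)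

/-- The component of a vector normal to the image of `u`. -/
def normalComp (G : E → E →L[ℝ] E →L[ℝ] ℝ) (u : Plane → E) (y : Plane) (v : E) : E :=
  v - ∑ i, ∑ j, (gramInv G u y i j * G (u y) v (partialVec u y i)) • partialVec u y j

/-- The mean curvature vector of `u`. -/
def meanCurv (G : E → E →L[ℝ] E →L[ℝ] ℝ) (u : Plane → E) (y : Plane) : E :=
  ∑ i, ∑ j, gramInv G u y i j • normalComp G u y (covHess G u y i j)

theorem basisVec_apply (i j : Fin 2) : basisVec i j = if j = i then 1 else 0 := by
  simp [basisVec]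

theorem eq_sum_basisVec (v : Plane) : v = v 0 • basisVec 0 + v 1 • basisVec 1 := by
  ext i
  fin_cases i <;> simp [basisVec_apply]

theorem map_eq_sum_basisVec {F : Type*} [NormedAddCommGroup F] [NormedSpace ℝ F]
    (A : Plane →L[ℝ] F) (v : Plane) : A v = v 0 • A (basisVec 0) + v 1 • A (basisVec 1) := by
  conv_lhs => rw [eq_sum_basisVec v]
  simp

/-- No nondegeneracy is assumed: when the determinant is zero, the inverse matrix and the quotients
are all zero by convention. -/
theorem gramInv_apply {G : E → E →L[ℝ] E →L[ℝ] ℝ} {u : Plane → E} {y : Plane}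
    (hs : gram G u y 1 0 = gram G u y 0 1) : gramInv G u y 0 0 = gram G u y 1 1 / gramDet G u y ∧
    gramInv G u y 0 1 = -gram G u y 0 1 / gramDet G u y ∧
    gramInv G u y 1 0 = -gram G u y 0 1 / gramDet G u y ∧
    gramInv G u y 1 1 = gram G u y 0 0 / gramDet G u y := by
  have hdet : (Matrix.of (gram G u y)).det = gramDet G u y := by
    rw [Matrix.det_fin_two, gramDet]; simp [hs]; ring
  unfold gramInv
  rw [Matrix.inv_def, hdet, Ring.inverse_eq_inv', Matrix.adjugate_fin_two]
  refine ⟨?_, ?_, ?_, ?_⟩ <;> simp [hs] <;> ring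

theorem normalComp_add (G : E → E →L[ℝ] E →L[ℝ] ℝ) (u : Plane → E) (y : Plane) (v w : E) :
    normalComp G u y (v + w) = normalComp G u y v + normalComp G u y w := by
  simp only [normalComp, map_add, add_apply, Fin.sum_univ_two]
  module

theorem normalComp_smul (G : E → E →L[ℝ] E →L[ℝ] ℝ) (u : Plane → E) (y : Plane) (c : ℝ) (v : E) :
    normalComp G u y (c • v) = c • normalComp G u y v := by
  simp only [normalComp, map_smul, smul_apply, smul_eq_mul, Fin.sum_univ_two]
  module

theorem gram_comm {G : E → E →L[ℝ] E →L[ℝ] ℝ} {U : Set E} (hG : IsMetricOn G U) {u : Plane → E}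
    {y : Plane} (hy : u y ∈ U) (i j : Fin 2) : gram G u y i j = gram G u y j i :=
  hG.symm _ hy _ _

theorem normalComp_partialVec {G : E → E →L[ℝ] E →L[ℝ] ℝ} {U : Set E} (hG : IsMetricOn G U)
    {u : Plane → E} {y : Plane} (hy : u y ∈ U) (hdet : gramDet G u y ≠ 0) (k : Fin 2) :
    normalComp G u y (partialVec u y k) = 0 := by
  obtain ⟨h00, h01, h10, h11⟩ := gramInv_apply (gram_comm hG hy 1 0)
  have hg : ∀ i, G (u y) (partialVec u y k) (partialVec u y i) = gram G u y k i := fun i => rfl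
  simp only [normalComp, Fin.sum_univ_two, hg, h00, h01, h10, h11]
  have hd : gramDet G u y = gram G u y 0 0 * gram G u y 1 1 - gram G u y 0 1 ^ 2 := rfl
  fin_cases k
  · simp only [Fin.zero_eta, Fin.mk_one]
    have h1 : gram G u y 1 1 / gramDet G u y * gram G u y 0 0 +
        -gram G u y 0 1 / gramDet G u y * gram G u y 0 1 = 1 := by
      field_simp; rw [hd]; ring
    have h2 : -gram G u y 0 1 / gramDet G u y * gram G u y 0 0 +
        gram G u y 0 0 / gramDet G u y * gram G u y 0 1 = 0 := by
      field_simp; ring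
    calc _ = partialVec u y 0 - ((gram G u y 1 1 / gramDet G u y * gram G u y 0 0 +
        -gram G u y 0 1 / gramDet G u y * gram G u y 0 1) • partialVec u y 0 +
        (-gram G u y 0 1 / gramDet G u y * gram G u y 0 0 +
        gram G u y 0 0 / gramDet G u y * gram G u y 0 1) • partialVec u y 1) := by module
      _ = 0 := by rw [h1, h2]; simp
  · simp only [Fin.mk_one, gram_comm hG hy 1 0]
    have h1 : gram G u y 1 1 / gramDet G u y * gram G u y 0 1 +
        -gram G u y 0 1 / gramDet G u y * gram G u y 1 1 = 0 := by
      field_simp; ring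
    have h2 : -gram G u y 0 1 / gramDet G u y * gram G u y 0 1 +
        gram G u y 0 0 / gramDet G u y * gram G u y 1 1 = 1 := by
      field_simp; rw [hd]; ring
    calc _ = partialVec u y 1 - ((gram G u y 1 1 / gramDet G u y * gram G u y 0 1 +
        -gram G u y 0 1 / gramDet G u y * gram G u y 1 1) • partialVec u y 0 +
        (-gram G u y 0 1 / gramDet G u y * gram G u y 0 1 +
        gram G u y 0 0 / gramDet G u y * gram G u y 1 1) • partialVec u y 1) := by module
      _ = 0 := by rw [h1, h2]; simp

theorem normalComp_inner {G : E → E →L[ℝ] E →L[ℝ] ℝ} {U : Set E} (hG : IsMetricOn G U)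
    {u : Plane → E} {y : Plane} (hy : u y ∈ U) (hdet : gramDet G u y ≠ 0) (v : E) (k : Fin 2) :
    G (u y) (normalComp G u y v) (partialVec u y k) = 0 := by
  obtain ⟨h00, h01, h10, h11⟩ := gramInv_apply (gram_comm hG hy 1 0)
  have hg : ∀ i j, G (u y) (partialVec u y i) (partialVec u y j) = gram G u y i j :=
    fun i j => rfl
  simp only [normalComp, Fin.sum_univ_two, map_sub, map_add, map_smul, sub_apply, add_apply,
    smul_apply, smul_eq_mul, hg, h00, h01, h10, h11]
  have hd : gramDet G u y = gram G u y 0 0 * gram G u y 1 1 - gram G u y 0 1 ^ 2 := rfl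
  have hs := gram_comm hG hy 1 0
  fin_cases k
  · simp only [Fin.zero_eta, hs]
    field_simp; rw [hd]; ring
  · simp only [Fin.mk_one]
    field_simp; rw [hd]; ring

theorem meanCurv_inner_partialVec {G : E → E →L[ℝ] E →L[ℝ] ℝ} {U : Set E} (hG : IsMetricOn G U)
    {u : Plane → E} {y : Plane} (hy : u y ∈ U) (hdet : gramDet G u y ≠ 0) (k : Fin 2) :
    G (u y) (meanCurv G u y) (partialVec u y k) = 0 := by
  simp [meanCurv, Fin.sum_univ_two, normalComp_inner hG hy hdet]

/-- The mean curvature vector is natural under isometries. -/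
theorem meanCurv_comp_left [FiniteDimensional ℝ E] {G G' : E → E →L[ℝ] E →L[ℝ] ℝ} {U U' : Set E}
    (hG : IsMetricOn G U) (hG' : IsMetricOn G' U') {Φ : E → E} {u : Plane → E} {y : Plane}
    (hu : ContDiffAt ℝ ∞ u y) (hx : u y ∈ U) (hx' : Φ (u y) ∈ U') (hΦ : ContDiffAt ℝ ∞ Φ (u y))
    (hsurj : Function.Surjective (fderiv ℝ Φ (u y)))
    (h : ∀ᶠ z in 𝓝 (u y), ∀ v w, G z v w = G' (Φ z) (fderiv ℝ Φ z v) (fderiv ℝ Φ z w)) :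
    meanCurv G' (Φ ∘ u) y = fderiv ℝ Φ (u y) (meanCurv G u y) := by
  have hev : fderiv ℝ (Φ ∘ u) =ᶠ[𝓝 y] fun z => (fderiv ℝ Φ (u z)).comp (fderiv ℝ u z) := by
    have h1 : ContDiffAt ℝ 1 Φ (u y) := hΦ.of_le (by exact_mod_cast le_top)
    have h2 : ContDiffAt ℝ 1 u y := hu.of_le (by exact_mod_cast le_top)
    filter_upwards [h2.eventually (by simp),
      hu.continuousAt.eventually (h1.eventually (by simp))] with z hz1 hz2
    exact fderiv_comp z (hz2.differentiableAt (by simp)) (hz1.differentiableAt (by simp))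
  have hp : ∀ i, partialVec (Φ ∘ u) y i = fderiv ℝ Φ (u y) (partialVec u y i) := by
    intro i
    rw [partialVec, hev.self_of_nhds]; rfl
  have hg : ∀ i j, gram G' (Φ ∘ u) y i j = gram G u y i j := by
    intro i j
    rw [gram, hp, hp, gram, h.self_of_nhds]; rfl
  have hinv : gramInv G' (Φ ∘ u) y = gramInv G u y := by
    unfold gramInv
    congr 2
    ext i j
    exact hg i j
  -- The second derivative of `Φ` produced by the chain rule is the inhomogeneous term in the
  -- transformation law of the Christoffel symbols.
  have hhess : ∀ i j, covHess G' (Φ ∘ u) y i j = fderiv ℝ Φ (u y) (covHess G u y i j) := by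
    intro i j
    have hd2 : HasFDerivAt (fderiv ℝ Φ) (fderiv ℝ (fderiv ℝ Φ) (u y)) (u y) :=
      ((hΦ.fderiv_right (m := ∞) (by simp)).differentiableAt (by simp)).hasFDerivAt
    have hdu : HasFDerivAt u (fderiv ℝ u y) y := (hu.differentiableAt (by simp)).hasFDerivAt
    have hdu2 : HasFDerivAt (fderiv ℝ u) (fderiv ℝ (fderiv ℝ u) y) y :=
      ((hu.fderiv_right (m := ∞) (by simp)).differentiableAt (by simp)).hasFDerivAt
    have h3 := (hd2.comp y hdu).clm_comp hdu2
    rw [covHess, (h3.congr_of_eventuallyEq hev).fderiv, covHess, map_add,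
      christoffel_transform hG hG' hx hx' hΦ hsurj h, hp, hp]
    simp [partialVec]
    abel
  have hN : ∀ v, normalComp G' (Φ ∘ u) y (fderiv ℝ Φ (u y) v) =
      fderiv ℝ Φ (u y) (normalComp G u y v) := by
    intro v
    rw [normalComp, normalComp, map_sub, map_sum]
    congr 1
    refine Finset.sum_congr rfl fun i _ => ?_
    rw [map_sum]
    refine Finset.sum_congr rfl fun j _ => ?_
    rw [map_smul, hp, hp, hinv, h.self_of_nhds]
    rfl
  rw [meanCurv, meanCurv, map_sum]
  refine Finset.sum_congr rfl fun i _ => ?_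
  rw [map_sum]
  refine Finset.sum_congr rfl fun j _ => ?_
  rw [map_smul, hinv, hhess, hN]

/-- The mean curvature vector does not depend on the parametrization. -/
theorem meanCurv_comp_right {G : E → E →L[ℝ] E →L[ℝ] ℝ} {U : Set E}
    (hG : IsMetricOn G U) {u : Plane → E} {τ : Plane → Plane} {y : Plane}
    (hτ : ContDiffAt ℝ ∞ τ y) (hu : ContDiffAt ℝ ∞ u (τ y)) (hx : u (τ y) ∈ U)
    (hτdet : IsUnit (Matrix.of fun a i => fderiv ℝ τ y (basisVec i) a : Matrix (Fin 2) (Fin 2) ℝ))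
    (hdet : gramDet G u (τ y) ≠ 0) : meanCurv G (u ∘ τ) y = meanCurv G u (τ y) := by
  set A : Matrix (Fin 2) (Fin 2) ℝ := Matrix.of fun a i => fderiv ℝ τ y (basisVec i) a with hA
  have hev : fderiv ℝ (u ∘ τ) =ᶠ[𝓝 y] fun z => (fderiv ℝ u (τ z)).comp (fderiv ℝ τ z) := by
    have h1 : ContDiffAt ℝ 1 u (τ y) := hu.of_le (by exact_mod_cast le_top)
    have h2 : ContDiffAt ℝ 1 τ y := hτ.of_le (by exact_mod_cast le_top)
    filter_upwards [h2.eventually (by simp),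
      hτ.continuousAt.eventually (h1.eventually (by simp))] with z hz1 hz2
    exact fderiv_comp z (hz2.differentiableAt (by simp)) (hz1.differentiableAt (by simp))
  have hp : ∀ i, partialVec (u ∘ τ) y i =
      A 0 i • partialVec u (τ y) 0 + A 1 i • partialVec u (τ y) 1 := by
    intro i
    rw [partialVec, hev.self_of_nhds, ContinuousLinearMap.comp_apply, map_eq_sum_basisVec]; rfl
  have hg : Matrix.of (gram G (u ∘ τ) y) = A.transpose * Matrix.of (gram G u (τ y)) * A := by
    ext i j
    simp only [Matrix.of_apply, gram, hp, map_add, map_smul, add_apply, smul_apply, smul_eq_mul,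
      Matrix.mul_apply, Fin.sum_univ_two, Matrix.transpose_apply, Function.comp_apply]
    ring
  have hinv : gramInv G u (τ y) = A * gramInv G (u ∘ τ) y * A.transpose := by
    unfold gramInv
    rw [hg, Matrix.mul_inv_rev, Matrix.mul_inv_rev, ← Matrix.mul_assoc,
      Matrix.mul_nonsing_inv _ ((Matrix.isUnit_iff_isUnit_det _).1 hτdet), Matrix.one_mul,
      Matrix.mul_assoc, Matrix.nonsing_inv_mul, Matrix.mul_one]
    rw [Matrix.det_transpose]
    exact (Matrix.isUnit_iff_isUnit_det _).1 hτdet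
  set I := gramInv G (u ∘ τ) y with hI
  have hinv' : ∀ a b, gramInv G u (τ y) a b =
      A a 0 * I 0 0 * A b 0 + A a 1 * I 1 0 * A b 0 + A a 0 * I 0 1 * A b 1
        + A a 1 * I 1 1 * A b 1 := by
    intro a b
    rw [hinv]
    simp only [Matrix.mul_apply, Fin.sum_univ_two, Matrix.transpose_apply]
    ring
  have hN : ∀ v, normalComp G (u ∘ τ) y v = normalComp G u (τ y) v := by
    intro v
    simp only [normalComp, Fin.sum_univ_two, hp, hinv', ← hI, map_add, map_smul, smul_eq_mul,
      Function.comp_apply]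
    module
  have hhess : ∀ i j, covHess G (u ∘ τ) y i j =
      A 0 i • A 0 j • covHess G u (τ y) 0 0 + A 0 i • A 1 j • covHess G u (τ y) 0 1
      + A 1 i • A 0 j • covHess G u (τ y) 1 0 + A 1 i • A 1 j • covHess G u (τ y) 1 1
      + (fderiv ℝ (fderiv ℝ τ) y (basisVec i) (basisVec j) 0 • partialVec u (τ y) 0
        + fderiv ℝ (fderiv ℝ τ) y (basisVec i) (basisVec j) 1 • partialVec u (τ y) 1) := by
    intro i j
    have hd2 : HasFDerivAt (fderiv ℝ u) (fderiv ℝ (fderiv ℝ u) (τ y)) (τ y) :=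
      ((hu.fderiv_right (m := ∞) (by simp)).differentiableAt (by simp)).hasFDerivAt
    have hdu : HasFDerivAt τ (fderiv ℝ τ y) y := (hτ.differentiableAt (by simp)).hasFDerivAt
    have hdu2 : HasFDerivAt (fderiv ℝ τ) (fderiv ℝ (fderiv ℝ τ) y) y :=
      ((hτ.fderiv_right (m := ∞) (by simp)).differentiableAt (by simp)).hasFDerivAt
    have h3 := (hd2.comp y hdu).clm_comp hdu2
    have h4 : ∀ i, fderiv ℝ τ y (basisVec i) = A 0 i • basisVec 0 + A 1 i • basisVec 1 :=
      fun i => eq_sum_basisVec _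
    have h5 : fderiv ℝ (fderiv ℝ (u ∘ τ)) y (basisVec i) (basisVec j) =
        fderiv ℝ u (τ y) (fderiv ℝ (fderiv ℝ τ) y (basisVec i) (basisVec j))
        + fderiv ℝ (fderiv ℝ u) (τ y) (fderiv ℝ τ y (basisVec i)) (fderiv ℝ τ y (basisVec j)) := by
      rw [(h3.congr_of_eventuallyEq hev).fderiv]
      simp
    rw [covHess, h5, map_eq_sum_basisVec (fderiv ℝ u (τ y)), h4, h4, hp, hp]
    simp only [covHess, map_add, map_smul, add_apply, smul_apply, Function.comp_apply]
    simp only [partialVec]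
    module
  -- The second derivative of `τ` contributes only tangential vectors to the Hessian, and the normal
  -- projection kills them.
  have hzero := normalComp_partialVec hG hx hdet
  simp only [meanCurv, Fin.sum_univ_two, hN, hhess, normalComp_add, normalComp_smul, hzero,
    smul_zero, add_zero, hinv', ← hI]
  module

end MeanCurv

/-! ## The first variation of area in coordinates -/

/-- The vector density `√(det h) h^{ij} x_j` associated with a covector `x`. -/
def flux (h : Fin 2 → Fin 2 → ℝ) (x : Fin 2 → ℝ) : Fin 2 → ℝ :=
  ![(h 1 1 * x 0 - h 0 1 * x 1) / √(h 0 0 * h 1 1 - h 0 1 ^ 2),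
    (h 0 0 * x 1 - h 0 1 * x 0) / √(h 0 0 * h 1 1 - h 0 1 ^ 2)]

/-- The density `√(det h) h^{ij} α_i β_j`. -/
def pairing (h : Fin 2 → Fin 2 → ℝ) (α β : Fin 2 → ℝ) : ℝ :=
  α 0 * flux h β 0 + α 1 * flux h β 1

/-- The first variation formula as an identity of rational functions. Here `h` is the induced
metric, `s` the root of its determinant, `x j = ⟨X, ∂_j⟩`, `p k j = ⟨∇_k X, ∂_j⟩`, `q k j = ⟨X, ∇_k
∂_j⟩` and `c k i j = ⟨∇_k ∂_i, ∂_j⟩`. The two outer summands on the right are the divergence of the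
flux, and the last one is `s ⟨H, X⟩`. -/
theorem firstVariation_algebra {h00 h01 h11 x0 x1 p00 p01 p10 p11 q00 q01 q11
    c000 c001 c010 c011 c110 c111 s : ℝ} (hd : h00 * h11 - h01 ^ 2 ≠ 0) (hs : s ≠ 0)
    (hs2 : s ^ 2 = h00 * h11 - h01 ^ 2) :
    (2 * p00 * h11 + h00 * (2 * p11) - 2 * h01 * (p01 + p10)) / (2 * s) =
      ((((2 * c011) * x0 + h11 * (p00 + q00)) - ((c001 + c010) * x1 + h01 * (p01 + q01))) / s
        - (h11 * x0 - h01 * x1) * ((2 * c000) * h11 + h00 * (2 * c011) - 2 * h01 * (c001 + c010)) /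
          (2 * s * (h00 * h11 - h01 ^ 2)))
      + ((((2 * c010) * x1 + h00 * (p11 + q11)) - ((c011 + c110) * x0 + h01 * (p10 + q01))) / s
        - (h00 * x1 - h01 * x0) * ((2 * c010) * h11 + h00 * (2 * c111) - 2 * h01 * (c011 + c110)) /
          (2 * s * (h00 * h11 - h01 ^ 2))) - s * (h11 / (h00 * h11 - h01 ^ 2) *
          (q00 - (h11 / (h00 * h11 - h01 ^ 2) * c000 * x0 + -h01 / (h00 * h11 - h01 ^ 2) * c000 * x1
            + (-h01 / (h00 * h11 - h01 ^ 2) * c001 * x0 + h00 / (h00 * h11 - h01 ^ 2) * c001 * x1)))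
        + -h01 / (h00 * h11 - h01 ^ 2) * (q01 - (h11 / (h00 * h11 - h01 ^ 2) * c010 * x0
            + -h01 / (h00 * h11 - h01 ^ 2) * c010 * x1 + (-h01 / (h00 * h11 - h01 ^ 2) * c011 * x0
            + h00 / (h00 * h11 - h01 ^ 2) * c011 * x1))) + (-h01 / (h00 * h11 - h01 ^ 2) *
          (q01 - (h11 / (h00 * h11 - h01 ^ 2) * c010 * x0 + -h01 / (h00 * h11 - h01 ^ 2) * c010 * x1
            + (-h01 / (h00 * h11 - h01 ^ 2) * c011 * x0 + h00 / (h00 * h11 - h01 ^ 2) * c011 * x1)))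
        + h00 / (h00 * h11 - h01 ^ 2) * (q11 - (h11 / (h00 * h11 - h01 ^ 2) * c110 * x0
            + -h01 / (h00 * h11 - h01 ^ 2) * c110 * x1 + (-h01 / (h00 * h11 - h01 ^ 2) * c111 * x0
            + h00 / (h00 * h11 - h01 ^ 2) * c111 * x1))))) := by
  set d := h00 * h11 - h01 ^ 2 with hdd
  have hsd : s = d / s := by field_simp; exact hs2
  have key : ∀ Z : ℝ, s * Z = d * Z / s := by
    intro Z; rw [← hs2]; field_simp
  rw [key]
  field_simp
  rw [hdd]
  ring

theorem hasFDerivAt_div_sqrt {V : Type*} [NormedAddCommGroup V] [NormedSpace ℝ V] {n d : V → ℝ}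
    {n' d' : V →L[ℝ] ℝ} {y : V} (hn : HasFDerivAt n n' y) (hd : HasFDerivAt d d' y)
    (hpos : 0 < d y) :
    DifferentiableAt ℝ (fun z => n z / √(d z)) y ∧ ∀ v, fderiv ℝ (fun z => n z / √(d z)) y v =
      n' v / √(d y) - n y * d' v / (2 * √(d y) * d y) := by
  have hs : 0 < √(d y) := Real.sqrt_pos.2 hpos
  have h0 := (hasDerivAt_inv hs.ne').comp_hasFDerivAt y (hd.sqrt hpos.ne')
  have h1 := hn.mul h0
  have heq : (fun z => n z / √(d z)) = n * (fun x => x⁻¹) ∘ fun z => √(d z) := by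
    funext z; simp [div_eq_mul_inv]
  rw [heq]
  refine ⟨HasFDerivAt.differentiableAt h1, fun v => ?_⟩
  have h2 : √(d y) ^ 2 = d y := Real.sq_sqrt hpos.le
  rw [HasFDerivAt.fderiv h1]
  simp only [one_div, mul_inv_rev, smul_apply, add_apply, smul_eq_mul, Function.comp_apply]
  conv_rhs => rw [← h2, Real.sqrt_sq hs.le]
  field_simp
  ring

section FirstVariation

variable {E : Type*} [NormedAddCommGroup E] [NormedSpace ℝ E] [FiniteDimensional ℝ E]

/-- The pointwise first variation formula: the derivative of the area density is the divergence
of the tangential part of the velocity minus the product of the velocity with the mean curvature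
vector. -/
theorem firstVariation {G : E → E →L[ℝ] E →L[ℝ] ℝ} {U : Set E} (hG : IsMetricOn G U)
    {u : ℝ × Plane → E} {y₀ : Plane} (hu : ContDiffAt ℝ ∞ u (0, y₀)) (hx : u (0, y₀) ∈ U)
    (hdet : 0 < gramDet G (fun y => u (0, y)) y₀) {X : Plane → E}
    (hX : ∀ᶠ y in 𝓝 y₀, X y = fderiv ℝ u (0, y) (1, 0)) {V : Fin 2 → Plane → ℝ}
    (hV : ∀ᶠ y in 𝓝 y₀, ∀ i, V i y = flux (gram G (fun y => u (0, y)) y)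
      (fun j => G (u (0, y)) (X y) (partialVec (fun y => u (0, y)) y j)) i) {f : ℝ × Plane → ℝ}
    (hf : ∀ᶠ q in 𝓝 (0, y₀), f q = gramDet G (fun y => u (q.1, y)) q.2) :
    (∀ i, DifferentiableAt ℝ (V i) y₀) ∧ fderiv ℝ f (0, y₀) (1, 0) / (2 * √(f (0, y₀))) =
      fderiv ℝ (V 0) y₀ (basisVec 0) + fderiv ℝ (V 1) y₀ (basisVec 1)
        - √(f (0, y₀)) * G (u (0, y₀)) (meanCurv G (fun y => u (0, y)) y₀) (X y₀) := by
  set u₀ : Plane → E := fun y => u (0, y) with hu₀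
  set q₀ : ℝ × Plane := (0, y₀) with hq₀
  set a : ℝ × Plane → Fin 2 → E := fun q i => fderiv ℝ u q (0, basisVec i) with ha
  set Y : ℝ × Plane → E := fun q => fderiv ℝ u q (1, 0) with hY
  set h : Fin 2 → Fin 2 → ℝ × Plane → ℝ := fun i j q => G (u q) (a q i) (a q j) with hh
  set x : Fin 2 → ℝ × Plane → ℝ := fun j q => G (u q) (Y q) (a q j) with hxx
  have hud : ∀ᶠ q in 𝓝 q₀, DifferentiableAt ℝ u q := by
    have h1 : ContDiffAt ℝ 1 u q₀ := hu.of_le (by exact_mod_cast le_top)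
    filter_upwards [h1.eventually (by simp)] with q hq using hq.differentiableAt (by simp)
  have hpart : ∀ᶠ q in 𝓝 q₀, ∀ i, partialVec (fun y => u (q.1, y)) q.2 i = a q i := by
    filter_upwards [hud] with q hq i
    have h1 : HasFDerivAt (fun y => u (q.1, y))
        ((fderiv ℝ u q).comp (ContinuousLinearMap.inr ℝ ℝ Plane)) q.2 :=
      HasFDerivAt.comp q.2 (g := u) (f := fun y => (q.1, y)) hq.hasFDerivAt
        (hasFDerivAt_prodMk_right _ _)
    rw [partialVec, h1.fderiv]
    rfl
  have hembT : Tendsto (fun y : Plane => ((0 : ℝ), y)) (𝓝 y₀) (𝓝 q₀) :=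
    (Continuous.prodMk_right (0 : ℝ)).tendsto y₀
  have hgram : ∀ᶠ y in 𝓝 y₀, ∀ i j, gram G u₀ y i j = h i j (0, y) := by
    filter_upwards [hembT.eventually hpart] with y hy i j
    simp only [gram, hh, ← hy]; rfl
  -- derivatives on the product
  have hdu : HasFDerivAt u (fderiv ℝ u q₀) q₀ := hud.self_of_nhds.hasFDerivAt
  have hdu2 : HasFDerivAt (fderiv ℝ u) (fderiv ℝ (fderiv ℝ u) q₀) q₀ :=
    ((hu.fderiv_right (m := ∞) (by simp)).differentiableAt (by simp)).hasFDerivAt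
  set S := fderiv ℝ (fderiv ℝ u) q₀ with hS
  have hsym : ∀ v w, S v w = S w v := fun v w =>
    (hu.isSymmSndFDerivAt (by simpa using two_le_infty)).eq v w
  have hdG : HasFDerivAt (fun q => G (u q)) ((fderiv ℝ G (u q₀)).comp (fderiv ℝ u q₀)) q₀ :=
    (hG.differentiableAt hx).hasFDerivAt.comp q₀ hdu
  -- Metric compatibility on the product of time and surface. All derivatives needed below, of the
  -- induced metric in space and time and of its pairing with the velocity, are instances of this
  -- one formula.
  have hpair : ∀ v w : ℝ × Plane, ∃ B : ℝ × Plane →L[ℝ] ℝ,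
      HasFDerivAt (fun q => G (u q) (fderiv ℝ u q v) (fderiv ℝ u q w)) B q₀ ∧
      ∀ z, B z = G (u q₀) (S z v + christoffel G (u q₀) (fderiv ℝ u q₀ z) (fderiv ℝ u q₀ v))
          (fderiv ℝ u q₀ w)
        + G (u q₀) (fderiv ℝ u q₀ v)
          (S z w + christoffel G (u q₀) (fderiv ℝ u q₀ z) (fderiv ℝ u q₀ w)) := by
    intro v w
    have h1 := (hdG.clm_apply (hdu2.clm_apply (hasFDerivAt_const v q₀))).clm_apply
      (hdu2.clm_apply (hasFDerivAt_const w q₀))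
    refine ⟨_, h1, fun z => ?_⟩
    simp only [map_add, add_apply]
    have h2 := hG.fderiv_eq hx (fderiv ℝ u q₀ z) (fderiv ℝ u q₀ v) (fderiv ℝ u q₀ w)
    simp
    rw [h2]
    ring
  choose B hB hB' using hpair
  -- scalar data
  set Γ := christoffel G (u q₀) with hΓ
  set e : Fin 2 → ℝ × Plane := fun i => (0, basisVec i) with he
  set c : Fin 2 → Fin 2 → Fin 2 → ℝ := fun k i j =>
    G (u q₀) (S (e k) (e i) + Γ (a q₀ k) (a q₀ i)) (a q₀ j) with hc
  set p : Fin 2 → Fin 2 → ℝ := fun k j =>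
    G (u q₀) (S (e k) (1, 0) + Γ (a q₀ k) (Y q₀)) (a q₀ j) with hp
  set r : Fin 2 → Fin 2 → ℝ := fun k j =>
    G (u q₀) (S (e k) (e j) + Γ (a q₀ k) (a q₀ j)) (Y q₀) with hr
  have hΓs : ∀ v w, Γ v w = Γ w v := hG.christoffel_symm hx
  have hcs : ∀ k i j, c k i j = c i k j := by
    intro k i j; simp only [hc]; rw [hsym, hΓs]
  have hrs : ∀ k j, r k j = r j k := by
    intro k i; simp only [hr]; rw [hsym, hΓs]
  have hdh : ∀ i j k, B (e i) (e j) (e k) = c k i j + c k j i := by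
    intro i j k
    rw [hB', hG.symm _ hx (fderiv ℝ u q₀ (e i))]
  have hdt : ∀ i j, B (e i) (e j) (1, 0) = p i j + p j i := by
    intro i j
    rw [hB', hG.symm _ hx (fderiv ℝ u q₀ (e i)), hsym (1, 0) (e i), hsym (1, 0) (e j),
      hΓs _ (fderiv ℝ u q₀ (e i)), hΓs _ (fderiv ℝ u q₀ (e j))]
  have hdx : ∀ j k, B (1, 0) (e j) (e k) = p k j + r k j := by
    intro j k
    rw [hB', hG.symm _ hx (fderiv ℝ u q₀ (1, 0))]
  have hhB : ∀ i j, HasFDerivAt (h i j) (B (e i) (e j)) q₀ := fun i j => hB (e i) (e j)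
  have hxB : ∀ j, HasFDerivAt (x j) (B (1, 0) (e j)) q₀ := fun j => hB (1, 0) (e j)
  -- the determinant
  have hd : HasFDerivAt (fun q => h 0 0 q * h 1 1 q - h 0 1 q ^ 2)
      (h 0 0 q₀ • B (e 1) (e 1) + h 1 1 q₀ • B (e 0) (e 0)
        - (2 * h 0 1 q₀) • B (e 0) (e 1)) q₀ := by
    have h1 := ((hhB 0 0).mul (hhB 1 1)).sub ((hhB 0 1).pow 2)
    refine h1.congr_fderiv ?_
    ext z <;> simp
  have hdet' : 0 < h 0 0 q₀ * h 1 1 q₀ - h 0 1 q₀ ^ 2 := by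
    have h1 := hgram.self_of_nhds
    rw [gramDet, h1, h1, h1] at hdet
    exact hdet
  have hfeq : f =ᶠ[𝓝 q₀] fun q => h 0 0 q * h 1 1 q - h 0 1 q ^ 2 := by
    filter_upwards [hf, hpart] with q hq1 hq2
    rw [hq1, gramDet]
    simp only [gram, hq2, hh]
  have hemb : HasFDerivAt (fun y : Plane => ((0 : ℝ), y))
      (ContinuousLinearMap.inr ℝ ℝ Plane) y₀ := hasFDerivAt_prodMk_right _ _
  -- the fluxes
  have hn0 : HasFDerivAt (fun q => h 1 1 q * x 0 q - h 0 1 q * x 1 q) _ q₀ :=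
    ((hhB 1 1).mul (hxB 0)).sub ((hhB 0 1).mul (hxB 1))
  have hn1 : HasFDerivAt (fun q => h 0 0 q * x 1 q - h 0 1 q * x 0 q) _ q₀ :=
    ((hhB 0 0).mul (hxB 1)).sub ((hhB 0 1).mul (hxB 0))
  obtain ⟨hV0d, hV0⟩ := hasFDerivAt_div_sqrt (y := y₀) (hn0.comp y₀ hemb) (hd.comp y₀ hemb) hdet'
  obtain ⟨hV1d, hV1⟩ := hasFDerivAt_div_sqrt (y := y₀) (hn1.comp y₀ hemb) (hd.comp y₀ hemb) hdet'
  have hVeq0 : V 0 =ᶠ[𝓝 y₀] fun y => (h 1 1 (0, y) * x 0 (0, y) - h 0 1 (0, y) * x 1 (0, y)) /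
      √(h 0 0 (0, y) * h 1 1 (0, y) - h 0 1 (0, y) ^ 2) := by
    filter_upwards [hV, hX, hgram, hembT.eventually hpart] with y h1 h2 h3 h4
    rw [h1]
    simp only [flux, h3, h2, Matrix.cons_val_zero, hxx, ← h4]
    rfl
  have hVeq1 : V 1 =ᶠ[𝓝 y₀] fun y => (h 0 0 (0, y) * x 1 (0, y) - h 0 1 (0, y) * x 0 (0, y)) /
      √(h 0 0 (0, y) * h 1 1 (0, y) - h 0 1 (0, y) ^ 2) := by
    filter_upwards [hV, hX, hgram, hembT.eventually hpart] with y h1 h2 h3 h4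
    rw [h1]
    simp only [flux, h3, h2, Matrix.cons_val_one, Matrix.cons_val_zero, hxx, ← h4]
    rfl
  refine ⟨fun i => ?_, ?_⟩
  · fin_cases i
    · exact hV0d.congr_of_eventuallyEq hVeq0
    · exact hV1d.congr_of_eventuallyEq hVeq1
  rw [hVeq0.fderiv_eq, hVeq1.fderiv_eq, hfeq.fderiv_eq, hfeq.self_of_nhds, hd.fderiv]
  rw [show (fun y => (h 1 1 (0, y) * x 0 (0, y) - h 0 1 (0, y) * x 1 (0, y)) /
      √(h 0 0 (0, y) * h 1 1 (0, y) - h 0 1 (0, y) ^ 2)) = fun z =>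
      ((fun q => h 1 1 q * x 0 q - h 0 1 q * x 1 q) ∘ fun y : Plane => ((0 : ℝ), y)) z /
      √(((fun q => h 0 0 q * h 1 1 q - h 0 1 q ^ 2) ∘ fun y : Plane => ((0 : ℝ), y)) z) from rfl,
    hV0,
    show (fun y => (h 0 0 (0, y) * x 1 (0, y) - h 0 1 (0, y) * x 0 (0, y)) /
      √(h 0 0 (0, y) * h 1 1 (0, y) - h 0 1 (0, y) ^ 2)) = fun z =>
      ((fun q => h 0 0 q * x 1 q - h 0 1 q * x 0 q) ∘ fun y : Plane => ((0 : ℝ), y)) z /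
      √(((fun q => h 0 0 q * h 1 1 q - h 0 1 q ^ 2) ∘ fun y : Plane => ((0 : ℝ), y)) z) from rfl,
    hV1]
  -- the mean curvature term
  have hgr : ∀ i j, gram G u₀ y₀ i j = h i j q₀ := hgram.self_of_nhds
  have hpv : ∀ i, partialVec u₀ y₀ i = a q₀ i := hpart.self_of_nhds
  have hch : ∀ i j, covHess G u₀ y₀ i j = S (e i) (e j) + Γ (a q₀ i) (a q₀ j) := by
    intro i j
    have h1 : fderiv ℝ u₀ =ᶠ[𝓝 y₀]
        fun y => (fderiv ℝ u (0, y)).comp (ContinuousLinearMap.inr ℝ ℝ Plane) := by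
      filter_upwards [hembT.eventually hud] with y hy
      exact (HasFDerivAt.comp y (g := u) (f := fun y => (0, y)) hy.hasFDerivAt
        (hasFDerivAt_prodMk_right _ _)).fderiv
    have h2 := (hdu2.comp y₀ hemb).clm_comp
      (hasFDerivAt_const (ContinuousLinearMap.inr ℝ ℝ Plane) y₀)
    rw [covHess, (h2.congr_of_eventuallyEq h1).fderiv, hpv, hpv]
    simp [hS, he, hΓ, hu₀, hq₀]
  have hX0 : X y₀ = Y q₀ := hX.self_of_nhds
  obtain ⟨h00, h01, h10, h11⟩ := gramInv_apply (G := G) (u := u₀) (y := y₀)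
    (gram_comm hG hx 1 0)
  have hgd : gramDet G u₀ y₀ = h 0 0 q₀ * h 1 1 q₀ - h 0 1 q₀ ^ 2 := by
    rw [gramDet, hgr, hgr, hgr]
  rw [hgd, hgr] at h00 h01 h10 h11
  have hcdef : ∀ k i j, G (u q₀) (S (e k) (e i) + Γ (a q₀ k) (a q₀ i)) (a q₀ j) = c k i j :=
    fun k i j => rfl
  have hrdef : ∀ k j, G (u q₀) (S (e k) (e j) + Γ (a q₀ k) (a q₀ j)) (Y q₀) = r k j :=
    fun k j => rfl
  have hxs : ∀ j, G (u q₀) (a q₀ j) (Y q₀) = x j q₀ := fun j => hG.symm _ hx _ _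
  have hu0q : u₀ y₀ = u q₀ := rfl
  have hM : G (u q₀) (meanCurv G u₀ y₀) (X y₀) =
      ∑ i, ∑ j, gramInv G u₀ y₀ i j * (r i j - ∑ k, ∑ l, gramInv G u₀ y₀ k l * c i j k * x l q₀) := by
    simp only [meanCurv, Fin.sum_univ_two, normalComp, hpv, hch, hX0, map_add, map_sub, map_smul,
      add_apply, sub_apply, smul_apply, smul_eq_mul, hu0q, hxs]
    simp only [← hcdef, ← hrdef, map_add, add_apply]
  rw [hM]
  simp only [Fin.sum_univ_two, h00, h01, h10, h11]
  have hz : ∀ v : Plane, (ContinuousLinearMap.inr ℝ ℝ Plane) v = (0, v) := fun v => rfl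
  simp only [ContinuousLinearMap.comp_apply, hz, add_apply, sub_apply, smul_apply, smul_eq_mul,
    Function.comp_apply]
  have he' : ∀ i, ((0 : ℝ), basisVec i) = e i := fun i => rfl
  simp only [he', hdh, hdt, hdx, ← hq₀]
  rw [hcs 1 0 0, hcs 1 0 1, hrs 1 0]
  have hmain := firstVariation_algebra (h00 := h 0 0 q₀) (h01 := h 0 1 q₀) (h11 := h 1 1 q₀)
    (x0 := x 0 q₀) (x1 := x 1 q₀) (p00 := p 0 0) (p01 := p 0 1) (p10 := p 1 0) (p11 := p 1 1)
    (q00 := r 0 0) (q01 := r 0 1) (q11 := r 1 1) (c000 := c 0 0 0) (c001 := c 0 0 1)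
    (c010 := c 0 1 0) (c011 := c 0 1 1) (c110 := c 1 1 0) (c111 := c 1 1 1) hdet'.ne'
    (Real.sqrt_pos.2 hdet').ne' (Real.sq_sqrt hdet'.le)
  calc _ = _ := by ring
    _ = _ := hmain
    _ = _ := by ring

end FirstVariation

/-! ## Kähler metrics in coordinates -/

section KahlerLocal

variable {E : Type*} [NormedAddCommGroup E] [NormedSpace ℂ E]

/-- `G` is a Kähler metric on the open set `U`. -/
structure IsKahlerOn (G : E → E →L[ℝ] E →L[ℝ] ℝ) (U : Set E) : Prop extends IsMetricOn G U where
  hermitian : ∀ y ∈ U, ∀ v w, G y (Complex.I • v) (Complex.I • w) = G y v w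
  closed : ∀ y ∈ U, ∀ u v w, fderiv ℝ G y u (Complex.I • v) w
    + fderiv ℝ G y v (Complex.I • w) u + fderiv ℝ G y w (Complex.I • u) v = 0

theorem I_smul_I_smul (v : E) : Complex.I • Complex.I • v = -v := by
  rw [smul_smul, Complex.I_mul_I, neg_smul, one_smul]

theorem complex_smul_eq (z : ℂ) (v : E) : z • v = z.re • v + z.im • Complex.I • v := by
  conv_lhs => rw [← Complex.re_add_im z]
  rw [add_smul, mul_smul, Complex.coe_smul, Complex.coe_smul]

theorem map_complex_smul {A : E →L[ℝ] E} (hA : ∀ v, A (Complex.I • v) = Complex.I • A v)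
    (z : ℂ) (v : E) : A (z • v) = z • A v := by
  rw [complex_smul_eq z v, complex_smul_eq z (A v), map_add, map_smul, map_smul, hA]

namespace IsKahlerOn

variable {G : E → E →L[ℝ] E →L[ℝ] ℝ} {U : Set E} (hG : IsKahlerOn G U)
include hG

theorem apply_I_left {y : E} (hy : y ∈ U) (v w : E) :
    G y (Complex.I • v) w = -G y v (Complex.I • w) := by
  have h := hG.hermitian y hy v (Complex.I • w)
  rw [I_smul_I_smul, map_neg] at h
  linarith

theorem apply_I_self {y : E} (hy : y ∈ U) (v : E) : G y (Complex.I • v) v = 0 := by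
  have h := hG.apply_I_left hy v v
  rw [hG.symm y hy v] at h
  linarith

theorem fderiv_I_left {y : E} (hy : y ∈ U) (u v w : E) :
    fderiv ℝ G y u (Complex.I • v) w = -fderiv ℝ G y u v (Complex.I • w) := by
  have h1 : ∀ v w, HasFDerivAt (fun z => G z v w)
      (((fderiv ℝ G y).flip v).flip w) y := by
    intro v w
    have h := (hG.differentiableAt hy).hasFDerivAt
    exact (h.clm_apply (hasFDerivAt_const v y)).clm_apply (hasFDerivAt_const w y) |>.congr_fderiv
      (by ext; simp)
  have h2 : (fun z => G z (Complex.I • v) w) =ᶠ[𝓝 y] fun z => -G z v (Complex.I • w) := by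
    filter_upwards [hG.isOpen.mem_nhds hy] with z hz using hG.apply_I_left hz v w
  have h3 := (h1 (Complex.I • v) w).unique ((h1 v (Complex.I • w)).neg.congr_of_eventuallyEq h2)
  have := DFunLike.congr_fun h3 u
  simpa using this

variable [FiniteDimensional ℝ E]

/-- The Levi-Civita connection of a Kähler metric is complex linear. -/
theorem christoffel_I {y : E} (hy : y ∈ U) (u v : E) :
    christoffel G y u (Complex.I • v) = Complex.I • christoffel G y u v := by
  refine hG.eq_of_forall hy fun w => ?_
  rw [hG.apply_I_left hy, hG.christoffel_spec hy, hG.christoffel_spec hy]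
  have e1 := hG.fderiv_I_left hy u v w
  -- The analytic input is closedness, used at `(u, v, w)` and at `(u, I v, I w)`. The remaining
  -- relations are the pointwise symmetries of the derivative of a hermitian metric.
  have e2 := hG.closed y hy u v w
  have e3 := hG.closed y hy u (Complex.I • v) (Complex.I • w)
  rw [I_smul_I_smul, I_smul_I_smul] at e3
  simp only [map_neg, neg_apply] at e3
  have e4 := hG.fderiv_I_left hy (Complex.I • w) u (Complex.I • v)
  rw [I_smul_I_smul, map_neg, neg_neg] at e4
  have e5 := hG.fderiv_symm hy (Complex.I • v) w u
  have e6 := hG.fderiv_I_left hy w u v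
  have e7 := hG.fderiv_symm hy v (Complex.I • w) u
  linarith

theorem hasFDerivAt_christoffel_apply {y : E} (hy : y ∈ U) (v w : E) :
    HasFDerivAt (fun z => christoffel G z v w)
      (((fderiv ℝ (christoffel G) y).flip v).flip w) y := by
  have h := ((hG.contDiffAt_christoffel hy).differentiableAt (by simp)).hasFDerivAt
  exact (h.clm_apply (hasFDerivAt_const v y)).clm_apply (hasFDerivAt_const w y) |>.congr_fderiv
    (by ext; simp)

theorem fderiv_christoffel_I {y : E} (hy : y ∈ U) (u v w : E) :
    fderiv ℝ (christoffel G) y u v (Complex.I • w) =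
      Complex.I • fderiv ℝ (christoffel G) y u v w := by
  have h2 : (fun z => christoffel G z v (Complex.I • w)) =ᶠ[𝓝 y]
      fun z => (Complex.I • ContinuousLinearMap.id ℝ E) (christoffel G z v w) := by
    filter_upwards [hG.isOpen.mem_nhds hy] with z hz using hG.christoffel_I hz v w
  have h3 := (hG.hasFDerivAt_christoffel_apply hy v (Complex.I • w)).unique
    (((Complex.I • ContinuousLinearMap.id ℝ E : E →L[ℝ] E).hasFDerivAt.comp y
      (hG.hasFDerivAt_christoffel_apply hy v w)).congr_of_eventuallyEq h2)
  have := DFunLike.congr_fun h3 u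
  simpa using this

theorem fderiv_christoffel_symm {y : E} (hy : y ∈ U) (u v w : E) :
    fderiv ℝ (christoffel G) y u v w = fderiv ℝ (christoffel G) y u w v := by
  have h2 : (fun z => christoffel G z v w) =ᶠ[𝓝 y] fun z => christoffel G z w v := by
    filter_upwards [hG.isOpen.mem_nhds hy] with z hz using hG.christoffel_symm hz v w
  have h3 := (hG.hasFDerivAt_christoffel_apply hy v w).unique
    ((hG.hasFDerivAt_christoffel_apply hy w v).congr_of_eventuallyEq h2)
  have := DFunLike.congr_fun h3 u
  simpa using this

theorem curvature_I {y : E} (hy : y ∈ U) (u v w : E) :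
    curvature G y u v (Complex.I • w) = Complex.I • curvature G y u v w := by
  simp only [curvature, hG.fderiv_christoffel_I hy, hG.christoffel_I hy, smul_add, smul_sub]

/-- The first Bianchi identity. -/
theorem curvature_bianchi {y : E} (hy : y ∈ U) (u v w : E) :
    curvature G y u v w = -curvature G y v w u + curvature G y u w v := by
  simp only [curvature]
  rw [hG.fderiv_christoffel_symm hy v w u, hG.fderiv_christoffel_symm hy w v u,
    hG.fderiv_christoffel_symm hy u w v, hG.christoffel_symm hy w u, hG.christoffel_symm hy v u,
    hG.christoffel_symm hy w v]
  abel

end IsKahlerOn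

variable (b : Module.Basis (Fin 2) ℂ E)

/-- The complex determinant of two vectors in a basis. -/
def detC (v w : E) : ℂ := b.coord 0 v * b.coord 1 w - b.coord 1 v * b.coord 0 w

/-- The complex trace of a map in a basis. -/
def traceC (A : E → E) : ℂ := b.coord 0 (A (b 0)) + b.coord 1 (A (b 1))

variable {b}

theorem eq_coord_smul (v : E) : v = b.coord 0 v • b 0 + b.coord 1 v • b 1 := by
  have := b.sum_repr v
  rw [Fin.sum_univ_two] at this
  exact this.symm

theorem coord_map {A : E →L[ℝ] E} (hA : ∀ v, A (Complex.I • v) = Complex.I • A v) (i : Fin 2)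
    (v : E) : b.coord i (A v) =
      b.coord 0 v * b.coord i (A (b 0)) + b.coord 1 v * b.coord i (A (b 1)) := by
  conv_lhs => rw [eq_coord_smul (b := b) v]
  rw [map_add, map_complex_smul hA, map_complex_smul hA, map_add, map_smul, map_smul,
    smul_eq_mul, smul_eq_mul]

/-- A complex linear map acts as a derivation on the top exterior power, by its trace. This is how
the covariant derivative of the determinant of a frame meets the connection form `tauForm`. -/
theorem detC_map_add {A : E →L[ℝ] E} (hA : ∀ v, A (Complex.I • v) = Complex.I • A v) (v w : E) :
    detC b (A v) w + detC b v (A w) = traceC b A * detC b v w := by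
  simp only [detC, traceC]
  rw [coord_map hA 0 v, coord_map hA 1 v, coord_map hA 0 w, coord_map hA 1 w]
  ring

theorem traceC_comm {A B : E →L[ℝ] E} (hA : ∀ v, A (Complex.I • v) = Complex.I • A v)
    (hB : ∀ v, B (Complex.I • v) = Complex.I • B v) :
    traceC b (fun v => A (B v)) = traceC b (fun v => B (A v)) := by
  simp only [traceC]
  rw [coord_map hA 0 (B _), coord_map hA 1 (B _), coord_map hB 0 (A _), coord_map hB 1 (A _)]
  ring

/-- The real trace of a complex linear map is twice the real part of its complex trace, and
multiplication by `I` brings the imaginary part into its place. -/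
theorem trace_I_smul (A : E →ₗ[ℝ] E) (hA : ∀ v, A (Complex.I • v) = Complex.I • A v) :
    LinearMap.trace ℝ E ((Complex.I • LinearMap.id (R := ℝ) (M := E)) ∘ₗ A) =
      -2 * (traceC b A).im := by
  rw [LinearMap.trace_eq_matrix_trace ℝ (Complex.basisOneI.smulTower b), Matrix.trace,
    Fintype.sum_prod_type]
  simp only [Matrix.diag_apply, LinearMap.toMatrix_apply, Module.Basis.smulTower_repr,
    Module.Basis.smulTower_apply, Fin.sum_univ_two, LinearMap.comp_apply, LinearMap.smul_apply,
    LinearMap.id_apply, traceC]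
  simp [hA]
  ring

theorem cramer {v w : E} (h : detC b v w ≠ 0) (x : E) :
    x = (detC b x w / detC b v w) • v + (detC b v x / detC b v w) • w := by
  refine b.ext_elem fun i => ?_
  rw [map_add, map_smul, map_smul, Finsupp.add_apply, Finsupp.smul_apply, Finsupp.smul_apply]
  have hc : ∀ i x, b.repr x i = b.coord i x := fun i x => rfl
  have h' : b.coord 0 v * b.coord 1 w - b.coord 1 v * b.coord 0 w ≠ 0 := h
  simp only [hc, detC, smul_eq_mul]
  rw [div_mul_eq_mul_div, div_mul_eq_mul_div, ← add_div, eq_div_iff h']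
  fin_cases i
  · simp only [Fin.zero_eta]; ring
  · simp only [Fin.mk_one]; ring

end KahlerLocal

/-! ### The Ricci form as the curvature of the canonical bundle -/

section KahlerRicci

variable {E : Type*} [NormedAddCommGroup E] [NormedSpace ℂ E] [FiniteDimensional ℝ E]

/-- The imaginary part of the complex trace. -/
def imTrace (b : Module.Basis (Fin 2) ℂ E) : (E →L[ℝ] E) →L[ℝ] ℝ :=
  LinearMap.toContinuousLinearMap
    { toFun := fun A => (traceC b A).im
      map_add' := fun A B => by simp [traceC]; ring
      map_smul' := fun r A => by simp [traceC]; ring }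

theorem imTrace_apply (b : Module.Basis (Fin 2) ℂ E) (A : E →L[ℝ] E) :
    imTrace b A = (traceC b A).im := rfl

/-- The connection form of the canonical bundle. -/
def tauForm (b : Module.Basis (Fin 2) ℂ E) (G : E → E →L[ℝ] E →L[ℝ] ℝ) (y : E) : E →L[ℝ] ℝ :=
  (imTrace b).comp (christoffel G y)

theorem tauForm_apply (b : Module.Basis (Fin 2) ℂ E) (G : E → E →L[ℝ] E →L[ℝ] ℝ) (y v : E) :
    tauForm b G y v = (traceC b (christoffel G y v)).im := rfl

/-- The curvature tensor `u ↦ R(u, v) w`. -/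
def curvatureFst (G : E → E →L[ℝ] E →L[ℝ] ℝ) (y v w : E) : E →ₗ[ℝ] E where
  toFun := fun u => curvature G y u v w
  map_add' := fun u u' => by
    simp only [curvature, map_add, add_apply]; abel
  map_smul' := fun c u => by
    simp only [curvature, map_smul, smul_apply, RingHom.id_apply, smul_add, smul_sub]

/-- The curvature tensor `w ↦ R(u, v) w`. -/
def curvatureThd (G : E → E →L[ℝ] E →L[ℝ] ℝ) (y u v : E) : E →L[ℝ] E :=
  fderiv ℝ (christoffel G) y u v - fderiv ℝ (christoffel G) y v u
    + (christoffel G y u).comp (christoffel G y v) - (christoffel G y v).comp (christoffel G y u)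

theorem ricci_eq_trace (G : E → E →L[ℝ] E →L[ℝ] ℝ) (y v w : E) :
    ricci G y v w = LinearMap.trace ℝ E (curvatureFst G y v w) := rfl

namespace IsKahlerOn

variable {G : E → E →L[ℝ] E →L[ℝ] ℝ} {U : Set E} (hG : IsKahlerOn G U)
include hG

theorem contDiffAt_tauForm (b : Module.Basis (Fin 2) ℂ E) {y : E} (hy : y ∈ U) :
    ContDiffAt ℝ ∞ (tauForm b G) y :=
  contDiffAt_const.clm_comp (hG.contDiffAt_christoffel hy)

theorem fderiv_tauForm (b : Module.Basis (Fin 2) ℂ E) {y : E} (hy : y ∈ U) (v w : E) :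
    fderiv ℝ (tauForm b G) y v w = imTrace b (fderiv ℝ (christoffel G) y v w) := by
  have h := ((hG.contDiffAt_christoffel hy).differentiableAt (by simp)).hasFDerivAt
  have h2 := (hasFDerivAt_const (imTrace b) y).clm_comp h
  have h3 : HasFDerivAt (tauForm b G) _ y := h2
  rw [h3.fderiv]
  simp

/-- On a Kähler-Einstein surface the curvature of the canonical bundle is a multiple of the
fundamental form. -/
theorem fderiv_tauForm_sub (b : Module.Basis (Fin 2) ℂ E) {c : ℝ}
    (hc : ∀ y ∈ U, ∀ v w, ricci G y v w = c * G y v w) {y : E} (hy : y ∈ U) (v w : E) :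
    fderiv ℝ (tauForm b G) y v w - fderiv ℝ (tauForm b G) y w v = c * G y v (Complex.I • w) := by
  -- The commutator of the Christoffel symbols has zero complex trace, so only the derivative terms
  -- of the curvature survive.
  have h1 : fderiv ℝ (tauForm b G) y v w - fderiv ℝ (tauForm b G) y w v =
      imTrace b (curvatureThd G y v w) := by
    rw [hG.fderiv_tauForm b hy, hG.fderiv_tauForm b hy, curvatureThd, map_sub, map_add, map_sub,
      imTrace_apply b ((christoffel G y v).comp _), imTrace_apply b ((christoffel G y w).comp _)]
    have h2 : traceC b ((christoffel G y v).comp (christoffel G y w)) =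
        traceC b ((christoffel G y w).comp (christoffel G y v)) :=
      traceC_comm (hG.christoffel_I hy v) (hG.christoffel_I hy w)
    rw [h2]; ring
  -- The Bianchi identity together with `R(u, v) I = I R(u, v)`. On taking real traces the outer
  -- terms become Ricci curvatures, hence multiples of the metric, and the middle one becomes the
  -- imaginary part of the complex trace of `R(v, w)`.
  have h3 : curvatureFst G y v (Complex.I • w) = -((Complex.I • LinearMap.id (R := ℝ) (M := E)) ∘ₗ
      (curvatureThd G y v w).toLinearMap) + curvatureFst G y w (Complex.I • v) := by
    ext u
    have h4 := hG.curvature_bianchi hy u v w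
    change curvature G y u v (Complex.I • w) =
      -(Complex.I • curvature G y v w u) + curvature G y u w (Complex.I • v)
    rw [hG.curvature_I hy, hG.curvature_I hy, h4, smul_add, smul_neg]
  have h5 : ricci G y v (Complex.I • w) = 2 * imTrace b (curvatureThd G y v w)
      + ricci G y w (Complex.I • v) := by
    rw [ricci_eq_trace, h3, map_add, map_neg, trace_I_smul (b := b), ← ricci_eq_trace,
      imTrace_apply]
    · simp
    · exact hG.curvature_I hy v w
  rw [hc y hy, hc y hy] at h5
  have h6 := hG.apply_I_left hy w v
  have h7 := hG.apply_I_left hy v w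
  rw [hG.symm y hy _ v] at h6
  rw [h1]
  have h8 : G y w (Complex.I • v) = -G y v (Complex.I • w) := by linarith
  rw [h8] at h5
  linarith

end IsKahlerOn

end KahlerRicci

/-! ## Lagrangian surfaces in coordinates -/

section LagrangianLocal

variable {E : Type*} [NormedAddCommGroup E] [NormedSpace ℂ E] [FiniteDimensional ℝ E]
  {G : E → E →L[ℝ] E →L[ℝ] ℝ} {U : Set E} {b : Module.Basis (Fin 2) ℂ E}
  {u : Plane → E} {y : Plane}

theorem apply_complex_smul (A : E →L[ℝ] E →L[ℝ] ℝ) (z : ℂ) (v w : E) :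
    A (z • v) w = z.re * A v w + z.im * A (Complex.I • v) w := by
  rw [complex_smul_eq]
  simp

theorem apply_smul_add_smul (A : E →L[ℝ] E →L[ℝ] ℝ) (s t : ℝ) (v w x : E) :
    A (s • v + t • w) x = s * A v x + t * A w x := by
  simp

/-- A lagrangian plane is totally real. In a relation `s a₀ = t a₁` with complex coefficients,
pairing with `a₀` and `a₁` removes the imaginary parts, so the real parts vanish by nondegeneracy.
Multiplying the relation by `I` deals with the imaginary parts. A zero determinant would supply two
such relations, forcing `a₀ = 0`. -/
theorem detC_partialVec_ne_zero (hG : IsKahlerOn G U) (hy : u y ∈ U) (hdet : gramDet G u y ≠ 0)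
    (hlag : ∀ i j, G (u y) (Complex.I • partialVec u y i) (partialVec u y j) = 0) :
    detC b (partialVec u y 0) (partialVec u y 1) ≠ 0 := by
  intro h0
  set a : Fin 2 → E := partialVec u y with ha
  have key : ∀ s t : ℂ, s • a 0 = t • a 1 → s = 0 ∧ t = 0 := by
    have hre : ∀ s t : ℂ, s • a 0 = t • a 1 → s.re = 0 ∧ t.re = 0 := by
      intro s t hst
      have h1 : ∀ j, s.re * gram G u y 0 j = t.re * gram G u y 1 j := by
        intro j
        have h2 := congrArg (fun v => G (u y) v (a j)) hst
        rw [apply_complex_smul (G (u y)) s, apply_complex_smul (G (u y)) t, hlag 0 j, hlag 1 j, mul_zero, mul_zero,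
          add_zero, add_zero] at h2
        exact h2
      have h3 := h1 0
      have h4 := h1 1
      have hs := gram_comm hG.toIsMetricOn hy 1 0
      rw [hs] at h3
      have hd : gramDet G u y = gram G u y 0 0 * gram G u y 1 1 - gram G u y 0 1 ^ 2 := rfl
      constructor
      · have : s.re * gramDet G u y = 0 := by rw [hd]; linear_combination (gram G u y 1 1) * h3 - gram G u y 0 1 * h4
        exact (mul_eq_zero.1 this).resolve_right hdet
      · have : t.re * gramDet G u y = 0 := by rw [hd]; linear_combination (gram G u y 0 1) * h3 - gram G u y 0 0 * h4
        exact (mul_eq_zero.1 this).resolve_right hdet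
    intro s t hst
    have h1 := hre s t hst
    have h2 := hre (Complex.I * s) (Complex.I * t) (by rw [mul_smul, mul_smul, hst])
    simp at h2
    exact ⟨Complex.ext h1.1 h2.1, Complex.ext h1.2 h2.2⟩
  have hc : ∀ i x, b.repr x i = b.coord i x := fun i x => rfl
  have h0' : b.coord 0 (a 0) * b.coord 1 (a 1) - b.coord 1 (a 0) * b.coord 0 (a 1) = 0 := h0
  have h1 := key (b.coord 1 (a 1)) (b.coord 1 (a 0)) (by
    refine b.ext_elem fun i => ?_
    rw [map_smul, map_smul, Finsupp.smul_apply, Finsupp.smul_apply, hc, hc, smul_eq_mul,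
      smul_eq_mul]
    fin_cases i
    · simp only [Fin.zero_eta]; linear_combination h0'
    · simp only [Fin.mk_one]; ring)
  have h2 := key (b.coord 0 (a 1)) (b.coord 0 (a 0)) (by
    refine b.ext_elem fun i => ?_
    rw [map_smul, map_smul, Finsupp.smul_apply, Finsupp.smul_apply, hc, hc, smul_eq_mul,
      smul_eq_mul]
    fin_cases i
    · simp only [Fin.zero_eta]; ring
    · simp only [Fin.mk_one]; linear_combination -h0')
  have h3 : a 0 = 0 := by
    rw [eq_coord_smul (b := b) (a 0), h1.2, h2.2]; simp
  have h4 := (key 1 0 (by rw [h3]; simp)).1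
  exact one_ne_zero h4

/-- The coefficients of the mean curvature vector of a Lagrangian surface. -/
theorem exists_meanCurv_eq (hG : IsKahlerOn G U) (hy : u y ∈ U) (hdet : gramDet G u y ≠ 0)
    (hlag : ∀ i j, G (u y) (Complex.I • partialVec u y i) (partialVec u y j) = 0)
    (b : Module.Basis (Fin 2) ℂ E) : ∃ s t : ℝ, meanCurv G u y =
      s • Complex.I • partialVec u y 0 + t • Complex.I • partialVec u y 1 := by
  have hne := detC_partialVec_ne_zero (b := b) hG hy hdet hlag
  set a : Fin 2 → E := partialVec u y with ha
  have h1 := cramer hne (meanCurv G u y)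
  set s := detC b (meanCurv G u y) (partialVec u y 1) / detC b (a 0) (a 1)
  set t := detC b (a 0) (meanCurv G u y) / detC b (a 0) (a 1)
  -- `H` is expanded in the complex frame `∂_0, ∂_1`. Since it is orthogonal to the real span of the
  -- frame, the real parts of the coefficients are zero.
  have h2 : ∀ j, s.re * gram G u y 0 j + t.re * gram G u y 1 j = 0 := by
    intro j
    have h3 := meanCurv_inner_partialVec hG.toIsMetricOn hy hdet j
    rw [h1, map_add, add_apply, apply_complex_smul (G (u y)) s, apply_complex_smul (G (u y)) t,
      hlag 0 j, hlag 1 j, mul_zero, mul_zero, add_zero, add_zero] at h3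
    exact h3
  have h3 := h2 0
  have h4 := h2 1
  rw [gram_comm hG.toIsMetricOn hy 1 0] at h3
  have hd : gramDet G u y = gram G u y 0 0 * gram G u y 1 1 - gram G u y 0 1 ^ 2 := rfl
  have hs : s.re = 0 := by
    have : s.re * gramDet G u y = 0 := by
      rw [hd]; linear_combination (gram G u y 1 1) * h3 - gram G u y 0 1 * h4
    exact (mul_eq_zero.1 this).resolve_right hdet
  have ht : t.re = 0 := by
    have : t.re * gramDet G u y = 0 := by
      rw [hd]; linear_combination (-gram G u y 0 1) * h3 + gram G u y 0 0 * h4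
    exact (mul_eq_zero.1 this).resolve_right hdet
  refine ⟨s.im, t.im, ?_⟩
  conv_lhs => rw [h1]
  rw [complex_smul_eq s, complex_smul_eq t, hs, ht, zero_smul, zero_smul, zero_add, zero_add]

/-- The pairing of the mean curvature vector of a Lagrangian surface with a vector field in terms
of the associated one-forms. -/
theorem sqrt_mul_meanCurv_apply (hG : IsKahlerOn G U) (hy : u y ∈ U) (hdet : 0 < gramDet G u y)
    (hlag : ∀ i j, G (u y) (Complex.I • partialVec u y i) (partialVec u y j) = 0)
    (b : Module.Basis (Fin 2) ℂ E) (X : E) : √(gramDet G u y) * G (u y) (meanCurv G u y) X =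
      pairing (gram G u y) (fun i => G (u y) (Complex.I • X) (partialVec u y i))
        (fun i => G (u y) (Complex.I • meanCurv G u y) (partialVec u y i)) := by
  obtain ⟨s, t, hst⟩ := exists_meanCurv_eq hG hy hdet.ne' hlag b
  have hσ : ∀ i, G (u y) (Complex.I • meanCurv G u y) (partialVec u y i) =
      -(s * gram G u y 0 i + t * gram G u y 1 i) := by
    intro i
    rw [hst, smul_add, smul_comm Complex.I s, smul_comm Complex.I t, I_smul_I_smul,
      I_smul_I_smul]
    simp [gram]
    ring
  have hX : ∀ i, G (u y) (Complex.I • partialVec u y i) X =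
      -G (u y) (Complex.I • X) (partialVec u y i) := by
    intro i
    rw [hG.apply_I_left hy, hG.symm _ hy]
  have hl : G (u y) (meanCurv G u y) X = -(s * G (u y) (Complex.I • X) (partialVec u y 0)
      + t * G (u y) (Complex.I • X) (partialVec u y 1)) := by
    rw [hst, apply_smul_add_smul, hX, hX]
    ring
  have hs := gram_comm hG.toIsMetricOn hy 1 0
  rw [hl]
  simp only [pairing, flux, hσ, hs, Matrix.cons_val_zero, Matrix.cons_val_one]
  have hd : gramDet G u y = gram G u y 0 0 * gram G u y 1 1 - gram G u y 0 1 ^ 2 := rfl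
  rw [← hd]
  have hs0 : √(gramDet G u y) ≠ 0 := (Real.sqrt_pos.2 hdet).ne'
  have hsq : √(gramDet G u y) ^ 2 = gramDet G u y := Real.sq_sqrt hdet.le
  set r := √(gramDet G u y)
  field_simp
  rw [hsq, hd]
  ring

/-- Since `H` is a real combination of `I ∂_0` and `I ∂_1`, its squared length is a combination of
the components of `ω(H, ·)`. -/
theorem meanCurv_eq_zero (hG : IsKahlerOn G U) (hy : u y ∈ U) (hdet : gramDet G u y ≠ 0)
    (hlag : ∀ i j, G (u y) (Complex.I • partialVec u y i) (partialVec u y j) = 0)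
    (b : Module.Basis (Fin 2) ℂ E)
    (hσ : ∀ i, G (u y) (Complex.I • meanCurv G u y) (partialVec u y i) = 0) :
    meanCurv G u y = 0 := by
  obtain ⟨s, t, hst⟩ := exists_meanCurv_eq hG hy hdet hlag b
  have h1 : G (u y) (meanCurv G u y) (meanCurv G u y) = 0 := by
    have h2 : ∀ i, G (u y) (Complex.I • partialVec u y i) (meanCurv G u y) = 0 := by
      intro i
      rw [hG.apply_I_left hy, hG.symm _ hy, hσ, neg_zero]
    nth_rw 1 [hst]
    rw [apply_smul_add_smul, h2, h2]
    simp
  by_contra hne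
  exact (hG.pos _ hy _ hne).ne' h1

/-- The form `ω(H, ·)` of a Lagrangian surface in terms of the complex determinant of its tangent
vectors and the canonical connection. -/
theorem meanCurv_form_eq (hG : IsKahlerOn G U) (hy : u y ∈ U) (hu : ContDiffAt ℝ ∞ u y)
    (hdet : gramDet G u y ≠ 0) (hlag : ∀ᶠ z in 𝓝 y, ∀ i j,
      G (u z) (Complex.I • partialVec u z i) (partialVec u z j) = 0)
    (b : Module.Basis (Fin 2) ℂ E) (k : Fin 2) :
    DifferentiableAt ℝ (fun z => detC b (partialVec u z 0) (partialVec u z 1)) y ∧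
    G (u y) (Complex.I • meanCurv G u y) (partialVec u y k) =
      -((fderiv ℝ (fun z => detC b (partialVec u z 0) (partialVec u z 1)) y (basisVec k) /
          detC b (partialVec u y 0) (partialVec u y 1)).im +
        tauForm b G (u y) (partialVec u y k)) := by
  have hlag0 := hlag.self_of_nhds
  have hne := detC_partialVec_ne_zero (b := b) hG hy hdet hlag0
  have hdu : HasFDerivAt u (fderiv ℝ u y) y := (hu.differentiableAt (by simp)).hasFDerivAt
  have hdu2 : HasFDerivAt (fderiv ℝ u) (fderiv ℝ (fderiv ℝ u) y) y :=
    ((hu.fderiv_right (m := ∞) (by simp)).differentiableAt (by simp)).hasFDerivAt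
  set S := fderiv ℝ (fderiv ℝ u) y with hS
  have hsym : ∀ v w, S v w = S w v := fun v w =>
    (hu.isSymmSndFDerivAt (by simpa using two_le_infty)).eq v w
  set a : Fin 2 → E := partialVec u y with ha
  set Γ := christoffel G (u y) with hΓ
  set C : Fin 2 → Fin 2 → E := covHess G u y with hC
  have hCs : ∀ i j, C i j = S (basisVec i) (basisVec j) + Γ (a i) (a j) := fun i j => rfl
  have hCsym : ∀ i j, C i j = C j i := by
    intro i j
    rw [hCs, hCs, hsym, hΓ, hG.christoffel_symm hy]
  have hpa : ∀ i, HasFDerivAt (fun z => partialVec u z i) (S.flip (basisVec i)) y := by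
    intro i
    exact (hdu2.clm_apply (hasFDerivAt_const (basisVec i) y)).congr_fderiv (by ext; simp)
  have hcoord : ∀ (l i : Fin 2), HasFDerivAt (fun z => b.coord l (partialVec u z i))
      ((LinearMap.toContinuousLinearMap ((b.coord l).restrictScalars ℝ)).comp
        (S.flip (basisVec i))) y := fun l i =>
    (LinearMap.toContinuousLinearMap ((b.coord l).restrictScalars ℝ)).hasFDerivAt.comp y (hpa i)
  have hζ := ((hcoord 0 0).mul (hcoord 1 1)).sub ((hcoord 1 0).mul (hcoord 0 1))
  have hζ' : HasFDerivAt (fun z => detC b (partialVec u z 0) (partialVec u z 1)) _ y := hζ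
  refine ⟨hζ'.differentiableAt, ?_⟩
  have hdζ : fderiv ℝ (fun z => detC b (partialVec u z 0) (partialVec u z 1)) y (basisVec k) =
      detC b (S (basisVec k) (basisVec 0)) (a 1) + detC b (a 0) (S (basisVec k) (basisVec 1)) := by
    rw [hζ'.fderiv]
    simp [detC, ha]
    ring
  have hsplit : ∀ i, S (basisVec k) (basisVec i) = C k i - Γ (a k) (a i) := by
    intro i; rw [hCs]; abel
  have hsubl : ∀ v v' w, detC b (v - v') w = detC b v w - detC b v' w := by
    intro v v' w; simp only [detC, map_sub]; ring
  have hsubr : ∀ v w w', detC b v (w - w') = detC b v w - detC b v w' := by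
    intro v v' w; simp only [detC, map_sub]; ring
  have htr := detC_map_add (b := b) (hG.christoffel_I hy (a k)) (a 0) (a 1)
  rw [hdζ, hsplit, hsplit, hsubl, hsubr, tauForm_apply]
  set ζ := detC b (a 0) (a 1) with hζd
  have hq : (detC b (C k 0) (a 1) - detC b ((Γ (a k)) (a 0)) (a 1) +
      (detC b (a 0) (C k 1) - detC b (a 0) ((Γ (a k)) (a 1)))) / ζ =
      detC b (C k 0) (a 1) / ζ + detC b (a 0) (C k 1) / ζ - traceC b (Γ (a k)) := by
    field_simp
    linear_combination -htr
  rw [hq, Complex.sub_im, Complex.add_im, sub_add_cancel]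
  -- the cubic form
  set T : Fin 2 → Fin 2 → Fin 2 → ℝ := fun k i j => G (u y) (Complex.I • C k i) (a j) with hT
  have hT1 : ∀ k i j, T k i j = T i k j := by
    intro k i j; simp only [hT]; rw [hCsym]
  -- Differentiating `ω(∂_i, ∂_j) = 0` along `∂_k` gives this symmetry, because the connection
  -- commutes with `I`. With the symmetry of the Hessian, the cubic form is totally symmetric.
  have hT2 : ∀ k i j, T k i j = T k j i := by
    intro k i j
    have hdG : HasFDerivAt (fun q => G (u q)) ((fderiv ℝ G (u y)).comp (fderiv ℝ u y)) y :=
      (hG.differentiableAt hy).hasFDerivAt.comp y hdu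
    have h1 := (hdG.clm_apply ((Complex.I • ContinuousLinearMap.id ℝ E : E →L[ℝ] E).hasFDerivAt.comp
      y (hpa i))).clm_apply (hpa j)
    have h2 : (fun z => G (u z) ((Complex.I • ContinuousLinearMap.id ℝ E : E →L[ℝ] E)
        (partialVec u z i)) (partialVec u z j)) =ᶠ[𝓝 y] fun _ => 0 := by
      filter_upwards [hlag] with z hz using hz i j
    have h3 := DFunLike.congr_fun
      (h1.unique ((hasFDerivAt_const (0 : ℝ) y).congr_of_eventuallyEq h2)) (basisVec k)
    simp at h3
    have h4 := hG.fderiv_eq hy (a k) (Complex.I • a i) (a j)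
    change _ + (_ + fderiv ℝ G (u y) (a k) (Complex.I • a i) (a j)) = 0 at h3
    rw [h4, hG.christoffel_I hy, ← hΓ] at h3
    have e1 : T k i j = G (u y) (Complex.I • S (basisVec k) (basisVec i)) (a j)
        + G (u y) (Complex.I • Γ (a k) (a i)) (a j) := by
      simp only [hT, hCs, smul_add, map_add, add_apply]
    have e2 : T k j i = -(G (u y) (Complex.I • a i) (S (basisVec k) (basisVec j))
        + G (u y) (Complex.I • a i) (Γ (a k) (a j))) := by
      simp only [hT]
      rw [hG.apply_I_left hy, hG.symm _ hy, hCs, map_add]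
    rw [e1, e2]
    change G (u y) (Complex.I • a i) (S (basisVec k) (basisVec j)) +
      (G (u y) (Complex.I • S (basisVec k) (basisVec i)) (a j) + _) = 0 at h3
    linarith
  obtain ⟨i00, i01, i10, i11⟩ := gramInv_apply (gram_comm hG.toIsMetricOn hy 1 0)
  have hnorm : ∀ v j, G (u y) (Complex.I • normalComp G u y v) (a j) =
      G (u y) (Complex.I • v) (a j) := by
    intro v j
    simp only [normalComp, Fin.sum_univ_two, smul_sub, smul_add, smul_comm Complex.I, map_sub,
      map_add, map_smul, sub_apply, add_apply, smul_apply]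
    rw [hlag0 0 j, hlag0 1 j]
    simp
  have hH : G (u y) (Complex.I • meanCurv G u y) (a k) =
      gramInv G u y 0 0 * T 0 0 k + gramInv G u y 0 1 * T 0 1 k
      + (gramInv G u y 1 0 * T 1 0 k + gramInv G u y 1 1 * T 1 1 k) := by
    have hl : ∀ (p q r s : ℝ) (w x y' z : E),
        G (u y) (Complex.I • (p • w + q • x + (r • y' + s • z))) (a k) =
        p * G (u y) (Complex.I • w) (a k) + q * G (u y) (Complex.I • x) (a k)
        + (r * G (u y) (Complex.I • y') (a k) + s * G (u y) (Complex.I • z) (a k)) := by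
      intro p q r s w x y' z
      simp only [smul_add, smul_comm Complex.I, map_add, map_smul, add_apply, smul_apply,
        smul_eq_mul]
    simp only [meanCurv, Fin.sum_univ_two]
    rw [hl, hnorm, hnorm, hnorm, hnorm]
  rw [hH]
  have hcoef : ∀ i j, T k i j = -((detC b (C k i) (a 1) / ζ).im * gram G u y 0 j +
      (detC b (a 0) (C k i) / ζ).im * gram G u y 1 j) := by
    intro i j
    simp only [hT]
    set s := detC b (C k i) (a 1) / ζ with hs
    set t := detC b (a 0) (C k i) / ζ with ht
    have h1 : C k i = s • a 0 + t • a 1 := cramer hne (C k i)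
    have h2 : Complex.I • C k i = (Complex.I * s) • a 0 + (Complex.I * t) • a 1 := by
      rw [h1, smul_add, mul_smul, mul_smul]
    rw [h2, map_add, add_apply, apply_complex_smul (G (u y)) (Complex.I * s),
      apply_complex_smul (G (u y)) (Complex.I * t), hlag0 0 j, hlag0 1 j]
    simp [gram]
    ring
  have c00 := hcoef 0 0
  have c01 := hcoef 0 1
  have c10 := hcoef 1 0
  have c11 := hcoef 1 1
  set p := (detC b (C k 0) (a 1) / ζ).im
  set q := (detC b (a 0) (C k 0) / ζ).im
  set r := (detC b (C k 1) (a 1) / ζ).im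
  set w := (detC b (a 0) (C k 1) / ζ).im
  -- `ω(H, ∂_k)` traces `T` over its first two indices. Total symmetry moves the free index `k` to
  -- the front, and the trace over the other two is the imaginary part of the trace of the
  -- coefficients of `∇_k ∂_i` in the complex frame, that is, of the logarithmic derivative of `ζ`
  -- corrected by the connection.
  have t00 : T 0 0 k = T k 0 0 := by rw [hT2, hT1]
  have t01 : T 0 1 k = T k 0 1 := by rw [hT2, hT1, hT2 k 0 1, hT2]
  have t10 : T 1 0 k = T k 1 0 := by rw [hT2, hT1, hT2 k 1 0, hT2]
  have t11 : T 1 1 k = T k 1 1 := by rw [hT2, hT1]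
  rw [t00, t01, t10, t11, i00, i01, i10, i11, c00, c01, c10, c11,
    gram_comm hG.toIsMetricOn hy 1 0]
  have hd : gramDet G u y = gram G u y 0 0 * gram G u y 1 1 - gram G u y 0 1 ^ 2 := rfl
  field_simp
  rw [hd]
  ring

end LagrangianLocal

/-! ## Charts of real manifolds -/

/-- A chart of the maximal smooth atlas of a manifold. -/
abbrev IsChart {F M : Type*} [NormedAddCommGroup F] [NormedSpace ℝ F] [TopologicalSpace M]
    [ChartedSpace F M] (e : OpenPartialHomeomorph M F) : Prop :=
  e ∈ IsManifold.maximalAtlas 𝓘(ℝ, F) ∞ M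

section Charts

variable {F : Type*} [NormedAddCommGroup F] [NormedSpace ℝ F]
  {M : Type*} [TopologicalSpace M] [ChartedSpace F M] [IsManifold 𝓘(ℝ, F) ∞ M]
  {e e' : OpenPartialHomeomorph M F}

theorem chart_contMDiffAt (he : IsChart e) {x : M}
    (hx : x ∈ e.source) : ContMDiffAt 𝓘(ℝ, F) 𝓘(ℝ, F) ∞ e x :=
  contMDiffAt_of_mem_maximalAtlas he hx

theorem chart_symm_contMDiffAt (he : IsChart e) {y : F}
    (hy : y ∈ e.target) : ContMDiffAt 𝓘(ℝ, F) 𝓘(ℝ, F) ∞ e.symm y :=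
  contMDiffAt_symm_of_mem_maximalAtlas he hy

theorem chart_mdifferentiable (he : IsChart e) : e.MDifferentiable 𝓘(ℝ, F) 𝓘(ℝ, F) :=
  ⟨fun x hx => ((chart_contMDiffAt he hx).mdifferentiableAt (by simp)).mdifferentiableWithinAt,
    fun x hx => ((chart_symm_contMDiffAt he hx).mdifferentiableAt
      (by simp)).mdifferentiableWithinAt⟩

theorem isChart_chartAt (x : M) : IsChart (chartAt F x) :=
  IsManifold.chart_mem_maximalAtlas x

theorem mfderiv_symm_mfderiv (he : IsChart e) {x : M}
    (hx : x ∈ e.source) (v : TangentSpace 𝓘(ℝ, F) x) :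
    mfderiv 𝓘(ℝ, F) 𝓘(ℝ, F) e.symm (e x) (mfderiv 𝓘(ℝ, F) 𝓘(ℝ, F) e x v) = v :=
  DFunLike.congr_fun ((chart_mdifferentiable he).symm_comp_deriv hx) v

theorem mfderiv_mfderiv_symm (he : IsChart e) {y : F} (hy : y ∈ e.target) (v : F) :
    mfderiv 𝓘(ℝ, F) 𝓘(ℝ, F) e (e.symm y) (mfderiv 𝓘(ℝ, F) 𝓘(ℝ, F) e.symm y v) = v :=
  DFunLike.congr_fun ((chart_mdifferentiable he).comp_symm_deriv hy) v

theorem mfderiv_symm_injective (he : IsChart e) {y : F}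
    (hy : y ∈ e.target) {v : F} (h : mfderiv 𝓘(ℝ, F) 𝓘(ℝ, F) e.symm y v = 0) : v = 0 := by
  have := mfderiv_mfderiv_symm he hy v
  rw [h, map_zero] at this
  exact this.symm

/-- The derivative of a map from a vector space in terms of a chart of the target. -/
theorem fderiv_chart_comp {V : Type*} [NormedAddCommGroup V] [NormedSpace ℝ V]
    (he : IsChart e) {f : V → M} {y : V}
    (hf : MDifferentiableAt 𝓘(ℝ, V) 𝓘(ℝ, F) f y) (hy : f y ∈ e.source) (v : V) :
    DifferentiableAt ℝ (e ∘ f) y ∧ fderiv ℝ (e ∘ f) y v =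
      mfderiv 𝓘(ℝ, F) 𝓘(ℝ, F) e (f y) (mfderiv 𝓘(ℝ, V) 𝓘(ℝ, F) f y v) := by
  have h1 := (chart_contMDiffAt he hy).mdifferentiableAt (by simp)
  have h2 : MDifferentiableAt 𝓘(ℝ, V) 𝓘(ℝ, F) (e ∘ f) y := h1.comp y hf
  refine ⟨h2.differentiableAt, ?_⟩
  rw [← mfderiv_eq_fderiv, mfderiv_comp y h1 hf]
  rfl

theorem mfderiv_eq_symm_fderiv {V : Type*} [NormedAddCommGroup V] [NormedSpace ℝ V]
    (he : IsChart e) {f : V → M} {y : V}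
    (hf : MDifferentiableAt 𝓘(ℝ, V) 𝓘(ℝ, F) f y) (hy : f y ∈ e.source) (v : V) :
    mfderiv 𝓘(ℝ, V) 𝓘(ℝ, F) f y v =
      mfderiv 𝓘(ℝ, F) 𝓘(ℝ, F) e.symm (e (f y)) (fderiv ℝ (e ∘ f) y v) := by
  rw [(fderiv_chart_comp he hf hy v).2, mfderiv_symm_mfderiv he hy]

theorem contDiffAt_chart_comp {V : Type*} [NormedAddCommGroup V] [NormedSpace ℝ V]
    (he : IsChart e) {f : V → M} {y : V}
    (hf : ContMDiffAt 𝓘(ℝ, V) 𝓘(ℝ, F) ∞ f y) (hy : f y ∈ e.source) : ContDiffAt ℝ ∞ (e ∘ f) y :=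
  ((chart_contMDiffAt he hy).comp y hf).contDiffAt

theorem contDiffAt_transition (he : IsChart e) (he' : IsChart e') {y : F} (hy : y ∈ e.target)
    (hy' : e.symm y ∈ e'.source) : ContDiffAt ℝ ∞ (e' ∘ e.symm) y :=
  contDiffAt_chart_comp he' (chart_symm_contMDiffAt he hy) hy'

theorem fderiv_transition (he : IsChart e) (he' : IsChart e') {y : F} (hy : y ∈ e.target)
    (hy' : e.symm y ∈ e'.source) (v : F) :
    mfderiv 𝓘(ℝ, F) 𝓘(ℝ, F) e'.symm (e' (e.symm y)) (fderiv ℝ (e' ∘ e.symm) y v) =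
      mfderiv 𝓘(ℝ, F) 𝓘(ℝ, F) e.symm y v :=
  (mfderiv_eq_symm_fderiv he' ((chart_symm_contMDiffAt he hy).mdifferentiableAt (by simp)) hy'
    v).symm

theorem fderiv_transition_symm (he : IsChart e) (he' : IsChart e') {y : F} (hy : y ∈ e.target)
    (hy' : e.symm y ∈ e'.source) (v : F) :
    fderiv ℝ (e ∘ e'.symm) (e' (e.symm y)) (fderiv ℝ (e' ∘ e.symm) y v) = v := by
  have h1 : e'.symm (e' (e.symm y)) = e.symm y := e'.left_inv hy'
  have h2 : e'.symm (e' (e.symm y)) ∈ e.source := by rw [h1]; exact e.map_target hy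
  rw [(fderiv_chart_comp he ((chart_symm_contMDiffAt he' (e'.map_source hy')).mdifferentiableAt
    (by simp)) h2 _).2, fderiv_transition he he' hy hy' v]
  have : ∀ x, x = e.symm y → mfderiv 𝓘(ℝ, F) 𝓘(ℝ, F) e x
      (mfderiv 𝓘(ℝ, F) 𝓘(ℝ, F) e.symm y v : F) = v := by
    rintro x rfl
    exact mfderiv_mfderiv_symm he hy v
  exact this _ h1

theorem contMDiffAt_mfderiv_symm_section (he : IsChart e) {y : F} (hy : y ∈ e.target) (v : F) :
    ContMDiffAt 𝓘(ℝ, F) (𝓘(ℝ, F).prod 𝓘(ℝ, F)) ∞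
      (fun z => Bundle.TotalSpace.mk' F (E := fun x : M => TangentSpace 𝓘(ℝ, F) x) (e.symm z)
        (mfderiv 𝓘(ℝ, F) 𝓘(ℝ, F) e.symm z v)) y := by
  have hs := chart_symm_contMDiffAt he hy
  have hv : ContMDiffAt 𝓘(ℝ, F) 𝓘(ℝ, F).tangent ∞
      (fun z : F => (⟨z, v⟩ : TangentBundle 𝓘(ℝ, F) F)) y :=
    contMDiffAt_vectorSpace_iff_contDiffAt.2 contDiffAt_const
  exact ContMDiffAt.clm_apply_of_inCoordinates (ContMDiffAt.mfderiv_const hs (by simp)) hv hs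

theorem contDiffAt_metric_apply
    (g : Bundle.ContMDiffRiemannianMetric 𝓘(ℝ, F) ∞ F (fun x : M => TangentSpace 𝓘(ℝ, F) x))
    {s : F → M} {y : F} (hs : ContMDiffAt 𝓘(ℝ, F) 𝓘(ℝ, F) ∞ s y)
    {v w : ∀ z, TangentSpace 𝓘(ℝ, F) (s z)} (hv : ContMDiffAt 𝓘(ℝ, F) (𝓘(ℝ, F).prod 𝓘(ℝ, F)) ∞
      (fun z => Bundle.TotalSpace.mk' F (E := fun x : M => TangentSpace 𝓘(ℝ, F) x) (s z) (v z)) y)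
    (hw : ContMDiffAt 𝓘(ℝ, F) (𝓘(ℝ, F).prod 𝓘(ℝ, F)) ∞
      (fun z => Bundle.TotalSpace.mk' F (E := fun x : M => TangentSpace 𝓘(ℝ, F) x) (s z) (w z)) y) :
    ContDiffAt ℝ ∞ (fun z => g.inner (s z) (v z) (w z)) y := by
  have : ContMDiffAt 𝓘(ℝ, F) (𝓘(ℝ, F).prod 𝓘(ℝ)) ∞ (fun m => Bundle.TotalSpace.mk' ℝ
      (E := Bundle.Trivial M ℝ) (s m) (g.inner (s m) (v m) (w m))) y := by
    apply ContMDiffAt.clm_bundle_apply₂ (F₁ := F) (F₂ := F)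
    · exact ContMDiffAt.comp y g.contMDiff.contMDiffAt hs
    · exact hv
    · exact hw
  simp only [Bundle.contMDiffAt_totalSpace] at this
  exact this.2.contDiffAt

theorem contDiffAt_metric_chart
    (g : Bundle.ContMDiffRiemannianMetric 𝓘(ℝ, F) ∞ F (fun x : M => TangentSpace 𝓘(ℝ, F) x))
    (he : IsChart e) {y : F} (hy : y ∈ e.target) (v w : F) :
    ContDiffAt ℝ ∞ (fun z => g.inner (e.symm z) (mfderiv 𝓘(ℝ, F) 𝓘(ℝ, F) e.symm z v)
      (mfderiv 𝓘(ℝ, F) 𝓘(ℝ, F) e.symm z w)) y :=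
  contDiffAt_metric_apply g (chart_symm_contMDiffAt he hy)
    (contMDiffAt_mfderiv_symm_section he hy v) (contMDiffAt_mfderiv_symm_section he hy w)

omit [IsManifold 𝓘(ℝ, F) ∞ M] in
/-- The derivative of the inverse of a chart is the derivative of the transition map to the
preferred chart. -/
theorem mfderiv_chart_symm {y : F} (h : MDifferentiableAt 𝓘(ℝ, F) 𝓘(ℝ, F) e.symm y) :
    mfderiv 𝓘(ℝ, F) 𝓘(ℝ, F) e.symm y = fderiv ℝ (chartAt F (e.symm y) ∘ e.symm) y := by
  refine h.mfderiv.trans ?_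
  simp only [writtenInExtChartAt, extChartAt, mfld_simps, fderivWithin_univ]
  rw [chartAt_self_eq]
  simp only [OpenPartialHomeomorph.refl_symm, OpenPartialHomeomorph.refl_apply]
  rfl

end Charts

variable {E : Type*} [NormedAddCommGroup E] [NormedSpace ℂ E] [FiniteDimensional ℝ E]
  {N : Type*} [TopologicalSpace N] [ChartedSpace E N] [IsManifold 𝓘(ℂ, E) ω N]
  {S : Type*} [TopologicalSpace S] [ChartedSpace Plane S] [IsManifold (𝓡 2) ∞ S]
  {g : Metric (E := E) N} {ℓ : S → N}
  {c : OpenPartialHomeomorph S Plane} {e : OpenPartialHomeomorph N E} {y : Plane}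

/-! ## The metric in charts -/

section MetricCharts

theorem inChart_apply (B : ∀ x : N, TangentSpace 𝓘(ℝ, E) x →L[ℝ] TangentSpace 𝓘(ℝ, E) x →L[ℝ] ℝ)
    (e : OpenPartialHomeomorph N E) (y v w : E) :
    inChart B e y v w = B (e.symm y) (mfderiv 𝓘(ℝ, E) 𝓘(ℝ, E) e.symm y v)
      (mfderiv 𝓘(ℝ, E) 𝓘(ℝ, E) e.symm y w) := rfl

theorem isMetricOn_inChart (g : Metric (E := E) N)
    (he : IsChart e) : IsMetricOn (inChart g.inner e) e.target where
  isOpen := e.open_target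
  smooth := by
    refine contDiffOn_clm_apply.2 fun v => contDiffOn_clm_apply.2 fun w => ?_
    exact fun y hy => (contDiffAt_metric_chart g he hy v w).contDiffWithinAt
  symm y _ v w := by
    rw [inChart_apply, inChart_apply]
    exact g.symm (e.symm y) (mfderiv 𝓘(ℝ, E) 𝓘(ℝ, E) e.symm y v)
      (mfderiv 𝓘(ℝ, E) 𝓘(ℝ, E) e.symm y w)
  pos y hy v hv := by
    rw [inChart_apply]
    exact g.pos (e.symm y) (mfderiv 𝓘(ℝ, E) 𝓘(ℝ, E) e.symm y v)
      fun h => hv (mfderiv_symm_injective he hy h)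

theorem isChart_of_mem_atlas (he : e ∈ atlas E N) : IsChart e :=
  IsManifold.subset_maximalAtlas he

/-- Tangent vectors at a point are expressed in the preferred chart there, so the derivative of
`e.symm` is that of a transition map. Transition maps are holomorphic. -/
theorem mfderiv_symm_I (he : e ∈ atlas E N) {y : E} (hy : y ∈ e.target) (v : E) :
    mfderiv 𝓘(ℝ, E) 𝓘(ℝ, E) e.symm y (Complex.I • v) =
      complexStructure (e.symm y) (mfderiv 𝓘(ℝ, E) 𝓘(ℝ, E) e.symm y v) := by
  have hm : MDifferentiableAt 𝓘(ℝ, E) 𝓘(ℝ, E) e.symm y :=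
    (chart_symm_contMDiffAt (isChart_of_mem_atlas he) hy).mdifferentiableAt (by simp)
  rw [mfderiv_chart_symm hm]
  have h := (contDiffGroupoid ω 𝓘(ℂ, E)).compatible he (chart_mem_atlas E (e.symm y))
  rw [contDiffGroupoid, mem_groupoid_of_pregroupoid] at h
  have h1 := h.1
  simp only [contDiffPregroupoid] at h1
  have h2 : ContDiffOn ℂ ω (chartAt E (e.symm y) ∘ e.symm)
      (e.symm.trans (chartAt E (e.symm y))).source := by
    refine ContDiffOn.congr (h1.mono ?_) fun x hx => ?_
    · intro x hx; simpa using hx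
    · simp
  have hmem : y ∈ (e.symm.trans (chartAt E (e.symm y))).source := by
    rw [OpenPartialHomeomorph.trans_source]
    exact ⟨hy, mem_chart_source E (e.symm y)⟩
  have h3 : DifferentiableAt ℂ (chartAt E (e.symm y) ∘ e.symm) y :=
    (h2.contDiffAt ((e.symm.trans (chartAt E (e.symm y))).open_source.mem_nhds
      hmem)).differentiableAt (by simp)
  have h4 := (h3.hasFDerivAt.restrictScalars ℝ).fderiv
  rw [h4]
  exact (fderiv ℂ (chartAt E (e.symm y) ∘ e.symm) y).map_smul Complex.I v

theorem inChart_fundamentalForm (g : Metric (E := E) N) (he : e ∈ atlas E N) {y : E}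
    (hy : y ∈ e.target) (v w : E) :
    inChart (fundamentalForm g) e y v w = inChart g.inner e y (Complex.I • v) w := by
  rw [inChart_apply, inChart_apply, mfderiv_symm_I he hy]
  rfl

theorem isKahlerOn_inChart {g : Metric (E := E) N} (hg : IsKahler g) (he : e ∈ atlas E N) :
    IsKahlerOn (inChart g.inner e) e.target where
  toIsMetricOn := isMetricOn_inChart g (isChart_of_mem_atlas he)
  hermitian y hy v w := by
    rw [inChart_apply, mfderiv_symm_I he hy, mfderiv_symm_I he hy, hg.hermitian]
    rfl
  closed y hy u v w := by
    have hM := isMetricOn_inChart g (isChart_of_mem_atlas he)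
    have hev : inChart (fundamentalForm g) e =ᶠ[𝓝 y] fun z =>
        (inChart g.inner e z).comp (Complex.I • ContinuousLinearMap.id ℝ E : E →L[ℝ] E) := by
      filter_upwards [e.open_target.mem_nhds hy] with z hz
      ext v w
      rw [inChart_fundamentalForm g he hz]
      rfl
    generalize hJ : (Complex.I • ContinuousLinearMap.id ℝ E : E →L[ℝ] E) = J at hev
    have hJ' : ∀ v, J v = Complex.I • v := by intro v; rw [← hJ]; rfl
    have h1 := (hM.differentiableAt hy).hasFDerivAt.clm_comp (hasFDerivAt_const J y)
    have h2 : ∀ u v w, fderiv ℝ (inChart (fundamentalForm g) e) y u v w =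
        fderiv ℝ (inChart g.inner e) y u (Complex.I • v) w := by
      intro u v w
      rw [(h1.congr_of_eventuallyEq hev).fderiv]
      simp [hJ']
    rw [← h2, ← h2, ← h2]
    exact hg.closed e he y hy u v w

end MetricCharts

/-! ### Nondegeneracy of the induced metric -/

section GramDet

variable {E : Type*} [NormedAddCommGroup E] [NormedSpace ℝ E]
  {G : E → E →L[ℝ] E →L[ℝ] ℝ} {U : Set E} {u : Plane → E} {y : Plane}

/-- Gram-Schmidt without division: the vector on the right is a multiple of the part of `∂_0`
orthogonal to `∂_1`. The sign of the determinant is read off from this squared length. -/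
theorem gram_mul_gramDet (hG : IsMetricOn G U) (hy : u y ∈ U) : gram G u y 1 1 * gramDet G u y =
      G (u y) (gram G u y 1 1 • partialVec u y 0 - gram G u y 0 1 • partialVec u y 1)
        (gram G u y 1 1 • partialVec u y 0 - gram G u y 0 1 • partialVec u y 1) := by
  have hg : ∀ i j, G (u y) (partialVec u y i) (partialVec u y j) = gram G u y i j :=
    fun i j => rfl
  simp only [map_sub, map_smul, sub_apply, smul_apply, smul_eq_mul, hg, gramDet,
    gram_comm hG hy 1 0]
  ring

theorem gramDet_pos_of_injective (hG : IsMetricOn G U) (hy : u y ∈ U)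
    (h : Function.Injective (fderiv ℝ u y)) : 0 < gramDet G u y := by
  have hb : ∀ s t : ℝ, s • partialVec u y 0 + t • partialVec u y 1 = 0 → s = 0 ∧ t = 0 := by
    intro s t hst
    have h1 : fderiv ℝ u y (s • basisVec 0 + t • basisVec 1) = 0 := by
      rw [map_add, map_smul, map_smul]; exact hst
    have h2 : s • basisVec 0 + t • basisVec 1 = 0 := h (by rw [h1, map_zero])
    constructor
    · simpa [basisVec_apply] using congrArg (fun v : Plane => v 0) h2
    · simpa [basisVec_apply] using congrArg (fun v : Plane => v 1) h2
  have h11 : 0 < gram G u y 1 1 := by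
    refine hG.pos _ hy _ fun h1 => ?_
    have := (hb 0 1 (by rw [h1]; simp)).2
    exact one_ne_zero this
  have h2 := gram_mul_gramDet hG hy
  have h3 : 0 < gram G u y 1 1 * gramDet G u y := by
    rw [h2]
    refine hG.pos _ hy _ fun h4 => h11.ne' (hb _ (-gram G u y 0 1) ?_).1
    rw [neg_smul, ← sub_eq_add_neg]; exact h4
  exact (mul_pos_iff_of_pos_left h11).1 h3

theorem injective_of_gramDet_ne_zero (hs : gram G u y 1 0 = gram G u y 0 1)
    (h : gramDet G u y ≠ 0) : Function.Injective (fderiv ℝ u y) := by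
  refine (injective_iff_map_eq_zero _).2 fun v hv => ?_
  rw [map_eq_sum_basisVec] at hv
  have h1 : ∀ j, v 0 * gram G u y 0 j + v 1 * gram G u y 1 j = 0 := by
    intro j
    have := congrArg (fun w => G (u y) w (partialVec u y j)) hv
    simpa [gram, partialVec] using this
  have h2 := h1 0
  have h3 := h1 1
  rw [hs] at h2
  have hd : gramDet G u y = gram G u y 0 0 * gram G u y 1 1 - gram G u y 0 1 ^ 2 := rfl
  have e0 : v 0 = 0 := by
    have : v 0 * gramDet G u y = 0 := by
      rw [hd]; linear_combination (gram G u y 1 1) * h2 - gram G u y 0 1 * h3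
    exact (mul_eq_zero.1 this).resolve_right h
  have e1 : v 1 = 0 := by
    have : v 1 * gramDet G u y = 0 := by
      rw [hd]; linear_combination (-gram G u y 0 1) * h2 + gram G u y 0 0 * h3
    exact (mul_eq_zero.1 this).resolve_right h
  rw [eq_sum_basisVec v, e0, e1]
  simp

theorem gramDet_pos_iff (hG : IsMetricOn G U) (hy : u y ∈ U) :
    0 < gramDet G u y ↔ Function.Injective (fderiv ℝ u y) :=
  ⟨fun h => injective_of_gramDet_ne_zero (gram_comm hG hy 1 0) h.ne',
    gramDet_pos_of_injective hG hy⟩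

theorem gramDet_nonneg (hG : IsMetricOn G U) (hy : u y ∈ U) : 0 ≤ gramDet G u y := by
  rcases eq_or_ne (partialVec u y 1) 0 with h1 | h1
  · simp [gramDet, gram, h1]
  · have h11 : 0 < gram G u y 1 1 := hG.pos _ hy _ h1
    have h2 := gram_mul_gramDet hG hy
    have h3 : 0 ≤ gram G u y 1 1 * gramDet G u y := by
      rw [h2]
      rcases eq_or_ne (gram G u y 1 1 • partialVec u y 0 - gram G u y 0 1 • partialVec u y 1) 0
        with h0 | h0
      · rw [h0]; simp
      · exact (hG.pos _ hy _ h0).le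
    exact nonneg_of_mul_nonneg_right h3 h11

theorem partialVec_congr {u' : Plane → E} (h : u =ᶠ[𝓝 y] u') (i : Fin 2) :
    partialVec u y i = partialVec u' y i := by
  rw [partialVec, h.fderiv_eq, partialVec]

theorem gram_congr {u' : Plane → E} (h : u =ᶠ[𝓝 y] u') : gram G u y = gram G u' y := by
  ext i j
  rw [gram, gram, partialVec_congr h, partialVec_congr h, h.self_of_nhds]

theorem meanCurv_congr {u' : Plane → E} (h : u =ᶠ[𝓝 y] u') : meanCurv G u y = meanCurv G u' y := by
  have hI : gramInv G u y = gramInv G u' y := by rw [gramInv, gram_congr h, gramInv]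
  have hp := fun i => partialVec_congr h i
  have hC : ∀ i j, covHess G u y i j = covHess G u' y i j := by
    intro i j
    rw [covHess, covHess, h.fderiv.fderiv_eq, hp, hp, h.self_of_nhds]
  have hN : ∀ v, normalComp G u y v = normalComp G u' y v := by
    intro v
    simp only [normalComp, hI, hp, h.self_of_nhds]
  simp only [meanCurv, hI, hC, hN]

end GramDet

/-! ## Maps into the surface in charts -/

theorem mfderiv_symm_zero {F : Type*} [NormedAddCommGroup F] [NormedSpace ℝ F]
    {M : Type*} [TopologicalSpace M] [ChartedSpace F M] (e : OpenPartialHomeomorph M F) (y : F) :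
    mfderiv 𝓘(ℝ, F) 𝓘(ℝ, F) e.symm y (0 : F) = 0 :=
  map_zero (mfderiv 𝓘(ℝ, F) 𝓘(ℝ, F) e.symm y)

theorem det_eq_jacobian (A : Plane →L[ℝ] Plane) :
    A.det = A (basisVec 0) 0 * A (basisVec 1) 1 - A (basisVec 1) 0 * A (basisVec 0) 1 := by
  rw [ContinuousLinearMap.det, ← LinearMap.det_toMatrix
    (EuclideanSpace.basisFun (Fin 2) ℝ).toBasis, Matrix.det_fin_two]
  simp [LinearMap.toMatrix_apply, basisVec]

theorem isUnit_jacobian_of_det_ne_zero {A : Plane →L[ℝ] Plane} (h : A.det ≠ 0) :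
    IsUnit (Matrix.of fun a i => A (basisVec i) a : Matrix (Fin 2) (Fin 2) ℝ) := by
  rw [Matrix.isUnit_iff_isUnit_det, Matrix.det_fin_two, isUnit_iff_ne_zero]
  rw [det_eq_jacobian] at h
  exact h

theorem det_mul_det_eq_one {F : Type*} [NormedAddCommGroup F] [NormedSpace ℝ F]
    {A B : F →L[ℝ] F} (h : ∀ v, B (A v) = v) : B.det * A.det = 1 := by
  rw [ContinuousLinearMap.det, ContinuousLinearMap.det, ← LinearMap.det_comp]
  have : (B : F →ₗ[ℝ] F) ∘ₗ (A : F →ₗ[ℝ] F) = LinearMap.id := LinearMap.ext h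
  rw [this, LinearMap.det_id]

section MapCharts

/-- A map in charts. -/
def chartRep (ℓ : S → N) (c : OpenPartialHomeomorph S Plane) (e : OpenPartialHomeomorph N E) :
    Plane → E := fun y => e (ℓ (c.symm y))

variable (hc : IsChart c)
  (he : IsChart e) {y : Plane} (hy : y ∈ c.target)
  (hℓ : ContMDiffAt (𝓡 2) 𝓘(ℝ, E) ∞ ℓ (c.symm y)) (hye : ℓ (c.symm y) ∈ e.source)

include hc hy hℓ in
theorem contMDiffAt_comp_chart_symm :
    ContMDiffAt (𝓡 2) 𝓘(ℝ, E) ∞ (fun y' : Plane => ℓ (c.symm y')) y :=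
  ContMDiffAt.comp y hℓ (chart_symm_contMDiffAt hc hy)

include hc hy hℓ in
theorem mfderiv_comp_chart_symm (v : Plane) :
    mfderiv (𝓡 2) 𝓘(ℝ, E) (fun y' : Plane => ℓ (c.symm y')) y v =
      mfderiv (𝓡 2) 𝓘(ℝ, E) ℓ (c.symm y) (mfderiv (𝓡 2) (𝓡 2) c.symm y v) := by
  have h : mfderiv (𝓡 2) 𝓘(ℝ, E) (fun y' : Plane => ℓ (c.symm y')) y = _ :=
    mfderiv_comp y (hℓ.mdifferentiableAt (by simp))
      ((chart_symm_contMDiffAt hc hy).mdifferentiableAt (by simp))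
  rw [h]
  rfl

include hc hy hℓ he hye

theorem contDiffAt_chartRep : ContDiffAt ℝ ∞ (chartRep ℓ c e) y :=
  contDiffAt_chart_comp he (contMDiffAt_comp_chart_symm hc hy hℓ) hye

theorem mfderiv_comp_eq_chartRep (v : Plane) :
    mfderiv (𝓡 2) 𝓘(ℝ, E) (fun y' : Plane => ℓ (c.symm y')) y v =
      mfderiv 𝓘(ℝ, E) 𝓘(ℝ, E) e.symm (chartRep ℓ c e y) (fderiv ℝ (chartRep ℓ c e) y v) :=
  mfderiv_eq_symm_fderiv he
    ((contMDiffAt_comp_chart_symm hc hy hℓ).mdifferentiableAt (by simp)) hye v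

omit hc he hy hℓ hye [IsManifold (𝓡 2) ∞ S] [FiniteDimensional ℝ E] in
theorem metric_congr (g : Metric (E := E) N) {x x' : N} (h : x = x') (v w : E) :
    g.inner x v w = g.inner x' v w := by
  subst h; rfl

theorem metric_mfderiv (g : Metric (E := E) N) (v : E) (w : Plane) : g.inner (ℓ (c.symm y))
      (mfderiv 𝓘(ℝ, E) 𝓘(ℝ, E) e.symm (chartRep ℓ c e y) v)
      (mfderiv (𝓡 2) 𝓘(ℝ, E) (fun y' : Plane => ℓ (c.symm y')) y w) =
    inChart g.inner e (chartRep ℓ c e y) v (fderiv ℝ (chartRep ℓ c e) y w) := by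
  rw [mfderiv_comp_eq_chartRep hc he hy hℓ hye, inChart_apply]
  exact metric_congr g (e.left_inv hye).symm _ _

theorem inducedMetric_eq_gram (g : Metric (E := E) N) :
    inducedMetric g ℓ c y = gram (inChart g.inner e) (chartRep ℓ c e) y := by
  ext i j
  rw [inducedMetric, gram, partialVec, partialVec, ← metric_mfderiv hc he hy hℓ hye,
    ← mfderiv_comp_eq_chartRep hc he hy hℓ hye]

theorem isImmersedAt_iff_injective_chartRep :
    IsImmersedAt (E := E) ℓ (c.symm y) ↔ Function.Injective (fderiv ℝ (chartRep ℓ c e) y) := by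
  have h1 : ∀ v, mfderiv 𝓘(ℝ, E) 𝓘(ℝ, E) e.symm (chartRep ℓ c e y)
      (fderiv ℝ (chartRep ℓ c e) y v) =
      mfderiv (𝓡 2) 𝓘(ℝ, E) ℓ (c.symm y) (mfderiv (𝓡 2) (𝓡 2) c.symm y v) := by
    intro v
    rw [← mfderiv_comp_chart_symm hc hy hℓ, mfderiv_comp_eq_chartRep hc he hy hℓ hye]
  constructor
  · intro h
    refine (injective_iff_map_eq_zero _).2 fun v hv => ?_
    have h2 := h1 v
    rw [hv, mfderiv_symm_zero] at h2
    have h3 := (injective_iff_map_eq_zero (mfderiv (𝓡 2) 𝓘(ℝ, E) ℓ (c.symm y))).1 h _ h2.symm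
    exact mfderiv_symm_injective hc hy h3
  · intro h
    refine (injective_iff_map_eq_zero (mfderiv (𝓡 2) 𝓘(ℝ, E) ℓ (c.symm y))).2 fun w hw => ?_
    have hsrc : c.symm y ∈ c.source := c.map_target hy
    have h2 := mfderiv_symm_mfderiv hc hsrc w
    have h3 : mfderiv (𝓡 2) (𝓡 2) c.symm y (mfderiv (𝓡 2) (𝓡 2) c (c.symm y) w) = w := by
      have : ∀ z, z = y → mfderiv (𝓡 2) (𝓡 2) c.symm z
          (mfderiv (𝓡 2) (𝓡 2) c (c.symm y) w : Plane) = (w : Plane) →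
          mfderiv (𝓡 2) (𝓡 2) c.symm y (mfderiv (𝓡 2) (𝓡 2) c (c.symm y) w : Plane) =
            (w : Plane) := by
        rintro z rfl hz; exact hz
      exact this _ (c.right_inv hy) h2
    have h4 := h1 (mfderiv (𝓡 2) (𝓡 2) c (c.symm y) w)
    rw [h3] at h4
    have h5 := mfderiv_symm_injective he (e.map_source hye) (h4.trans hw)
    have h6 : (mfderiv (𝓡 2) (𝓡 2) c (c.symm y) w : Plane) = 0 :=
      (injective_iff_map_eq_zero _).1 h _ h5
    rw [← h3, h6]
    exact mfderiv_symm_zero c y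

theorem isImmersedAt_iff_gramDet_pos (g : Metric (E := E) N) :
    IsImmersedAt (E := E) ℓ (c.symm y) ↔ 0 < gramDet (inChart g.inner e) (chartRep ℓ c e) y := by
  rw [isImmersedAt_iff_injective_chartRep hc he hy hℓ hye]
  exact (gramDet_pos_iff (isMetricOn_inChart g he) (e.map_source hye)).symm

end MapCharts

/-! ### The mean curvature vector on the manifold -/

section MeanCurvature

theorem lagrangian_chartRep (hc : IsChart c) (he : e ∈ atlas E N) (hy : y ∈ c.target)
    (hℓ : ContMDiffAt (𝓡 2) 𝓘(ℝ, E) ∞ ℓ (c.symm y)) (hye : ℓ (c.symm y) ∈ e.source)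
    {g : Metric (E := E) N} (hlag : IsLagrangian g ℓ) (i j : Fin 2) :
    inChart g.inner e (chartRep ℓ c e y) (Complex.I • partialVec (chartRep ℓ c e) y i)
      (partialVec (chartRep ℓ c e) y j) = 0 := by
  have he' := isChart_of_mem_atlas he
  rw [partialVec, partialVec, ← metric_mfderiv hc he' hy hℓ hye]
  have h1 : mfderiv 𝓘(ℝ, E) 𝓘(ℝ, E) e.symm (chartRep ℓ c e y)
      (Complex.I • fderiv ℝ (chartRep ℓ c e) y (basisVec i)) =
      complexStructure (ℓ (c.symm y))
        (mfderiv (𝓡 2) 𝓘(ℝ, E) (fun y' : Plane => ℓ (c.symm y')) y (basisVec i)) := by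
    rw [mfderiv_symm_I he (y := chartRep ℓ c e y) (e.map_source hye), mfderiv_comp_eq_chartRep hc he' hy hℓ hye]
    rfl
  rw [h1, mfderiv_comp_chart_symm hc hy hℓ, mfderiv_comp_chart_symm hc hy hℓ]
  exact hlag (c.symm y) _ _

theorem meanCurvature_eq_meanCurv {g : Metric (E := E) N} (hℓ : ContMDiff (𝓡 2) 𝓘(ℝ, E) ∞ ℓ)
    (p : S) : meanCurvature g ℓ p = meanCurv (inChart g.inner (chartAt E (ℓ p)))
      (chartRep ℓ (chartAt Plane p) (chartAt E (ℓ p))) (chartAt Plane p p) := by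
  have hc := isChart_chartAt (F := Plane) p
  have he := isChart_chartAt (F := E) (ℓ p)
  have hy : chartAt Plane p p ∈ (chartAt Plane p).target := mem_chart_target Plane p
  have hp : (chartAt Plane p).symm (chartAt Plane p p) = p :=
    (chartAt Plane p).left_inv (mem_chart_source Plane p)
  have hI : inducedInverse g ℓ p = gramInv (inChart g.inner (chartAt E (ℓ p)))
      (chartRep ℓ (chartAt Plane p) (chartAt E (ℓ p))) (chartAt Plane p p) := by
    rw [inducedInverse, inducedMetric_eq_gram hc he hy hℓ.contMDiffAt
      (by rw [hp]; exact mem_chart_source E (ℓ p)), gramInv]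
  have hu : chartRep ℓ (chartAt Plane p) (chartAt E (ℓ p)) (chartAt Plane p p) =
      chartAt E (ℓ p) (ℓ p) := by rw [chartRep, hp]
  simp only [meanCurvature, normalPart, hessian, meanCurv, normalComp, covHess, hI, partialVec, hu]
  rfl

/-- The mean curvature vector may be computed in any charts. -/
theorem meanCurvature_eq {g : Metric (E := E) N} (hℓ : ContMDiff (𝓡 2) 𝓘(ℝ, E) ∞ ℓ)
    (hc : IsChart c) (he : IsChart e)
    {p : S} (hp : p ∈ c.source) (hpe : ℓ p ∈ e.source) (himm : IsImmersedAt (E := E) ℓ p) :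
    mfderiv 𝓘(ℝ, E) 𝓘(ℝ, E) e.symm (e (ℓ p))
      (meanCurv (E := E) (inChart g.inner e) (chartRep ℓ c e) (c p)) = meanCurvature g ℓ p := by
  set c₀ := chartAt Plane p
  set e₀ := chartAt E (ℓ p)
  have hc₀ : IsChart c₀ := isChart_chartAt p
  have he₀ : IsChart e₀ := isChart_chartAt (ℓ p)
  have hp₀ : p ∈ c₀.source := mem_chart_source Plane p
  have hpe₀ : ℓ p ∈ e₀.source := mem_chart_source E (ℓ p)
  have hl₀ : c₀.symm (c₀ p) = p := c₀.left_inv hp₀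
  have hl : c.symm (c p) = p := c.left_inv hp
  have hle : e.symm (e (ℓ p)) = ℓ p := e.left_inv hpe
  have hG := isMetricOn_inChart g he
  have hG₀ := isMetricOn_inChart g he₀
  set u := chartRep ℓ c e with hu
  set u₀ := chartRep ℓ c₀ e₀ with hu₀
  set τ : Plane → Plane := c ∘ c₀.symm with hτ
  set Φ : E → E := e₀ ∘ e.symm with hΦ
  have hτ0 : τ (c₀ p) = c p := by rw [hτ, Function.comp_apply, hl₀]
  have hup : u (c p) = e (ℓ p) := by rw [hu, chartRep, hl]
  have hy₀ : c₀ p ∈ c₀.target := c₀.map_source hp₀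
  have hev : u₀ =ᶠ[𝓝 (c₀ p)] Φ ∘ (u ∘ τ) := by
    have h1 : Tendsto c₀.symm (𝓝 (c₀ p)) (𝓝 p) := by
      have := c₀.tendsto_symm hp₀
      exact this
    have h2 : ∀ᶠ q in 𝓝 p, q ∈ c.source := c.open_source.mem_nhds hp
    have h3 : ∀ᶠ q in 𝓝 p, ℓ q ∈ e.source :=
      hℓ.continuous.continuousAt.eventually (e.open_source.mem_nhds hpe)
    filter_upwards [h1.eventually (h2.and h3)] with y hy
    simp only [hu₀, hu, hΦ, hτ, chartRep, Function.comp_apply]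
    rw [c.left_inv hy.1, e.left_inv hy.2]
  have huc : ContDiffAt ℝ ∞ u (τ (c₀ p)) := by
    rw [hτ0]
    exact contDiffAt_chartRep hc he (c.map_source hp) hℓ.contMDiffAt (by rw [hl]; exact hpe)
  have hτc : ContDiffAt ℝ ∞ τ (c₀ p) :=
    contDiffAt_transition hc₀ hc hy₀ (by rw [hl₀]; exact hp)
  have hutc : ContDiffAt ℝ ∞ (u ∘ τ) (c₀ p) := huc.comp _ hτc
  have hx : u (τ (c₀ p)) ∈ e.target := by rw [hτ0, hup]; exact e.map_source hpe
  have hΦx : Φ (u (τ (c₀ p))) = e₀ (ℓ p) := by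
    rw [hτ0, hup, hΦ, Function.comp_apply, hle]
  have hx' : Φ (u (τ (c₀ p))) ∈ e₀.target := by rw [hΦx]; exact e₀.map_source hpe₀
  have hxs : e.symm (u (τ (c₀ p))) ∈ e₀.source := by rw [hτ0, hup, hle]; exact hpe₀
  have hinj : Function.Injective (fderiv ℝ Φ (u (τ (c₀ p)))) := fun v w hvw => by
    rw [← fderiv_transition_symm he he₀ hx hxs v, ← fderiv_transition_symm he he₀ hx hxs w]
    exact congrArg _ hvw
  have hsurj : Function.Surjective (fderiv ℝ Φ (u (τ (c₀ p)))) :=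
    LinearMap.injective_iff_surjective.1 hinj
  have hiso : ∀ᶠ z in 𝓝 (u (τ (c₀ p))), ∀ v w, inChart g.inner e z v w =
      inChart g.inner e₀ (Φ z) (fderiv ℝ Φ z v) (fderiv ℝ Φ z w) := by
    have h1 : ∀ᶠ z in 𝓝 (u (τ (c₀ p))), e.symm z ∈ e₀.source :=
      (e.continuousAt_symm hx).eventually (e₀.open_source.mem_nhds hxs)
    filter_upwards [h1, e.open_target.mem_nhds hx] with z hz1 hz2 v w
    rw [inChart_apply, inChart_apply]
    have h2 : ∀ v, mfderiv 𝓘(ℝ, E) 𝓘(ℝ, E) e₀.symm (Φ z) (fderiv ℝ Φ z v) =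
      mfderiv 𝓘(ℝ, E) 𝓘(ℝ, E) e.symm z v := fderiv_transition he he₀ hz2 hz1
    rw [h2, h2]
    exact metric_congr g (e₀.left_inv hz1).symm _ _
  have hdet : gramDet (inChart g.inner e) u (τ (c₀ p)) ≠ 0 := by
    rw [hτ0]
    refine ((isImmersedAt_iff_gramDet_pos hc he (c.map_source hp) hℓ.contMDiffAt
      (by rw [hl]; exact hpe) g).1 ?_).ne'
    rw [hl]; exact himm
  have hjac : (fderiv ℝ τ (c₀ p)).det ≠ 0 := fun h0 => by
    have h1 := det_mul_det_eq_one (fderiv_transition_symm hc₀ hc hy₀ (by rw [hl₀]; exact hp))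
    have h2 : (fderiv ℝ (c ∘ c₀.symm) (c₀ p)).det = 0 := h0
    rw [h2, mul_zero] at h1
    exact zero_ne_one h1
  rw [meanCurvature_eq_meanCurv hℓ, meanCurv_congr hev,
    meanCurv_comp_left hG hG₀ (u := u ∘ τ) hutc hx hx'
      (contDiffAt_transition he he₀ hx hxs) hsurj hiso,
    meanCurv_comp_right hG hτc huc hx (isUnit_jacobian_of_det_ne_zero hjac) hdet,
    Function.comp_apply, hτ0, hup]
  -- The tangent space at `ℓ p` is identified with `E` by the preferred chart, so this derivative is
  -- the derivative of the transition map `Φ`.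
  have h1 : mfderiv 𝓘(ℝ, E) 𝓘(ℝ, E) e.symm (e (ℓ p)) =
      fderiv ℝ (chartAt E (e.symm (e (ℓ p))) ∘ e.symm) (e (ℓ p)) :=
    mfderiv_chart_symm ((chart_symm_contMDiffAt he (e.map_source hpe)).mdifferentiableAt (by simp))
  rw [h1, hle]
  rfl

/-- The form `ω(H, dℓ ·)` in charts. -/
theorem fundamentalForm_meanCurvature {g : Metric (E := E) N} (hℓ : ContMDiff (𝓡 2) 𝓘(ℝ, E) ∞ ℓ)
    (hc : IsChart c) (he : e ∈ atlas E N)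
    {y : Plane} (hy : y ∈ c.target) (hye : ℓ (c.symm y) ∈ e.source)
    (himm : IsImmersedAt (E := E) ℓ (c.symm y)) (v : Plane) :
    fundamentalForm g (ℓ (c.symm y)) (meanCurvature (E := E) g ℓ (c.symm y))
      (mfderiv (𝓡 2) 𝓘(ℝ, E) ℓ (c.symm y) (mfderiv (𝓡 2) (𝓡 2) c.symm y v)) =
    inChart g.inner e (chartRep ℓ c e y)
      (Complex.I • meanCurv (inChart g.inner e) (chartRep ℓ c e) y)
      (fderiv ℝ (chartRep ℓ c e) y v) := by
  have he' := isChart_of_mem_atlas he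
  rw [← metric_mfderiv hc he' hy hℓ.contMDiffAt hye, ← meanCurvature_eq hℓ hc he'
    (c.map_target hy) hye himm, c.right_inv hy, mfderiv_symm_I he (y := chartRep ℓ c e y)
      (e.map_source hye), mfderiv_comp_chart_symm hc hy hℓ.contMDiffAt]
  rfl

end MeanCurvature

/-! ## Densities and one-forms on the surface -/

section Densities

/-- A family of functions in the charts of the surface that transforms as a density. -/
def IsDensity (w : OpenPartialHomeomorph S Plane → Plane → ℝ) : Prop :=
  ∀ c ∈ IsManifold.maximalAtlas (𝓡 2) ∞ S, ∀ c' ∈ IsManifold.maximalAtlas (𝓡 2) ∞ S,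
    ∀ y ∈ c.target, c.symm y ∈ c'.source →
      w c y = |(fderiv ℝ (c' ∘ c.symm) y).det| * w c' (c' (c.symm y))

theorem IsDensity.mul {w : OpenPartialHomeomorph S Plane → Plane → ℝ} (hw : IsDensity w)
    (f : S → ℝ) : IsDensity fun c y => f (c.symm y) * w c y := by
  intro c hc c' hc' y hy hy'
  beta_reduce
  rw [hw c hc c' hc' y hy hy', c'.left_inv hy']
  ring

/-- A density supported in two charts has the same integral in both. -/
theorem IsDensity.integral_eq {w : OpenPartialHomeomorph S Plane → Plane → ℝ} (hw : IsDensity w)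
    {c c' : OpenPartialHomeomorph S Plane} (hc : IsChart c) (hc' : IsChart c')
    (h : ∀ y ∈ c.target, c.symm y ∉ c'.source → w c y = 0)
    (h' : ∀ y ∈ c'.target, c'.symm y ∉ c.source → w c' y = 0) :
    ∫ y in c.target, w c y = ∫ y in c'.target, w c' y := by
  set T := c.symm.trans c' with hT
  have hTs : T.source = c.target ∩ c.symm ⁻¹' c'.source := by
    rw [hT, OpenPartialHomeomorph.trans_source]; rfl
  have hTt : T.target = c'.target ∩ c'.symm ⁻¹' c.source := by
    rw [hT, OpenPartialHomeomorph.trans_target]; rfl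
  have e1 : ∫ y in c.target, w c y = ∫ y in T.source, w c y := by
    refine setIntegral_eq_of_subset_of_forall_sdiff_eq_zero c.open_target.measurableSet
      (by rw [hTs]; exact inter_subset_left) fun y hy => h y hy.1 fun hy' => hy.2 ?_
    rw [hTs]; exact ⟨hy.1, hy'⟩
  have e2 : ∫ y in c'.target, w c' y = ∫ y in T.target, w c' y := by
    refine setIntegral_eq_of_subset_of_forall_sdiff_eq_zero c'.open_target.measurableSet
      (by rw [hTt]; exact inter_subset_left) fun y hy => h' y hy.1 fun hy' => hy.2 ?_
    rw [hTt]; exact ⟨hy.1, hy'⟩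
  rw [e1, e2, ← T.image_source_eq_target,
    integral_image_eq_integral_abs_det_fderiv_smul volume T.open_source.measurableSet
      (f' := fun y => fderiv ℝ (c' ∘ c.symm) y) _ T.injOn]
  · refine setIntegral_congr_fun T.open_source.measurableSet fun y hy => ?_
    rw [hTs] at hy
    exact hw c hc c' hc' y hy.1 hy.2
  · intro y hy
    rw [hTs] at hy
    exact ((contDiffAt_transition hc hc' hy.1 hy.2).differentiableAt
      (by simp)).hasFDerivAt.hasFDerivWithinAt

theorem integrableOn_target_of_compact {w : Plane → ℝ}
    (hw : ContinuousOn w c.target) {K : Set S} (hK : IsCompact K) (hKs : K ⊆ c.source)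
    (h : ∀ y ∈ c.target, c.symm y ∉ K → w y = 0) : IntegrableOn w c.target := by
  have hK' : IsCompact (c '' K) := hK.image_of_continuousOn (c.continuousOn.mono hKs)
  have hKt : c '' K ⊆ c.target := by
    rintro _ ⟨q, hq, rfl⟩; exact c.map_source (hKs hq)
  refine ((hw.mono hKt).integrableOn_compact hK').of_forall_sdiff_eq_zero
    c.open_target.measurableSet fun y hy => h y hy.1 fun hyK => hy.2 ?_
  exact ⟨_, hyK, c.right_inv hy.1⟩

/-- One-forms on the surface. -/
abbrev OneForm (S : Type*) [TopologicalSpace S] [ChartedSpace Plane S] : Type _ :=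
  ∀ q : S, TangentSpace (𝓡 2) q →L[ℝ] ℝ

/-- The components of a one-form in a chart. -/
def formComp (η : OneForm S) (c : OpenPartialHomeomorph S Plane) (y : Plane) (k : Fin 2) : ℝ :=
  η (c.symm y) (mfderiv (𝓡 2) (𝓡 2) c.symm y (basisVec k))

/-- The differential of a function. -/
def diffForm (f : S → ℝ) : OneForm S := fun q => mfderiv (𝓡 2) 𝓘(ℝ, ℝ) f q

theorem formComp_transform (η : OneForm S) {c c' : OpenPartialHomeomorph S Plane}
    (hc : IsChart c) (hc' : IsChart c')
    (hy : y ∈ c.target) (hy' : c.symm y ∈ c'.source) (k : Fin 2) :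
    formComp η c y k = fderiv ℝ (c' ∘ c.symm) y (basisVec k) 0 * formComp η c' (c' (c.symm y)) 0
      + fderiv ℝ (c' ∘ c.symm) y (basisVec k) 1 * formComp η c' (c' (c.symm y)) 1 := by
  have h1 := fderiv_transition hc hc' hy hy' (basisVec k)
  have h2 : ∀ (x x' : S) (_ : x = x') (v : Plane), η x v = η x' v := by
    rintro x _ rfl v; rfl
  have h3 := map_eq_sum_basisVec (F := ℝ)
    ((η (c'.symm (c' (c.symm y)))).comp (mfderiv (𝓡 2) (𝓡 2) c'.symm (c' (c.symm y))) :
      Plane →L[ℝ] ℝ) (fderiv ℝ (c' ∘ c.symm) y (basisVec k))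
  simp only [smul_eq_mul] at h3
  refine Eq.trans ?_ h3
  rw [formComp, ← h1]
  exact h2 _ _ (c'.left_inv hy').symm _

theorem formComp_diffForm {f : S → ℝ} (hc : IsChart c) (hy : y ∈ c.target)
    (hf : MDifferentiableAt (𝓡 2) 𝓘(ℝ, ℝ) f (c.symm y)) (k : Fin 2) :
    formComp (diffForm f) c y k = fderiv ℝ (f ∘ c.symm) y (basisVec k) := by
  rw [← mfderiv_eq_fderiv, mfderiv_comp y hf
    ((chart_symm_contMDiffAt hc hy).mdifferentiableAt (by simp))]
  rfl

/-- The numerator of the pairing and the determinant of the metric both scale by the square of the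
Jacobian. The root in the denominator takes back one factor. -/
theorem pairing_transform {h h' : Fin 2 → Fin 2 → ℝ} {α α' β β' : Fin 2 → ℝ}
    {A : Plane →L[ℝ] Plane} (hs : h' 1 0 = h' 0 1) (hA : A.det ≠ 0)
    (hh : ∀ i j, h i j = A (basisVec i) 0 * A (basisVec j) 0 * h' 0 0
      + A (basisVec i) 0 * A (basisVec j) 1 * h' 0 1 + A (basisVec i) 1 * A (basisVec j) 0 * h' 1 0
      + A (basisVec i) 1 * A (basisVec j) 1 * h' 1 1)
    (hα : ∀ k, α k = A (basisVec k) 0 * α' 0 + A (basisVec k) 1 * α' 1)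
    (hβ : ∀ k, β k = A (basisVec k) 0 * β' 0 + A (basisVec k) 1 * β' 1) :
    pairing h α β = |A.det| * pairing h' α' β' := by
  have hdet : h 0 0 * h 1 1 - h 0 1 ^ 2 = A.det ^ 2 * (h' 0 0 * h' 1 1 - h' 0 1 ^ 2) := by
    rw [det_eq_jacobian, hh, hh, hh, hs]; ring
  have hsq : √(h 0 0 * h 1 1 - h 0 1 ^ 2) = |A.det| * √(h' 0 0 * h' 1 1 - h' 0 1 ^ 2) := by
    rw [hdet, Real.sqrt_mul (sq_nonneg _), Real.sqrt_sq_eq_abs]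
  have hN : ∀ (h : Fin 2 → Fin 2 → ℝ) (α β : Fin 2 → ℝ), pairing h α β =
      (h 1 1 * α 0 * β 0 - h 0 1 * (α 0 * β 1 + α 1 * β 0) + h 0 0 * α 1 * β 1) /
        √(h 0 0 * h 1 1 - h 0 1 ^ 2) := by
    intro h α β
    simp only [pairing, flux, Matrix.cons_val_zero, Matrix.cons_val_one]
    ring
  have hnum : h 1 1 * α 0 * β 0 - h 0 1 * (α 0 * β 1 + α 1 * β 0) + h 0 0 * α 1 * β 1 =
      A.det ^ 2 * (h' 1 1 * α' 0 * β' 0 - h' 0 1 * (α' 0 * β' 1 + α' 1 * β' 0)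
        + h' 0 0 * α' 1 * β' 1) := by
    rw [det_eq_jacobian, hh, hh, hh, hα, hα, hβ, hβ, hs]; ring
  rw [hN, hN, hsq, hnum, ← sq_abs]
  have : |A.det| ≠ 0 := abs_ne_zero.2 hA
  field_simp

end Densities

/-! ### The pairing of one-forms in the induced metric -/

section Pairing

variable (hℓ : ContMDiff (𝓡 2) 𝓘(ℝ, E) ∞ ℓ)

/-- The density `⟨α, β⟩ dA` of two one-forms for the metric induced by `ℓ`. -/
def pairingDensity (g : Metric (E := E) N) (ℓ : S → N) (α β : OneForm S)
    (c : OpenPartialHomeomorph S Plane) (y : Plane) : ℝ :=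
  pairing (inducedMetric g ℓ c y) (formComp α c y) (formComp β c y)

include hℓ

theorem inducedMetric_comm (c : OpenPartialHomeomorph S Plane) (y : Plane) (i j : Fin 2) :
    inducedMetric g ℓ c y i j = inducedMetric g ℓ c y j i := g.symm _ _ _

theorem inducedMetric_transform {c c' : OpenPartialHomeomorph S Plane}
    (hc : IsChart c) (hc' : IsChart c')
    (hy : y ∈ c.target) (hy' : c.symm y ∈ c'.source) (i j : Fin 2) : inducedMetric g ℓ c y i j =
      fderiv ℝ (c' ∘ c.symm) y (basisVec i) 0 * fderiv ℝ (c' ∘ c.symm) y (basisVec j) 0 *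
        inducedMetric g ℓ c' (c' (c.symm y)) 0 0
      + fderiv ℝ (c' ∘ c.symm) y (basisVec i) 0 * fderiv ℝ (c' ∘ c.symm) y (basisVec j) 1 *
        inducedMetric g ℓ c' (c' (c.symm y)) 0 1
      + fderiv ℝ (c' ∘ c.symm) y (basisVec i) 1 * fderiv ℝ (c' ∘ c.symm) y (basisVec j) 0 *
        inducedMetric g ℓ c' (c' (c.symm y)) 1 0
      + fderiv ℝ (c' ∘ c.symm) y (basisVec i) 1 * fderiv ℝ (c' ∘ c.symm) y (basisVec j) 1 *
        inducedMetric g ℓ c' (c' (c.symm y)) 1 1 := by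
  set y' := c' (c.symm y) with hy'd
  have hyt : y' ∈ c'.target := c'.map_source hy'
  have hs : c'.symm y' = c.symm y := c'.left_inv hy'
  have he := isChart_chartAt (F := E) (ℓ (c.symm y))
  set e := chartAt E (ℓ (c.symm y))
  have hye : ℓ (c.symm y) ∈ e.source := mem_chart_source E _
  have hye' : ℓ (c'.symm y') ∈ e.source := by rw [hs]; exact hye
  rw [inducedMetric_eq_gram hc he hy hℓ.contMDiffAt hye,
    inducedMetric_eq_gram hc' he hyt hℓ.contMDiffAt hye']
  have hev : chartRep ℓ c e =ᶠ[𝓝 y] chartRep ℓ c' e ∘ (c' ∘ c.symm) := by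
    have h1 : ∀ᶠ z in 𝓝 y, c.symm z ∈ c'.source :=
      (c.continuousAt_symm hy).eventually (c'.open_source.mem_nhds hy')
    filter_upwards [h1] with z hz
    simp only [chartRep, Function.comp_apply]
    rw [c'.left_inv hz]
  have hd : fderiv ℝ (chartRep ℓ c e) y =
      (fderiv ℝ (chartRep ℓ c' e) y').comp (fderiv ℝ (c' ∘ c.symm) y) := by
    rw [hev.fderiv_eq]
    exact fderiv_comp y
      ((contDiffAt_chartRep hc' he hyt hℓ.contMDiffAt hye').differentiableAt (by simp))
      ((contDiffAt_transition hc hc' hy hy').differentiableAt (by simp))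
  have hp : ∀ i, partialVec (chartRep ℓ c e) y i =
      fderiv ℝ (c' ∘ c.symm) y (basisVec i) 0 • partialVec (chartRep ℓ c' e) y' 0
      + fderiv ℝ (c' ∘ c.symm) y (basisVec i) 1 • partialVec (chartRep ℓ c' e) y' 1 := by
    intro i
    rw [partialVec, hd, ContinuousLinearMap.comp_apply, map_eq_sum_basisVec]; rfl
  have hu : chartRep ℓ c e y = chartRep ℓ c' e y' := by rw [chartRep, chartRep, hs]
  simp only [gram, hp, hu, map_add, map_smul, add_apply, smul_apply, smul_eq_mul]
  ring

theorem isDensity_pairingDensity (α β : OneForm S) : IsDensity (pairingDensity g ℓ α β) := by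
  intro c hc c' hc' y hy hy'
  refine pairing_transform (inducedMetric_comm hℓ _ _ 1 0) (fun h0 => ?_)
    (inducedMetric_transform hℓ hc hc' hy hy') (formComp_transform α hc hc' hy hy')
    (formComp_transform β hc hc' hy hy')
  have h1 := det_mul_det_eq_one (fderiv_transition_symm hc hc' hy hy')
  rw [h0, mul_zero] at h1
  exact zero_ne_one h1

end Pairing

/-! ## Integration over the surface -/

section Integral

variable [T2Space S] [CompactSpace S]

variable (S) in
theorem exists_finset_chartPartition : ∃ T : Finset S, (∀ p ∉ T, ∀ q, chartPartition S p q = 0) ∧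
      ∀ q, ∑ p ∈ T, chartPartition S p q = 1 := by
  have h := (chartPartition S).locallyFinite.finite_nonempty_of_compact
  have h0 : ∀ p ∉ h.toFinset, ∀ q, chartPartition S p q = 0 := by
    intro p hp q
    by_contra hq
    exact hp (h.mem_toFinset.2 ⟨q, hq⟩)
  refine ⟨h.toFinset, h0, fun q => ?_⟩
  have h1 := (chartPartition S).sum_eq_one (mem_univ q)
  rw [finsum_eq_sum_of_support_subset (s := h.toFinset)] at h1
  · exact h1
  · intro p hp
    by_contra hp'
    exact hp (h0 p hp' q)

/-- The integral of a density over the surface. -/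
def surfaceIntegral (w : OpenPartialHomeomorph S Plane → Plane → ℝ) : ℝ :=
  ∑ᶠ p : S, ∫ y in (chartAt Plane p).target,
    chartPartition S p ((chartAt Plane p).symm y) * w (chartAt Plane p) y

theorem surfaceIntegral_eq_sum {T : Finset S} (hT : ∀ p ∉ T, ∀ q, chartPartition S p q = 0)
    (w : OpenPartialHomeomorph S Plane → Plane → ℝ) :
    surfaceIntegral w = ∑ p ∈ T, ∫ y in (chartAt Plane p).target,
      chartPartition S p ((chartAt Plane p).symm y) * w (chartAt Plane p) y := by
  refine finsum_eq_sum_of_support_subset _ fun p hp => ?_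
  by_contra hpT
  refine hp ?_
  simp [hT p hpT]

theorem integrableOn_chartPartition_mul (p : S) {w : Plane → ℝ}
    (hw : ContinuousOn w (chartAt Plane p).target) :
    IntegrableOn (fun y => chartPartition S p ((chartAt Plane p).symm y) * w y)
      (chartAt Plane p).target := by
  refine integrableOn_target_of_compact (c := chartAt Plane p) (K := tsupport (chartPartition S p))
    ?_ (isClosed_tsupport _).isCompact (chartPartition_isSubordinate S p) fun y _ hK => ?_
  · exact ((chartPartition S p).contMDiff.continuous.comp_continuousOn
      (chartAt Plane p).continuousOn_symm).mul hw
  · rw [image_eq_zero_of_notMem_tsupport hK, zero_mul]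

/-- The integral over the surface of a density supported in a chart. -/
theorem IsDensity.surfaceIntegral_eq {w : OpenPartialHomeomorph S Plane → Plane → ℝ}
    (hw : IsDensity w) (hc : IsChart c)
    (h : ∀ c' ∈ IsManifold.maximalAtlas (𝓡 2) ∞ S, ∀ y ∈ c'.target, c'.symm y ∉ c.source →
      w c' y = 0) (hint : IntegrableOn (w c) c.target) :
    surfaceIntegral w = ∫ y in c.target, w c y := by
  obtain ⟨T, hT, hsum⟩ := exists_finset_chartPartition S
  rw [surfaceIntegral_eq_sum hT]
  have h1 : ∀ p ∈ T, ∫ y in (chartAt Plane p).target,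
      chartPartition S p ((chartAt Plane p).symm y) * w (chartAt Plane p) y =
      ∫ y in c.target, chartPartition S p (c.symm y) * w c y := by
    intro p _
    refine (hw.mul (chartPartition S p)).integral_eq (isChart_chartAt p) hc
      (fun y hy hyc => ?_) (fun y hy hyc => ?_)
    · rw [h _ (isChart_chartAt p) y hy hyc, mul_zero]
    · have : c.symm y ∉ tsupport (chartPartition S p) := fun h' =>
        hyc (chartPartition_isSubordinate S p h')
      rw [image_eq_zero_of_notMem_tsupport this, zero_mul]
  rw [Finset.sum_congr rfl h1, ← integral_finsetSum]
  · refine setIntegral_congr_fun c.open_target.measurableSet fun y _ => ?_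
    rw [← Finset.sum_mul, hsum, one_mul]
  · intro p _
    have hcont : ContinuousOn (fun y => chartPartition S p (c.symm y)) c.target :=
      (chartPartition S p).contMDiff.continuous.comp_continuousOn c.continuousOn_symm
    refine Integrable.bdd_mul (c := 1) hint
      (hcont.aestronglyMeasurable c.open_target.measurableSet) (ae_of_all _ fun y => ?_)
    rw [Real.norm_eq_abs, abs_of_nonneg ((chartPartition S).nonneg p _)]
    exact (chartPartition S).le_one p _

/-- The densities that are continuous in all charts. -/
def IsContinuousDensity (w : OpenPartialHomeomorph S Plane → Plane → ℝ) : Prop :=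
  ∀ c ∈ IsManifold.maximalAtlas (𝓡 2) ∞ S, ContinuousOn (w c) c.target

theorem surfaceIntegral_sum {ι : Type*} (s : Finset ι)
    {w : ι → OpenPartialHomeomorph S Plane → Plane → ℝ} (hw : ∀ i ∈ s, IsContinuousDensity (w i)) :
    surfaceIntegral (fun c y => ∑ i ∈ s, w i c y) = ∑ i ∈ s, surfaceIntegral (w i) := by
  obtain ⟨T, hT, -⟩ := exists_finset_chartPartition S
  simp only [surfaceIntegral_eq_sum hT]
  rw [Finset.sum_comm]
  refine Finset.sum_congr rfl fun p _ => ?_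
  rw [← integral_finsetSum]
  · simp only [Finset.mul_sum]
  · exact fun i hi => integrableOn_chartPartition_mul p (hw i hi _ (isChart_chartAt p))

theorem surfaceIntegral_sub {w w' : OpenPartialHomeomorph S Plane → Plane → ℝ}
    (hw : IsContinuousDensity w) (hw' : IsContinuousDensity w') :
    surfaceIntegral (fun c y => w c y - w' c y) = surfaceIntegral w - surfaceIntegral w' := by
  obtain ⟨T, hT, -⟩ := exists_finset_chartPartition S
  simp only [surfaceIntegral_eq_sum hT]
  rw [← Finset.sum_sub_distrib]
  refine Finset.sum_congr rfl fun p _ => ?_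
  rw [← integral_sub (integrableOn_chartPartition_mul p (hw _ (isChart_chartAt p)))
    (integrableOn_chartPartition_mul p (hw' _ (isChart_chartAt p)))]
  simp only [mul_sub]

theorem surfaceIntegral_mono {w w' : OpenPartialHomeomorph S Plane → Plane → ℝ}
    (hw : IsContinuousDensity w) (hw' : IsContinuousDensity w')
    (h : ∀ c ∈ IsManifold.maximalAtlas (𝓡 2) ∞ S, ∀ y ∈ c.target, w c y ≤ w' c y) :
    surfaceIntegral w ≤ surfaceIntegral w' := by
  obtain ⟨T, hT, -⟩ := exists_finset_chartPartition S
  simp only [surfaceIntegral_eq_sum hT]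
  refine Finset.sum_le_sum fun p _ => ?_
  refine setIntegral_mono_on (integrableOn_chartPartition_mul p (hw _ (isChart_chartAt p)))
    (integrableOn_chartPartition_mul p (hw' _ (isChart_chartAt p)))
    (chartAt Plane p).open_target.measurableSet fun y hy => ?_
  exact mul_le_mul_of_nonneg_left (h _ (isChart_chartAt p) y hy)
    ((chartPartition S).nonneg p _)

end Integral

/-! ## The divergence theorem on the surface -/

theorem integral_fderiv_eq_zero {W : Plane → ℝ} (hW : ContDiff ℝ 1 W) (hs : HasCompactSupport W)
    (v : Plane) : ∫ y, fderiv ℝ W y v = 0 := by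
  have h1 : Continuous fun y => fderiv ℝ W y v :=
    (hW.continuous_fderiv (by simp)).clm_apply continuous_const
  have h2 : HasCompactSupport fun y => fderiv ℝ W y v :=
    hs.fderiv_apply ℝ v
  have h := integral_mul_fderiv_eq_neg_fderiv_mul_of_integrable (μ := volume) (𝕜 := ℝ) (f := W)
    (g := fun _ => 1) (v := v) (by simpa using h1.integrable_of_hasCompactSupport h2) (by simp)
    (by simpa using hW.continuous.integrable_of_hasCompactSupport hs)
    (fun x _ => hW.differentiable (by simp) x) (fun x _ => differentiableAt_const _)
  simp at h
  exact h

section Divergence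

theorem contDiffAt_comp_symm {a : S → ℝ} (ha : ContMDiff (𝓡 2) 𝓘(ℝ, ℝ) ∞ a) (hc : IsChart c)
    (hy : y ∈ c.target) : ContDiffAt ℝ ∞ (a ∘ c.symm) y :=
  (ContMDiffAt.comp y ha.contMDiffAt (chart_symm_contMDiffAt hc hy)).contDiffAt

theorem continuousAt_formComp_diffForm {a : S → ℝ} (ha : ContMDiff (𝓡 2) 𝓘(ℝ, ℝ) ∞ a)
    (hc : IsChart c)
    (hy : y ∈ c.target) (k : Fin 2) : ContinuousAt (fun z => formComp (diffForm a) c z k) y := by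
  have h1 : ContinuousAt (fun z => fderiv ℝ (a ∘ c.symm) z (basisVec k)) y :=
    (((contDiffAt_comp_symm ha hc hy).fderiv_right (m := ∞) (by simp)).continuousAt).clm_apply
      continuousAt_const
  refine h1.congr ?_
  filter_upwards [c.open_target.mem_nhds hy] with z hz
  exact (formComp_diffForm hc hz (ha.contMDiffAt.mdifferentiableAt (by simp)) k).symm

theorem formComp_diffForm_eq_zero {a : S → ℝ}
    (hy : c.symm y ∉ tsupport a) (k : Fin 2) : formComp (diffForm a) c y k = 0 := by
  have h1 : a =ᶠ[𝓝 (c.symm y)] fun _ => 0 := notMem_tsupport_iff_eventuallyEq.1 hy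
  rw [formComp, diffForm, h1.mfderiv_eq, mfderiv_const]
  rfl

/-- The vector field `V` is controlled only on the support of `a`, so that it may be singular at
branch points. Only the products `a V i`, extended by zero, are integrated by parts on the plane;
they are `C¹` with compact support. -/
theorem chart_divergence (hc : IsChart c) {a : S → ℝ}
    (ha : ContMDiff (𝓡 2) 𝓘(ℝ, ℝ) ∞ a) (hK : IsCompact (tsupport a))
    (hKs : tsupport a ⊆ c.source) {V : Fin 2 → Plane → ℝ}
    (hV : ∀ y ∈ c.target, c.symm y ∈ tsupport a → ∀ i, ContDiffAt ℝ 1 (V i) y) :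
    ∫ y in c.target, a (c.symm y) *
        (fderiv ℝ (V 0) y (basisVec 0) + fderiv ℝ (V 1) y (basisVec 1)) =
      -∫ y in c.target, (formComp (diffForm a) c y 0 * V 0 y
        + formComp (diffForm a) c y 1 * V 1 y) := by
  classical
  set K := c '' tsupport a with hKd
  have hKc : IsCompact K := hK.image_of_continuousOn (c.continuousOn.mono hKs)
  have hKt : K ⊆ c.target := by
    rintro _ ⟨q, hq, rfl⟩; exact c.map_source (hKs hq)
  have hKm : ∀ y ∈ c.target, (y ∈ K ↔ c.symm y ∈ tsupport a) := by
    intro y hy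
    constructor
    · rintro ⟨q, hq, rfl⟩
      rwa [c.left_inv (hKs hq)]
    · exact fun h => ⟨_, h, c.right_inv hy⟩
  set b : Plane → ℝ := fun y => if y ∈ c.target then a (c.symm y) else 0 with hb
  have hbK : ∀ y ∉ K, b y = 0 := by
    intro y hy
    by_cases hyt : y ∈ c.target
    · simp only [hb, if_pos hyt]
      exact image_eq_zero_of_notMem_tsupport fun h => hy ((hKm y hyt).2 h)
    · simp only [hb, if_neg hyt]
  have hbt : ∀ y ∈ c.target, b =ᶠ[𝓝 y] a ∘ c.symm := by
    intro y hy
    filter_upwards [c.open_target.mem_nhds hy] with z hz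
    simp only [hb, if_pos hz, Function.comp_apply]
  have hbc : ∀ y ∈ c.target, ContDiffAt ℝ ∞ b y := fun y hy =>
    (contDiffAt_comp_symm ha hc hy).congr_of_eventuallyEq (hbt y hy)
  have hb0 : ∀ y ∉ K, b =ᶠ[𝓝 y] fun _ => 0 := by
    intro y hy
    filter_upwards [hKc.isClosed.isOpen_compl.mem_nhds hy] with z hz using hbK z hz
  have hVK : ∀ y ∈ K, ∀ i, ContDiffAt ℝ 1 (V i) y := fun y hy i =>
    hV y (hKt hy) ((hKm y (hKt hy)).1 hy) i
  have hW : ∀ i, ContDiff ℝ 1 fun y => b y * V i y := by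
    intro i
    refine contDiff_iff_contDiffAt.2 fun y => ?_
    by_cases hy : y ∈ K
    · exact ((hbc y (hKt hy)).of_le (by exact_mod_cast le_top)).mul (hVK y hy i)
    · refine (contDiffAt_const (c := (0 : ℝ))).congr_of_eventuallyEq ?_
      filter_upwards [hb0 y hy] with z hz
      rw [hz, zero_mul]
  have hWs : ∀ i, HasCompactSupport fun y => b y * V i y := fun i =>
    HasCompactSupport.intro hKc fun y hy => by rw [hbK y hy, zero_mul]
  have hprod : ∀ i y, fderiv ℝ (fun y => b y * V i y) y (basisVec i) =
      b y * fderiv ℝ (V i) y (basisVec i) + fderiv ℝ b y (basisVec i) * V i y := by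
    intro i y
    by_cases hy : y ∈ K
    · rw [fderiv_fun_mul ((hbc y (hKt hy)).differentiableAt (by simp))
        ((hVK y hy i).differentiableAt (by simp))]
      simp [mul_comm]
    · have h1 : (fun y => b y * V i y) =ᶠ[𝓝 y] fun _ => 0 := by
        filter_upwards [hb0 y hy] with z hz
        rw [hz, zero_mul]
      rw [h1.fderiv_eq, (hb0 y hy).fderiv_eq, hbK y hy]
      simp
  have hf1 : ∀ i, Integrable fun y => b y * fderiv ℝ (V i) y (basisVec i) := by
    intro i
    refine Continuous.integrable_of_hasCompactSupport (continuous_iff_continuousAt.2 fun y => ?_)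
      (HasCompactSupport.intro hKc fun y hy => by rw [hbK y hy, zero_mul])
    by_cases hy : y ∈ K
    · exact (hbc y (hKt hy)).continuousAt.mul (((hVK y hy i).fderiv_right (m := 0)
        (by simp)).continuousAt.clm_apply continuousAt_const)
    · refine (continuousAt_const (y := (0 : ℝ))).congr ?_
      filter_upwards [hb0 y hy] with z hz
      rw [hz, zero_mul]
  have hf2 : ∀ i, Integrable fun y => fderiv ℝ b y (basisVec i) * V i y := by
    intro i
    have h1 : Integrable fun y => fderiv ℝ (fun y => b y * V i y) y (basisVec i) :=
      (((hW i).continuous_fderiv (by simp)).clm_apply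
        continuous_const).integrable_of_hasCompactSupport ((hWs i).fderiv_apply ℝ _)
    refine (h1.sub (hf1 i)).congr (ae_of_all _ fun y => ?_)
    simp only [Pi.sub_apply, hprod]
    ring
  have hI : ∀ i, ∫ y, b y * fderiv ℝ (V i) y (basisVec i) =
      -∫ y, fderiv ℝ b y (basisVec i) * V i y := by
    intro i
    have h1 := integral_fderiv_eq_zero (hW i) (hWs i) (basisVec i)
    simp only [hprod] at h1
    rw [integral_add (hf1 i) (hf2 i)] at h1
    linarith
  have hL : ∫ y in c.target, a (c.symm y) *
      (fderiv ℝ (V 0) y (basisVec 0) + fderiv ℝ (V 1) y (basisVec 1)) =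
      ∫ y, (b y * fderiv ℝ (V 0) y (basisVec 0) + b y * fderiv ℝ (V 1) y (basisVec 1)) := by
    refine Eq.trans ?_ (setIntegral_eq_integral_of_forall_compl_eq_zero (s := c.target) ?_)
    · refine setIntegral_congr_fun c.open_target.measurableSet fun y hy => ?_
      simp only [hb, if_pos hy]; ring
    · intro y hy
      simp only [hb, if_neg hy]; ring
  have hR : ∫ y in c.target, (formComp (diffForm a) c y 0 * V 0 y
        + formComp (diffForm a) c y 1 * V 1 y) =
      ∫ y, (fderiv ℝ b y (basisVec 0) * V 0 y + fderiv ℝ b y (basisVec 1) * V 1 y) := by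
    refine Eq.trans ?_ (setIntegral_eq_integral_of_forall_compl_eq_zero (s := c.target) ?_)
    · refine setIntegral_congr_fun c.open_target.measurableSet fun y hy => ?_
      have h1 : ∀ k, formComp (diffForm a) c y k = fderiv ℝ b y (basisVec k) := by
        intro k
        rw [formComp_diffForm hc hy (ha.contMDiffAt.mdifferentiableAt (by simp)),
          (hbt y hy).fderiv_eq]
      simp only [h1]
    · intro y hy
      rw [(hb0 y fun h => hy (hKt h)).fderiv_eq]
      simp
  rw [hL, hR, integral_add (hf1 0) (hf1 1), integral_add (hf2 0) (hf2 1), hI, hI]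
  ring

end Divergence

/-! ### Integration by parts against functions vanishing near the singularities -/

section SurfaceDivergence

/-- The vector density associated with a one-form by the metric induced by `ℓ`. -/
def fluxDensity (g : Metric (E := E) N) (ℓ : S → N) (ξ : OneForm S)
    (c : OpenPartialHomeomorph S Plane) (i : Fin 2) (y : Plane) : ℝ :=
  flux (inducedMetric g ℓ c y) (formComp ξ c y) i

theorem isContinuousDensity_pairing_diffForm {ξ : OneForm S} {a : S → ℝ}
    (ha : ContMDiff (𝓡 2) 𝓘(ℝ, ℝ) ∞ a)
    (hV : ∀ c ∈ IsManifold.maximalAtlas (𝓡 2) ∞ S, ∀ y ∈ c.target, c.symm y ∈ tsupport a →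
      ∀ i, ContinuousAt (fluxDensity g ℓ ξ c i) y) : ∀ c ∈ IsManifold.maximalAtlas (𝓡 2) ∞ S,
      ContinuousOn (pairingDensity g ℓ (diffForm a) ξ c) c.target := by
  intro c hc y hy
  refine ContinuousAt.continuousWithinAt ?_
  by_cases hya : c.symm y ∈ tsupport a
  · exact ((continuousAt_formComp_diffForm ha hc hy 0).mul (hV c hc y hy hya 0)).add
      ((continuousAt_formComp_diffForm ha hc hy 1).mul (hV c hc y hy hya 1))
  · refine (continuousAt_const (y := (0 : ℝ))).congr ?_
    have h1 : ∀ᶠ z in 𝓝 y, c.symm z ∈ (tsupport a)ᶜ :=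
      (c.continuousAt_symm hy).eventually ((isClosed_tsupport a).isOpen_compl.mem_nhds hya)
    filter_upwards [h1] with z hz
    simp only [pairingDensity, pairing, formComp_diffForm_eq_zero hz]
    simp

variable [T2Space S] [CompactSpace S]

/-- Integration by parts on the surface, away from the branch points. -/
theorem surfaceIntegral_divergence (hℓ : ContMDiff (𝓡 2) 𝓘(ℝ, E) ∞ ℓ) {ξ : OneForm S} {θ : S → ℝ}
    (hθ : ContMDiff (𝓡 2) 𝓘(ℝ, ℝ) ∞ θ)
    (hV : ∀ c ∈ IsManifold.maximalAtlas (𝓡 2) ∞ S, ∀ y ∈ c.target, c.symm y ∈ tsupport θ →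
      ∀ i, ContDiffAt ℝ 1 (fluxDensity g ℓ ξ c i) y) :
    surfaceIntegral (fun c y => θ (c.symm y) * (fderiv ℝ (fluxDensity g ℓ ξ c 0) y (basisVec 0)
        + fderiv ℝ (fluxDensity g ℓ ξ c 1) y (basisVec 1))) =
      -surfaceIntegral (pairingDensity g ℓ (diffForm θ) ξ) := by
  obtain ⟨T, hT, hsum⟩ := exists_finset_chartPartition S
  -- The partition of unity cuts `θ` into pieces supported in single charts. The differentials of
  -- the pieces add up to that of `θ`, so the terms from differentiating the partition cancel.
  set a : S → S → ℝ := fun p q => chartPartition S p q * θ q with ha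
  have hac : ∀ p, ContMDiff (𝓡 2) 𝓘(ℝ, ℝ) ∞ (a p) := fun p =>
    (chartPartition S p).contMDiff.mul hθ
  have hat : ∀ p, tsupport (a p) ⊆ tsupport θ := fun p => tsupport_mul_subset_right
  have has : ∀ p, tsupport (a p) ⊆ (chartAt Plane p).source := fun p =>
    tsupport_mul_subset_left.trans (chartPartition_isSubordinate S p)
  have hcd : ∀ p, IsContinuousDensity (pairingDensity g ℓ (diffForm (a p)) ξ) := fun p =>
    isContinuousDensity_pairing_diffForm (hac p) fun c hc y hy hya i =>
      (hV c hc y hy (hat p hya) i).continuousAt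
  have h1 : ∀ p ∈ T, ∫ y in (chartAt Plane p).target,
      chartPartition S p ((chartAt Plane p).symm y) * (θ ((chartAt Plane p).symm y) *
        (fderiv ℝ (fluxDensity g ℓ ξ (chartAt Plane p) 0) y (basisVec 0)
        + fderiv ℝ (fluxDensity g ℓ ξ (chartAt Plane p) 1) y (basisVec 1))) =
      -surfaceIntegral (pairingDensity g ℓ (diffForm (a p)) ξ) := by
    intro p _
    have hc := isChart_chartAt (F := Plane) p
    have hz : ∀ c' : OpenPartialHomeomorph S Plane, ∀ y, c'.symm y ∉ tsupport (a p) →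
        pairingDensity g ℓ (diffForm (a p)) ξ c' y = 0 := by
      intro c' y hy
      simp only [pairingDensity, pairing, formComp_diffForm_eq_zero hy]
      simp
    rw [(isDensity_pairingDensity hℓ _ _).surfaceIntegral_eq hc
      (fun c' _ y _ hyc => hz c' y fun h => hyc (has p h))
      (integrableOn_target_of_compact (hcd p _ hc) (isClosed_tsupport (a p)).isCompact (has p)
        fun y _ hy => hz _ y hy)]
    refine Eq.trans ?_ (chart_divergence hc (hac p) (isClosed_tsupport (a p)).isCompact (has p)
      (V := fluxDensity g ℓ ξ (chartAt Plane p)) fun y hy hya i => hV _ hc y hy (hat p hya) i)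
    simp only [ha, mul_assoc]
  rw [surfaceIntegral_eq_sum hT, Finset.sum_congr rfl h1, Finset.sum_neg_distrib,
    ← surfaceIntegral_sum T fun p _ => hcd p]
  congr 1
  rw [surfaceIntegral_eq_sum hT, surfaceIntegral_eq_sum hT]
  refine Finset.sum_congr rfl fun p _ => ?_
  have hc := isChart_chartAt (F := Plane) p
  refine setIntegral_congr_fun (chartAt Plane p).open_target.measurableSet fun y hy => ?_
  have h2 : ∀ k, ∑ p' ∈ T, formComp (diffForm (a p')) (chartAt Plane p) y k =
      formComp (diffForm θ) (chartAt Plane p) y k := by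
    intro k
    rw [formComp_diffForm hc hy (hθ.contMDiffAt.mdifferentiableAt (by simp))]
    have h3 : (fun z => ∑ p' ∈ T, (a p' ∘ (chartAt Plane p).symm) z) =
        θ ∘ (chartAt Plane p).symm := by
      funext z
      simp only [ha, Function.comp_apply]
      rw [← Finset.sum_mul, hsum, one_mul]
    rw [← h3, fderiv_fun_sum fun p' _ =>
      (contDiffAt_comp_symm (hac p') hc hy).differentiableAt (by simp), sum_apply]
    refine Finset.sum_congr rfl fun p' _ => ?_
    rw [formComp_diffForm hc hy ((hac p').contMDiffAt.mdifferentiableAt (by simp))]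
  simp only [pairingDensity, pairing, ← h2, Finset.sum_mul, Finset.sum_add_distrib]

end SurfaceDivergence

/-! ## The first variation of area -/

theorem contDiffAt_flux {V : Type*} [NormedAddCommGroup V] [NormedSpace ℝ V] {n : ℕ∞ω}
    {h : V → Fin 2 → Fin 2 → ℝ} {x : V → Fin 2 → ℝ} {y : V}
    (hh : ∀ i j, ContDiffAt ℝ n (fun z => h z i j) y) (hx : ∀ j, ContDiffAt ℝ n (fun z => x z j) y)
    (hdet : h y 0 0 * h y 1 1 - h y 0 1 ^ 2 ≠ 0) (hs : 0 ≤ h y 0 0 * h y 1 1 - h y 0 1 ^ 2)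
    (i : Fin 2) : ContDiffAt ℝ n (fun z => flux (h z) (x z) i) y := by
  have hd : ContDiffAt ℝ n (fun z => √(h z 0 0 * h z 1 1 - h z 0 1 ^ 2)) y :=
    (((hh 0 0).mul (hh 1 1)).sub ((hh 0 1).pow 2)).sqrt hdet
  have hd0 : √(h y 0 0 * h y 1 1 - h y 0 1 ^ 2) ≠ 0 :=
    (Real.sqrt_pos.2 (lt_of_le_of_ne hs hdet.symm)).ne'
  fin_cases i
  · exact (((hh 1 1).mul (hx 0)).sub ((hh 0 1).mul (hx 1))).div hd hd0
  · exact (((hh 0 0).mul (hx 1)).sub ((hh 0 1).mul (hx 0))).div hd hd0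

section Flux

theorem contDiffAt_inducedMetric (hℓ : ContMDiff (𝓡 2) 𝓘(ℝ, E) ∞ ℓ) (hc : IsChart c)
    (hy : y ∈ c.target) (i j : Fin 2) : ContDiffAt ℝ ∞ (fun z => inducedMetric g ℓ c z i j) y := by
  have he := isChart_chartAt (F := E) (ℓ (c.symm y))
  set e := chartAt E (ℓ (c.symm y))
  have hye : ℓ (c.symm y) ∈ e.source := mem_chart_source E _
  have hu := contDiffAt_chartRep hc he hy hℓ.contMDiffAt hye
  have hdu : ContDiffAt ℝ ∞ (fderiv ℝ (chartRep ℓ c e)) y := hu.fderiv_right (by simp)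
  have hg : ContDiffAt ℝ ∞ (fun z => inChart g.inner e (chartRep ℓ c e z)
      (fderiv ℝ (chartRep ℓ c e) z (basisVec i)) (fderiv ℝ (chartRep ℓ c e) z (basisVec j))) y :=
    ((((isMetricOn_inChart g he).contDiffAt (e.map_source hye)).comp y hu).clm_apply
      (hdu.clm_apply contDiffAt_const)).clm_apply (hdu.clm_apply contDiffAt_const)
  refine hg.congr_of_eventuallyEq ?_
  have h1 : ∀ᶠ z in 𝓝 y, ℓ (c.symm z) ∈ e.source :=
    (ContinuousAt.comp (g := ℓ) hℓ.continuous.continuousAt (c.continuousAt_symm hy)).eventually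
      (e.open_source.mem_nhds hye)
  filter_upwards [c.open_target.mem_nhds hy, h1] with z hz hz'
  rw [inducedMetric_eq_gram hc he hz hℓ.contMDiffAt hz']
  rfl

theorem inducedMetric_det_pos (hℓ : ContMDiff (𝓡 2) 𝓘(ℝ, E) ∞ ℓ) (hc : IsChart c)
    (hy : y ∈ c.target) : IsImmersedAt (E := E) ℓ (c.symm y) ↔
      0 < inducedMetric g ℓ c y 0 0 * inducedMetric g ℓ c y 1 1 - inducedMetric g ℓ c y 0 1 ^ 2 := by
  have he := isChart_chartAt (F := E) (ℓ (c.symm y))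
  have hye := mem_chart_source E (ℓ (c.symm y))
  rw [isImmersedAt_iff_gramDet_pos hc he hy hℓ.contMDiffAt hye g,
    inducedMetric_eq_gram hc he hy hℓ.contMDiffAt hye, gramDet]

theorem contDiffAt_fluxDensity (hℓ : ContMDiff (𝓡 2) 𝓘(ℝ, E) ∞ ℓ) (hc : IsChart c)
    (hy : y ∈ c.target) (himm : IsImmersedAt (E := E) ℓ (c.symm y)) {ξ : OneForm S}
    (hξ : ∀ k, ContDiffAt ℝ ∞ (fun z => formComp ξ c z k) y) (i : Fin 2) :
    ContDiffAt ℝ ∞ (fluxDensity g ℓ ξ c i) y := by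
  have h := (inducedMetric_det_pos (g := g) hℓ hc hy).1 himm
  exact contDiffAt_flux (fun i j => contDiffAt_inducedMetric hℓ hc hy i j) hξ h.ne' h.le i

end Flux

/-! ### The area along a variation -/

section Variation

variable {L : ℝ → S → N} {ε : ℝ}

/-- The square of the area density of a variation. -/
def areaSq (g : Metric (E := E) N) (L : ℝ → S → N) (c : OpenPartialHomeomorph S Plane)
    (q : ℝ × Plane) : ℝ :=
  inducedMetric g (L q.1) c q.2 0 0 * inducedMetric g (L q.1) c q.2 1 1
    - inducedMetric g (L q.1) c q.2 0 1 ^ 2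

/-- The velocity of a variation at time zero. -/
def velocity (L : ℝ → S → N) (q : S) : TangentSpace 𝓘(ℝ, E) (L 0 q) :=
  mfderiv 𝓘(ℝ, ℝ) 𝓘(ℝ, E) (fun t => L t q) 0 (1 : ℝ)

/-- The one-form `g(X, dℓ ·)` of a variation with velocity `X`. -/
def velocityForm (g : Metric (E := E) N) (L : ℝ → S → N) : OneForm S := fun q =>
  (g.inner (L 0 q) (velocity (E := E) L q)).comp (mfderiv (𝓡 2) 𝓘(ℝ, E) (L 0) q)

variable (hL : ContMDiffOn (𝓘(ℝ, ℝ).prod (𝓡 2)) 𝓘(ℝ, E) ∞ (fun q : ℝ × S => L q.1 q.2)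
      (Ioo (-ε) ε ×ˢ univ))
include hL

omit [FiniteDimensional ℝ E] [IsManifold 𝓘(ℂ, E) ω N] [IsManifold (𝓡 2) ∞ S] in
theorem variation_contMDiffAt {t : ℝ} (ht : t ∈ Ioo (-ε) ε) (q : S) :
    ContMDiffAt (𝓘(ℝ, ℝ).prod (𝓡 2)) 𝓘(ℝ, E) ∞ (fun q : ℝ × S => L q.1 q.2) (t, q) :=
  hL.contMDiffAt ((isOpen_Ioo.prod isOpen_univ).mem_nhds ⟨ht, mem_univ q⟩)

omit [FiniteDimensional ℝ E] [IsManifold 𝓘(ℂ, E) ω N] [IsManifold (𝓡 2) ∞ S] in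
theorem variation_contMDiff {t : ℝ} (ht : t ∈ Ioo (-ε) ε) : ContMDiff (𝓡 2) 𝓘(ℝ, E) ∞ (L t) :=
  fun q => ContMDiffAt.comp (g := fun q : ℝ × S => L q.1 q.2) (f := fun q => (t, q)) q
    (variation_contMDiffAt hL ht q) (contMDiffAt_const.prodMk contMDiffAt_id)

omit [FiniteDimensional ℝ E] [IsManifold 𝓘(ℂ, E) ω N] [IsManifold (𝓡 2) ∞ S] in
theorem variation_time_contMDiffAt {t : ℝ} (ht : t ∈ Ioo (-ε) ε) (q : S) :
    ContMDiffAt 𝓘(ℝ, ℝ) 𝓘(ℝ, E) ∞ (fun t => L t q) t :=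
  ContMDiffAt.comp (g := fun q : ℝ × S => L q.1 q.2) (f := fun t => (t, q)) t
    (variation_contMDiffAt hL ht q) (contMDiffAt_id.prodMk contMDiffAt_const)

theorem variation_chart_contDiffAt (hc : IsChart c) (he : IsChart e) {t : ℝ} (ht : t ∈ Ioo (-ε) ε)
    (hy : y ∈ c.target) (hye : L t (c.symm y) ∈ e.source) :
    ContDiffAt ℝ ∞ (fun q : ℝ × Plane => chartRep (L q.1) c e q.2) (t, y) := by
  have h1 : ContMDiffAt 𝓘(ℝ, ℝ × Plane) (𝓘(ℝ, ℝ).prod (𝓡 2)) ∞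
      (fun q : ℝ × Plane => (q.1, c.symm q.2)) (t, y) :=
    contDiff_fst.contMDiff.contMDiffAt.prodMk
      (ContMDiffAt.comp (t, y) (g := c.symm) (f := Prod.snd) (chart_symm_contMDiffAt hc hy)
        contDiff_snd.contMDiff.contMDiffAt)
  have h2 : ContMDiffAt 𝓘(ℝ, ℝ × Plane) 𝓘(ℝ, E) ∞
      (fun q : ℝ × Plane => L q.1 (c.symm q.2)) (t, y) :=
    ContMDiffAt.comp (g := fun q : ℝ × S => L q.1 q.2) (t, y)
      (variation_contMDiffAt hL ht (c.symm y)) h1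
  exact contDiffAt_chart_comp he h2 hye

theorem eventually_variation_chart (hc : IsChart c) {t : ℝ}
    (ht : t ∈ Ioo (-ε) ε) (hy : y ∈ c.target) (hye : L t (c.symm y) ∈ e.source) :
    ∀ᶠ q in 𝓝 (t, y), q.1 ∈ Ioo (-ε) ε ∧ q.2 ∈ c.target ∧ L q.1 (c.symm q.2) ∈ e.source := by
  have h1 : ContinuousAt (fun q : ℝ × Plane => L q.1 (c.symm q.2)) (t, y) :=
    ContinuousAt.comp (g := fun q : ℝ × S => L q.1 q.2)
      (f := fun q : ℝ × Plane => (q.1, c.symm q.2)) (x := (t, y))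
      (variation_contMDiffAt hL ht (c.symm y)).continuousAt
      (continuousAt_fst.prodMk
        (ContinuousAt.comp (g := c.symm) (f := Prod.snd) (x := (t, y)) (c.continuousAt_symm hy)
          continuousAt_snd))
  filter_upwards [continuousAt_fst.eventually (isOpen_Ioo.mem_nhds ht),
    continuousAt_snd.eventually (c.open_target.mem_nhds hy),
    h1.eventually (e.open_source.mem_nhds hye)] with q h1 h2 h3 using ⟨h1, h2, h3⟩

theorem areaSq_eventuallyEq (hc : IsChart c) (he : IsChart e) {t : ℝ} (ht : t ∈ Ioo (-ε) ε)
    (hy : y ∈ c.target) (hye : L t (c.symm y) ∈ e.source) : ∀ᶠ q in 𝓝 (t, y), areaSq g L c q =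
      gramDet (inChart g.inner e) (fun z => chartRep (L q.1) c e z) q.2 := by
  filter_upwards [eventually_variation_chart hL hc ht hy hye] with q hq
  rw [areaSq, inducedMetric_eq_gram hc he hq.2.1 (variation_contMDiff hL hq.1).contMDiffAt hq.2.2]
  rfl

theorem areaSq_nonneg (hc : IsChart c) {t : ℝ} (ht : t ∈ Ioo (-ε) ε)
    (hy : y ∈ c.target) : 0 ≤ areaSq g L c (t, y) := by
  have he := isChart_chartAt (F := E) (L t (c.symm y))
  rw [(areaSq_eventuallyEq hL hc he ht hy (mem_chart_source E _)).self_of_nhds]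
  exact gramDet_nonneg (isMetricOn_inChart g he) ((chartAt E _).map_source (mem_chart_source E _))

theorem areaSq_contDiffOn (hc : IsChart c) :
    ContDiffOn ℝ ∞ (areaSq g L c) (Ioo (-ε) ε ×ˢ c.target) := by
  rintro ⟨t, y⟩ ⟨ht, hy⟩
  have he := isChart_chartAt (F := E) (L t (c.symm y))
  set e := chartAt E (L t (c.symm y))
  have hye : L t (c.symm y) ∈ e.source := mem_chart_source E _
  have hG := isMetricOn_inChart g he
  have hu := variation_chart_contDiffAt hL hc he ht hy hye
  set u : ℝ × Plane → E := fun q => chartRep (L q.1) c e q.2 with hud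
  have hdu : ContDiffAt ℝ ∞ (fderiv ℝ u) (t, y) := hu.fderiv_right (by simp)
  have hg : ∀ i j, ContDiffAt ℝ ∞ (fun q => inChart g.inner e (u q) (fderiv ℝ u q (0, basisVec i))
      (fderiv ℝ u q (0, basisVec j))) (t, y) := fun i j =>
    (((hG.contDiffAt (e.map_source hye)).comp (t, y) hu).clm_apply
      (hdu.clm_apply contDiffAt_const)).clm_apply (hdu.clm_apply contDiffAt_const)
  refine ContDiffAt.contDiffWithinAt ?_
  refine (((hg 0 0).mul (hg 1 1)).sub ((hg 0 1).pow 2)).congr_of_eventuallyEq ?_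
  filter_upwards [areaSq_eventuallyEq (g := g) hL hc he ht hy hye,
    eventually_variation_chart hL hc ht hy hye] with q hq hq'
  have hp : ∀ i, partialVec (fun z => chartRep (L q.1) c e z) q.2 i =
      fderiv ℝ u q (0, basisVec i) := by
    intro i
    have h1 : DifferentiableAt ℝ u q :=
      (variation_chart_contDiffAt hL hc he hq'.1 hq'.2.1 hq'.2.2).differentiableAt (by simp)
    have h2 : HasFDerivAt (fun z => u (q.1, z))
        ((fderiv ℝ u q).comp (ContinuousLinearMap.inr ℝ ℝ Plane)) q.2 :=
      HasFDerivAt.comp q.2 (g := u) (f := fun z => (q.1, z)) h1.hasFDerivAt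
        (hasFDerivAt_prodMk_right _ _)
    have h3 : HasFDerivAt (fun z => chartRep (L q.1) c e z) _ q.2 := h2
    rw [partialVec, h3.fderiv]
    rfl
  rw [hq]
  simp only [gramDet, gram, hp]
  rfl

theorem velocity_chart (hc : IsChart c) (he : IsChart e) (hε : 0 < ε)
    (hy : y ∈ c.target) (hye : L 0 (c.symm y) ∈ e.source) :
    velocity (E := E) L (c.symm y) = mfderiv 𝓘(ℝ, E) 𝓘(ℝ, E) e.symm (chartRep (L 0) c e y)
      (fderiv ℝ (fun q : ℝ × Plane => chartRep (L q.1) c e q.2) (0, y) ((1 : ℝ), (0 : Plane))) := by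
  have h0 : (0 : ℝ) ∈ Ioo (-ε) ε := ⟨by linarith, hε⟩
  have h1 := mfderiv_eq_symm_fderiv he
    ((variation_time_contMDiffAt hL h0 (c.symm y)).mdifferentiableAt (by simp)) hye (1 : ℝ)
  have h2 : HasFDerivAt (fun t => chartRep (L t) c e y)
      ((fderiv ℝ (fun q : ℝ × Plane => chartRep (L q.1) c e q.2) (0, y)).comp
        (ContinuousLinearMap.inl ℝ ℝ Plane)) (0 : ℝ) :=
    HasFDerivAt.comp (0 : ℝ) (g := fun q : ℝ × Plane => chartRep (L q.1) c e q.2)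
      (f := fun t => (t, y))
      ((variation_chart_contDiffAt hL hc he h0 hy hye).differentiableAt (by simp)).hasFDerivAt
      (hasFDerivAt_prodMk_left _ _)
  have h3 : fderiv ℝ (e ∘ fun t => L t (c.symm y)) 0 (1 : ℝ) =
      fderiv ℝ (fun q : ℝ × Plane => chartRep (L q.1) c e q.2) (0, y) ((1 : ℝ), (0 : Plane)) := by
    have h4 : HasFDerivAt (e ∘ fun t => L t (c.symm y)) _ (0 : ℝ) := h2
    rw [h4.fderiv]
    rfl
  rw [h3] at h1
  exact h1

theorem formComp_velocityForm (hc : IsChart c) (he : IsChart e) (hε : 0 < ε)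
    (hy : y ∈ c.target) (hye : L 0 (c.symm y) ∈ e.source) (k : Fin 2) :
    formComp (velocityForm g L) c y k = inChart g.inner e (chartRep (L 0) c e y)
      (fderiv ℝ (fun q : ℝ × Plane => chartRep (L q.1) c e q.2) (0, y) ((1 : ℝ), (0 : Plane)))
      (partialVec (chartRep (L 0) c e) y k) := by
  have h0 : (0 : ℝ) ∈ Ioo (-ε) ε := ⟨by linarith, hε⟩
  have hℓ := (variation_contMDiff hL h0).contMDiffAt (x := c.symm y)
  rw [partialVec, ← metric_mfderiv hc he hy hℓ hye, ← velocity_chart hL hc he hε hy hye,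
    mfderiv_comp_chart_symm hc hy hℓ]
  rfl

/-- The pointwise first variation formula. -/
theorem fderiv_areaSq (hc : IsChart c) (he : IsChart e) (hε : 0 < ε)
    (hy : y ∈ c.target) (hye : L 0 (c.symm y) ∈ e.source)
    (himm : IsImmersedAt (E := E) (L 0) (c.symm y)) :
    fderiv ℝ (areaSq g L c) (0, y) (1, 0) / (2 * √(areaSq g L c (0, y))) =
      fderiv ℝ (fluxDensity g (L 0) (velocityForm g L) c 0) y (basisVec 0)
      + fderiv ℝ (fluxDensity g (L 0) (velocityForm g L) c 1) y (basisVec 1)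
      - √(gramDet (inChart g.inner e) (chartRep (L 0) c e) y) *
        inChart g.inner e (chartRep (L 0) c e y)
          (meanCurv (inChart g.inner e) (chartRep (L 0) c e) y)
          (fderiv ℝ (fun q : ℝ × Plane => chartRep (L q.1) c e q.2) (0, y)
            ((1 : ℝ), (0 : Plane))) := by
  have h0 : (0 : ℝ) ∈ Ioo (-ε) ε := ⟨by linarith, hε⟩
  have hℓ := variation_contMDiff hL h0
  have hev : ∀ᶠ z in 𝓝 y, z ∈ c.target ∧ L 0 (c.symm z) ∈ e.source := by
    have h1 : Tendsto (fun z : Plane => ((0 : ℝ), z)) (𝓝 y) (𝓝 (0, y)) :=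
      (Continuous.prodMk_right (0 : ℝ)).tendsto y
    filter_upwards [h1.eventually (eventually_variation_chart hL hc h0 hy hye)] with z hz
      using hz.2
  have h := (firstVariation (G := inChart g.inner e) (isMetricOn_inChart g he)
    (u := fun q : ℝ × Plane => chartRep (L q.1) c e q.2) (y₀ := y)
    (variation_chart_contDiffAt hL hc he h0 hy hye) (e.map_source hye)
    ((isImmersedAt_iff_gramDet_pos hc he hy hℓ.contMDiffAt hye g).1 himm)
    (X := fun z => fderiv ℝ (fun q : ℝ × Plane => chartRep (L q.1) c e q.2) (0, z) (1, 0))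
    (Eventually.of_forall fun _ => rfl) (V := fluxDensity g (L 0) (velocityForm g L) c) (by
      filter_upwards [hev] with z hz i
      rw [fluxDensity, inducedMetric_eq_gram hc he hz.1 hℓ.contMDiffAt hz.2]
      congr 1
      ext k
      exact formComp_velocityForm hL hc he hε hz.1 hz.2 k) (f := areaSq g L c)
    (areaSq_eventuallyEq hL hc he h0 hy hye)).2
  rw [h, (areaSq_eventuallyEq hL hc he h0 hy hye).self_of_nhds]

/-- The derivative of the area density of a variation. -/
def areaVariation (g : Metric (E := E) N) (L : ℝ → S → N) (c : OpenPartialHomeomorph S Plane)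
    (y : Plane) : ℝ :=
  fderiv ℝ (areaSq g L c) (0, y) (1, 0) / (2 * √(areaSq g L c (0, y)))

/-- Only time `0` needs a small degeneracy set: a countable set is null in every chart, and the
square root lemma tolerates zeros of the density at other times. Where the density vanishes at time
`0`, `areaVariation` is zero by division by zero. -/
theorem hasDerivAt_area [T2Space S] [CompactSpace S] (hε : 0 < ε)
    (hB : {q : S | ¬IsImmersedAt (E := E) (L 0) q}.Countable) :
    (∀ p : S, IntegrableOn (fun y => chartPartition S p ((chartAt Plane p).symm y) *
      areaVariation g L (chartAt Plane p) y) (chartAt Plane p).target) ∧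
    HasDerivAt (fun t => area g (L t)) (surfaceIntegral (areaVariation g L)) 0 := by
  have h0 : (0 : ℝ) ∈ Ioo (-ε) ε := ⟨by linarith, hε⟩
  have key := fun p : S => by
    have hc := isChart_chartAt (F := Plane) p
    set c := chartAt Plane p
    have hKs := chartPartition_isSubordinate S p
    have hK : IsCompact (c '' tsupport (chartPartition S p)) :=
      (isClosed_tsupport _).isCompact.image_of_continuousOn (c.continuousOn.mono hKs)
    refine (hasDerivAt_integral_sqrt (μ := volume) (f := areaSq g L c) hε c.open_target hK ?_
      (areaSq_contDiffOn hL hc) (fun q hq => areaSq_nonneg hL hc hq.1 hq.2)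
      (ρ := fun y => chartPartition S p (c.symm y))
      ((chartPartition S p).contMDiff.continuous.comp_continuousOn c.continuousOn_symm) ?_ ?_).2
    · rintro _ ⟨q, hq, rfl⟩; exact c.map_source (hKs hq)
    · intro y hy hyK
      refine image_eq_zero_of_notMem_tsupport fun h => hyK ⟨_, h, c.right_inv hy⟩
    · filter_upwards [(hB.image c).ae_notMem volume] with y hyB hy h
      refine hyB ⟨c.symm y, fun himm => ?_, c.right_inv hy⟩
      exact ((inducedMetric_det_pos (g := g) (variation_contMDiff hL h0) hc hy).1 himm).ne' h
  refine ⟨fun p => (key p).1, ?_⟩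
  obtain ⟨T, hT, -⟩ := exists_finset_chartPartition S
  have h1 : (fun t => area g (L t)) = fun t => ∑ p ∈ T, ∫ y in (chartAt Plane p).target,
      chartPartition S p ((chartAt Plane p).symm y) * √(areaSq g L (chartAt Plane p) (t, y)) := by
    funext t
    exact surfaceIntegral_eq_sum hT (areaDensity g (L t))
  rw [h1, surfaceIntegral_eq_sum hT]
  exact HasDerivAt.fun_sum fun p _ => (key p).2

end Variation

open Asymptotics

/-! ## Branch points in coordinates -/

section BranchExpansion

variable {F : Type*} [NormedAddCommGroup F] [NormedSpace ℝ F]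

/-- The derivative of a smooth function on the plane which is `o(‖y‖^(n+1))` is `o(‖y‖^n)`. -/
theorem fderiv_isLittleO_pow [FiniteDimensional ℝ F] {f : Plane → F} {n : ℕ} (hf : ContDiffAt ℝ ∞ f 0)
    (h : f =o[𝓝 0] fun y => ‖y‖ ^ (n + 1)) : fderiv ℝ f =o[𝓝 0] fun y => ‖y‖ ^ n := by
  -- The general lemma wants source and target in the same universe as `Plane`, so `F` is replaced
  -- by a coordinate space.
  let A : F ≃L[ℝ] (Fin (Module.finrank ℝ F) → ℝ) :=
    ContinuousLinearEquiv.ofFinrankEq (by simp)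
  let A' : F →L[ℝ] (Fin (Module.finrank ℝ F) → ℝ) := A
  let B' : (Fin (Module.finrank ℝ F) → ℝ) →L[ℝ] F := A.symm
  have h1 : (fun y => A (f y)) =o[𝓝 0] fun y : Plane => ‖y‖ ^ (n + 1) :=
    (ContinuousLinearMap.isBigO_comp A' f
      (𝓝 0)).trans_isLittleO h
  have h2 := fderiv_isLittleO_of_contDiffAt n (f := fun y => A (f y))
    (A.contDiff.contDiffAt.comp 0 hf) h1
  have h3 : fderiv ℝ f =ᶠ[𝓝 0] fun y =>
      B'.comp (fderiv ℝ (fun y => A (f y)) y) := by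
    have h4 : ContDiffAt ℝ 1 f 0 := hf.of_le (by exact_mod_cast le_top)
    filter_upwards [h4.eventually (by simp)] with y hy
    have h5 : HasFDerivAt (fun y => A (f y)) (A'.comp (fderiv ℝ f y)) y :=
      A'.hasFDerivAt.comp y (hy.differentiableAt (by simp)).hasFDerivAt
    rw [h5.fderiv]
    ext v
    simp [A', B']
  refine h3.trans_isLittleO (IsBigO.trans_isLittleO ?_ h2)
  exact IsBigO.of_bound ‖B'‖ (Eventually.of_forall fun y =>
    ContinuousLinearMap.opNorm_comp_le _ _)

/-- The complex coordinate as a linear map. -/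
def toComplexL : Plane →L[ℝ] ℂ :=
  LinearMap.toContinuousLinearMap
    { toFun := toComplex
      map_add' := fun v w => by simp [toComplex, Complex.ext_iff]
      map_smul' := fun r v => by simp [toComplex, Complex.ext_iff] }

theorem toComplexL_apply (v : Plane) : toComplexL v = toComplex v := rfl

theorem norm_toComplex (v : Plane) : ‖toComplex v‖ = ‖v‖ := by
  rw [EuclideanSpace.norm_eq, Fin.sum_univ_two, Complex.norm_eq_sqrt_sq_add_sq]
  simp [toComplex]

theorem toComplex_basisVec : toComplex (basisVec 0) = 1 ∧ toComplex (basisVec 1) = Complex.I := by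
  constructor <;> simp [toComplex, basisVec_apply, Complex.ext_iff]

/-- The real linear map `x + i y ↦ x a + y b`. -/
def realSpan (a b : F) : ℂ →L[ℝ] F := Complex.reCLM.smulRight a + Complex.imCLM.smulRight b

theorem realSpan_apply (a b : F) (z : ℂ) : realSpan a b z = z.re • a + z.im • b := rfl

/-- The derivative of `z ↦ Re(z^m) a + Im(z^m) b` as a function of `z^(m-1)`. -/
def powDerivL (m : ℕ) (a b : F) : ℂ →L[ℝ] Plane →L[ℝ] F :=
  LinearMap.toContinuousLinearMap
    { toFun := fun w => (realSpan a b).comp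
        (((m * w) • (ContinuousLinearMap.id ℝ ℂ) : ℂ →L[ℝ] ℂ).comp toComplexL)
      map_add' := fun w w' => by ext v; simp [mul_add, add_mul]
      map_smul' := fun r w => by
        ext v
        change realSpan a b (m * (r • w) * toComplex v) = r • realSpan a b (m * w * toComplex v)
        rw [← map_smul]
        congr 1
        rw [Complex.real_smul, Complex.real_smul]
        ring }

theorem powDerivL_apply (m : ℕ) (a b : F) (w : ℂ) (v : Plane) :
    powDerivL m a b w v = realSpan a b (m * w * toComplex v) := rfl

theorem hasFDerivAt_pow_comp (m : ℕ) (y₀ y : Plane) :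
    HasFDerivAt (fun y : Plane => toComplex (y - y₀) ^ m)
      (((m * toComplex (y - y₀) ^ (m - 1)) • ContinuousLinearMap.id ℝ ℂ : ℂ →L[ℝ] ℂ).comp
        toComplexL) y := by
  have h1 : HasFDerivAt (fun y : Plane => toComplex (y - y₀)) toComplexL y :=
    toComplexL.hasFDerivAt.comp y ((hasFDerivAt_id y).sub_const y₀)
  exact ((hasDerivAt_pow m (toComplex (y - y₀))).complexToReal_fderiv).comp y h1

theorem hasFDerivAt_realSpan_pow (m : ℕ) (a b : F) (y₀ y : Plane) :
    HasFDerivAt (fun y : Plane => realSpan a b (toComplex (y - y₀) ^ m))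
      (powDerivL m a b (toComplex (y - y₀) ^ (m - 1))) y :=
  (realSpan a b).hasFDerivAt.comp y (hasFDerivAt_pow_comp m y₀ y)

/-- The derivative of a map at a branch point. -/
theorem branch_expansion [FiniteDimensional ℝ F] {u : Plane → F} {y₀ : Plane} {m : ℕ} {a b : F} (hm : 2 ≤ m)
    (hu : ContDiffAt ℝ ∞ u y₀)
    (h : (fun y => u y - u y₀ - realSpan a b (toComplex (y - y₀) ^ m)) =o[𝓝 y₀]
      fun y => ‖y - y₀‖ ^ m) :
    (fun y => fderiv ℝ u y - powDerivL m a b (toComplex (y - y₀) ^ (m - 1))) =o[𝓝 y₀]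
      fun y => ‖y - y₀‖ ^ (m - 1) := by
  obtain ⟨n, rfl⟩ : ∃ n, m = n + 2 := ⟨m - 2, by omega⟩
  simp only [show n + 2 - 1 = n + 1 by omega] at *
  have htr : Tendsto (fun x : Plane => y₀ + x) (𝓝 0) (𝓝 y₀) := by
    have : Continuous fun x : Plane => y₀ + x := by fun_prop
    simpa using this.tendsto 0
  have htr' : Tendsto (fun y : Plane => y - y₀) (𝓝 y₀) (𝓝 0) := by
    have : Continuous fun y : Plane => y - y₀ := by fun_prop
    simpa using this.tendsto y₀
  set v : Plane → F := fun y => u y - u y₀ - realSpan a b (toComplex (y - y₀) ^ (n + 2)) with hv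
  have hPs : ContDiff ℝ ∞ fun y : Plane => realSpan a b (toComplex (y - y₀) ^ (n + 2)) := by
    have h1 : ContDiff ℝ ∞ fun y : Plane => toComplexL (y - y₀) :=
      toComplexL.contDiff.comp (contDiff_id.sub contDiff_const)
    exact (realSpan a b).contDiff.comp (h1.pow (n + 2))
  have hvs : ContDiffAt ℝ ∞ v y₀ := (hu.sub contDiffAt_const).sub hPs.contDiffAt
  have hvs0 : ContDiffAt ℝ ∞ (fun x => v (y₀ + x)) 0 := by
    refine ContDiffAt.comp (0 : Plane) (f := fun x : Plane => y₀ + x) (by simpa using hvs) ?_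
    exact contDiffAt_const.add contDiffAt_id
  have h0 : (fun x => v (y₀ + x)) =o[𝓝 0] fun x => ‖x‖ ^ (n + 1 + 1) := by
    refine (h.comp_tendsto htr).congr_right fun x => ?_
    simp
  -- An asymptotic expansion may not be differentiated in general. Here the remainder is smooth, and
  -- its derivative loses exactly one power.
  have h1 := fderiv_isLittleO_pow hvs0 h0
  have hd : ContDiffAt ℝ 2 u y₀ := hu.of_le two_le_infty
  have hev1 : ∀ᶠ y in 𝓝 y₀, fderiv ℝ v y =
      fderiv ℝ u y - powDerivL (n + 2) a b (toComplex (y - y₀) ^ (n + 1)) := by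
    filter_upwards [hd.eventually (by simp)] with y hy
    exact (((hy.differentiableAt (by simp)).hasFDerivAt.sub_const (u y₀)).sub
      (hasFDerivAt_realSpan_pow (n + 2) a b y₀ y)).fderiv
  have hback1 : (fderiv ℝ v) =o[𝓝 y₀] fun y => ‖y - y₀‖ ^ (n + 1) := by
    refine (h1.comp_tendsto htr').congr_left fun y => ?_
    simp only [Function.comp_apply]
    rw [fderiv_comp_add_left, add_sub_cancel]
  exact hback1.congr' hev1 EventuallyEq.rfl

/-- At a branch point the rotated and rescaled coordinate vectors converge. -/
theorem branch_frame {u : Plane → F} {y₀ : Plane} {m : ℕ} {a b : F} (hm : 2 ≤ m)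
    (h : (fun y => fderiv ℝ u y - powDerivL m a b (toComplex (y - y₀) ^ (m - 1))) =o[𝓝 y₀]
      fun y => ‖y - y₀‖ ^ (m - 1)) : ∃ (p q : Plane → ℝ) (A₀ A₁ : Plane → F),
      (∀ y, p y ^ 2 + q y ^ 2 = (m * ‖y - y₀‖ ^ (m - 1)) ^ 2) ∧
      Tendsto A₀ (𝓝[≠] y₀) (𝓝 a) ∧ Tendsto A₁ (𝓝[≠] y₀) (𝓝 b) ∧
      ∀ y ≠ y₀, partialVec u y 0 = p y • A₀ y + q y • A₁ y ∧
        partialVec u y 1 = -q y • A₀ y + p y • A₁ y := by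
  -- With `m z^(m-1) = p + i q`, the leading parts of `∂_0 u` and `∂_1 u` are `p a + q b` and `-q a
  -- + p b`: a rotation and dilation of `(a, b)` by the factor `s = m |z|^(m-1)`.
  set w : Plane → ℂ := fun y => m * toComplex (y - y₀) ^ (m - 1) with hw
  set p : Plane → ℝ := fun y => (w y).re with hp
  set q : Plane → ℝ := fun y => (w y).im with hq
  set s : Plane → ℝ := fun y => m * ‖y - y₀‖ ^ (m - 1) with hs
  have hsq : ∀ y, p y ^ 2 + q y ^ 2 = s y ^ 2 := by
    intro y
    have h1 : ‖w y‖ = s y := by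
      simp only [hw, hs, norm_mul, Complex.norm_natCast, norm_pow, norm_toComplex]
    rw [← h1, Complex.norm_eq_sqrt_sq_add_sq, Real.sq_sqrt (by positivity)]
  have hm0 : (m : ℝ) ≠ 0 := by positivity
  have hs0 : ∀ y ≠ y₀, 0 < s y := fun y hy => by
    have : 0 < ‖y - y₀‖ := norm_pos_iff.2 (sub_ne_zero.2 hy)
    positivity
  have hple : ∀ y, |p y| ≤ s y := fun y => by
    rw [← abs_of_nonneg (show 0 ≤ s y by positivity)]
    exact sq_le_sq.1 (by nlinarith [hsq y, sq_nonneg (q y)])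
  have hqle : ∀ y, |q y| ≤ s y := fun y => by
    rw [← abs_of_nonneg (show 0 ≤ s y by positivity)]
    exact sq_le_sq.1 (by nlinarith [hsq y, sq_nonneg (p y)])
  set r : Fin 2 → Plane → F := fun i y =>
    (fderiv ℝ u y - powDerivL m a b (toComplex (y - y₀) ^ (m - 1))) (basisVec i) with hr
  have hr0 : ∀ i, Tendsto (fun y => ‖r i y‖ / s y) (𝓝[≠] y₀) (𝓝 0) := by
    intro i
    have h1 : r i =o[𝓝 y₀] s := by
      have h2 : r i =O[𝓝 y₀] fun y =>
          fderiv ℝ u y - powDerivL m a b (toComplex (y - y₀) ^ (m - 1)) :=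
        IsBigO.of_bound ‖basisVec i‖ (Eventually.of_forall fun y => by
          rw [mul_comm]; exact ContinuousLinearMap.le_opNorm _ _)
      refine (h2.trans_isLittleO h).trans_isBigO (IsBigO.of_bound 1 (Eventually.of_forall ?_))
      intro y
      simp only [hs, norm_mul, norm_pow, norm_norm, one_mul, RCLike.norm_natCast]
      exact le_mul_of_one_le_left (by positivity) (by exact_mod_cast (by omega : 1 ≤ m))
    exact (h1.norm_left.tendsto_div_nhds_zero).mono_left nhdsWithin_le_nhds
  have he0 : ∀ y, partialVec u y 0 = p y • a + q y • b + r 0 y := by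
    intro y
    simp only [hr, sub_apply, powDerivL_apply, realSpan_apply, toComplex_basisVec.1, mul_one]
    rw [partialVec]
    simp only [hp, hq, hw]
    abel
  have he1 : ∀ y, partialVec u y 1 = -q y • a + p y • b + r 1 y := by
    intro y
    simp only [hr, sub_apply, powDerivL_apply, realSpan_apply, toComplex_basisVec.2]
    rw [partialVec]
    have e1 : (m * toComplex (y - y₀) ^ (m - 1) * Complex.I).re = -q y := by
      rw [Complex.mul_I_re]
    have e2 : (m * toComplex (y - y₀) ^ (m - 1) * Complex.I).im = p y := by
      rw [Complex.mul_I_im]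
    rw [e1, e2]
    abel
  have hlim : ∀ (f g : Plane → ℝ), (∀ y, |f y| ≤ s y) → (∀ y, |g y| ≤ s y) →
      Tendsto (fun y => (s y ^ 2)⁻¹ • (f y • r 0 y + g y • r 1 y)) (𝓝[≠] y₀) (𝓝 0) := by
    intro f g hf hg
    refine squeeze_zero_norm' (a := fun y => ‖r 0 y‖ / s y + ‖r 1 y‖ / s y) ?_
      (by simpa using (hr0 0).add (hr0 1))
    filter_upwards [self_mem_nhdsWithin] with y hy
    have hsy := hs0 y hy
    rw [norm_smul, norm_inv, norm_pow, Real.norm_of_nonneg hsy.le, ← add_div, inv_mul_eq_div,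
      div_le_div_iff₀ (by positivity) hsy]
    have h1 : ‖f y • r 0 y + g y • r 1 y‖ ≤ s y * (‖r 0 y‖ + ‖r 1 y‖) := by
      refine (norm_add_le _ _).trans ?_
      rw [norm_smul, norm_smul, mul_add, Real.norm_eq_abs, Real.norm_eq_abs]
      exact add_le_add (mul_le_mul_of_nonneg_right (hf y) (norm_nonneg _))
        (mul_le_mul_of_nonneg_right (hg y) (norm_nonneg _))
    nlinarith
  -- The frame `(A₀, A₁)` undoes the rotation and dilation, whose inverse is its transpose divided
  -- by `s²`. It differs from `(a, b)` by errors divided by `s`, and these tend to zero.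
  refine ⟨p, q, fun y => (s y ^ 2)⁻¹ • (p y • partialVec u y 0 + -q y • partialVec u y 1),
    fun y => (s y ^ 2)⁻¹ • (q y • partialVec u y 0 + p y • partialVec u y 1), hsq, ?_, ?_, ?_⟩
  · have h1 := (hlim p (fun y => -q y) hple (fun y => by rw [abs_neg]; exact hqle y)).const_add a
    rw [add_zero] at h1
    refine h1.congr' ?_
    filter_upwards [self_mem_nhdsWithin] with y hy
    have hsy := (hs0 y hy).ne'
    rw [he0, he1]
    have e1 : a = (s y ^ 2)⁻¹ • ((p y ^ 2 + q y ^ 2) • a) := by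
      rw [hsq, smul_smul, inv_mul_cancel₀ (pow_ne_zero 2 hsy), one_smul]
    nth_rw 1 [e1]
    module
  · have h1 := (hlim q p hqle hple).const_add b
    rw [add_zero] at h1
    refine h1.congr' ?_
    filter_upwards [self_mem_nhdsWithin] with y hy
    have hsy := (hs0 y hy).ne'
    rw [he0, he1]
    have e1 : b = (s y ^ 2)⁻¹ • ((p y ^ 2 + q y ^ 2) • b) := by
      rw [hsq, smul_smul, inv_mul_cancel₀ (pow_ne_zero 2 hsy), one_smul]
    nth_rw 1 [e1]
    module
  · intro y hy
    have hsy := (hs0 y hy).ne'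
    have e1 : ∀ x : F, x = (s y ^ 2)⁻¹ • ((p y ^ 2 + q y ^ 2) • x) := fun x => by
      rw [hsq, smul_smul, inv_mul_cancel₀ (pow_ne_zero 2 hsy), one_smul]
    constructor
    · nth_rw 1 [e1 (partialVec u y 0)]
      module
    · nth_rw 1 [e1 (partialVec u y 1)]
      module

end BranchExpansion

/-! ## Primitives of the mean curvature form -/

section Primitive

variable {G : E → E →L[ℝ] E →L[ℝ] ℝ} {U : Set E} {u : Plane → E} {y₀ : Plane}

theorem contDiffAt_partialVec (hu : ContDiffAt ℝ ∞ u y₀) (i : Fin 2) :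
    ContDiffAt ℝ ∞ (fun y => partialVec u y i) y₀ :=
  (hu.fderiv_right (m := ∞) (by simp)).clm_apply contDiffAt_const

theorem contDiffAt_detC_partialVec (b : Module.Basis (Fin 2) ℂ E) (hu : ContDiffAt ℝ ∞ u y₀) :
    ContDiffAt ℝ ∞ (fun y => detC b (partialVec u y 0) (partialVec u y 1)) y₀ := by
  have h : ∀ l i : Fin 2, ContDiffAt ℝ ∞ (fun y => b.coord l (partialVec u y i)) y₀ := fun l i =>
    (LinearMap.toContinuousLinearMap ((b.coord l).restrictScalars ℝ)).contDiff.contDiffAt.comp y₀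
      (contDiffAt_partialVec hu i)
  exact ((h 0 0).mul (h 1 1)).sub ((h 1 0).mul (h 0 1))

/-- The pull back of `tauForm` by a lagrangian map is closed, hence locally exact. -/
theorem exists_primitive_tauForm (hG : IsKahlerOn G U) {c : ℝ}
    (hc : ∀ y ∈ U, ∀ v w, ricci G y v w = c * G y v w) (b : Module.Basis (Fin 2) ℂ E)
    (hu : ∀ᶠ y in 𝓝 y₀, ContDiffAt ℝ ∞ u y) (hy : ∀ᶠ y in 𝓝 y₀, u y ∈ U)
    (hlag : ∀ᶠ y in 𝓝 y₀, ∀ i j, G (u y) (Complex.I • partialVec u y i) (partialVec u y j) = 0) :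
    ∃ α : Plane → ℝ, ∀ᶠ y in 𝓝 y₀, ContDiffAt ℝ ∞ α y ∧
      ∀ v, fderiv ℝ α y v = tauForm b G (u y) (fderiv ℝ u y v) := by
  obtain ⟨r, hr, hball⟩ := Metric.eventually_nhds_iff_ball.1 ((hu.and hy).and hlag)
  set θ : Plane → Plane →L[ℝ] ℝ := fun y => (tauForm b G (u y)).comp (fderiv ℝ u y) with hθ
  have hθs : ∀ y ∈ Metric.ball y₀ r, ContDiffAt ℝ ∞ θ y := by
    intro y hy
    obtain ⟨⟨h1, h2⟩, -⟩ := hball y hy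
    exact ((hG.contDiffAt_tauForm b h2).comp y h1).clm_comp (h1.fderiv_right (m := ∞) (by simp))
  -- Closedness of the pulled back form: the second derivative of `u` is symmetric, and the exterior
  -- derivative of `tauForm` is a multiple of `ω`, which vanishes on the image of the differential.
  have hsymm : ∀ y ∈ Metric.ball y₀ r, ∀ v w, fderiv ℝ θ y v w = fderiv ℝ θ y w v := by
    intro y hy v w
    obtain ⟨⟨h1, h2⟩, h3⟩ := hball y hy
    have hdu : HasFDerivAt u (fderiv ℝ u y) y := (h1.differentiableAt (by simp)).hasFDerivAt
    have hdu2 : HasFDerivAt (fderiv ℝ u) (fderiv ℝ (fderiv ℝ u) y) y :=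
      ((h1.fderiv_right (m := ∞) (by simp)).differentiableAt (by simp)).hasFDerivAt
    have hdt : HasFDerivAt (fun y => tauForm b G (u y))
        ((fderiv ℝ (tauForm b G) (u y)).comp (fderiv ℝ u y)) y :=
      ((hG.contDiffAt_tauForm b h2).differentiableAt (by simp)).hasFDerivAt.comp y hdu
    have hd : ∀ v w, fderiv ℝ θ y v w = fderiv ℝ (tauForm b G) (u y) (fderiv ℝ u y v)
        (fderiv ℝ u y w) + tauForm b G (u y) (fderiv ℝ (fderiv ℝ u) y v w) := by
      intro v w
      rw [(hdt.clm_comp hdu2).fderiv]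
      simp [add_comm]
    have hs := (h1.isSymmSndFDerivAt (by simpa using two_le_infty)).eq v w
    have ht := hG.fderiv_tauForm_sub b hc h2 (fderiv ℝ u y v) (fderiv ℝ u y w)
    have h0 : G (u y) (fderiv ℝ u y v) (Complex.I • fderiv ℝ u y w) = 0 := by
      have e : G (u y) (Complex.I • fderiv ℝ u y v) (fderiv ℝ u y w) = 0 := by
        rw [map_eq_sum_basisVec (fderiv ℝ u y) v, map_eq_sum_basisVec (fderiv ℝ u y) w]
        have h3' : ∀ i j, G (u y) (Complex.I • fderiv ℝ u y (basisVec i))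
          (fderiv ℝ u y (basisVec j)) = 0 := h3
        simp only [smul_add, smul_comm Complex.I, map_add, map_smul, add_apply, smul_apply, h3',
          smul_zero, add_zero]
      rw [hG.apply_I_left h2] at e
      linarith
    rw [h0, mul_zero, sub_eq_zero] at ht
    rw [hd, hd, ht, hs]
  obtain ⟨α, hα⟩ := (convex_ball y₀ r).exists_forall_hasFDerivAt_of_fderiv_symmetric
    Metric.isOpen_ball (show DifferentiableOn ℝ θ _ from
      fun y hy => ((hθs y hy).differentiableAt (by simp)).differentiableWithinAt) hsymm
  refine ⟨α, ?_⟩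
  have hαs : ContDiffOn ℝ ∞ α (Metric.ball y₀ r) := by
    rw [contDiffOn_infty_iff_fderiv_of_isOpen Metric.isOpen_ball]
    refine ⟨fun y hy => (hα y hy).differentiableAt.differentiableWithinAt, fun y hy => ?_⟩
    exact ((hθs y hy).contDiffWithinAt).congr (fun z hz => (hα z hz).fderiv) (hα y hy).fderiv
  filter_upwards [Metric.ball_mem_nhds y₀ hr] with y hy
  exact ⟨hαs.contDiffAt (Metric.isOpen_ball.mem_nhds hy), fun v => by rw [(hα y hy).fderiv]; rfl⟩

/-- The mean curvature form of a lagrangian map into a Kähler-Einstein surface is locally exact. -/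
theorem exists_primitive_meanCurv (hG : IsKahlerOn G U) {c : ℝ}
    (hc : ∀ y ∈ U, ∀ v w, ricci G y v w = c * G y v w) (b : Module.Basis (Fin 2) ℂ E)
    (hu : ∀ᶠ y in 𝓝 y₀, ContDiffAt ℝ ∞ u y) (hy : ∀ᶠ y in 𝓝 y₀, u y ∈ U)
    (hlag : ∀ᶠ y in 𝓝 y₀, ∀ i j, G (u y) (Complex.I • partialVec u y i) (partialVec u y j) = 0)
    {ζ₀ : ℂ} (hζ₀ : ζ₀ ≠ 0) (hslit : ∀ᶠ y in 𝓝 y₀, gramDet G u y ≠ 0 →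
      detC b (partialVec u y 0) (partialVec u y 1) / ζ₀ ∈ Complex.slitPlane)
    (harg : Tendsto (fun y => (detC b (partialVec u y 0) (partialVec u y 1) / ζ₀).arg)
      (𝓝[≠] y₀) (𝓝 0)) :
    ∃ β : Plane → ℝ, Tendsto β (𝓝[≠] y₀) (𝓝 0) ∧ ∀ᶠ y in 𝓝 y₀, gramDet G u y ≠ 0 →
      ContDiffAt ℝ ∞ β y ∧ ∀ k, G (u y) (Complex.I • meanCurv G u y) (partialVec u y k) =
        fderiv ℝ β y (basisVec k) := by
  obtain ⟨α, hα⟩ := exists_primitive_tauForm hG hc b hu hy hlag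
  set ζ : Plane → ℂ := fun y => detC b (partialVec u y 0) (partialVec u y 1) with hζ
  -- Dividing by `ζ₀` brings the determinant into the domain where the principal argument is smooth,
  -- without changing its logarithmic derivative. Subtracting `α y₀` makes the primitive tend to
  -- zero at `y₀`.
  refine ⟨fun y => -((ζ y / ζ₀).arg + (α y - α y₀)), ?_, ?_⟩
  · have h1 : Tendsto α (𝓝[≠] y₀) (𝓝 (α y₀)) :=
      hα.self_of_nhds.1.continuousAt.tendsto.mono_left nhdsWithin_le_nhds
    simpa using (harg.add (h1.sub_const (α y₀))).neg
  · filter_upwards [hα, hu, hy, hlag.eventually_nhds, hslit] with y h1 h2 h3 h4 h5 hdet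
    have hsl := h5 hdet
    have hζs : ContDiffAt ℝ ∞ ζ y := contDiffAt_detC_partialVec b h2
    have hζs' : ContDiffAt ℝ ∞ (fun y => ζ y / ζ₀) y := hζs.div_const ζ₀
    have hlog : ContDiffAt ℝ ∞ (fun y => (Complex.log (ζ y / ζ₀)).im) y :=
      Complex.imCLM.contDiff.contDiffAt.comp y
        (ContDiffAt.comp y (f := fun y => ζ y / ζ₀)
          ((Complex.contDiffAt_log (n := ∞) hsl).restrict_scalars ℝ) hζs')
    have hargs : (fun y => (ζ y / ζ₀).arg) = fun y => (Complex.log (ζ y / ζ₀)).im := by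
      funext z; rw [Complex.log_im]
    refine ⟨?_, fun k => ?_⟩
    · have h6 : ContDiffAt ℝ ∞ (fun y => (ζ y / ζ₀).arg) y := by rw [hargs]; exact hlog
      exact (h6.add (h1.1.sub contDiffAt_const)).neg
    · obtain ⟨hd, hform⟩ := meanCurv_form_eq hG h3 h2 hdet h4 b k
      have hdζ : HasFDerivAt (fun y => ζ y / ζ₀)
          ((ContinuousLinearMap.mul ℝ ℂ ζ₀⁻¹).comp (fderiv ℝ ζ y)) y := by
        have := (ContinuousLinearMap.mul ℝ ℂ ζ₀⁻¹).hasFDerivAt.comp y hd.hasFDerivAt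
        refine this.congr_of_eventuallyEq (Eventually.of_forall fun z => ?_)
        simp [div_eq_inv_mul, hζ]
      have h7 : HasFDerivAt (fun y => (ζ y / ζ₀).arg) (Complex.imCLM.comp
          (((ζ y / ζ₀)⁻¹ • (1 : ℂ →L[ℝ] ℂ)).comp
          ((ContinuousLinearMap.mul ℝ ℂ ζ₀⁻¹).comp (fderiv ℝ ζ y)))) y := by
        rw [hargs]
        exact Complex.imCLM.hasFDerivAt.comp y
          ((Complex.hasStrictFDerivAt_log_real hsl).hasFDerivAt.comp y hdζ)
      have h8 := (h7.add ((h1.1.differentiableAt (by simp)).hasFDerivAt.sub_const (α y₀))).neg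
      have h9 : HasFDerivAt (fun y => -((ζ y / ζ₀).arg + (α y - α y₀))) _ y := h8
      rw [hform, h9.fderiv]
      simp only [neg_apply, add_apply, ContinuousLinearMap.comp_apply, smul_apply,
        one_apply_eq_self, Complex.imCLM_apply, ContinuousLinearMap.mul_apply',
        h1.2, smul_eq_mul]
      have hne : ζ y / ζ₀ ≠ 0 := Complex.slitPlane_ne_zero hsl
      have e : (ζ y / ζ₀)⁻¹ * (ζ₀⁻¹ * fderiv ℝ ζ y (basisVec k)) =
          fderiv ℝ ζ y (basisVec k) / ζ y := by
        have : ζ y ≠ 0 := fun h => hne (by rw [h, zero_div])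
        field_simp
      rw [e]
      rfl

end Primitive

/-! ## The geometry near a branch point -/

section BranchLocal

theorem tendsto_clm_apply {E F : Type*} [NormedAddCommGroup E] [NormedSpace ℝ E]
    [NormedAddCommGroup F] [NormedSpace ℝ F] {X : Type*} {l : Filter X} {A : X → E →L[ℝ] F}
    {v : X → E} {A₀ : E →L[ℝ] F} {v₀ : E} (hA : Tendsto A l (𝓝 A₀)) (hv : Tendsto v l (𝓝 v₀)) :
    Tendsto (fun x => A x (v x)) l (𝓝 (A₀ v₀)) :=
  ((isBoundedBilinearMap_apply (𝕜 := ℝ) (E := E) (F := F)).continuous.tendsto (A₀, v₀)).comp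
    (hA.prodMk_nhds hv)

theorem tendsto_detC {E : Type*} [NormedAddCommGroup E] [NormedSpace ℂ E] [FiniteDimensional ℝ E]
    (b : Module.Basis (Fin 2) ℂ E) {X : Type*} {l : Filter X} {A₀ A₁ : X → E} {a a' : E}
    (h0 : Tendsto A₀ l (𝓝 a)) (h1 : Tendsto A₁ l (𝓝 a')) :
    Tendsto (fun x => detC b (A₀ x) (A₁ x)) l (𝓝 (detC b a a')) := by
  have h : ∀ (k : Fin 2) {A : X → E} {a : E}, Tendsto A l (𝓝 a) →
      Tendsto (fun x => b.coord k (A x)) l (𝓝 (b.coord k a)) := fun k A a hA =>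
    ((LinearMap.toContinuousLinearMap ((b.coord k).restrictScalars ℝ)).continuous.tendsto a).comp hA
  exact ((h 0 h0).mul (h 1 h1)).sub ((h 1 h0).mul (h 0 h1))

theorem detC_rotate {E : Type*} [NormedAddCommGroup E] [NormedSpace ℂ E]
    (b : Module.Basis (Fin 2) ℂ E) (p q : ℝ) (v w : E) :
    detC b (p • v + q • w) (-q • v + p • w) = ((p ^ 2 + q ^ 2 : ℝ) : ℂ) * detC b v w := by
  simp only [detC, map_add, ← Complex.coe_smul, map_smul, smul_eq_mul]
  push_cast
  ring

variable {E : Type*} [NormedAddCommGroup E] [NormedSpace ℝ E]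
  {G : E → E →L[ℝ] E →L[ℝ] ℝ} {U : Set E} {u : Plane → E} {y₀ : Plane}

theorem partialVec_realSpan (x a a' : E) (y₀ y : Plane) :
    partialVec (fun y => x + realSpan a a' (toComplex (y - y₀))) y 0 = a ∧
    partialVec (fun y => x + realSpan a a' (toComplex (y - y₀))) y 1 = a' := by
  have h : HasFDerivAt (fun y => x + realSpan a a' (toComplex (y - y₀)))
      ((realSpan a a').comp toComplexL) y :=
    (((realSpan a a').comp toComplexL).hasFDerivAt.comp y
      ((hasFDerivAt_id y).sub_const y₀)).const_add x
  constructor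
  · rw [partialVec, h.fderiv, ContinuousLinearMap.comp_apply, toComplexL_apply,
      toComplex_basisVec.1]
    simp [realSpan_apply]
  · rw [partialVec, h.fderiv, ContinuousLinearMap.comp_apply, toComplexL_apply,
      toComplex_basisVec.2]
    simp [realSpan_apply]

/-- The affine map with coordinate vectors `a`, `a'` reduces this to the statement for
differentials. -/
theorem gramDet_pos_of_linearIndependent (hG : IsMetricOn G U) {x a a' : E} (hx : x ∈ U)
    (h : LinearIndependent ℝ ![a, a']) : 0 < G x a a * G x a' a' - G x a a' ^ 2 := by
  obtain ⟨h0, h1⟩ := partialVec_realSpan x a a' 0 0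
  set w : Plane → E := fun y : Plane => x + realSpan a a' (toComplex (y - 0)) with hw
  have hx' : w 0 = x := by
    simp [hw, realSpan_apply, toComplex]
  have hinj : Function.Injective (fderiv ℝ w 0) := by
    rw [injective_iff_map_eq_zero]
    intro v hv
    rw [map_eq_sum_basisVec] at hv
    change v 0 • partialVec w 0 0 + v 1 • partialVec w 0 1 = 0 at hv
    rw [h0, h1] at hv
    obtain ⟨e0, e1⟩ := LinearIndependent.pair_iff.1 h _ _ hv
    ext i
    fin_cases i
    · exact e0
    · exact e1
  have := gramDet_pos_of_injective (u := w) hG (by rw [hx']; exact hx) hinj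
  rw [gramDet, gram, gram, gram, h0, h1, hx'] at this
  exact this

theorem gram_rotate (hG : IsMetricOn G U) (hy : u y ∈ U) {p q : ℝ} {v w : E}
    (h0 : partialVec u y 0 = p • v + q • w) (h1 : partialVec u y 1 = -q • v + p • w) :
    gram G u y 0 0 = p ^ 2 * G (u y) v v + 2 * p * q * G (u y) v w + q ^ 2 * G (u y) w w ∧
    gram G u y 0 1 = p * q * (G (u y) w w - G (u y) v v) + (p ^ 2 - q ^ 2) * G (u y) v w ∧
    gram G u y 1 1 = q ^ 2 * G (u y) v v - 2 * p * q * G (u y) v w + p ^ 2 * G (u y) w w ∧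
    gramDet G u y = (p ^ 2 + q ^ 2) ^ 2 * (G (u y) v v * G (u y) w w - G (u y) v w ^ 2) := by
  have e00 : gram G u y 0 0 =
      p ^ 2 * G (u y) v v + 2 * p * q * G (u y) v w + q ^ 2 * G (u y) w w := by
    rw [gram, h0]
    simp only [map_add, map_smul, add_apply, smul_apply, smul_eq_mul, hG.symm _ hy w v]
    ring
  have e01 : gram G u y 0 1 =
      p * q * (G (u y) w w - G (u y) v v) + (p ^ 2 - q ^ 2) * G (u y) v w := by
    rw [gram, h0, h1]
    simp only [map_add, map_smul, add_apply, smul_apply, smul_eq_mul, hG.symm _ hy w v]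
    ring
  have e11 : gram G u y 1 1 =
      q ^ 2 * G (u y) v v - 2 * p * q * G (u y) v w + p ^ 2 * G (u y) w w := by
    rw [gram, h1]
    simp only [map_add, map_smul, add_apply, smul_apply, smul_eq_mul, hG.symm _ hy w v]
    ring
  refine ⟨e00, e01, e11, ?_⟩
  rw [gramDet, e00, e01, e11]
  ring

/-- In two dimensions the flux depends only on the conformal class of the metric: the factor `s` of
`h` cancels against the root of its determinant. The degeneration of the induced metric at a branch
point is of this kind, so the flux stays bounded there. -/
theorem abs_flux_le {h : Fin 2 → Fin 2 → ℝ} {m M s d : ℝ} (hm : 0 < m) (hs : 0 < s)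
    (hd : m ≤ d) (hdet : h 0 0 * h 1 1 - h 0 1 ^ 2 = s ^ 2 * d)
    (h00 : |h 0 0| ≤ s * M) (h01 : |h 0 1| ≤ s * M) (h11 : |h 1 1| ≤ s * M)
    (x : Fin 2 → ℝ) (i : Fin 2) : |flux h x i| ≤ M / √m * (|x 0| + |x 1|) := by
  have hM : 0 ≤ M := by
    by_contra hM
    have := abs_nonneg (h 0 0)
    nlinarith
  have hsq : √(h 0 0 * h 1 1 - h 0 1 ^ 2) = s * √d := by
    rw [hdet, Real.sqrt_mul (by positivity), Real.sqrt_sq hs.le]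
  have hmd : √m ≤ √d := Real.sqrt_le_sqrt hd
  have hm' : 0 < √m := Real.sqrt_pos.2 hm
  have hd' : 0 < √d := hm'.trans_le hmd
  have key : ∀ {A B z w : ℝ}, |A| ≤ s * M → |B| ≤ s * M →
      |(A * z - B * w) / (s * √d)| ≤ M / √m * (|z| + |w|) := by
    intro A B z w hA hB
    rw [abs_div, abs_of_pos (by positivity : 0 < s * √d), div_mul_eq_mul_div,
      div_le_div_iff₀ (by positivity) hm']
    have h1 : |A * z - B * w| ≤ s * M * (|z| + |w|) := by
      refine (abs_sub _ _).trans ?_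
      rw [abs_mul, abs_mul, mul_add]
      exact add_le_add (mul_le_mul_of_nonneg_right hA (abs_nonneg _))
        (mul_le_mul_of_nonneg_right hB (abs_nonneg _))
    calc |A * z - B * w| * √m ≤ s * M * (|z| + |w|) * √d :=
          mul_le_mul h1 hmd hm'.le (by positivity)
      _ = M * (|z| + |w|) * (s * √d) := by ring
  fin_cases i
  · have : flux h x 0 = (h 1 1 * x 0 - h 0 1 * x 1) / (s * √d) := by
      rw [← hsq]; simp [flux]
    change |flux h x 0| ≤ _
    rw [this]
    exact key h11 h01
  · have : flux h x 1 = (h 0 0 * x 1 - h 0 1 * x 0) / (s * √d) := by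
      rw [← hsq]; simp [flux]
    change |flux h x 1| ≤ _
    rw [this, add_comm |x 0|]
    exact key h00 h01

theorem abs_add_two_mul_add_le {A B C x y z S X Y Z : ℝ} (hA : |A| ≤ S) (hB : |B| ≤ S)
    (hC : |C| ≤ S) (hx : |x| ≤ X) (hy : |y| ≤ Y) (hz : |z| ≤ Z) :
    |A * x + 2 * (B * y) + C * z| ≤ S * (X + 2 * Y + Z) := by
  have h1 : |A * x| ≤ S * X := by
    rw [abs_mul]; exact mul_le_mul hA hx (abs_nonneg _) ((abs_nonneg _).trans hA)
  have h2 : |B * y| ≤ S * Y := by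
    rw [abs_mul]; exact mul_le_mul hB hy (abs_nonneg _) ((abs_nonneg _).trans hA)
  have h3 : |C * z| ≤ S * Z := by
    rw [abs_mul]; exact mul_le_mul hC hz (abs_nonneg _) ((abs_nonneg _).trans hA)
  rw [abs_le] at *
  constructor <;> linarith [h1.1, h1.2, h2.1, h2.2, h3.1, h3.2]

/-- Near a branch point the map is immersive and the induced conformal structure is bounded. -/
theorem branch_gram (hG : IsMetricOn G U) (hU : ∀ᶠ y in 𝓝 y₀, u y ∈ U) (hu : ContinuousAt u y₀)
    {p q s : Plane → ℝ} {A₀ A₁ : Plane → E} {a a' : E} (hs : ∀ y ≠ y₀, 0 < s y)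
    (hpq : ∀ y, p y ^ 2 + q y ^ 2 = s y ^ 2)
    (hA₀ : Tendsto A₀ (𝓝[≠] y₀) (𝓝 a)) (hA₁ : Tendsto A₁ (𝓝[≠] y₀) (𝓝 a'))
    (hfr : ∀ y ≠ y₀, partialVec u y 0 = p y • A₀ y + q y • A₁ y ∧
        partialVec u y 1 = -q y • A₀ y + p y • A₁ y) (ha : LinearIndependent ℝ ![a, a']) :
    (∀ᶠ y in 𝓝[≠] y₀, 0 < gramDet G u y) ∧
    ∃ C, 0 ≤ C ∧ ∀ᶠ y in 𝓝[≠] y₀, ∀ x i, |flux (gram G u y) x i| ≤ C * (|x 0| + |x 1|) := by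
  have hx : u y₀ ∈ U := hU.self_of_nhds
  have hGt : Tendsto (fun y => G (u y)) (𝓝[≠] y₀) (𝓝 (G (u y₀))) :=
    (((hG.contDiffAt hx).continuousAt).comp hu).tendsto.mono_left nhdsWithin_le_nhds
  have hvv := tendsto_clm_apply (tendsto_clm_apply hGt hA₀) hA₀
  have hvw := tendsto_clm_apply (tendsto_clm_apply hGt hA₀) hA₁
  have hww := tendsto_clm_apply (tendsto_clm_apply hGt hA₁) hA₁
  set d : Plane → ℝ := fun y => G (u y) (A₀ y) (A₀ y) * G (u y) (A₁ y) (A₁ y)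
    - G (u y) (A₀ y) (A₁ y) ^ 2 with hd
  have hdt : Tendsto d (𝓝[≠] y₀) (𝓝 (G (u y₀) a a * G (u y₀) a' a' - G (u y₀) a a' ^ 2)) :=
    (hvv.mul hww).sub (hvw.pow 2)
  have hpos := gramDet_pos_of_linearIndependent hG hx ha
  set δ := G (u y₀) a a * G (u y₀) a' a' - G (u y₀) a a' ^ 2
  have h1 : ∀ᶠ y in 𝓝[≠] y₀, δ / 2 < d y := hdt.eventually_const_lt (by linarith)
  have hM : ∀ {f : Plane → ℝ} {L : ℝ}, Tendsto f (𝓝[≠] y₀) (𝓝 L) →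
      ∀ᶠ y in 𝓝[≠] y₀, |f y| < |L| + 1 := fun hf =>
    hf.abs.eventually_lt_const (by linarith)
  set M := (|G (u y₀) a a| + 1) + 2 * (|G (u y₀) a a'| + 1) + (|G (u y₀) a' a'| + 1)
  have hU' : ∀ᶠ y in 𝓝[≠] y₀, u y ∈ U := hU.filter_mono nhdsWithin_le_nhds
  have hne : ∀ᶠ y in 𝓝[≠] y₀, y ≠ y₀ := self_mem_nhdsWithin
  constructor
  · filter_upwards [h1, hU', hne] with y hy hyU hyne
    obtain ⟨e0, e1⟩ := hfr y hyne
    rw [(gram_rotate hG hyU e0 e1).2.2.2, hpq]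
    have := hs y hyne
    have : 0 < d y := by linarith
    positivity
  · refine ⟨M / √(δ / 2), by positivity, ?_⟩
    filter_upwards [h1, hU', hne, hM hvv, hM hvw, hM hww] with y hy hyU hyne m1 m2 m3 x i
    obtain ⟨e0, e1⟩ := hfr y hyne
    obtain ⟨g00, g01, g11, gd⟩ := gram_rotate hG hyU e0 e1
    have hsy := hs y hyne
    have hp : |p y| ≤ s y := by
      rw [← abs_of_pos hsy]; exact sq_le_sq.1 (by nlinarith [hpq y, sq_nonneg (q y)])
    have hq : |q y| ≤ s y := by
      rw [← abs_of_pos hsy]; exact sq_le_sq.1 (by nlinarith [hpq y, sq_nonneg (p y)])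
    have hpp : |p y ^ 2| ≤ s y ^ 2 := by rw [abs_of_nonneg (sq_nonneg _)]; nlinarith [hpq y, sq_nonneg (q y)]
    have hqq : |q y ^ 2| ≤ s y ^ 2 := by rw [abs_of_nonneg (sq_nonneg _)]; nlinarith [hpq y, sq_nonneg (p y)]
    have hpqm : |p y * q y| ≤ s y ^ 2 := by
      rw [abs_mul, sq]; exact mul_le_mul hp hq (abs_nonneg _) hsy.le
    have hpqd : |p y ^ 2 - q y ^ 2| ≤ s y ^ 2 := by
      rw [abs_le]; constructor <;> nlinarith [hpq y, sq_nonneg (p y), sq_nonneg (q y)]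
    have hdet : gram G u y 0 0 * gram G u y 1 1 - gram G u y 0 1 ^ 2 = (s y ^ 2) ^ 2 * d y := by
      have : gramDet G u y = gram G u y 0 0 * gram G u y 1 1 - gram G u y 0 1 ^ 2 := rfl
      rw [← this, gd, hpq]
    refine abs_flux_le (by positivity) (by positivity : 0 < s y ^ 2) hy.le hdet ?_ ?_ ?_ x i
    · rw [g00]
      refine le_trans (le_of_eq ?_) (abs_add_two_mul_add_le hpp hpqm hqq m1.le m2.le m3.le)
      congr 1
      ring
    · rw [g01]
      have hpqm' : |-(p y * q y)| ≤ s y ^ 2 := by rwa [abs_neg]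
      have hpqd' : |(p y ^ 2 - q y ^ 2) / 2| ≤ s y ^ 2 := by
        rw [abs_div, abs_two]
        linarith [abs_nonneg (p y ^ 2 - q y ^ 2)]
      refine le_trans (le_of_eq ?_) (abs_add_two_mul_add_le hpqm' hpqd' hpqm m1.le m2.le m3.le)
      congr 1
      ring
    · rw [g11]
      have hpqm' : |-(p y * q y)| ≤ s y ^ 2 := by rwa [abs_neg]
      refine le_trans (le_of_eq ?_) (abs_add_two_mul_add_le hqq hpqm' hpp m1.le m2.le m3.le)
      congr 1
      ring

end BranchLocal

/-! ### The phase of the tangent plane at a branch point -/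

section BranchLagrangian

variable {G : E → E →L[ℝ] E →L[ℝ] ℝ} {U : Set E} {u : Plane → E} {y₀ : Plane}

theorem detC_ne_zero_of_lagrangian (hG : IsKahlerOn G U) {x a a' : E} (hx : x ∈ U)
    (h : LinearIndependent ℝ ![a, a']) (hlag : G x (Complex.I • a) a' = 0)
    (b : Module.Basis (Fin 2) ℂ E) : detC b a a' ≠ 0 := by
  obtain ⟨h0, h1⟩ := partialVec_realSpan x a a' 0 0
  set w : Plane → E := fun y : Plane => x + realSpan a a' (toComplex (y - 0)) with hw
  have hx' : w 0 = x := by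
    simp [hw, realSpan_apply, toComplex]
  rw [← h0, ← h1]
  refine detC_partialVec_ne_zero (u := w) hG (by rw [hx']; exact hx) ?_ ?_
  · rw [gramDet, gram, gram, gram, h0, h1, hx']
    exact (gramDet_pos_of_linearIndependent hG.toIsMetricOn hx h).ne'
  · have h10 : G x (Complex.I • a') a = 0 := by
      rw [hG.apply_I_left hx, hG.symm _ hx, hlag, neg_zero]
    intro i j
    rw [hx']
    fin_cases i <;> fin_cases j <;> simp only [Fin.zero_eta, Fin.mk_one, h0, h1]
    · exact hG.apply_I_self hx a
    · exact hlag
    · exact h10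
    · exact hG.apply_I_self hx a'

/-- At a branch point of a lagrangian map the argument of the complex determinant of the
differential converges. -/
theorem branch_arg (hG : IsKahlerOn G U) (hU : ∀ᶠ y in 𝓝 y₀, u y ∈ U) (hu : ContinuousAt u y₀)
    (hlag : ∀ᶠ y in 𝓝 y₀, ∀ i j, G (u y) (Complex.I • partialVec u y i) (partialVec u y j) = 0)
    {p q s : Plane → ℝ} {A₀ A₁ : Plane → E} {a a' : E} (hs : ∀ y ≠ y₀, 0 < s y)
    (hpq : ∀ y, p y ^ 2 + q y ^ 2 = s y ^ 2)
    (hA₀ : Tendsto A₀ (𝓝[≠] y₀) (𝓝 a)) (hA₁ : Tendsto A₁ (𝓝[≠] y₀) (𝓝 a'))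
    (hfr : ∀ y ≠ y₀, partialVec u y 0 = p y • A₀ y + q y • A₁ y ∧
        partialVec u y 1 = -q y • A₀ y + p y • A₁ y) (ha : LinearIndependent ℝ ![a, a'])
    (b : Module.Basis (Fin 2) ℂ E) : detC b a a' ≠ 0 ∧ (∀ᶠ y in 𝓝[≠] y₀,
      detC b (partialVec u y 0) (partialVec u y 1) / detC b a a' ∈ Complex.slitPlane) ∧
    Tendsto (fun y => (detC b (partialVec u y 0) (partialVec u y 1) / detC b a a').arg)
      (𝓝[≠] y₀) (𝓝 0) := by
  have hx : u y₀ ∈ U := hU.self_of_nhds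
  have hne : ∀ᶠ y in 𝓝[≠] y₀, y ≠ y₀ := self_mem_nhdsWithin
  have hGt : Tendsto (fun y => G (u y)) (𝓝[≠] y₀) (𝓝 (G (u y₀))) :=
    (((hG.toIsMetricOn.contDiffAt hx).continuousAt).comp hu).tendsto.mono_left nhdsWithin_le_nhds
  have hI : Tendsto (fun y => Complex.I • A₀ y) (𝓝[≠] y₀) (𝓝 (Complex.I • a)) :=
    hA₀.const_smul Complex.I
  have hlim := tendsto_clm_apply (tendsto_clm_apply hGt hI) hA₁
  -- Since `ω(∂_0, ∂_1) = (p² + q²) ω(A₀, A₁)`, the normalised frame is lagrangian off the branch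
  -- point. The limiting plane spanned by `a` and `a'` is therefore lagrangian, which makes `detC b
  -- a a'` nonzero.
  have hzero : (fun y => G (u y) (Complex.I • A₀ y) (A₁ y)) =ᶠ[𝓝[≠] y₀] fun _ => 0 := by
    filter_upwards [hlag.filter_mono nhdsWithin_le_nhds, hne,
      hU.filter_mono nhdsWithin_le_nhds] with y hy hyne hyU
    obtain ⟨e0, e1⟩ := hfr y hyne
    have h01 := hy 0 1
    have h10 : G (u y) (Complex.I • A₁ y) (A₀ y) = -G (u y) (Complex.I • A₀ y) (A₁ y) := by
      rw [hG.apply_I_left hyU, hG.symm _ hyU]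
    rw [e0, e1] at h01
    simp only [smul_add, smul_comm Complex.I, map_add, map_smul, add_apply, smul_apply,
      smul_eq_mul, hG.apply_I_self hyU, h10] at h01
    have h2 : (s y) ^ 2 * G (u y) (Complex.I • A₀ y) (A₁ y) = 0 := by
      rw [← hpq]; linarith
    exact (mul_eq_zero.1 h2).resolve_left (pow_ne_zero 2 (hs y hyne).ne')
  have hab : G (u y₀) (Complex.I • a) a' = 0 :=
    tendsto_nhds_unique hlim (tendsto_const_nhds.congr' hzero.symm)
  have hζ := detC_ne_zero_of_lagrangian hG hx ha hab b
  have hdet : Tendsto (fun y => detC b (A₀ y) (A₁ y) / detC b a a') (𝓝[≠] y₀) (𝓝 1) := by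
    have := (tendsto_detC b hA₀ hA₁).div_const (detC b a a')
    rwa [div_self hζ] at this
  -- The rotation and dilation multiplies the determinant by the positive number `s²`. So the
  -- winding of `z^(m-1)` does not show in the argument, which is that of the convergent frame.
  have heq : ∀ y ≠ y₀, detC b (partialVec u y 0) (partialVec u y 1) / detC b a a' =
      ((s y ^ 2 : ℝ) : ℂ) * (detC b (A₀ y) (A₁ y) / detC b a a') := by
    intro y hy
    obtain ⟨e0, e1⟩ := hfr y hy
    rw [e0, e1, detC_rotate, hpq, mul_div_assoc]
  refine ⟨hζ, ?_, ?_⟩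
  · filter_upwards [hne, hdet.eventually_mem (Complex.isOpen_slitPlane.mem_nhds
      Complex.one_mem_slitPlane)] with y hy hmem
    rw [heq y hy]
    have h2 : 0 < s y ^ 2 := by have := hs y hy; positivity
    rw [Complex.mem_slitPlane_iff_arg] at hmem ⊢
    rw [Complex.arg_real_mul _ h2]
    exact ⟨hmem.1, mul_ne_zero (by exact_mod_cast h2.ne') hmem.2⟩
  · have h3 : Tendsto (fun y => (detC b (A₀ y) (A₁ y) / detC b a a').arg) (𝓝[≠] y₀) (𝓝 0) := by
      have := (Complex.continuousAt_arg Complex.one_mem_slitPlane).tendsto.comp hdet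
      rwa [Complex.arg_one] at this
    refine h3.congr' ?_
    filter_upwards [hne] with y hy
    have h2 : 0 < s y ^ 2 := by have := hs y hy; positivity
    rw [heq y hy, Complex.arg_real_mul _ h2]

end BranchLagrangian

/-! ## The mean curvature form on the surface -/

section MeanForm

/-- The form `ω(H, dℓ ·)`. -/
def meanForm (g : Metric (E := E) N) (ℓ : S → N) : OneForm S := fun q =>
  (fundamentalForm g (ℓ q) (meanCurvature (E := E) g ℓ q)).comp (mfderiv (𝓡 2) 𝓘(ℝ, E) ℓ q)

theorem formComp_meanForm (hℓ : ContMDiff (𝓡 2) 𝓘(ℝ, E) ∞ ℓ) (hc : IsChart c)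
    (he : e ∈ atlas E N) (hy : y ∈ c.target)
    (hye : ℓ (c.symm y) ∈ e.source) (himm : IsImmersedAt (E := E) ℓ (c.symm y)) (k : Fin 2) :
    formComp (meanForm g ℓ) c y k = inChart g.inner e (chartRep ℓ c e y)
      (Complex.I • meanCurv (inChart g.inner e) (chartRep ℓ c e) y)
      (partialVec (chartRep ℓ c e) y k) :=
  fundamentalForm_meanCurvature hℓ hc he hy hye himm (basisVec k)

theorem eventually_chartRep (hℓ : ContMDiff (𝓡 2) 𝓘(ℝ, E) ∞ ℓ) (hc : IsChart c)
    (he : e ∈ atlas E N) {p : S} (hp : p ∈ c.source) (hpe : ℓ p ∈ e.source) :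
    ∀ᶠ y in 𝓝 (c p), y ∈ c.target ∧ ℓ (c.symm y) ∈ e.source ∧
      chartRep ℓ c e y ∈ e.target ∧ ContDiffAt ℝ ∞ (chartRep ℓ c e) y := by
  have h1 : Tendsto c.symm (𝓝 (c p)) (𝓝 p) := c.tendsto_symm hp
  have h2 : ∀ᶠ y in 𝓝 (c p), ℓ (c.symm y) ∈ e.source :=
    (hℓ.continuous.continuousAt.tendsto.comp h1).eventually (e.open_source.mem_nhds hpe)
  filter_upwards [h2, c.open_target.mem_nhds (c.map_source hp)] with y hy1 hy2
  exact ⟨hy2, hy1, e.map_source hy1,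
    contDiffAt_chartRep hc (isChart_of_mem_atlas he) hy2 hℓ.contMDiffAt hy1⟩

/-- At an immersed point the determinant is continuous and nonzero, so normalising by its value at
the point keeps it near `1`. -/
theorem exists_primitive_meanForm (hKahler : IsKahler g) (hEinstein : IsEinstein g)
    (b : Module.Basis (Fin 2) ℂ E) (hℓ : IsBranchedLagrangianImmersion g ℓ) {p : S}
    (hp : IsImmersedAt (E := E) ℓ p) :
    ∃ β : Plane → ℝ, ∀ᶠ y in 𝓝 (chartAt Plane p p), ContDiffAt ℝ ∞ β y ∧
      ∀ k, formComp (meanForm g ℓ) (chartAt Plane p) y k = fderiv ℝ β y (basisVec k) := by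
  obtain ⟨κ, hκ⟩ := hEinstein
  set c := chartAt Plane p
  set e := chartAt E (ℓ p)
  have he : e ∈ atlas E N := chart_mem_atlas E (ℓ p)
  have he' := isChart_of_mem_atlas he
  have hc : IsChart c := isChart_chartAt p
  have hps : p ∈ c.source := mem_chart_source Plane p
  have hpe : ℓ p ∈ e.source := mem_chart_source E (ℓ p)
  have hs := hℓ.branched.smooth
  have hev := eventually_chartRep hs hc he hps hpe
  have hG := isKahlerOn_inChart hKahler he
  set u := chartRep ℓ c e
  set G := inChart g.inner e
  have hlag : ∀ᶠ y in 𝓝 (c p), ∀ i j,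
      G (u y) (Complex.I • partialVec u y i) (partialVec u y j) = 0 := by
    filter_upwards [hev] with y hy i j
    exact lagrangian_chartRep hc he hy.1 hs.contMDiffAt hy.2.1 hℓ.lagrangian i j
  have hl : c.symm (c p) = p := c.left_inv hps
  have h0 := hev.self_of_nhds
  have hdet : 0 < gramDet G u (c p) :=
    (isImmersedAt_iff_gramDet_pos hc he' h0.1 hs.contMDiffAt h0.2.1 g).1 (by rw [hl]; exact hp)
  set ζ : Plane → ℂ := fun y => detC b (partialVec u y 0) (partialVec u y 1) with hζ
  have hζ0 : ζ (c p) ≠ 0 := detC_partialVec_ne_zero hG h0.2.2.1 hdet.ne' hlag.self_of_nhds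
  have hcont : Tendsto (fun y => ζ y / ζ (c p)) (𝓝 (c p)) (𝓝 1) := by
    have h1 : Tendsto ζ (𝓝 (c p)) (𝓝 (ζ (c p))) :=
      (contDiffAt_detC_partialVec b h0.2.2.2).continuousAt
    have h2 := h1.div_const (ζ (c p))
    rwa [div_self hζ0] at h2
  have hsl := hcont.eventually_mem (Complex.isOpen_slitPlane.mem_nhds Complex.one_mem_slitPlane)
  have harg : Tendsto (fun y => (ζ y / ζ (c p)).arg) (𝓝 (c p)) (𝓝 0) := by
    have := (Complex.continuousAt_arg Complex.one_mem_slitPlane).tendsto.comp hcont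
    rwa [Complex.arg_one] at this
  obtain ⟨β, -, hβ⟩ := exists_primitive_meanCurv hG (hκ e he) b (hev.mono fun y hy => hy.2.2.2)
    (hev.mono fun y hy => hy.2.2.1) hlag hζ0 (hsl.mono fun y hy _ => hy)
    (harg.mono_left nhdsWithin_le_nhds)
  have hdet' : ∀ᶠ y in 𝓝 (c p), 0 < gramDet G u y := by
    have h1 : ContinuousAt (gramDet G u) (c p) := by
      have hGc : ContinuousAt (fun y => G (u y)) (c p) :=
        ((hG.toIsMetricOn.contDiffAt h0.2.2.1).continuousAt).comp h0.2.2.2.continuousAt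
      have hgr : ∀ i j, ContinuousAt (fun y => gram G u y i j) (c p) := fun i j =>
        tendsto_clm_apply (tendsto_clm_apply hGc (contDiffAt_partialVec h0.2.2.2 i).continuousAt)
          (contDiffAt_partialVec h0.2.2.2 j).continuousAt
      exact ((hgr 0 0).mul (hgr 1 1)).sub ((hgr 0 1).pow 2)
    exact h1.eventually_const_lt hdet
  refine ⟨β, ?_⟩
  filter_upwards [hβ, hev, hdet'] with y h1 h2 h3
  obtain ⟨h4, h5⟩ := h1 h3.ne'
  refine ⟨h4, fun k => ?_⟩
  rw [← h5 k]
  exact formComp_meanForm hs hc he h2.1 h2.2.1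
    ((isImmersedAt_iff_gramDet_pos hc he' h2.1 hs.contMDiffAt h2.2.1 g).2 h3) k

/-- The behaviour of a branched lagrangian immersion near a branch point. -/
theorem exists_branch_chart (hKahler : IsKahler g) (hEinstein : IsEinstein g)
    (b : Module.Basis (Fin 2) ℂ E) (hℓ : IsBranchedLagrangianImmersion g ℓ) {p : S}
    (hp : ¬IsImmersedAt (E := E) ℓ p) : ∃ c ∈ IsManifold.maximalAtlas (𝓡 2) ∞ S, p ∈ c.source ∧
      (∀ᶠ y in 𝓝[≠] (c p), IsImmersedAt (E := E) ℓ (c.symm y)) ∧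
      (∃ C, 0 ≤ C ∧ ∀ᶠ y in 𝓝[≠] (c p), ∀ x i,
        |flux (inducedMetric g ℓ c y) x i| ≤ C * (|x 0| + |x 1|)) ∧
      ∃ β : Plane → ℝ, Tendsto β (𝓝[≠] (c p)) (𝓝 0) ∧ ∀ᶠ y in 𝓝[≠] (c p), ContDiffAt ℝ ∞ β y ∧
          ∀ k, formComp (meanForm g ℓ) c y k = fderiv ℝ β y (basisVec k) := by
  obtain ⟨κ, hκ⟩ := hEinstein
  obtain ⟨c, hc, hps, m, a, a', hm, ha, hexp⟩ :=
    (hℓ.branched.immersed_or_branch p).resolve_left hp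
  set e := chartAt E (ℓ p)
  have he : e ∈ atlas E N := chart_mem_atlas E (ℓ p)
  have he' := isChart_of_mem_atlas he
  have hpe : ℓ p ∈ e.source := mem_chart_source E (ℓ p)
  have hs := hℓ.branched.smooth
  have hev := eventually_chartRep hs hc he hps hpe
  have hG := isKahlerOn_inChart hKahler he
  set u := chartRep ℓ c e with hu
  set G := inChart g.inner e
  have hlag : ∀ᶠ y in 𝓝 (c p), ∀ i j,
      G (u y) (Complex.I • partialVec u y i) (partialVec u y j) = 0 := by
    filter_upwards [hev] with y hy i j
    exact lagrangian_chartRep hc he hy.1 hs.contMDiffAt hy.2.1 hℓ.lagrangian i j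
  have hl : c.symm (c p) = p := c.left_inv hps
  have h0 := hev.self_of_nhds
  have hup : u (c p) = e (ℓ p) := by rw [hu, chartRep, hl]
  have hexp' : (fun y => u y - u (c p) - realSpan a a' (toComplex (y - c p) ^ m)) =o[𝓝 (c p)]
      fun y => ‖y - c p‖ ^ m := by
    rw [hup]; exact hexp
  obtain ⟨P, Q, A₀, A₁, hPQ, hA₀, hA₁, hfr⟩ :=
    branch_frame hm (branch_expansion hm h0.2.2.2 hexp')
  have hpos : ∀ y ≠ c p, 0 < (m : ℝ) * ‖y - c p‖ ^ (m - 1) := fun y hy => by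
    have h1 : 0 < ‖y - c p‖ := norm_pos_iff.2 (sub_ne_zero.2 hy)
    have h2 : (0 : ℝ) < m := by exact_mod_cast (by omega : 0 < m)
    positivity
  have hU : ∀ᶠ y in 𝓝 (c p), u y ∈ e.target := hev.mono fun y hy => hy.2.2.1
  obtain ⟨hdet, C, hC0, hC⟩ := branch_gram hG.toIsMetricOn hU h0.2.2.2.continuousAt hpos hPQ hA₀
    hA₁ hfr ha
  obtain ⟨hζ0, hsl, harg⟩ := branch_arg hG hU h0.2.2.2.continuousAt hlag hpos hPQ hA₀ hA₁ hfr ha b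
  have hdet0 : gramDet G u (c p) = 0 := by
    by_contra hne
    refine hp ?_
    rw [← hl]
    exact (isImmersedAt_iff_gramDet_pos hc he' h0.1 hs.contMDiffAt h0.2.1 g).2
      (lt_of_le_of_ne (gramDet_nonneg hG.toIsMetricOn h0.2.2.1) (Ne.symm hne))
  -- The centre, where the determinant of the metric is zero, is excluded by the nondegeneracy
  -- hypothesis, so the statement on the punctured neighbourhood is enough.
  have hsl' : ∀ᶠ y in 𝓝 (c p), gramDet G u y ≠ 0 →
      detC b (partialVec u y 0) (partialVec u y 1) / detC b a a' ∈ Complex.slitPlane := by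
    filter_upwards [eventually_nhdsWithin_iff.1 hsl] with y hy hne
    exact hy fun h => hne (by rw [h]; exact hdet0)
  obtain ⟨β, hβ0, hβ⟩ := exists_primitive_meanCurv hG (hκ e he) b
    (hev.mono fun y hy => hy.2.2.2) hU hlag hζ0 hsl' harg
  have hev' := hev.filter_mono (nhdsWithin_le_nhds (s := {c p}ᶜ))
  have himm : ∀ᶠ y in 𝓝[≠] (c p), IsImmersedAt (E := E) ℓ (c.symm y) := by
    filter_upwards [hev', hdet] with y h2 h3
    exact (isImmersedAt_iff_gramDet_pos hc he' h2.1 hs.contMDiffAt h2.2.1 g).2 h3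
  refine ⟨c, hc, hps, himm, ⟨C, hC0, ?_⟩, β, hβ0, ?_⟩
  · filter_upwards [hev', hC] with y h2 h3
    rw [inducedMetric_eq_gram hc he' h2.1 hs.contMDiffAt h2.2.1]
    exact h3
  · filter_upwards [hev', hdet, himm, hβ.filter_mono nhdsWithin_le_nhds] with y h2 h3 h4 h5
    obtain ⟨h6, h7⟩ := h5 h3.ne'
    refine ⟨h6, fun k => ?_⟩
    rw [← h7 k]
    exact formComp_meanForm hs hc he h2.1 h2.2.1 h4 k

theorem isOpen_immersed (g : Metric (E := E) N) (hℓ : ContMDiff (𝓡 2) 𝓘(ℝ, E) ∞ ℓ) :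
    IsOpen {p | IsImmersedAt (E := E) ℓ p} := by
  rw [isOpen_iff_mem_nhds]
  intro p hp
  have hc := isChart_chartAt (F := Plane) p
  have hps : p ∈ (chartAt Plane p).source := mem_chart_source Plane p
  have hy := (chartAt Plane p).map_source hps
  have hcont : ContinuousAt (fun y => inducedMetric g ℓ (chartAt Plane p) y 0 0 *
      inducedMetric g ℓ (chartAt Plane p) y 1 1 - inducedMetric g ℓ (chartAt Plane p) y 0 1 ^ 2)
      (chartAt Plane p p) :=
    (((contDiffAt_inducedMetric hℓ hc hy 0 0).mul (contDiffAt_inducedMetric hℓ hc hy 1 1)).sub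
      ((contDiffAt_inducedMetric hℓ hc hy 0 1).pow 2)).continuousAt
  have hl : (chartAt Plane p).symm (chartAt Plane p p) = p := (chartAt Plane p).left_inv hps
  have h0 := (inducedMetric_det_pos (g := g) hℓ hc hy).1 (by rw [hl]; exact hp)
  have h1 := hcont.eventually_const_lt h0
  have h2 := ((chartAt Plane p).continuousAt hps).eventually h1
  filter_upwards [h2, (chartAt Plane p).open_source.mem_nhds hps] with q hq hqs
  have h3 := (inducedMetric_det_pos (g := g) hℓ hc ((chartAt Plane p).map_source hqs)).2 hq
  rwa [(chartAt Plane p).left_inv hqs] at h3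

/-- The degenerate points form a closed set, and the expansion at a branch point makes each of them
isolated; such a set in a compact surface is finite. -/
theorem finite_not_immersed [CompactSpace S] (hKahler : IsKahler g) (hEinstein : IsEinstein g)
    (b : Module.Basis (Fin 2) ℂ E) (hℓ : IsBranchedLagrangianImmersion g ℓ) :
    {p | ¬IsImmersedAt (E := E) ℓ p}.Finite := by
  have hcl : IsClosed {p | ¬IsImmersedAt (E := E) ℓ p} :=
    (isOpen_immersed g hℓ.branched.smooth).isClosed_compl
  refine hcl.isCompact.finite ?_
  rw [isDiscrete_iff_nhdsNE]
  intro p hp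
  obtain ⟨c, -, hps, himm, -⟩ := exists_branch_chart hKahler hEinstein b hℓ hp
  have h1 : ∀ᶠ q in 𝓝 p, c q ≠ c p → IsImmersedAt (E := E) ℓ (c.symm (c q)) :=
    (c.continuousAt hps).eventually (eventually_nhdsWithin_iff.1 himm)
  rw [inf_principal_eq_bot, mem_nhdsWithin_iff_eventually]
  filter_upwards [h1, c.open_source.mem_nhds hps] with q hq hqs hqp hbad
  rw [c.left_inv hqs] at hq
  exact hbad (hq fun h => hqp (c.injOn hqs hps h))

end MeanForm

/-! ## Hamiltonian flows in coordinates -/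

section HamiltonianFlow

/-- Germs of maps along `{0} × S` that agree locally come from a single map. -/
theorem exists_glue_germs {S M : Type*} [TopologicalSpace S] [T2Space S] [CompactSpace S]
    (L : S → ℝ × S → M) (h : ∀ p, ∀ᶠ q in 𝓝 p, L q =ᶠ[𝓝 ((0 : ℝ), q)] L p) :
    ∃ L' : ℝ × S → M, ∀ p, L' =ᶠ[𝓝 ((0 : ℝ), p)] L p := by
  -- Each point has a closed neighbourhood on which the germs are those of its own map. Finitely
  -- many of these sets cover, and the glued map uses at `(t, q)` the map of a set containing `q`.
  -- Near `p` only the sets containing `p` matter, because the others are closed and miss `p`.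
  have hK : ∀ p, ∃ K ∈ 𝓝 p, IsClosed K ∧ ∀ q ∈ K, L q =ᶠ[𝓝 ((0 : ℝ), q)] L p := by
    intro p
    obtain ⟨K, ⟨hK, hKc⟩, hKs⟩ := (closed_nhds_basis p).mem_iff.1 (h p)
    exact ⟨K, hK, hKc, hKs⟩
  choose K hK hKc hKL using hK
  obtain ⟨T, -, hT⟩ := isCompact_univ.elim_nhds_subcover K fun p _ => hK p
  have hi : ∀ q : S, ∃ i ∈ T, q ∈ K i := fun q => by simpa using hT (mem_univ q)
  choose i hiT hiK using hi
  refine ⟨fun z => L (i z.2) z, fun p => ?_⟩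
  have h1 : ∀ j ∈ T, ∀ᶠ z : ℝ × S in 𝓝 ((0 : ℝ), p), z.2 ∈ K j → L j z = L p z := by
    intro j _
    by_cases hp : p ∈ K j
    · filter_upwards [hKL j p hp] with z hz _
      exact hz.symm
    · have h2 : ∀ᶠ z : ℝ × S in 𝓝 ((0 : ℝ), p), z.2 ∈ (K j)ᶜ :=
        continuous_snd.continuousAt.eventually ((hKc j).isOpen_compl.mem_nhds hp)
      filter_upwards [h2] with z hz hz'
      exact absurd hz' hz
  filter_upwards [(Filter.eventually_all_finset T).2 h1] with z hz
  exact hz _ (hiT _) (hiK _)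

variable {E : Type*} [NormedAddCommGroup E] [NormedSpace ℝ E] [FiniteDimensional ℝ E]

theorem exists_contDiff_extension {F : Type*} [NormedAddCommGroup F] [NormedSpace ℝ F] {X : E → F}
    {x₀ : E} (hX : ∀ᶠ x in 𝓝 x₀, ContDiffAt ℝ ∞ X x) :
    ∃ v : E → F, ContDiff ℝ ∞ v ∧ v =ᶠ[𝓝 x₀] X := by
  obtain ⟨r, hr, hball⟩ := Metric.eventually_nhds_iff_ball.1 hX
  let χ : ContDiffBump x₀ := ⟨r / 3, r / 2, by positivity, by linarith⟩
  refine ⟨fun x => χ x • X x, ?_, ?_⟩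
  · rw [contDiff_iff_contDiffAt]
    intro x
    by_cases hx : x ∈ tsupport χ
    · rw [χ.tsupport_eq] at hx
      exact χ.contDiffAt.smul (hball x (Metric.closedBall_subset_ball (by simp [χ]; linarith) hx))
    · have h1 : ∀ᶠ y in 𝓝 x, y ∈ (tsupport χ)ᶜ := (isClosed_tsupport _).isOpen_compl.mem_nhds hx
      refine (contDiffAt_const (c := (0 : F))).congr_of_eventuallyEq ?_
      filter_upwards [h1] with y hy
      rw [image_eq_zero_of_notMem_tsupport hy, zero_smul]
  · filter_upwards [χ.eventuallyEq_one] with x hx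
    rw [hx]; simp

/-- Uniqueness for ordinary differential equations with a parameter. Shrinking to a product
neighbourhood gives one time interval for all nearby initial points. -/
theorem eventually_eq_of_ode {S : Type*} [TopologicalSpace S] {X : E → E} {q : S}
    {γ γ' : ℝ × S → E} (hX : ContDiffAt ℝ 1 X (γ (0, q))) (hγ : ContinuousAt γ (0, q))
    (hγ' : ContinuousAt γ' (0, q))
    (hd : ∀ᶠ z in 𝓝 ((0 : ℝ), q), HasDerivAt (fun t => γ (t, z.2)) (X (γ z)) z.1)
    (hd' : ∀ᶠ z in 𝓝 ((0 : ℝ), q), HasDerivAt (fun t => γ' (t, z.2)) (X (γ' z)) z.1)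
    (h0 : ∀ᶠ q' in 𝓝 q, γ (0, q') = γ' (0, q')) : γ =ᶠ[𝓝 ((0 : ℝ), q)] γ' := by
  obtain ⟨K, s, hs, hK⟩ := hX.exists_lipschitzOnWith
  have h00 : γ (0, q) = γ' (0, q) := h0.self_of_nhds
  have h1 : ∀ᶠ z in 𝓝 ((0 : ℝ), q), γ z ∈ s := hγ.eventually hs
  have h2 : ∀ᶠ z in 𝓝 ((0 : ℝ), q), γ' z ∈ s := hγ'.eventually (by rw [← h00]; exact hs)
  have h3 := ((hd.and hd').and (h1.and h2))
  rw [nhds_prod_eq] at h3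
  obtain ⟨pa, ha, pb, hb, hab⟩ := Filter.eventually_prod_iff.1 h3
  obtain ⟨δ, hδ, hball⟩ := Metric.eventually_nhds_iff_ball.1 ha
  have hI : ∀ t ∈ Ioo (-δ) δ, pa t := fun t ht => hball t (by
    rw [Real.ball_eq_Ioo]; simpa using ht)
  rw [nhds_prod_eq]
  filter_upwards [prod_mem_prod (Ioo_mem_nhds (neg_lt_zero.2 hδ) hδ) (hb.and h0)] with z hz
  have h4 : EqOn (fun t => γ (t, z.2)) (fun t => γ' (t, z.2)) (Ioo (-δ) δ) := by
    refine ODE_solution_unique_of_mem_Ioo (v := fun _ => X) (s := fun _ => s) (K := K) (t₀ := 0)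
      (fun t _ => hK) ⟨neg_lt_zero.2 hδ, hδ⟩ (fun t ht => ?_) (fun t ht => ?_) hz.2.2
    · have := hab (hI t ht) hz.2.1
      exact ⟨this.1.1, this.2.1⟩
    · have := hab (hI t ht) hz.2.1
      exact ⟨this.1.2, this.2.2⟩
  exact h4 hz.1

end HamiltonianFlow

/-! ### Hamiltonian vector fields of a Kähler metric -/

section Symplectic

variable {G : E → E →L[ℝ] E →L[ℝ] ℝ} {U : Set E}

/-- The Hamiltonian vector field of `K`, characterised by `ω(X, ·) = dK`. -/
def hamiltonianField (G : E → E →L[ℝ] E →L[ℝ] ℝ) (K : E → ℝ) (x : E) : E :=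
  -((Complex.I • ContinuousLinearMap.id ℝ E : E →L[ℝ] E) ((G x).inverse (fderiv ℝ K x)))

theorem apply_hamiltonianField (hG : IsMetricOn G U) (K : E → ℝ) {x : E} (hx : x ∈ U) (w : E) :
    G x (Complex.I • hamiltonianField G K x) w = fderiv ℝ K x w := by
  have h1 : Complex.I • hamiltonianField G K x = (G x).inverse (fderiv ℝ K x) := by
    rw [hamiltonianField]
    generalize (G x).inverse (fderiv ℝ K x) = w
    change Complex.I • -(Complex.I • w) = w
    rw [smul_neg, I_smul_I_smul, neg_neg]
  rw [h1, hG.apply_inverse hx]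

theorem eq_hamiltonianField (hG : IsMetricOn G U) {K : E → ℝ} {x : E} (hx : x ∈ U) {v : E}
    (h : ∀ w, G x (Complex.I • v) w = fderiv ℝ K x w) : v = hamiltonianField G K x := by
  have h1 : Complex.I • v = Complex.I • hamiltonianField G K x :=
    hG.eq_of_forall hx fun w => by rw [h, apply_hamiltonianField hG K hx]
  exact smul_right_injective E Complex.I_ne_zero h1

theorem contDiffAt_hamiltonianField (hG : IsMetricOn G U) {K : E → ℝ} {x : E} (hx : x ∈ U)
    (hK : ContDiffAt ℝ ∞ K x) : ContDiffAt ℝ ∞ (hamiltonianField G K) x :=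
  ((Complex.I • ContinuousLinearMap.id ℝ E : E →L[ℝ] E).contDiff.contDiffAt.comp x
    ((hG.contDiffAt_inverse hx).clm_apply (hK.fderiv_right (m := ∞) (by simp)))).neg

/-- The infinitesimal invariance of a closed form under a Hamiltonian vector field. -/
theorem hamiltonianField_invariant (hG : IsKahlerOn G U) {K : E → ℝ} {x : E} (hx : x ∈ U)
    (hK : ContDiffAt ℝ ∞ K x) (a b : E) : fderiv ℝ G x (hamiltonianField G K x) (Complex.I • a) b
      + G x (Complex.I • fderiv ℝ (hamiltonianField G K) x a) b
      + G x (Complex.I • a) (fderiv ℝ (hamiltonianField G K) x b) = 0 := by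
  have hG' := hG.toIsMetricOn
  set X := hamiltonianField G K with hX
  have hXd : HasFDerivAt X (fderiv ℝ X x) x :=
    ((contDiffAt_hamiltonianField hG' hx hK).differentiableAt (by simp)).hasFDerivAt
  have hdK : HasFDerivAt (fderiv ℝ K) (fderiv ℝ (fderiv ℝ K) x) x :=
    ((hK.fderiv_right (m := ∞) (by simp)).differentiableAt (by simp)).hasFDerivAt
  have hsymm := (hK.isSymmSndFDerivAt (by simpa using two_le_infty)).eq a b
  set J : E →L[ℝ] E := Complex.I • ContinuousLinearMap.id ℝ E with hJ
  have hJa : ∀ v, J v = Complex.I • v := fun v => rfl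
  -- This differentiates `ω(X, ·) = dK`. By symmetry of the second derivative of `K` the form `ω(X,
  -- ·)` is closed; together with `dω = 0` this is Cartan's formula for the Lie derivative of `ω`.
  have hdiff : ∀ v w, fderiv ℝ G x v (Complex.I • X x) w + G x (Complex.I • fderiv ℝ X x v) w =
      fderiv ℝ (fderiv ℝ K) x v w := by
    intro v w
    have h1 := ((hG'.differentiableAt hx).hasFDerivAt.clm_apply
      (J.hasFDerivAt.comp x hXd)).clm_apply (hasFDerivAt_const w x)
    have h2 : (fun z => G z (J (X z)) w) =ᶠ[𝓝 x] fun z => fderiv ℝ K z w := by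
      filter_upwards [hG'.isOpen.mem_nhds hx] with z hz
      exact apply_hamiltonianField hG' K hz w
    have h3 := DFunLike.congr_fun (h1.unique
      ((hdK.clm_apply (hasFDerivAt_const w x)).congr_of_eventuallyEq h2)) v
    simp only [add_apply, ContinuousLinearMap.comp_apply, ContinuousLinearMap.flip_apply,
      Function.comp_apply, hJa, map_zero, zero_apply, zero_add] at h3
    linarith
  have hcl := hG.closed x hx (X x) a b
  have h4 := hdiff a b
  have h5 := hdiff b a
  have h6 : G x (Complex.I • a) (fderiv ℝ X x b) = -G x (Complex.I • fderiv ℝ X x b) a := by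
    rw [hG.apply_I_left hx, hG'.symm _ hx]
  have h7 : fderiv ℝ G x a (Complex.I • b) (X x) = -fderiv ℝ G x a (Complex.I • X x) b := by
    rw [hG.fderiv_I_left hx, hG'.fderiv_symm hx]
  rw [h6]
  linarith

/-- The flow of a Hamiltonian vector field is symplectic. -/
theorem exists_hamiltonian_flow (hG : IsKahlerOn G U) {K : E → ℝ} {x₀ : E} (hx₀ : x₀ ∈ U)
    (hK : ∀ᶠ x in 𝓝 x₀, ContDiffAt ℝ ∞ K x) :
    ∃ φ : ℝ × E → E, (∀ᶠ z in 𝓝 ((0 : ℝ), x₀), ContDiffAt ℝ ∞ φ z ∧ φ z ∈ U) ∧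
      (∀ᶠ x in 𝓝 x₀, φ (0, x) = x) ∧ (∀ᶠ z in 𝓝 ((0 : ℝ), x₀),
        HasDerivAt (fun t => φ (t, z.2)) (hamiltonianField G K (φ z)) z.1) ∧
      ∀ᶠ z in 𝓝 ((0 : ℝ), x₀), ∀ a b, G (φ z) (Complex.I • fderiv ℝ φ z (0, a))
        (fderiv ℝ φ z (0, b)) = G z.2 (Complex.I • a) b := by
  have hG' := hG.toIsMetricOn
  set X := hamiltonianField G K with hX
  have hUx : ∀ᶠ x in 𝓝 x₀, x ∈ U := hG'.isOpen.mem_nhds hx₀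
  -- The flow theorem is stated for fields smooth on the whole space, so `X` is replaced by a field
  -- agreeing with it near `x₀`.
  obtain ⟨v, hv, hvX⟩ := exists_contDiff_extension
    ((hUx.and hK).mono fun x hx => contDiffAt_hamiltonianField hG' hx.1 hx.2)
  obtain ⟨φ, hφs, hφ0, hφd⟩ := exists_smooth_flow hv x₀
  have hφc : ContinuousAt φ (0, x₀) := hφs.self_of_nhds.continuousAt
  have hφ00 : φ (0, x₀) = x₀ := hφ0.self_of_nhds
  have hgood : ∀ᶠ x in 𝓝 x₀, x ∈ U ∧ ContDiffAt ℝ ∞ K x ∧ v =ᶠ[𝓝 x] X :=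
    hUx.and (hK.and hvX.eventuallyEq_nhds)
  have hgood' : ∀ᶠ z in 𝓝 ((0 : ℝ), x₀), φ z ∈ U ∧ ContDiffAt ℝ ∞ K (φ z) ∧ v =ᶠ[𝓝 (φ z)] X :=
    hφc.eventually (by rw [hφ00]; exact hgood)
  have hd : ∀ᶠ z in 𝓝 ((0 : ℝ), x₀), HasDerivAt (fun t => φ (t, z.2)) (X (φ z)) z.1 := by
    filter_upwards [hφd, hgood'] with z h1 h2
    rw [← h2.2.2.self_of_nhds]; exact h1
  refine ⟨φ, hφs.and (hgood'.mono fun z hz => hz.1), hφ0, hd, ?_⟩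
  -- the pull back of the form is constant in time
  have hder : ∀ᶠ z in 𝓝 ((0 : ℝ), x₀), ∀ a b, HasDerivAt (fun t => G (φ (t, z.2))
      (Complex.I • fderiv ℝ φ (t, z.2) (0, a)) (fderiv ℝ φ (t, z.2) (0, b))) 0 z.1 := by
    filter_upwards [hφs, hgood', hd, hφd.eventually_nhds] with z h1 h2 h3 h4 a b
    have hdφ : HasFDerivAt φ (fderiv ℝ φ z) z := (h1.differentiableAt (by simp)).hasFDerivAt
    have hdφ2 : HasFDerivAt (fderiv ℝ φ) (fderiv ℝ (fderiv ℝ φ) z) z :=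
      ((h1.fderiv_right (m := ∞) (by simp)).differentiableAt (by simp)).hasFDerivAt
    have hline : HasDerivAt (fun t : ℝ => (t, z.2)) ((1 : ℝ), (0 : E)) z.1 :=
      (hasDerivAt_id z.1).prodMk (hasDerivAt_const z.1 z.2)
    have hXd : HasFDerivAt v (fderiv ℝ X (φ z)) (φ z) := by
      have : fderiv ℝ v (φ z) = fderiv ℝ X (φ z) := h2.2.2.fderiv_eq
      rw [← this]
      exact (hv.differentiable (by simp) _).hasFDerivAt
    have htime : (fun z' => fderiv ℝ φ z' (1, 0)) =ᶠ[𝓝 z] fun z' => v (φ z') := by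
      have hs : ∀ᶠ z' in 𝓝 z, DifferentiableAt ℝ φ z' :=
        ((h1.of_le (m := 1) (by exact_mod_cast le_top)).eventually (by simp)).mono
          fun z' hz' => hz'.differentiableAt (by simp)
      filter_upwards [h4, hs] with z' h5 h6
      have h7 : HasDerivAt (fun t => φ (t, z'.2)) (fderiv ℝ φ z' (1, 0)) z'.1 :=
        HasFDerivAt.comp_hasDerivAt (f := fun t : ℝ => (t, z'.2)) z'.1 h6.hasFDerivAt
          ((hasDerivAt_id z'.1).prodMk (hasDerivAt_const z'.1 z'.2))
      exact h7.unique h5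
    have hmix : ∀ c : E, fderiv ℝ (fderiv ℝ φ) z (1, 0) (0, c) =
        fderiv ℝ X (φ z) (fderiv ℝ φ z (0, c)) := by
      intro c
      have hsym := (h1.isSymmSndFDerivAt (by simpa using two_le_infty)).eq
        ((1 : ℝ), (0 : E)) ((0 : ℝ), c)
      rw [hsym]
      have h5 := hdφ2.clm_apply (hasFDerivAt_const ((1 : ℝ), (0 : E)) z)
      have h6 := h5.unique ((hXd.comp z hdφ).congr_of_eventuallyEq htime)
      have h7 := DFunLike.congr_fun h6 ((0 : ℝ), c)
      simpa using h7
    have hcol : ∀ c : E, HasDerivAt (fun t => fderiv ℝ φ (t, z.2) (0, c))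
        (fderiv ℝ X (φ z) (fderiv ℝ φ z (0, c))) z.1 := by
      intro c
      rw [← hmix c]
      have h5 : HasDerivAt (fun t => fderiv ℝ φ (t, z.2)) (fderiv ℝ (fderiv ℝ φ) z (1, 0)) z.1 :=
        HasFDerivAt.comp_hasDerivAt (f := fun t : ℝ => (t, z.2)) z.1 hdφ2 hline
      have h6 := h5.clm_apply (hasDerivAt_const z.1 ((0 : ℝ), c))
      simpa using h6
    have hGd : HasDerivAt (fun t => G (φ (t, z.2))) (fderiv ℝ G (φ z) (X (φ z))) z.1 :=
      HasFDerivAt.comp_hasDerivAt (f := fun t : ℝ => φ (t, z.2)) z.1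
        (hG'.differentiableAt h2.1).hasFDerivAt h3
    set J : E →L[ℝ] E := Complex.I • ContinuousLinearMap.id ℝ E with hJ
    have h8 := (hGd.clm_apply (J.hasFDerivAt.comp_hasDerivAt z.1 (hcol a))).clm_apply (hcol b)
    have h9 := hamiltonianField_invariant hG h2.1 h2.2.1 (fderiv ℝ φ z (0, a))
      (fderiv ℝ φ z (0, b))
    refine h8.congr_deriv ?_
    simp only [add_apply]
    exact h9
  have h10 := hder
  rw [nhds_prod_eq] at h10
  obtain ⟨pa, ha, pb, hb, hab⟩ := Filter.eventually_prod_iff.1 h10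
  obtain ⟨δ, hδ, hball⟩ := Metric.eventually_nhds_iff_ball.1 ha
  have hinit : ∀ᶠ x in 𝓝 x₀, ∀ a, fderiv ℝ φ (0, x) (0, a) = a := by
    have hs : ∀ᶠ x in 𝓝 x₀, ContDiffAt ℝ ∞ φ (0, x) :=
      (Continuous.prodMk_right (0 : ℝ)).continuousAt.eventually hφs
    filter_upwards [hφ0.eventually_nhds, hs] with x h1 h2 a
    have h3 : HasFDerivAt (fun x' : E => φ (0, x')) ((fderiv ℝ φ (0, x)).comp
        (ContinuousLinearMap.inr ℝ ℝ E)) x :=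
      HasFDerivAt.comp (f := fun x' : E => ((0 : ℝ), x')) x
        (h2.differentiableAt (by simp)).hasFDerivAt (hasFDerivAt_prodMk_right (0 : ℝ) x)
    have h4 := h3.unique ((hasFDerivAt_id x).congr_of_eventuallyEq h1)
    have h5 := DFunLike.congr_fun h4 a
    simpa using h5
  rw [nhds_prod_eq]
  filter_upwards [prod_mem_prod (Metric.ball_mem_nhds (0 : ℝ) hδ) (hb.and (hinit.and hφ0))]
    with z hz a b
  obtain ⟨hz1, hz2, hz3, hz4⟩ := hz
  set f : ℝ → ℝ := fun t => G (φ (t, z.2)) (Complex.I • fderiv ℝ φ (t, z.2) (0, a))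
    (fderiv ℝ φ (t, z.2) (0, b)) with hf
  have hfd : ∀ t ∈ Metric.ball (0 : ℝ) δ, HasDerivAt f 0 t := fun t ht =>
    hab (hball t ht) hz2 a b
  have hconst : f z.1 = f 0 :=
    (convex_ball (0 : ℝ) δ).is_const_of_fderivWithin_eq_zero (𝕜 := ℝ)
      (fun t ht => (hfd t ht).differentiableAt.differentiableWithinAt)
      (fun t ht => by
        rw [fderivWithin_of_isOpen Metric.isOpen_ball ht]
        ext; simp [(hfd t ht).deriv]) hz1 (Metric.mem_ball_self hδ)
  have h0 : f 0 = G z.2 (Complex.I • a) b := by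
    simp only [hf]
    rw [hz3, hz3, hz4]
  exact hconst.trans h0

end Symplectic

/-! ## Hamiltonian flows on the manifold -/

section ManifoldFlow

theorem fundamentalForm_congr (g : Metric (E := E) N) {x x' : N} (h : x = x') (v w : E) :
    fundamentalForm g x v w = fundamentalForm g x' v w := by
  subst h; rfl

/-- The Hamiltonian vector field of `H` in the chart `e`. -/
def chartField (g : Metric (E := E) N) (H : N → ℝ) (e : OpenPartialHomeomorph N E) : E → E :=
  hamiltonianField (inChart g.inner e) (H ∘ e.symm)

theorem contDiffAt_comp_chart_symm (he : e ∈ atlas E N) {H : N → ℝ}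
    {y : E} (hy : y ∈ e.target) (hH : ContMDiffAt 𝓘(ℝ, E) 𝓘(ℝ, ℝ) ∞ H (e.symm y)) :
    ContDiffAt ℝ ∞ (H ∘ e.symm) y :=
  (hH.comp y (chart_symm_contMDiffAt (isChart_of_mem_atlas he) hy)).contDiffAt

theorem chartField_congr {H H' : N → ℝ} {y : E}
    (hy : y ∈ e.target) {C : ℝ} (h : ∀ᶠ x in 𝓝 (e.symm y), H x = H' x + C) :
    chartField g H e y = chartField g H' e y := by
  have h1 : H ∘ e.symm =ᶠ[𝓝 y] fun z => (H' ∘ e.symm) z + C :=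
    (e.continuousAt_symm hy).eventually h
  rw [chartField, chartField, hamiltonianField, hamiltonianField, h1.fderiv_eq, fderiv_add_const]

/-- Transition maps preserve the fundamental form, and the field is determined by `ω(X, ·) = dH`. -/
theorem chartField_transform {e e' : OpenPartialHomeomorph N E}
    (he : e ∈ atlas E N) (he' : e' ∈ atlas E N) {H : N → ℝ} {y : E} (hy : y ∈ e.target)
    (hy' : e.symm y ∈ e'.source) (hH : ContMDiffAt 𝓘(ℝ, E) 𝓘(ℝ, ℝ) ∞ H (e.symm y)) :
    fderiv ℝ (e' ∘ e.symm) y (chartField g H e y) = chartField g H e' (e' (e.symm y)) := by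
  have hm := isChart_of_mem_atlas he
  have hm' := isChart_of_mem_atlas he'
  have hG := isMetricOn_inChart g hm
  have hG' := isMetricOn_inChart g hm'
  have hx' : e' (e.symm y) ∈ e'.target := e'.map_source hy'
  have hl : e'.symm (e' (e.symm y)) = e.symm y := e'.left_inv hy'
  set Φ : E → E := e' ∘ e.symm with hΦ
  have hinj : Function.Injective (fderiv ℝ Φ y) := fun v w hvw => by
    rw [← fderiv_transition_symm hm hm' hy hy' v, ← fderiv_transition_symm hm hm' hy hy' w]
    exact congrArg _ hvw
  have hsurj : Function.Surjective (fderiv ℝ Φ y) := LinearMap.injective_iff_surjective.1 hinj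
  refine eq_hamiltonianField hG' hx' fun w => ?_
  obtain ⟨w', rfl⟩ := hsurj w
  have h2 : ∀ v, mfderiv 𝓘(ℝ, E) 𝓘(ℝ, E) e'.symm (e' (e.symm y)) (fderiv ℝ Φ y v) =
      mfderiv 𝓘(ℝ, E) 𝓘(ℝ, E) e.symm y v := fderiv_transition hm hm' hy hy'
  rw [← inChart_fundamentalForm g he' hx', inChart_apply, h2, h2]
  refine (fundamentalForm_congr g hl _ _).trans ?_
  refine Eq.trans (inChart_apply _ e y _ w').symm ?_
  rw [inChart_fundamentalForm g he hy]
  refine (apply_hamiltonianField hG _ hy w').trans ?_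
  have h3 : H ∘ e.symm =ᶠ[𝓝 y] (H ∘ e'.symm) ∘ Φ := by
    filter_upwards [(e.continuousAt_symm hy).eventually (e'.open_source.mem_nhds hy')] with z hz
    simp only [hΦ, Function.comp_apply]
    rw [e'.left_inv hz]
  have h4 : DifferentiableAt ℝ (H ∘ e'.symm) (Φ y) :=
    (contDiffAt_comp_chart_symm he' hx' (by rw [hl]; exact hH)).differentiableAt (by simp)
  have h5 : DifferentiableAt ℝ Φ y := (contDiffAt_transition hm hm' hy hy').differentiableAt
    (by simp)
  rw [h3.fderiv_eq, fderiv_comp y h4 h5]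
  rfl

/-- `L` follows, near `(0, p)`, the Hamiltonian vector field of `H`, in the chart `e`. -/
def FollowsField (g : Metric (E := E) N) (H : N → ℝ) (e : OpenPartialHomeomorph N E)
    (L : ℝ × S → N) (p : S) : Prop :=
  ∀ᶠ z in 𝓝 ((0 : ℝ), p), L z ∈ e.source ∧
    HasDerivAt (fun t => e (L (t, z.2))) (chartField g H e (e (L z))) z.1

/-- The Hamiltonian field depends neither on the chart nor on an additive constant in the
Hamiltonian. This makes the local flows comparable at neighbouring points of the surface. -/
theorem FollowsField.congr {e e' : OpenPartialHomeomorph N E} (he : e ∈ atlas E N)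
    (he' : e' ∈ atlas E N) {H H' : N → ℝ} {L : ℝ × S → N} {p : S} (h : FollowsField g H e L p)
    (hL : ContinuousAt L (0, p)) (hp : L (0, p) ∈ e'.source) {C : ℝ}
    (hH : ∀ᶠ x in 𝓝 (L (0, p)), ContMDiffAt 𝓘(ℝ, E) 𝓘(ℝ, ℝ) ∞ H x)
    (hHH : ∀ᶠ x in 𝓝 (L (0, p)), H x = H' x + C) : FollowsField g H' e' L p := by
  have hm := isChart_of_mem_atlas he
  have hm' := isChart_of_mem_atlas he'
  have h1 : ∀ᶠ z in 𝓝 ((0 : ℝ), p), L z ∈ e'.source :=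
    hL.eventually (e'.open_source.mem_nhds hp)
  filter_upwards [h, h.eventually_nhds, h1, hL.eventually (hH.and hHH.eventually_nhds)]
    with z hz hzn hz' hzH
  refine ⟨hz', ?_⟩
  have hy : e (L z) ∈ e.target := e.map_source hz.1
  have hl : e.symm (e (L z)) = L z := e.left_inv hz.1
  have h2 : HasFDerivAt (e' ∘ e.symm) (fderiv ℝ (e' ∘ e.symm) (e (L z))) (e (L z)) :=
    ((contDiffAt_transition hm hm' hy (by rw [hl]; exact hz')).differentiableAt
      (by simp)).hasFDerivAt
  have h3 := HasFDerivAt.comp_hasDerivAt (f := fun t : ℝ => e (L (t, z.2))) z.1 h2 hz.2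
  rw [chartField_transform he he' hy (by rw [hl]; exact hz') (by rw [hl]; exact hzH.1), hl,
    chartField_congr (H' := H') (e'.map_source hz')
      (by rw [e'.left_inv hz']; exact hzH.2)] at h3
  refine h3.congr_of_eventuallyEq ?_
  have h4 : ∀ᶠ t in 𝓝 z.1, L (t, z.2) ∈ e.source := by
    have h5 : Tendsto (fun t : ℝ => (t, z.2)) (𝓝 z.1) (𝓝 z) := by
      have : Continuous fun t : ℝ => (t, z.2) := by fun_prop
      exact this.tendsto z.1
    exact h5.eventually (hzn.mono fun w hw => hw.1)
  filter_upwards [h4] with t ht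
  simp only [Function.comp_apply]
  rw [e.left_inv ht]

theorem FollowsField.eventuallyEq (he : e ∈ atlas E N)
    {H : N → ℝ} {L L' : ℝ × S → N} {p : S} (h : FollowsField g H e L p)
    (h' : FollowsField g H e L' p) (hL : ContinuousAt L (0, p)) (hL' : ContinuousAt L' (0, p))
    (hH : ContMDiffAt 𝓘(ℝ, E) 𝓘(ℝ, ℝ) ∞ H (L (0, p)))
    (h0 : ∀ᶠ q in 𝓝 p, L (0, q) = L' (0, q)) : L =ᶠ[𝓝 ((0 : ℝ), p)] L' := by
  have hs := h.self_of_nhds.1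
  have hs' := h'.self_of_nhds.1
  have hX : ContDiffAt ℝ 1 (chartField g H e) (e (L (0, p))) :=
    (contDiffAt_hamiltonianField (isMetricOn_inChart g (isChart_of_mem_atlas he))
      (e.map_source hs) (contDiffAt_comp_chart_symm he (e.map_source hs)
        (by rw [e.left_inv hs]; exact hH))).of_le (by exact_mod_cast le_top)
  have h1 := eventually_eq_of_ode (γ := fun z => e (L z)) (γ' := fun z => e (L' z)) hX
    (ContinuousAt.comp (f := L) (g := e) (e.continuousAt hs) hL)
    (ContinuousAt.comp (f := L') (g := e) (e.continuousAt hs') hL') (h.mono fun z hz => hz.2)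
    (h'.mono fun z hz => hz.2) (h0.mono fun q hq => by rw [hq])
  filter_upwards [h, h', h1] with z h2 h3 h4
  exact e.injOn h2.1 h3.1 h4

/-- A germ of a function near `ℓ p` generates a germ of a lagrangian deformation. -/
theorem exists_lagrangian_flow (hKahler : IsKahler g) (hℓ : ContMDiff (𝓡 2) 𝓘(ℝ, E) ∞ ℓ)
    (hlag : IsLagrangian g ℓ) {H : N → ℝ} {p : S}
    (hH : ∀ᶠ x in 𝓝 (ℓ p), ContMDiffAt 𝓘(ℝ, E) 𝓘(ℝ, ℝ) ∞ H x) : ∃ L : ℝ × S → N,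
      (∀ᶠ z in 𝓝 ((0 : ℝ), p), ContMDiffAt (𝓘(ℝ, ℝ).prod (𝓡 2)) 𝓘(ℝ, E) ∞ L z) ∧
      (∀ᶠ q in 𝓝 p, L (0, q) = ℓ q) ∧ FollowsField g H (chartAt E (ℓ p)) L p ∧
      ∀ᶠ z in 𝓝 ((0 : ℝ), p), ∀ v w : TangentSpace (𝓡 2) z.2,
        fundamentalForm g (L z) (mfderiv (𝓡 2) 𝓘(ℝ, E) (fun q => L (z.1, q)) z.2 v)
          (mfderiv (𝓡 2) 𝓘(ℝ, E) (fun q => L (z.1, q)) z.2 w) = 0 := by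
  set e := chartAt E (ℓ p) with hee
  have he : e ∈ atlas E N := chart_mem_atlas E (ℓ p)
  have hm := isChart_of_mem_atlas he
  have hpe : ℓ p ∈ e.source := mem_chart_source E (ℓ p)
  have hG := isKahlerOn_inChart hKahler he
  have hx₀ : e (ℓ p) ∈ e.target := e.map_source hpe
  have hK : ∀ᶠ y in 𝓝 (e (ℓ p)), ContDiffAt ℝ ∞ (H ∘ e.symm) y := by
    have h1 : Tendsto e.symm (𝓝 (e (ℓ p))) (𝓝 (ℓ p)) := e.tendsto_symm hpe
    filter_upwards [e.open_target.mem_nhds hx₀, h1.eventually hH] with y hy hyH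
    exact contDiffAt_comp_chart_symm he hy hyH
  obtain ⟨φ, hφs, hφ0, hφd, hφω⟩ := exists_hamiltonian_flow hG hx₀ hK
  have hsrc : ∀ᶠ q in 𝓝 p, ℓ q ∈ e.source :=
    hℓ.continuous.continuousAt.eventually (e.open_source.mem_nhds hpe)
  have hA : Tendsto (fun z : ℝ × S => (z.1, e (ℓ z.2))) (𝓝 (0, p)) (𝓝 (0, e (ℓ p))) := by
    refine Tendsto.prodMk_nhds continuous_fst.continuousAt ?_
    exact (((e.continuousAt hpe).comp hℓ.continuous.continuousAt).comp
      (f := fun z : ℝ × S => z.2) (x := ((0 : ℝ), p)) continuous_snd.continuousAt)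
  have hsrc' : ∀ᶠ z in 𝓝 ((0 : ℝ), p), ℓ z.2 ∈ e.source :=
    (continuous_snd.tendsto ((0 : ℝ), p)).eventually hsrc
  -- The surface is carried along by the local flow. It remains lagrangian because the flow
  -- preserves `ω`.
  refine ⟨fun z => e.symm (φ (z.1, e (ℓ z.2))), ?_, ?_, ?_, ?_⟩
  · filter_upwards [hA.eventually hφs, hsrc'] with z hz hzs
    have h1 : ContMDiffAt (𝓘(ℝ, ℝ).prod (𝓡 2)) 𝓘(ℝ, E) ∞ (fun z : ℝ × S => e (ℓ z.2)) z :=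
      ((chart_contMDiffAt hm hzs).comp z.2 hℓ.contMDiffAt).comp z contMDiffAt_snd
    have h2 : ContMDiffAt (𝓘(ℝ, ℝ).prod (𝓡 2)) 𝓘(ℝ, ℝ × E) ∞
        (fun z : ℝ × S => (z.1, e (ℓ z.2))) z := contMDiffAt_fst.prodMk_space h1
    exact (chart_symm_contMDiffAt hm hz.2).comp z
      (ContMDiffAt.comp z (g := φ) (f := fun z : ℝ × S => (z.1, e (ℓ z.2)))
        hz.1.contMDiffAt h2)
  · have h1 : ∀ᶠ q in 𝓝 p, φ (0, e (ℓ q)) = e (ℓ q) :=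
      ((e.continuousAt hpe).comp hℓ.continuous.continuousAt).eventually hφ0
    filter_upwards [h1, hsrc] with q h2 h3
    rw [h2, e.left_inv h3]
  · filter_upwards [hA.eventually hφs, hA.eventually hφd,
      (hA.eventually hφs.eventually_nhds)] with z h1 h2 h3
    refine ⟨e.map_target h1.2, ?_⟩
    simp only [e.right_inv h1.2]
    refine h2.congr_of_eventuallyEq ?_
    have h5 : Tendsto (fun t : ℝ => (t, e (ℓ z.2))) (𝓝 z.1) (𝓝 (z.1, e (ℓ z.2))) := by
      have : Continuous fun t : ℝ => (t, e (ℓ z.2)) := by fun_prop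
      exact this.tendsto z.1
    filter_upwards [h5.eventually h3] with t ht
    exact e.right_inv ht.2
  · filter_upwards [hA.eventually hφs, hA.eventually hφω, hsrc'] with z h1 h2 h3 v w
    have hℓd : MDifferentiableAt (𝓡 2) 𝓘(ℝ, E) ℓ z.2 := hℓ.contMDiffAt.mdifferentiableAt (by simp)
    have hed : MDifferentiableAt 𝓘(ℝ, E) 𝓘(ℝ, E) e (ℓ z.2) :=
      (chart_contMDiffAt hm h3).mdifferentiableAt (by simp)
    set x := e (ℓ z.2) with hx
    have hφx : HasFDerivAt (fun x' : E => φ (z.1, x')) ((fderiv ℝ φ (z.1, x)).comp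
        (ContinuousLinearMap.inr ℝ ℝ E)) x :=
      HasFDerivAt.comp (f := fun x' : E => (z.1, x')) x
        (h1.1.differentiableAt (by simp)).hasFDerivAt (hasFDerivAt_prodMk_right z.1 x)
    have hsd : MDifferentiableAt 𝓘(ℝ, E) 𝓘(ℝ, E) e.symm (φ (z.1, x)) :=
      (chart_symm_contMDiffAt hm h1.2).mdifferentiableAt (by simp)
    have hcomp := HasMFDerivAt.comp z.2 (g := e.symm)
      (f := fun q => φ (z.1, e (ℓ q))) hsd.hasMFDerivAt
      (HasMFDerivAt.comp z.2 (g := fun x' : E => φ (z.1, x')) (f := fun q => e (ℓ q))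
        hφx.hasMFDerivAt (HasMFDerivAt.comp z.2 hed.hasMFDerivAt hℓd.hasMFDerivAt))
    have hd : ∀ v, mfderiv (𝓡 2) 𝓘(ℝ, E) (fun q => e.symm (φ (z.1, e (ℓ q)))) z.2 v =
        mfderiv 𝓘(ℝ, E) 𝓘(ℝ, E) e.symm (φ (z.1, x)) (fderiv ℝ φ (z.1, x)
          (0, mfderiv 𝓘(ℝ, E) 𝓘(ℝ, E) e (ℓ z.2) (mfderiv (𝓡 2) 𝓘(ℝ, E) ℓ z.2 v))) := by
      intro v
      exact DFunLike.congr_fun hcomp.mfderiv v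
    rw [hd, hd]
    refine Eq.trans (inChart_apply (fundamentalForm g) e (φ (z.1, x)) _ _).symm ?_
    rw [inChart_fundamentalForm g he h1.2]
    refine (h2 _ _).trans ?_
    have hinv : ∀ v : TangentSpace 𝓘(ℝ, E) (ℓ z.2), mfderiv 𝓘(ℝ, E) 𝓘(ℝ, E) e.symm x
      (mfderiv 𝓘(ℝ, E) 𝓘(ℝ, E) e (ℓ z.2) v) = v := mfderiv_symm_mfderiv hm h3
    refine Eq.trans (inChart_fundamentalForm g he (e.map_source h3) _ _).symm ?_
    refine Eq.trans (inChart_apply (fundamentalForm g) e x _ _) ?_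
    rw [hinv, hinv]
    exact (fundamentalForm_congr g (e.left_inv h3) _ _).trans (hlag z.2 v w)

end ManifoldFlow

/-! ## Retractions onto an immersed surface -/

section Retraction

variable {V : Type*} [NormedAddCommGroup V] [InnerProductSpace ℝ V] [FiniteDimensional ℝ V]

/-- `s` is a foot point of `z` on the surface `u`. -/
def IsFootPoint (u : S → V) (z : V) (s : S) : Prop :=
  ∀ v : TangentSpace (𝓡 2) s, inner ℝ (u s - z) (mfderiv (𝓡 2) 𝓘(ℝ, V) u s v : V) = 0

/-- `r` is the germ at `u p` of the foot point map. -/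
structure IsRetractionGerm (u : S → V) (p : S) (r : V → S) : Prop where
  apply_eq : r (u p) = p
  smooth : ∀ᶠ z in 𝓝 (u p), ContMDiffAt 𝓘(ℝ, V) (𝓡 2) ∞ r z
  iff : ∀ᶠ w in 𝓝 (u p, p), IsFootPoint u w.1 w.2 ↔ r w.1 = w.2

/-- The implicit function theorem for the equation `⟨w y - z, dw y ·⟩ = 0` in `y`. At the base point
the term with the second derivative of `w` drops out, as `w y - z` is zero there, and what remains
is the induced metric `B`, which is invertible. -/
theorem exists_isRetractionGerm {u : S → V} (hu : ContMDiff (𝓡 2) 𝓘(ℝ, V) ∞ u) {p : S}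
    (hp : Function.Injective (mfderiv (𝓡 2) 𝓘(ℝ, V) u p)) :
    ∃ r : V → S, IsRetractionGerm u p r := by
  set c := chartAt Plane p
  have hc : IsChart c := isChart_chartAt p
  have hps : p ∈ c.source := mem_chart_source Plane p
  have hy₀ : c p ∈ c.target := c.map_source hps
  have hl : c.symm (c p) = p := c.left_inv hps
  set w : Plane → V := fun y => u (c.symm y) with hw
  have hws : ∀ y ∈ c.target, ContDiffAt ℝ ∞ w y := fun y hy =>
    (ContMDiffAt.comp y (g := u) (f := c.symm) hu.contMDiffAt
      (chart_symm_contMDiffAt hc hy)).contDiffAt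
  have hwd : ∀ y ∈ c.target, ∀ v, fderiv ℝ w y v =
      mfderiv (𝓡 2) 𝓘(ℝ, V) u (c.symm y) (mfderiv (𝓡 2) (𝓡 2) c.symm y v) := by
    intro y hy v
    rw [← mfderiv_eq_fderiv]
    have := mfderiv_comp y (g := u) (f := c.symm) (I' := 𝓡 2)
      (hu.contMDiffAt.mdifferentiableAt (by simp))
      ((chart_symm_contMDiffAt hc hy).mdifferentiableAt (by simp))
    exact DFunLike.congr_fun this v
  have hwp : w (c p) = u p := by rw [hw]; simp only [hl]
  set B : Plane →L[ℝ] Plane →L[ℝ] ℝ :=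
    ContinuousLinearMap.bilinearComp (innerSL ℝ) (fderiv ℝ w (c p)) (fderiv ℝ w (c p)) with hB
  have hBa : ∀ v v', B v v' = inner ℝ (fderiv ℝ w (c p) v) (fderiv ℝ w (c p) v') := fun _ _ => rfl
  have hBm : IsMetricOn (fun _ : Plane => B) univ := by
    refine ⟨isOpen_univ, contDiffOn_const, fun y _ v v' => ?_, fun y _ v hv => ?_⟩
    · rw [hBa, hBa, real_inner_comm]
    · rw [hBa, real_inner_self_eq_norm_sq]
      have h1 : fderiv ℝ w (c p) v ≠ 0 := by
        intro h0
        rw [hwd _ hy₀] at h0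
        have h2 : Function.Injective (mfderiv (𝓡 2) 𝓘(ℝ, V) u (c.symm (c p))) := by
          rw [hl]; exact hp
        have h3 := h2 (h0.trans (map_zero (mfderiv (𝓡 2) 𝓘(ℝ, V) u (c.symm (c p)))).symm)
        exact hv (mfderiv_symm_injective hc hy₀ h3)
      have := norm_pos_iff.2 h1
      positivity
  set Φ : V × Plane → Plane →L[ℝ] ℝ := fun x =>
    (innerSL ℝ (w x.2 - x.1)).comp (fderiv ℝ w x.2) with hΦ
  have hΦs : ∀ᶠ x in 𝓝 (u p, c p), ContDiffAt ℝ ∞ Φ x := by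
    have h1 : ∀ᶠ x : V × Plane in 𝓝 (u p, c p), x.2 ∈ c.target :=
      continuousAt_snd.eventually (c.open_target.mem_nhds hy₀)
    filter_upwards [h1] with x hx
    have h2 : ContDiffAt ℝ ∞ (fun x : V × Plane => w x.2 - x.1) x :=
      (ContDiffAt.comp x (g := w) (hws _ hx) contDiffAt_snd).sub contDiffAt_fst
    have h3 : ContDiffAt ℝ ∞ (fun x : V × Plane => fderiv ℝ w x.2) x :=
      ContDiffAt.comp x (g := fderiv ℝ w) ((hws _ hx).fderiv_right (m := ∞) (by simp))
        contDiffAt_snd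
    exact ((innerSL ℝ (E := V)).contDiff.contDiffAt.comp x h2).clm_comp h3
  have hΦ0 : Φ (u p, c p) = 0 := by
    ext v
    simp [hΦ, hwp]
  have hΦd : fderiv ℝ Φ (u p, c p) ∘L .inr ℝ V Plane = B := by
    have h1 : HasFDerivAt (fun y => Φ (u p, y)) (fderiv ℝ Φ (u p, c p) ∘L .inr ℝ V Plane) (c p) :=
      HasFDerivAt.comp (f := fun y : Plane => (u p, y)) (c p)
        (hΦs.self_of_nhds.differentiableAt (by simp)).hasFDerivAt (hasFDerivAt_prodMk_right (u p) _)
    have h2 : HasFDerivAt w (fderiv ℝ w (c p)) (c p) :=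
      ((hws _ hy₀).differentiableAt (by simp)).hasFDerivAt
    have h3 : HasFDerivAt (fderiv ℝ w) (fderiv ℝ (fderiv ℝ w) (c p)) (c p) :=
      (((hws _ hy₀).fderiv_right (m := ∞) (by simp)).differentiableAt (by simp)).hasFDerivAt
    have h4 : HasFDerivAt (fun y => innerSL ℝ (w y - u p)) ((innerSL ℝ).comp (fderiv ℝ w (c p)))
        (c p) := (innerSL ℝ (E := V)).hasFDerivAt.comp (c p) (h2.sub_const (u p))
    have h5 := h1.unique (h4.clm_comp h3)
    rw [h5]
    ext v v'
    simp [hBa, hwp]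
  obtain ⟨ψ, hψ0, hψs, hψiff, -⟩ := exists_smooth_implicitFunction (u := (u p, c p)) hΦs
    (by rw [hΦd]; exact hBm.isInvertible (mem_univ 0))
  simp only at hψ0 hψs
  have hψt : ∀ᶠ z in 𝓝 (u p), ψ z ∈ c.target :=
    hψs.self_of_nhds.continuousAt.eventually (c.open_target.mem_nhds (by rw [hψ0]; exact hy₀))
  refine ⟨fun z => c.symm (ψ z), ?_, ?_, ?_⟩
  · rw [hψ0, hl]
  · filter_upwards [hψs, hψt] with z h1 h2
    exact (chart_symm_contMDiffAt hc h2).comp z h1.contMDiffAt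
  · have h1 : Tendsto (fun x : V × S => (x.1, c x.2)) (𝓝 (u p, p)) (𝓝 (u p, c p)) :=
      continuousAt_fst.prodMk_nhds ((c.continuousAt hps).comp (f := fun x : V × S => x.2)
        (x := (u p, p)) continuousAt_snd)
    have h2 : ∀ᶠ x in 𝓝 (u p, p), x.2 ∈ c.source :=
      (continuous_snd.tendsto (u p, p)).eventually (c.open_source.mem_nhds hps)
    have h3 : ∀ᶠ x in 𝓝 (u p, p), ψ x.1 ∈ c.target :=
      (continuous_fst.tendsto (u p, p)).eventually hψt
    filter_upwards [h1.eventually hψiff, h2, h3] with x hx hxs hxt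
    have hls : c.symm (c x.2) = x.2 := c.left_inv hxs
    have h4 : IsFootPoint u x.1 x.2 ↔ Φ (x.1, c x.2) = 0 := by
      have h5 : ∀ v, Φ (x.1, c x.2) v = inner ℝ (u (c.symm (c x.2)) - x.1)
          (mfderiv (𝓡 2) 𝓘(ℝ, V) u (c.symm (c x.2)) (mfderiv (𝓡 2) (𝓡 2) c.symm (c x.2) v) : V) :=
        fun v => by
          rw [← hwd _ (c.map_source hxs)]
          rfl
      have h6 : IsFootPoint u x.1 x.2 ↔ IsFootPoint u x.1 (c.symm (c x.2)) := by rw [hls]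
      rw [h6]
      constructor
      · intro h
        ext v
        rw [h5]
        exact h _
      · intro h v
        have h7 : v = mfderiv (𝓡 2) (𝓡 2) c.symm (c x.2)
            (mfderiv (𝓡 2) (𝓡 2) c (c.symm (c x.2)) v) := by
          have := mfderiv_symm_mfderiv hc (c.map_target (c.map_source hxs)) v
          rw [c.right_inv (c.map_source hxs)] at this
          exact this.symm
        rw [h7]
        refine (h5 (mfderiv (𝓡 2) (𝓡 2) c (c.symm (c x.2)) v)).symm.trans ?_
        rw [h]
        rfl
    rw [h4, ← hΦ0, hx]
    constructor
    · intro h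
      rw [h, hls]
    · intro h
      rw [← h, c.right_inv hxt]

theorem IsRetractionGerm.eventually_apply {u : S → V} {p : S} {r : V → S}
    (h : IsRetractionGerm u p r) (hu : ContinuousAt u p) : ∀ᶠ q in 𝓝 p, r (u q) = q := by
  have h1 : Tendsto (fun q => (u q, q)) (𝓝 p) (𝓝 (u p, p)) := hu.prodMk_nhds continuousAt_id
  filter_upwards [h1.eventually h.iff] with q hq
  exact hq.1 fun v => by
    rw [sub_self]
    exact inner_zero_left _

/-- A foot point is characterised without reference to `p`, so the germs constructed at nearby
points coincide. Arbitrary local retractions would not do this, and the Hamiltonians built from them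
would not match. -/
theorem IsRetractionGerm.eventuallyEq {u : S → V} {p : S} {r : V → S}
    (h : IsRetractionGerm u p r) (hu : Continuous u) :
    ∀ᶠ q in 𝓝 p, ∀ r', IsRetractionGerm u q r' → r =ᶠ[𝓝 (u q)] r' := by
  have h1 : Tendsto (fun q => (u q, q)) (𝓝 p) (𝓝 (u p, p)) :=
    hu.continuousAt.prodMk_nhds continuousAt_id
  filter_upwards [h1.eventually h.iff.eventually_nhds] with q hq r' hr'
  have h2 : Tendsto (fun z => (z, r' z)) (𝓝 (u q)) (𝓝 (u q, q)) := by
    refine continuousAt_id.prodMk_nhds ?_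
    have := hr'.smooth.self_of_nhds.continuousAt.tendsto
    rwa [hr'.apply_eq] at this
  filter_upwards [h2.eventually hq, h2.eventually hr'.iff] with z h3 h4
  exact h3.1 (h4.2 rfl)

end Retraction

/-! ### Immersions in Euclidean space -/

section Embedding

/-- A manifold is immersed in a Euclidean space near a compact set. -/
theorem exists_euclidean_immersion {E : Type*} [NormedAddCommGroup E] [NormedSpace ℝ E]
    [FiniteDimensional ℝ E] {N : Type*} [TopologicalSpace N] [T2Space N] [SigmaCompactSpace N]
    [ChartedSpace E N] [IsManifold 𝓘(ℝ, E) ∞ N] {K : Set N} (hK : IsCompact K) :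
    ∃ (n : ℕ) (W : N → EuclideanSpace ℝ (Fin n)),
      ContMDiff 𝓘(ℝ, E) 𝓘(ℝ, EuclideanSpace ℝ (Fin n)) ∞ W ∧
      ∀ x ∈ K, Function.Injective (mfderiv 𝓘(ℝ, E) 𝓘(ℝ, EuclideanSpace ℝ (Fin n)) W x) := by
  obtain ⟨ι, f, -⟩ := SmoothBumpCovering.exists_isSubordinate 𝓘(ℝ, E) hK.isClosed
    fun (x : N) _ => univ_mem
  have hfin : Finite ι := by
    have h1 := f.locallyFinite.finite_nonempty_inter_compact hK
    have h2 : {i | (Function.support (f i) ∩ K).Nonempty} = univ :=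
      eq_univ_of_forall fun i => ⟨f.c i, (f i).c_mem_support, f.c_mem' i⟩
    rw [h2] at h1
    exact finite_univ_iff.1 h1
  cases nonempty_fintype ι
  let A : (ι → E) ≃L[ℝ] EuclideanSpace ℝ (Fin (Module.finrank ℝ (ι → E))) :=
    ContinuousLinearEquiv.ofFinrankEq finrank_euclideanSpace_fin.symm
  -- Only injectivity of the differential is wanted, so the components `f i` that make Whitney's map
  -- injective are left out.
  let w : N → ι → E := fun x i => f i x • chartAt E (f.c i) x
  have hw : ContMDiff 𝓘(ℝ, E) 𝓘(ℝ, ι → E) ∞ w :=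
    contMDiff_pi_space.2 fun i => (f i).contMDiff_smul fun x hx =>
      (chart_contMDiffAt (isChart_chartAt (f.c i)) hx).contMDiffWithinAt
  have hW : ContMDiff 𝓘(ℝ, E) 𝓘(ℝ, EuclideanSpace ℝ (Fin (Module.finrank ℝ (ι → E)))) ∞
      (fun x => A (w x)) := A.contDiff.contMDiff.comp hw
  refine ⟨_, fun x => A (w x), hW, fun x hx => ?_⟩
  let i := f.ind x hx
  let L : EuclideanSpace ℝ (Fin (Module.finrank ℝ (ι → E))) →L[ℝ] E :=
    (ContinuousLinearMap.proj i : (ι → E) →L[ℝ] E).comp (A.symm : _ →L[ℝ] (ι → E))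
  have h1 : (fun x => L (A (w x))) =ᶠ[𝓝 x] chartAt E (f.c i) := by
    filter_upwards [f.eventuallyEq_one x hx] with z hz
    have h2 : f i z = 1 := hz
    simp [L, w, h2]
  have hLW : HasMFDerivAt 𝓘(ℝ, E) 𝓘(ℝ, E) (fun x => L (A (w x))) x
      (L.comp (mfderiv 𝓘(ℝ, E) 𝓘(ℝ, EuclideanSpace ℝ (Fin (Module.finrank ℝ (ι → E))))
        (fun x => A (w x)) x)) :=
    L.hasMFDerivAt.comp x (hW.contMDiffAt.mdifferentiableAt (by simp)).hasMFDerivAt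
  have h3 := (hLW.congr_of_eventuallyEq h1.symm).mfderiv
  rw [injective_iff_map_eq_zero]
  intro v hv
  have h4 : mfderiv 𝓘(ℝ, E) 𝓘(ℝ, E) (chartAt E (f.c i)) x v = 0 := by
    rw [h3]
    refine Eq.trans ?_ (map_zero L)
    exact congrArg L hv
  have h5 := mfderiv_symm_mfderiv (isChart_chartAt (f.c i))
    (f.mem_chartAt_ind_source x hx) v
  rw [← h5, h4]
  exact map_zero _

end Embedding

/-! ## Lagrangian variations with a given closed form -/

section Transport

theorem IsImmersedAt.congr {ℓ ℓ' : S → N} {p : S} (h : ℓ' =ᶠ[𝓝 p] ℓ)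
    (hp : IsImmersedAt (E := E) ℓ p) : IsImmersedAt (E := E) ℓ' p := by
  intro v w hvw
  have h1 : ∀ v, mfderiv (𝓡 2) 𝓘(ℝ, E) ℓ' p v = mfderiv (𝓡 2) 𝓘(ℝ, E) ℓ p v := fun v =>
    DFunLike.congr_fun h.mfderiv_eq v
  exact hp ((h1 v).symm.trans (Eq.trans hvw (h1 w)))

theorem IsBranchPoint.congr {ℓ ℓ' : S → N} {p : S} (h : ℓ' =ᶠ[𝓝 p] ℓ)
    (hp : IsBranchPoint (E := E) ℓ p) : IsBranchPoint (E := E) ℓ' p := by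
  obtain ⟨c, hc, hpc, m, a, b, hm, hab, ho⟩ := hp
  refine ⟨c, hc, hpc, m, a, b, hm, hab, ?_⟩
  rw [h.self_of_nhds]
  refine ho.congr' ?_ EventuallyEq.rfl
  filter_upwards [(c.tendsto_symm hpc).eventually h] with y hy
  rw [hy]

end Transport

section Primitives

/-- Functions with the same differential differ locally by constants. -/
theorem eventually_eq_add_const {f f' : S → ℝ} {q : S}
    (hf : ∀ᶠ x in 𝓝 q, ContMDiffAt (𝓡 2) 𝓘(ℝ, ℝ) ∞ f x)
    (hf' : ∀ᶠ x in 𝓝 q, ContMDiffAt (𝓡 2) 𝓘(ℝ, ℝ) ∞ f' x)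
    (h : ∀ᶠ x in 𝓝 q, diffForm f x = diffForm f' x) : ∃ C, ∀ᶠ x in 𝓝 q, f x = f' x + C := by
  set c := chartAt Plane q
  have hc : IsChart c := isChart_chartAt q
  have hqs : q ∈ c.source := mem_chart_source Plane q
  have h1 : ∀ᶠ y in 𝓝 (c q), y ∈ c.target ∧ ContMDiffAt (𝓡 2) 𝓘(ℝ, ℝ) ∞ f (c.symm y) ∧
      ContMDiffAt (𝓡 2) 𝓘(ℝ, ℝ) ∞ f' (c.symm y) ∧
      diffForm f (c.symm y) = diffForm f' (c.symm y) := by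
    filter_upwards [c.open_target.mem_nhds (c.map_source hqs),
      (c.tendsto_symm hqs).eventually (hf.and (hf'.and h))] with y h2 h3
    exact ⟨h2, h3⟩
  obtain ⟨r, hr, hball⟩ := Metric.eventually_nhds_iff_ball.1 h1
  have hdiff : ∀ {k : S → ℝ} {y : Plane}, y ∈ c.target →
      ContMDiffAt (𝓡 2) 𝓘(ℝ, ℝ) ∞ k (c.symm y) → DifferentiableAt ℝ (k ∘ c.symm) y :=
    fun hy hk => ((hk.comp _ (chart_symm_contMDiffAt hc hy)).contDiffAt).differentiableAt (by simp)
  set k : Plane → ℝ := fun y => (f ∘ c.symm) y - (f' ∘ c.symm) y with hk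
  have hkd : ∀ y ∈ Metric.ball (c q) r, HasFDerivAt k (0 : Plane →L[ℝ] ℝ) y := by
    intro y hy
    obtain ⟨h2, h3, h4, h5⟩ := hball y hy
    have h6 := (hdiff h2 h3).hasFDerivAt.sub (hdiff h2 h4).hasFDerivAt
    have h7 : fderiv ℝ (f ∘ c.symm) y = fderiv ℝ (f' ∘ c.symm) y := by
      ext v
      rw [map_eq_sum_basisVec, map_eq_sum_basisVec (fderiv ℝ (f' ∘ c.symm) y)]
      have h8 : ∀ i, fderiv ℝ (f ∘ c.symm) y (basisVec i) =
          fderiv ℝ (f' ∘ c.symm) y (basisVec i) := by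
        intro i
        rw [← formComp_diffForm hc h2 (h3.mdifferentiableAt (by simp)),
          ← formComp_diffForm hc h2 (h4.mdifferentiableAt (by simp)), formComp, formComp, h5]
      rw [h8, h8]
    rw [h7, sub_self] at h6
    exact h6
  refine ⟨k (c q), ?_⟩
  filter_upwards [(c.continuousAt hqs).eventually (Metric.ball_mem_nhds (c q) hr),
    c.open_source.mem_nhds hqs] with x hx hxs
  have h9 : k (c x) = k (c q) := (convex_ball (c q) r).is_const_of_fderivWithin_eq_zero (𝕜 := ℝ)
      (fun y hy => (hkd y hy).differentiableAt.differentiableWithinAt)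
      (fun y hy => by
        rw [fderivWithin_of_isOpen Metric.isOpen_ball hy, (hkd y hy).fderiv])
      hx (Metric.mem_ball_self hr)
  rw [← h9]
  simp only [hk, Function.comp_apply]
  rw [c.left_inv hxs]
  ring

end Primitives

/-! ### Local Hamiltonians of a closed form on the surface -/

section LagrangianVariation

theorem fundamentalForm_chartField (he : e ∈ atlas E N) {x : N}
    (hx : x ∈ e.source) {H : N → ℝ} (hH : ContMDiffAt 𝓘(ℝ, E) 𝓘(ℝ, ℝ) ∞ H x)
    (w : TangentSpace 𝓘(ℝ, E) x) :
    fundamentalForm g x (mfderiv 𝓘(ℝ, E) 𝓘(ℝ, E) e.symm (e x) (chartField (E := E) g H e (e x))) w =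
      mfderiv 𝓘(ℝ, E) 𝓘(ℝ, ℝ) H x w := by
  have hm := isChart_of_mem_atlas he
  have hy := e.map_source hx
  have hl : e.symm (e x) = x := e.left_inv hx
  have hw := mfderiv_symm_mfderiv hm hx w
  set w' : E := mfderiv 𝓘(ℝ, E) 𝓘(ℝ, E) e x w
  have hHd : MDifferentiableAt 𝓘(ℝ, E) 𝓘(ℝ, ℝ) H (e.symm (e x)) := by
    rw [hl]; exact hH.mdifferentiableAt (by simp)
  have h1 : fderiv ℝ (H ∘ e.symm) (e x) w' =
      mfderiv 𝓘(ℝ, E) 𝓘(ℝ, ℝ) H (e.symm (e x)) (mfderiv 𝓘(ℝ, E) 𝓘(ℝ, E) e.symm (e x) w') := by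
    rw [← mfderiv_eq_fderiv, mfderiv_comp (e x) hHd
      ((chart_symm_contMDiffAt hm hy).mdifferentiableAt (by simp))]
    rfl
  have h2 : ∀ z, z = x → ∀ v : E, (mfderiv 𝓘(ℝ, E) 𝓘(ℝ, ℝ) H z : E →L[ℝ] ℝ) v =
      (mfderiv 𝓘(ℝ, E) 𝓘(ℝ, ℝ) H x : E →L[ℝ] ℝ) v := by
    rintro z rfl v; rfl
  have h3 : fundamentalForm g x
      (mfderiv 𝓘(ℝ, E) 𝓘(ℝ, E) e.symm (e x) (chartField (E := E) g H e (e x)))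
      (mfderiv 𝓘(ℝ, E) 𝓘(ℝ, E) e.symm (e x) w') =
      mfderiv 𝓘(ℝ, E) 𝓘(ℝ, ℝ) H x (mfderiv 𝓘(ℝ, E) 𝓘(ℝ, E) e.symm (e x) w') := by
    refine (fundamentalForm_congr g hl.symm _ _).trans ?_
    refine Eq.trans (inChart_apply (fundamentalForm g) e (e x) _ w').symm ?_
    rw [inChart_fundamentalForm g he hy]
    refine (apply_hamiltonianField (isMetricOn_inChart g hm) _ hy w').trans ?_
    exact h1.trans (h2 _ hl _)
  have h4 : ∀ v : E, v = w → fundamentalForm g x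
      (mfderiv 𝓘(ℝ, E) 𝓘(ℝ, E) e.symm (e x) (chartField (E := E) g H e (e x))) v =
      mfderiv 𝓘(ℝ, E) 𝓘(ℝ, ℝ) H x v → fundamentalForm g x
      (mfderiv 𝓘(ℝ, E) 𝓘(ℝ, E) e.symm (e x) (chartField (E := E) g H e (e x))) w =
      mfderiv 𝓘(ℝ, E) 𝓘(ℝ, ℝ) H x w := by
    rintro v rfl h; exact h
  exact h4 _ hw h3

theorem chartField_zero (e : OpenPartialHomeomorph N E) (y : E) :
    chartField g (fun _ => 0) e y = 0 := by
  have h : fderiv ℝ ((fun _ : N => (0 : ℝ)) ∘ e.symm) y = 0 := fderiv_const_apply (0 : ℝ)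
  rw [chartField, hamiltonianField, h, map_zero, map_zero, neg_zero]

/-- Germs of Hamiltonian functions inducing a closed form on the surface. -/
theorem exists_hamiltonians [T2Space N] [SigmaCompactSpace N] [CompactSpace S]
    (hℓ : ContMDiff (𝓡 2) 𝓘(ℝ, E) ∞ ℓ) {η : OneForm S} {f : S → S → ℝ}
    (hopen : IsOpen {p | IsImmersedAt (E := E) ℓ p})
    (hf : ∀ p, ∀ᶠ q in 𝓝 p, ContMDiffAt (𝓡 2) 𝓘(ℝ, ℝ) ∞ (f p) q ∧ η q = diffForm (f p) q)
    (hη : ∀ p, ¬IsImmersedAt (E := E) ℓ p → ∀ᶠ q in 𝓝 p, η q = 0) :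
    ∃ H : S → N → ℝ, (∀ p, ∀ᶠ x in 𝓝 (ℓ p), ContMDiffAt 𝓘(ℝ, E) 𝓘(ℝ, ℝ) ∞ (H p) x) ∧
      (∀ p, ∀ᶠ q in 𝓝 p, ∃ C, ∀ᶠ x in 𝓝 (ℓ q), H p x = H q x + C) ∧
      (∀ p v, mfderiv 𝓘(ℝ, E) 𝓘(ℝ, ℝ) (H p) (ℓ p) (mfderiv (𝓡 2) 𝓘(ℝ, E) ℓ p v) = η p v) ∧
      ∀ p, ¬IsImmersedAt (E := E) ℓ p → H p = fun _ => 0 := by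
  obtain ⟨n, W, hW, hWinj⟩ := exists_euclidean_immersion (E := E)
    (isCompact_range hℓ.continuous)
  have hu : ContMDiff (𝓡 2) 𝓘(ℝ, EuclideanSpace ℝ (Fin n)) ∞ (fun q => W (ℓ q)) := hW.comp hℓ
  have hr : ∀ p, ∃ r : EuclideanSpace ℝ (Fin n) → S, IsImmersedAt (E := E) ℓ p →
      IsRetractionGerm (fun q => W (ℓ q)) p r := by
    intro p
    by_cases hp : IsImmersedAt (E := E) ℓ p
    · obtain ⟨r, hr⟩ := exists_isRetractionGerm hu (p := p) (by
        have h1 : mfderiv (𝓡 2) 𝓘(ℝ, EuclideanSpace ℝ (Fin n)) (fun q => W (ℓ q)) p = _ :=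
          mfderiv_comp p (g := W) (I' := 𝓘(ℝ, E)) (hW.contMDiffAt.mdifferentiableAt (by simp))
            (hℓ.contMDiffAt.mdifferentiableAt (by simp))
        rw [h1]
        exact (hWinj _ (mem_range_self p)).comp hp)
      exact ⟨r, fun _ => hr⟩
    · exact ⟨fun _ => p, fun h => absurd h hp⟩
  choose r hr using hr
  classical
  -- The primitive `f p` is made constant along the fibres of the foot point map in Euclidean space.
  -- The Hamiltonians are germs indexed by points of the surface, not of `N`, so sheets of `ℓ` that
  -- cross do not interfere. At a branch point zero is a legitimate choice because `η` vanishes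
  -- nearby.
  set H : S → N → ℝ := fun p => if IsImmersedAt (E := E) ℓ p then fun x => f p (r p (W x))
    else fun _ => 0 with hH
  have hH1 : ∀ p, IsImmersedAt (E := E) ℓ p → H p = fun x => f p (r p (W x)) := fun p hp => by
    simp only [hH, if_pos hp]
  have hH0 : ∀ p, ¬IsImmersedAt (E := E) ℓ p → H p = fun _ => 0 := fun p hp => by
    simp only [hH, if_neg hp]
  have hrW : ∀ p, IsImmersedAt (E := E) ℓ p →
      Tendsto (fun x => r p (W x)) (𝓝 (ℓ p)) (𝓝 p) := by
    intro p hp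
    have h1 := ((hr p hp).smooth.self_of_nhds.continuousAt.tendsto).comp
      (hW.continuous.tendsto (ℓ p))
    rwa [(hr p hp).apply_eq] at h1
  have hsm : ∀ p, ∀ᶠ x in 𝓝 (ℓ p), ContMDiffAt 𝓘(ℝ, E) 𝓘(ℝ, ℝ) ∞ (H p) x := by
    intro p
    by_cases hp : IsImmersedAt (E := E) ℓ p
    · filter_upwards [(hW.continuous.tendsto (ℓ p)).eventually (hr p hp).smooth,
        (hrW p hp).eventually (hf p)] with x h1 h2
      rw [hH1 p hp]
      exact h2.1.comp x (h1.comp x hW.contMDiffAt)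
    · rw [hH0 p hp]
      exact Eventually.of_forall fun x => contMDiffAt_const
  refine ⟨H, hsm, fun p => ?_, fun p v => ?_, hH0⟩
  · by_cases hp : IsImmersedAt (E := E) ℓ p
    · filter_upwards [hopen.mem_nhds hp, (hr p hp).eventuallyEq hu.continuous,
        (hf p).eventually_nhds] with q hq h1 h2
      have h3 := h1 (r q) (hr q hq)
      obtain ⟨C, hC⟩ := eventually_eq_add_const (h2.mono fun x hx => hx.1)
        ((hf q).mono fun x hx => hx.1)
        ((h2.and (hf q)).mono fun x hx => hx.1.2.symm.trans hx.2.2)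
      refine ⟨C, ?_⟩
      filter_upwards [(hW.continuous.tendsto (ℓ q)).eventually h3, (hrW q hq).eventually hC]
        with x h4 h5
      rw [hH1 p hp, hH1 q hq]
      simp only
      rw [h4, h5]
    · rw [hH0 p hp]
      filter_upwards [(hη p hp).eventually_nhds] with q hq
      by_cases hqi : IsImmersedAt (E := E) ℓ q
      · obtain ⟨C, hC⟩ := eventually_eq_add_const (f := fun _ => 0) (f' := f q) (q := q)
          (Eventually.of_forall fun x => contMDiffAt_const) ((hf q).mono fun x hx => hx.1)
          ((hq.and (hf q)).mono fun x hx => by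
            rw [← hx.2.2, hx.1]; exact mfderiv_const)
        refine ⟨C, ?_⟩
        filter_upwards [(hrW q hqi).eventually hC] with x hx
        rw [hH1 q hqi]
        exact hx
      · rw [hH0 q hqi]
        exact ⟨0, Eventually.of_forall fun x => by simp⟩
  · by_cases hp : IsImmersedAt (E := E) ℓ p
    · have h1 : (fun q => H p (ℓ q)) =ᶠ[𝓝 p] f p := by
        filter_upwards [(hr p hp).eventually_apply hu.continuous.continuousAt] with q hq
        rw [hH1 p hp]
        simp only
        rw [hq]
      have h2 : mfderiv (𝓡 2) 𝓘(ℝ, ℝ) (fun q => H p (ℓ q)) p = _ :=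
        mfderiv_comp p (g := H p) (I' := 𝓘(ℝ, E)) ((hsm p).self_of_nhds.mdifferentiableAt (by simp))
          (hℓ.contMDiffAt.mdifferentiableAt (by simp))
      have h3 := (hf p).self_of_nhds.2
      rw [h3]
      have h4 : mfderiv (𝓡 2) 𝓘(ℝ, ℝ) (fun q => H p (ℓ q)) p v =
          mfderiv (𝓡 2) 𝓘(ℝ, ℝ) (f p) p v := DFunLike.congr_fun h1.mfderiv_eq v
      refine Eq.trans ?_ h4
      rw [h2]
      rfl
    · rw [hH0 p hp, (hη p hp).self_of_nhds]
      have h1 : mfderiv 𝓘(ℝ, E) 𝓘(ℝ, ℝ) (fun _ : N => (0 : ℝ)) (ℓ p) = 0 := mfderiv_const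
      rw [h1]
      rfl

end LagrangianVariation

/-! ### Realising a locally exact form by a lagrangian variation -/

section ExistsVariation

theorem FollowsField.const {p : S} (hℓ : ContinuousAt ℓ p)
    (hp : ℓ p ∈ e.source) : FollowsField g (fun _ => 0) e (fun z : ℝ × S => ℓ z.2) p := by
  have h1 : ∀ᶠ z in 𝓝 ((0 : ℝ), p), ℓ z.2 ∈ e.source :=
    (continuous_snd.tendsto ((0 : ℝ), p)).eventually (hℓ.eventually (e.open_source.mem_nhds hp))
  filter_upwards [h1] with z hz
  refine ⟨hz, ?_⟩
  rw [chartField_zero]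
  exact hasDerivAt_const z.1 (e (ℓ z.2))

theorem eventually_isImmersedAt {ε : ℝ} {L : ℝ → S → N} (hε : 0 < ε)
    (hL : ContMDiffOn (𝓘(ℝ, ℝ).prod (𝓡 2)) 𝓘(ℝ, E) ∞ (fun q : ℝ × S => L q.1 q.2)
      (Ioo (-ε) ε ×ˢ univ)) (g : Metric (E := E) N) {p : S} (hp : IsImmersedAt (E := E) (L 0) p) :
    ∀ᶠ z in 𝓝 ((0 : ℝ), p), IsImmersedAt (E := E) (L z.1) z.2 := by
  have h0 : (0 : ℝ) ∈ Ioo (-ε) ε := ⟨by linarith, hε⟩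
  set c := chartAt Plane p with hcc
  have hc : IsChart c := isChart_chartAt p
  have hps : p ∈ c.source := mem_chart_source Plane p
  have hpt := c.map_source hps
  have h1 : ContinuousAt (areaSq g L c) (0, c p) :=
    ((areaSq_contDiffOn hL hc).contDiffAt ((isOpen_Ioo.prod c.open_target).mem_nhds
      ⟨h0, hpt⟩)).continuousAt
  have h2 : 0 < areaSq g L c (0, c p) := by
    refine (inducedMetric_det_pos (variation_contMDiff hL h0) hc hpt).1 ?_
    rw [c.left_inv hps]
    exact hp
  have h3 : ContinuousAt (fun z : ℝ × S => (z.1, c z.2)) (0, p) :=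
    continuousAt_fst.prodMk (ContinuousAt.comp (g := c) (f := Prod.snd) (x := ((0 : ℝ), p))
      (c.continuousAt hps) continuousAt_snd)
  filter_upwards [h3.eventually (h1.eventually (lt_mem_nhds h2)),
    continuousAt_fst.eventually (isOpen_Ioo.mem_nhds h0),
    (continuous_snd.tendsto ((0 : ℝ), p)).eventually (c.open_source.mem_nhds hps)] with z h4 h5 h6
  have h7 := (inducedMetric_det_pos (g := g) (variation_contMDiff hL h5) hc (c.map_source h6)).2 h4
  rwa [c.left_inv h6] at h7

/-- Locally exact one-forms vanishing near the branch points are induced by variations through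
branched lagrangian immersions. -/
theorem exists_lagrangian_variation [T2Space N] [SigmaCompactSpace N] [T2Space S] [CompactSpace S]
    (hKahler : IsKahler g) (hℓ : IsBranchedLagrangianImmersion g ℓ) {η : OneForm S}
    {f : S → S → ℝ} (hopen : IsOpen {p | IsImmersedAt (E := E) ℓ p})
    (hf : ∀ p, ∀ᶠ q in 𝓝 p, ContMDiffAt (𝓡 2) 𝓘(ℝ, ℝ) ∞ (f p) q ∧ η q = diffForm (f p) q)
    (hη : ∀ p, ¬IsImmersedAt (E := E) ℓ p → ∀ᶠ q in 𝓝 p, η q = 0) :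
    ∃ (ε : ℝ) (L : ℝ → S → N), IsVariation (E := E) ε ℓ L ∧
      (∀ t ∈ Ioo (-ε) ε, IsBranchedLagrangianImmersion g (L t)) ∧
      (∀ p, ¬IsImmersedAt (E := E) ℓ p → ∀ᶠ z in 𝓝 ((0 : ℝ), p), L z.1 z.2 = ℓ z.2) ∧
      ∀ q (v : Plane), (fundamentalForm g (L 0 q) : E →L[ℝ] E →L[ℝ] ℝ) (velocity (E := E) L q)
        ((mfderiv (𝓡 2) 𝓘(ℝ, E) (L 0) q : Plane →L[ℝ] E) v) = (η q : Plane →L[ℝ] ℝ) v := by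
  have hsm := hℓ.branched.smooth
  obtain ⟨H, hHs, hHC, hHd, hH0⟩ := exists_hamiltonians hsm hopen hf hη
  choose L hLs hL0 hLF hLω using fun p => exists_lagrangian_flow hKahler hsm hℓ.lagrangian (hHs p)
  have hq0 : ∀ p : S, Tendsto (fun q : S => ((0 : ℝ), q)) (𝓝 p) (𝓝 (0, p)) := fun p =>
    (Continuous.prodMk continuous_const continuous_id).tendsto p
  -- Near `ℓ q` the Hamiltonians of `p` and `q` differ by a constant, so both maps follow the same
  -- field from the same initial surface, and they agree by uniqueness.
  have hcons : ∀ p, ∀ᶠ q in 𝓝 p, L q =ᶠ[𝓝 ((0 : ℝ), q)] L p := by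
    intro p
    filter_upwards [(hq0 p).eventually (hLF p).eventually_nhds, (hq0 p).eventually (hLs p),
      (hL0 p).eventually_nhds, hHC p, hsm.continuous.continuousAt.eventually
        (hHs p).eventually_nhds] with q h1 h2 h3 h4 h5
    obtain ⟨C, hC⟩ := h4
    have h6 : L p (0, q) = ℓ q := h3.self_of_nhds
    have h7 : FollowsField g (H p) (chartAt E (ℓ p)) (L p) q := h1
    have h8 : FollowsField g (H q) (chartAt E (ℓ q)) (L p) q :=
      h7.congr (chart_mem_atlas E _) (chart_mem_atlas E _) h2.continuousAt
        (by rw [h6]; exact mem_chart_source E _) (by rw [h6]; exact h5) (by rw [h6]; exact hC)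
    refine (hLF q).eventuallyEq (chart_mem_atlas E _) h8 (hLs q).self_of_nhds.continuousAt
      h2.continuousAt ?_ ?_
    · rw [(hL0 q).self_of_nhds]
      exact (hHs q).self_of_nhds
    · filter_upwards [h3, hL0 q] with x h9 h10
      rw [h9, h10]
  obtain ⟨L', hL'⟩ := exists_glue_germs L hcons
  have hL'0 : (fun q => L' (0, q)) = ℓ := by
    funext q
    rw [(hL' q).self_of_nhds, (hL0 q).self_of_nhds]
  -- At a branch point the Hamiltonian is zero, so the variation stands still nearby. The branch
  -- points are thus kept.
  have hLconst : ∀ p, ¬IsImmersedAt (E := E) ℓ p →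
      L' =ᶠ[𝓝 ((0 : ℝ), p)] fun z => ℓ z.2 := by
    intro p hp
    refine (hL' p).trans ?_
    have h1 : FollowsField g (H p) (chartAt E (ℓ p)) (fun z : ℝ × S => ℓ z.2) p := by
      rw [hH0 p hp]
      exact FollowsField.const hsm.continuous.continuousAt (mem_chart_source E _)
    refine (hLF p).eventuallyEq (chart_mem_atlas E _) h1 (hLs p).self_of_nhds.continuousAt
      (ContinuousAt.comp (g := ℓ) (f := Prod.snd) (x := ((0 : ℝ), p)) hsm.continuous.continuousAt
        continuousAt_snd) ?_ (hL0 p)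
    rw [(hL0 p).self_of_nhds]
    exact (hHs p).self_of_nhds
  have hslice : ∀ {F F' : ℝ × S → N} {z : ℝ × S}, F =ᶠ[𝓝 z] F' →
      (fun q => F (z.1, q)) =ᶠ[𝓝 z.2] fun q => F' (z.1, q) := by
    intro F F' z h
    have h1 : Tendsto (fun q : S => (z.1, q)) (𝓝 z.2) (𝓝 z) :=
      (Continuous.prodMk continuous_const continuous_id).tendsto z.2
    exact h1.eventually h
  have hsmooth : ∀ᶠ t in 𝓝 (0 : ℝ), ∀ q ∈ (univ : Set S),
      ContMDiffAt (𝓘(ℝ, ℝ).prod (𝓡 2)) 𝓘(ℝ, E) ∞ L' (t, q) := by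
    refine isCompact_univ.eventually_forall_of_forall_eventually fun p _ => ?_
    filter_upwards [(hL' p).eventually_nhds, hLs p] with z h1 h2
    exact h2.congr_of_eventuallyEq h1
  obtain ⟨ε₁, hε₁, hball₁⟩ := Metric.eventually_nhds_iff_ball.1 hsmooth
  have hsm₁ : ContMDiffOn (𝓘(ℝ, ℝ).prod (𝓡 2)) 𝓘(ℝ, E) ∞
      (fun q : ℝ × S => (fun t q => L' (t, q)) q.1 q.2) (Ioo (-ε₁) ε₁ ×ˢ univ) := by
    rintro ⟨t, q⟩ ⟨ht, -⟩
    exact (hball₁ t (by rw [Real.ball_eq_Ioo, zero_sub, zero_add]; exact ht) q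
      (mem_univ q)).contMDiffWithinAt
  -- Each nearby map is immersed at a point or coincides with `ℓ` around it. Compactness of the
  -- surface turns this local alternative into one interval of times.
  have hgood : ∀ᶠ t in 𝓝 (0 : ℝ), ∀ q ∈ (univ : Set S),
      (IsImmersedAt (E := E) (fun q => L' (t, q)) q ∨ (fun q => L' (t, q)) =ᶠ[𝓝 q] ℓ) ∧
      ∀ v w : TangentSpace (𝓡 2) q, fundamentalForm g (L' (t, q))
        (mfderiv (𝓡 2) 𝓘(ℝ, E) (fun q => L' (t, q)) q v)
        (mfderiv (𝓡 2) 𝓘(ℝ, E) (fun q => L' (t, q)) q w) = 0 := by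
    refine isCompact_univ.eventually_forall_of_forall_eventually fun p _ => ?_
    refine Eventually.and ?_ ?_
    · by_cases hp : IsImmersedAt (E := E) ℓ p
      · refine (eventually_isImmersedAt (L := fun t q => L' (t, q)) hε₁ hsm₁ g (p := p) ?_).mono fun z hz => Or.inl hz
        rw [hL'0]
        exact hp
      · exact (hLconst p hp).eventually_nhds.mono fun z hz => Or.inr (hslice hz)
    · filter_upwards [(hL' p).eventually_nhds, hLω p] with z h1 h2 v w
      have h3 : ∀ v, mfderiv (𝓡 2) 𝓘(ℝ, E) (fun q => L' (z.1, q)) z.2 v =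
          mfderiv (𝓡 2) 𝓘(ℝ, E) (fun q => L p (z.1, q)) z.2 v := fun v =>
        DFunLike.congr_fun (hslice h1).mfderiv_eq v
      have h4 : L' (z.1, z.2) = L p z := h1.self_of_nhds
      refine Eq.trans ?_ (h2 v w)
      rw [h3, h3]
      exact fundamentalForm_congr g h4 _ _
  obtain ⟨ε₂, hε₂, hball₂⟩ := Metric.eventually_nhds_iff_ball.1 hgood
  refine ⟨min ε₁ ε₂, fun t q => L' (t, q), ⟨lt_min hε₁ hε₂, hL'0, ?_⟩, ?_, ?_, ?_⟩
  · refine hsm₁.mono (prod_mono (Ioo_subset_Ioo ?_ (min_le_left _ _)) subset_rfl)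
    exact neg_le_neg (min_le_left _ _)
  · intro t ht
    have ht₁ : t ∈ Ioo (-ε₁) ε₁ := Ioo_subset_Ioo (neg_le_neg (min_le_left _ _))
      (min_le_left _ _) ht
    have ht₂ : t ∈ Metric.ball (0 : ℝ) ε₂ := by
      rw [Real.ball_eq_Ioo, zero_sub, zero_add]
      exact Ioo_subset_Ioo (neg_le_neg (min_le_right _ _)) (min_le_right _ _) ht
    refine ⟨⟨variation_contMDiff (L := fun t q => L' (t, q)) hsm₁ ht₁, fun q => ?_⟩, fun q => (hball₂ t ht₂ q (mem_univ q)).2⟩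
    rcases (hball₂ t ht₂ q (mem_univ q)).1 with h | h
    · exact Or.inl h
    · exact (hℓ.branched.immersed_or_branch q).imp (IsImmersedAt.congr h) (IsBranchPoint.congr h)
  · exact fun p hp => hLconst p hp
  · intro q v
    set e := chartAt E (ℓ q) with hee
    have he : e ∈ atlas E N := chart_mem_atlas E (ℓ q)
    have hqe : ℓ q ∈ e.source := mem_chart_source E (ℓ q)
    have h0 : (0 : ℝ) ∈ Ioo (-ε₁) ε₁ := ⟨by linarith, hε₁⟩
    have hval : L' (0, q) = ℓ q := congrFun hL'0 q
    have hder := (hLF q).self_of_nhds.2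
    have htime : (fun t : ℝ => e (L' (t, q))) =ᶠ[𝓝 0] fun t => e (L q (t, q)) := by
      have h1 : Tendsto (fun t : ℝ => (t, q)) (𝓝 0) (𝓝 (0, q)) :=
        (Continuous.prodMk continuous_id continuous_const).tendsto 0
      filter_upwards [h1.eventually (hL' q)] with t ht
      rw [ht]
    have hX : (velocity (E := E) (fun t q => L' (t, q)) q : E) =
        mfderiv 𝓘(ℝ, E) 𝓘(ℝ, E) e.symm (e (ℓ q)) (chartField (E := E) g (H q) e (e (ℓ q))) := by
      have h1 := mfderiv_eq_symm_fderiv (isChart_of_mem_atlas he)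
        ((variation_time_contMDiffAt (L := fun t q => L' (t, q)) hsm₁ h0 q).mdifferentiableAt (by simp))
        (by simp only [hval]; exact hqe) (1 : ℝ)
      refine Eq.trans h1 ?_
      have h2 : fderiv ℝ (fun t : ℝ => e (L' (t, q))) 0 (1 : ℝ) =
          chartField (E := E) g (H q) e (e (ℓ q)) := by
        rw [fderiv_apply_one_eq_deriv, htime.deriv_eq]
        refine (hder.deriv).trans ?_
        rw [(hL0 q).self_of_nhds]
      have h3 : ∀ z, z = ℓ q → ∀ Y Y' : E, Y = Y' →
          (mfderiv 𝓘(ℝ, E) 𝓘(ℝ, E) e.symm (e z) : E →L[ℝ] E) Y =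
          (mfderiv 𝓘(ℝ, E) 𝓘(ℝ, E) e.symm (e (ℓ q)) : E →L[ℝ] E) Y' := by
        rintro z rfl Y Y' rfl; rfl
      exact h3 _ hval _ _ h2
    have h4 : ∀ ℓ' : S → N, ℓ' = ℓ → ∀ X X' : E, X = X' →
        (fundamentalForm g (ℓ' q) : E →L[ℝ] E →L[ℝ] ℝ) X
          ((mfderiv (𝓡 2) 𝓘(ℝ, E) ℓ' q : Plane →L[ℝ] E) v) =
        (fundamentalForm g (ℓ q) : E →L[ℝ] E →L[ℝ] ℝ) X'
          ((mfderiv (𝓡 2) 𝓘(ℝ, E) ℓ q : Plane →L[ℝ] E) v) := by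
      rintro ℓ' rfl X X' rfl; rfl
    refine (h4 _ hL'0 _ _ hX).trans ?_
    exact (fundamentalForm_chartField he hqe (hHs q).self_of_nhds _).trans (hHd q v)

end ExistsVariation

/-! ## Smooth forms and cutoff functions -/

section PairingAlgebra

variable {h : Fin 2 → Fin 2 → ℝ}

/-- For a degenerate metric the pairing is zero by division by zero. Otherwise the numerator times
`h 1 1` is a sum of squares. -/
theorem pairing_self_nonneg (h0 : 0 ≤ h 0 0) (h1 : 0 ≤ h 1 1) (α : Fin 2 → ℝ) :
    0 ≤ pairing h α α := by
  rcases le_or_gt (h 0 0 * h 1 1 - h 0 1 ^ 2) 0 with hd | hd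
  · simp [pairing, flux, Real.sqrt_eq_zero_of_nonpos hd]
  · have h2 : 0 < h 1 1 := lt_of_le_of_ne h1 fun h3 => by
      rw [← h3] at hd
      nlinarith [sq_nonneg (h 0 1)]
    have h3 : 0 ≤ h 1 1 * (h 1 1 * α 0 ^ 2 - 2 * h 0 1 * α 0 * α 1 + h 0 0 * α 1 ^ 2) := by
      have h4 : h 1 1 * (h 1 1 * α 0 ^ 2 - 2 * h 0 1 * α 0 * α 1 + h 0 0 * α 1 ^ 2) =
        (h 1 1 * α 0 - h 0 1 * α 1) ^ 2 + (h 0 0 * h 1 1 - h 0 1 ^ 2) * α 1 ^ 2 := by ring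
      rw [h4]
      positivity
    have h5 : pairing h α α = (h 1 1 * α 0 ^ 2 - 2 * h 0 1 * α 0 * α 1 + h 0 0 * α 1 ^ 2) /
        √(h 0 0 * h 1 1 - h 0 1 ^ 2) := by
      simp only [pairing, flux, Matrix.cons_val_zero, Matrix.cons_val_one]
      ring
    rw [h5]
    exact div_nonneg (nonneg_of_mul_nonneg_right h3 h2) (Real.sqrt_nonneg _)

theorem eq_zero_of_pairing_self_eq_zero (h1 : 0 ≤ h 1 1)
    (hd : 0 < h 0 0 * h 1 1 - h 0 1 ^ 2) {α : Fin 2 → ℝ} (hα : pairing h α α = 0) (k : Fin 2) :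
    α k = 0 := by
  have h2 : 0 < h 1 1 := lt_of_le_of_ne h1 fun h3 => by
    rw [← h3] at hd
    nlinarith [sq_nonneg (h 0 1)]
  have h5 : pairing h α α = (h 1 1 * α 0 ^ 2 - 2 * h 0 1 * α 0 * α 1 + h 0 0 * α 1 ^ 2) /
      √(h 0 0 * h 1 1 - h 0 1 ^ 2) := by
    simp only [pairing, flux, Matrix.cons_val_zero, Matrix.cons_val_one]
    ring
  rw [h5, div_eq_zero_iff, or_iff_left (Real.sqrt_pos.2 hd).ne'] at hα
  have h4 : (h 1 1 * α 0 - h 0 1 * α 1) ^ 2 + (h 0 0 * h 1 1 - h 0 1 ^ 2) * α 1 ^ 2 = 0 := by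
    linear_combination h 1 1 * hα
  have h6 : α 1 = 0 := by
    have h7 : (h 0 0 * h 1 1 - h 0 1 ^ 2) * α 1 ^ 2 = 0 := by
      nlinarith [sq_nonneg (h 1 1 * α 0 - h 0 1 * α 1), mul_nonneg hd.le (sq_nonneg (α 1))]
    simpa [hd.ne'] using h7
  rw [h6] at h4
  have h8 : α 0 = 0 := by simpa [h2.ne'] using h4
  fin_cases k
  · exact h8
  · exact h6

/-- This expands `|a σ / 2 - τ|² ≥ 0`. In the application `a` is the complement of the cutoffs and
`τ` the sum of the forms `β dχ`, so the left factor on the right is the test form. -/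
theorem pairing_ge_of_complete_square (h0 : 0 ≤ h 0 0) (h1 : 0 ≤ h 1 1) (a : ℝ) (σ τ : Fin 2 → ℝ) :
    a ^ 2 / 4 * pairing h σ σ - pairing h τ τ ≤
      pairing h (fun k => a ^ 2 / 2 * σ k - a * τ k) σ := by
  have h2 := pairing_self_nonneg h0 h1 fun k => a / 2 * σ k - τ k
  have h3 : pairing h (fun k => a / 2 * σ k - τ k) (fun k => a / 2 * σ k - τ k) =
      pairing h (fun k => a ^ 2 / 2 * σ k - a * τ k) σ -
        (a ^ 2 / 4 * pairing h σ σ - pairing h τ τ) := by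
    simp only [pairing, flux, Matrix.cons_val_zero, Matrix.cons_val_one]
    ring
  linarith

end PairingAlgebra

/-! ### Smoothness of one-forms -/

section SmoothForms

/-- The components of the one-form `α` are smooth at `q`. -/
def IsSmoothForm (α : OneForm S) (q : S) : Prop :=
  ∀ c ∈ IsManifold.maximalAtlas (𝓡 2) ∞ S, ∀ y ∈ c.target, c.symm y = q →
    ∀ k, ContDiffAt ℝ ∞ (fun z => formComp α c z k) y

theorem IsSmoothForm.congr {α α' : OneForm S} {q : S} (h : ∀ᶠ x in 𝓝 q, α x = α' x)
    (hα' : IsSmoothForm α' q) : IsSmoothForm α q := by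
  intro c hc y hy hyq k
  subst hyq
  refine (hα' c hc y hy rfl k).congr_of_eventuallyEq ?_
  filter_upwards [(c.continuousAt_symm hy).eventually h] with z hz
  rw [formComp, formComp, hz]

theorem isSmoothForm_diffForm {f : S → ℝ} {q : S}
    (hf : ∀ᶠ x in 𝓝 q, ContMDiffAt (𝓡 2) 𝓘(ℝ, ℝ) ∞ f x) : IsSmoothForm (diffForm f) q := by
  intro c hc y hy hyq k
  subst hyq
  have h1 : ContDiffAt ℝ ∞ (f ∘ c.symm) y :=
    (ContMDiffAt.comp y hf.self_of_nhds (chart_symm_contMDiffAt hc hy)).contDiffAt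
  have h2 : ContDiffAt ℝ ∞ (fun z => fderiv ℝ (f ∘ c.symm) z (basisVec k)) y :=
    (h1.fderiv_right (m := ∞) (by simp)).clm_apply contDiffAt_const
  refine h2.congr_of_eventuallyEq ?_
  filter_upwards [c.open_target.mem_nhds hy, (c.continuousAt_symm hy).eventually hf] with z hz hz'
  exact formComp_diffForm hc hz (hz'.mdifferentiableAt (by simp)) k

theorem IsSmoothForm.smul {a : S → ℝ} {α : OneForm S} {q : S}
    (ha : ContMDiffAt (𝓡 2) 𝓘(ℝ, ℝ) ∞ a q) (hα : IsSmoothForm α q) :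
    IsSmoothForm (fun x => a x • α x) q := by
  intro c hc y hy hyq k
  have h := hα c hc y hy hyq k
  subst hyq
  exact ((ContMDiffAt.comp y ha (chart_symm_contMDiffAt hc hy)).contDiffAt).mul h

theorem diffForm_congr {f f' : S → ℝ} {q : S} (h : f =ᶠ[𝓝 q] f') : diffForm f q = diffForm f' q :=
  h.mfderiv_eq

theorem diffForm_const (C : ℝ) (q : S) : diffForm (fun _ : S => C) q = 0 := mfderiv_const

end SmoothForms

section PairingContinuity

theorem isContinuousDensity_pairing (hℓ : ContMDiff (𝓡 2) 𝓘(ℝ, E) ∞ ℓ) {α β : OneForm S}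
    (h : ∀ q, (∀ᶠ x in 𝓝 q, α x = 0) ∨
      IsImmersedAt (E := E) ℓ q ∧ IsSmoothForm α q ∧ IsSmoothForm β q) :
    IsContinuousDensity (pairingDensity g ℓ α β) := by
  intro c hc y hy
  refine ContinuousAt.continuousWithinAt ?_
  rcases h (c.symm y) with h0 | ⟨h1, h2, h3⟩
  · refine (continuousAt_const (y := (0 : ℝ))).congr ?_
    filter_upwards [(c.continuousAt_symm hy).eventually h0] with z hz
    simp [pairingDensity, pairing, formComp, hz]
  · have h4 := contDiffAt_fluxDensity (g := g) hℓ hc hy h1 (h3 c hc y hy rfl)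
    have h5 := h2 c hc y hy rfl
    exact ((h5 0).continuousAt.mul (h4 0).continuousAt).add
      ((h5 1).continuousAt.mul (h4 1).continuousAt)

theorem inducedMetric_self_nonneg (g : Metric (E := E) N) (ℓ : S → N)
    (c : OpenPartialHomeomorph S Plane) (y : Plane) (i : Fin 2) :
    0 ≤ inducedMetric g ℓ c y i i := by
  rw [inducedMetric]
  set v := mfderiv (𝓡 2) 𝓘(ℝ, E) (fun y' : Plane => ℓ (c.symm y')) y (basisVec i)
  rcases eq_or_ne v 0 with h | h
  · rw [h, map_zero]
  · exact (g.pos _ v h).le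

end PairingContinuity

/-! ### Cutoff functions in small discs -/

section Cutoff

/-- Bump functions on the plane with gradient of the order of the inverse radius. -/
theorem exists_plane_cutoff : ∃ C, 0 < C ∧ ∀ (y₀ : Plane) (r : ℝ), 0 < r → ∃ ψ : Plane → ℝ,
    ContDiff ℝ ∞ ψ ∧ (∀ y, ψ y ∈ Icc (0 : ℝ) 1) ∧ (∀ᶠ y in 𝓝 y₀, ψ y = 1) ∧
    (∀ y, y ∉ Metric.closedBall y₀ r → ψ y = 0) ∧ ∀ y k, |fderiv ℝ ψ y (basisVec k)| ≤ C / r := by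
  set B : ContDiffBump (0 : Plane) := ⟨1 / 2, 1, by norm_num, by norm_num⟩
  have hB : ContDiff ℝ ∞ B := B.contDiff
  obtain ⟨C, hC⟩ := (B.hasCompactSupport.fderiv (𝕜 := ℝ)).exists_bound_of_continuous
    (hB.continuous_fderiv (by simp))
  refine ⟨|C| + 1, by positivity, fun y₀ r hr => ?_⟩
  refine ⟨fun y => B (r⁻¹ • (y - y₀)), hB.comp (by fun_prop),
    fun y => ⟨B.nonneg, B.le_one⟩, ?_, fun y hy => ?_, fun y k => ?_⟩
  · have h1 : Tendsto (fun y : Plane => r⁻¹ • (y - y₀)) (𝓝 y₀) (𝓝 0) := by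
      have h2 : Continuous fun y : Plane => r⁻¹ • (y - y₀) := by fun_prop
      have h3 := h2.tendsto y₀
      simpa using h3
    exact h1.eventually B.eventuallyEq_one
  · refine B.zero_of_le_dist ?_
    rw [dist_zero_right, norm_smul, norm_inv, Real.norm_of_nonneg hr.le, ← dist_eq_norm]
    rw [Metric.mem_closedBall, not_le] at hy
    change 1 ≤ r⁻¹ * dist y y₀
    rw [inv_mul_eq_div, le_div_iff₀ hr]
    linarith
  · have h1 : HasFDerivAt (fun y : Plane => r⁻¹ • (y - y₀))
        (r⁻¹ • ContinuousLinearMap.id ℝ Plane) y :=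
      ((hasFDerivAt_id y).sub_const y₀).const_smul r⁻¹
    have h2 := HasFDerivAt.comp y (g := B) (hB.differentiable (by simp) _).hasFDerivAt h1
    have h3 : fderiv ℝ (fun y => B (r⁻¹ • (y - y₀))) y (basisVec k) =
        r⁻¹ * fderiv ℝ B (r⁻¹ • (y - y₀)) (basisVec k) := by
      rw [show (fun y => B (r⁻¹ • (y - y₀))) = B ∘ fun y => r⁻¹ • (y - y₀) from rfl, h2.fderiv]
      simp
    have h4 : |fderiv ℝ B (r⁻¹ • (y - y₀)) (basisVec k)| ≤ |C| + 1 := by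
      have h5 := (fderiv ℝ B (r⁻¹ • (y - y₀))).le_opNorm (basisVec k)
      rw [show ‖basisVec k‖ = 1 by simp [basisVec], mul_one, Real.norm_eq_abs] at h5
      linarith [hC (r⁻¹ • (y - y₀)), le_abs_self C]
    rw [h3, abs_mul, abs_of_pos (inv_pos.2 hr), inv_mul_eq_div]
    gcongr

/-- `χ` is a cutoff function at `b` supported in `O` and in a disc of radius `r` in the chart `c`,
with gradient bounded by `C / r`. -/
structure IsCutoff (C : ℝ) (c : OpenPartialHomeomorph S Plane) (b : S) (O : Set S) (r : ℝ)
    (χ : S → ℝ) : Prop where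
  pos : 0 < r
  smooth : ContMDiff (𝓡 2) 𝓘(ℝ, ℝ) ∞ χ
  mem_Icc : ∀ q, χ q ∈ Icc (0 : ℝ) 1
  eventually_eq_one : ∀ᶠ q in 𝓝 b, χ q = 1
  subset_target : Metric.closedBall (c b) r ⊆ c.target
  subset : tsupport χ ⊆ O
  support : ∀ q ∈ tsupport χ, q ∈ c.source ∧ c q ∈ Metric.closedBall (c b) r
  bound : ∀ y ∈ c.target, ∀ k, |formComp (diffForm χ) c y k| ≤ C / r

/-- One bump on the plane is rescaled, so `C` does not depend on the chart, the point or the radius.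
Extension by zero is smooth because the image of the closed disc is compact, hence closed in the
Hausdorff surface. -/
theorem exists_isCutoff [T2Space S] : ∃ C, 0 < C ∧
    ∀ c ∈ IsManifold.maximalAtlas (𝓡 2) ∞ S, ∀ b ∈ c.source, ∀ O ∈ 𝓝 b, ∀ δ > 0,
      ∃ r ≤ δ, ∃ χ : S → ℝ, IsCutoff C c b O r χ := by
  obtain ⟨C, hC, hψ⟩ := exists_plane_cutoff
  refine ⟨C, hC, fun c hc b hb O hO δ hδ => ?_⟩
  have h1 : ∀ᶠ y in 𝓝 (c b), y ∈ c.target ∧ c.symm y ∈ O :=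
    (c.open_target.eventually_mem (c.map_source hb)).and ((c.tendsto_symm hb).eventually hO)
  obtain ⟨r₀, hr₀, hball⟩ := Metric.nhds_basis_closedBall.eventually_iff.1 h1
  set r := min r₀ δ with hr
  have hrpos : 0 < r := lt_min hr₀ hδ
  have hball' : ∀ y ∈ Metric.closedBall (c b) r, y ∈ c.target ∧ c.symm y ∈ O := fun y hy =>
    hball (Metric.closedBall_subset_closedBall (min_le_left _ _) hy)
  obtain ⟨ψ, hψs, hψI, hψ1, hψ0, hψb⟩ := hψ (c b) r hrpos
  set K := c.symm '' Metric.closedBall (c b) r with hK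
  have hKc : IsClosed K := ((isCompact_closedBall (c b) r).image_of_continuousOn
    (c.continuousOn_symm.mono fun y hy => (hball' y hy).1)).isClosed
  have hKm : ∀ q ∈ K, q ∈ c.source ∧ c q ∈ Metric.closedBall (c b) r ∧ q ∈ O := by
    rintro _ ⟨y, hy, rfl⟩
    obtain ⟨h2, h3⟩ := hball' y hy
    exact ⟨c.map_target h2, by rwa [c.right_inv h2], h3⟩
  classical
  set χ : S → ℝ := fun q => if q ∈ c.source then ψ (c q) else 0 with hχ
  have hχs : ∀ q ∈ c.source, χ q = ψ (c q) := fun q hq => by simp only [hχ, if_pos hq]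
  have hχK : ∀ q ∉ K, χ q = 0 := by
    intro q hq
    by_cases hqs : q ∈ c.source
    · rw [hχs q hqs]
      exact hψ0 _ fun h => hq ⟨c q, h, c.left_inv hqs⟩
    · simp only [hχ, if_neg hqs]
  have htK : tsupport χ ⊆ K := closure_minimal (fun q hq => by
    by_contra h
    exact hq (hχK q h)) hKc
  refine ⟨r, min_le_right _ _, χ, hrpos, fun q => ?_, fun q => ?_, ?_, fun y hy => (hball' y hy).1,
    fun q hq => (hKm q (htK hq)).2.2, fun q hq => ⟨(hKm q (htK hq)).1, (hKm q (htK hq)).2.1⟩,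
    fun y hy k => ?_⟩
  · by_cases hq : q ∈ K
    · have h2 := (hKm q hq).1
      have h3 : ContMDiffAt (𝓡 2) 𝓘(ℝ, ℝ) ∞ (fun q => ψ (c q)) q :=
        hψs.contMDiff.contMDiffAt.comp q (chart_contMDiffAt hc h2)
      refine h3.congr_of_eventuallyEq ?_
      filter_upwards [c.open_source.mem_nhds h2] with x hx using hχs x hx
    · refine (contMDiffAt_const (c := (0 : ℝ))).congr_of_eventuallyEq ?_
      filter_upwards [hKc.isOpen_compl.mem_nhds hq] with x hx using hχK x hx
  · by_cases hqs : q ∈ c.source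
    · rw [hχs q hqs]
      exact hψI _
    · simp [hχ, if_neg hqs]
  · filter_upwards [c.open_source.mem_nhds hb, (c.continuousAt hb).eventually hψ1] with q h2 h3
    rw [hχs q h2, h3]
  · have h2 : χ ∘ c.symm =ᶠ[𝓝 y] ψ := by
      filter_upwards [c.open_target.mem_nhds hy] with z hz
      rw [Function.comp_apply, hχs _ (c.map_target hz), c.right_inv hz]
    have h3 : MDifferentiableAt (𝓡 2) 𝓘(ℝ, ℝ) χ (c.symm y) := by
      have h4 : ContMDiffAt (𝓡 2) 𝓘(ℝ, ℝ) ∞ (fun q => ψ (c q)) (c.symm y) :=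
        hψs.contMDiff.contMDiffAt.comp _ (chart_contMDiffAt hc (c.map_target hy))
      refine (h4.congr_of_eventuallyEq ?_).mdifferentiableAt (by simp)
      filter_upwards [c.open_source.mem_nhds (c.map_target hy)] with x hx using hχs x hx
    rw [formComp_diffForm hc hy h3, h2.fderiv_eq]
    exact hψb y k

theorem IsDensity.abs_surfaceIntegral_le [T2Space S] [CompactSpace S]
    {w : OpenPartialHomeomorph S Plane → Plane → ℝ} (hw : IsDensity w) (hwc : IsContinuousDensity w)
    (hc : IsChart c) {y₀ : Plane} {r K : ℝ} (hr : 0 ≤ r) (hball : Metric.closedBall y₀ r ⊆ c.target)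
    (hsupp : ∀ c' y, w c' y ≠ 0 → c'.symm y ∈ c.source ∧ c (c'.symm y) ∈ Metric.closedBall y₀ r)
    (hK : ∀ y ∈ Metric.closedBall y₀ r, |w c y| ≤ K) :
    |surfaceIntegral w| ≤ K * (r ^ 2 * volume.real (Metric.ball (0 : Plane) 1)) := by
  have hcomp : IsCompact (c.symm '' Metric.closedBall y₀ r) :=
    (isCompact_closedBall y₀ r).image_of_continuousOn (c.continuousOn_symm.mono hball)
  have h1 := hw.surfaceIntegral_eq hc
    (fun c' _ y _ hy => by
      by_contra h
      exact hy (hsupp c' y h).1)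
    (integrableOn_target_of_compact (hwc c hc) hcomp (by
      rintro _ ⟨y, hy, rfl⟩
      exact c.map_target (hball hy)) fun y hy hyK => by
        by_contra h
        refine hyK ⟨y, ?_, rfl⟩
        have h2 := (hsupp c y h).2
        rwa [c.right_inv hy] at h2)
  have h2 : ∫ y in c.target, w c y = ∫ y in Metric.closedBall y₀ r, w c y := by
    refine setIntegral_eq_of_subset_of_forall_sdiff_eq_zero c.open_target.measurableSet hball
      fun y hy => ?_
    by_contra h
    have h2 := (hsupp c y h).2
    rw [c.right_inv hy.1] at h2
    exact hy.2 h2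
  rw [h1, h2, ← Real.norm_eq_abs]
  refine (norm_setIntegral_le_of_norm_le_const (isCompact_closedBall y₀ r).measure_lt_top
    hK).trans (le_of_eq ?_)
  rw [Measure.addHaar_real_closedBall _ _ hr]
  simp

end Cutoff

/-! ## The first variation of area of lagrangian surfaces -/

section FirstVariationForms

variable {L : ℝ → S → N} {ε : ℝ}

/-- The form `ω(X, dℓ ·)` of a variation with velocity `X`. -/
def deformForm (g : Metric (E := E) N) (L : ℝ → S → N) : OneForm S := fun q =>
  (fundamentalForm g (L 0 q) (velocity (E := E) L q)).comp (mfderiv (𝓡 2) 𝓘(ℝ, E) (L 0) q)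

variable (hL : ContMDiffOn (𝓘(ℝ, ℝ).prod (𝓡 2)) 𝓘(ℝ, E) ∞ (fun q : ℝ × S => L q.1 q.2)
      (Ioo (-ε) ε ×ˢ univ))
include hL

theorem formComp_deformForm (hc : IsChart c) (he : e ∈ atlas E N) (hε : 0 < ε)
    (hy : y ∈ c.target) (hye : L 0 (c.symm y) ∈ e.source) (k : Fin 2) :
    formComp (deformForm g L) c y k = inChart g.inner e (chartRep (L 0) c e y)
      (Complex.I • fderiv ℝ (fun q : ℝ × Plane => chartRep (L q.1) c e q.2) (0, y)
        ((1 : ℝ), (0 : Plane))) (partialVec (chartRep (L 0) c e) y k) := by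
  have h0 : (0 : ℝ) ∈ Ioo (-ε) ε := ⟨by linarith, hε⟩
  have he' := isChart_of_mem_atlas he
  have hℓ := (variation_contMDiff hL h0).contMDiffAt (x := c.symm y)
  rw [partialVec, ← metric_mfderiv hc he' hy hℓ hye, mfderiv_symm_I he (y := chartRep (L 0) c e y)
    (e.map_source hye), ← velocity_chart hL hc he' hε hy hye, mfderiv_comp_chart_symm hc hy hℓ]
  rfl

theorem isSmoothForm_velocityForm (hε : 0 < ε) (q : S) : IsSmoothForm (velocityForm g L) q := by
  intro c hc y hy _ k
  have h0 : (0 : ℝ) ∈ Ioo (-ε) ε := ⟨by linarith, hε⟩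
  have hℓ := variation_contMDiff hL h0
  have he := isChart_chartAt (F := E) (L 0 (c.symm y))
  set e := chartAt E (L 0 (c.symm y))
  have hye : L 0 (c.symm y) ∈ e.source := mem_chart_source E _
  have hu := contDiffAt_chartRep hc he hy hℓ.contMDiffAt hye
  have hdu : ContDiffAt ℝ ∞ (fderiv ℝ (chartRep (L 0) c e)) y := hu.fderiv_right (by simp)
  have hX : ContDiffAt ℝ ∞ (fun z => fderiv ℝ (fun q : ℝ × Plane => chartRep (L q.1) c e q.2)
      (0, z) ((1 : ℝ), (0 : Plane))) y := by
    have h1 : ContDiffAt ℝ ∞ (fderiv ℝ (fun q : ℝ × Plane => chartRep (L q.1) c e q.2)) (0, y) :=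
      (variation_chart_contDiffAt hL hc he h0 hy hye).fderiv_right (by simp)
    exact (ContDiffAt.comp (f := fun z : Plane => ((0 : ℝ), z)) y h1
      (contDiffAt_const.prodMk contDiffAt_id)).clm_apply contDiffAt_const
  have h1 : ContDiffAt ℝ ∞ (fun z => inChart g.inner e (chartRep (L 0) c e z)
      (fderiv ℝ (fun q : ℝ × Plane => chartRep (L q.1) c e q.2) (0, z) ((1 : ℝ), (0 : Plane)))
      (partialVec (chartRep (L 0) c e) z k)) y :=
    ((((isMetricOn_inChart g he).contDiffAt (e.map_source hye)).comp y hu).clm_apply hX).clm_apply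
      (hdu.clm_apply contDiffAt_const)
  refine h1.congr_of_eventuallyEq ?_
  have h2 : ∀ᶠ z in 𝓝 y, L 0 (c.symm z) ∈ e.source :=
    (ContinuousAt.comp (g := L 0) hℓ.continuous.continuousAt (c.continuousAt_symm hy)).eventually
      (e.open_source.mem_nhds hye)
  filter_upwards [c.open_target.mem_nhds hy, h2] with z hz hz'
  exact formComp_velocityForm hL hc he hε hz hz' k

/-- The lagrangian condition enters here: the term `⟨H, X⟩ dA` of the general formula becomes the
pairing of `ω(X, ·)` with `ω(H, ·)`. -/
theorem areaVariation_eq (hε : 0 < ε) (hKahler : IsKahler g) (b : Module.Basis (Fin 2) ℂ E)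
    (hlag : IsLagrangian g (L 0)) (hc : IsChart c) (hy : y ∈ c.target)
    (himm : IsImmersedAt (E := E) (L 0) (c.symm y)) : areaVariation g L c y =
      fderiv ℝ (fluxDensity g (L 0) (velocityForm g L) c 0) y (basisVec 0)
      + fderiv ℝ (fluxDensity g (L 0) (velocityForm g L) c 1) y (basisVec 1)
      - pairingDensity g (L 0) (deformForm g L) (meanForm g (L 0)) c y := by
  have h0 : (0 : ℝ) ∈ Ioo (-ε) ε := ⟨by linarith, hε⟩
  have hℓ := variation_contMDiff hL h0
  have he : chartAt E (L 0 (c.symm y)) ∈ atlas E N := chart_mem_atlas E _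
  set e := chartAt E (L 0 (c.symm y))
  have he' := isChart_of_mem_atlas he
  have hye : L 0 (c.symm y) ∈ e.source := mem_chart_source E _
  rw [areaVariation, fderiv_areaSq hL hc he' hε hy hye himm, sqrt_mul_meanCurv_apply
    (isKahlerOn_inChart hKahler he) (e.map_source hye)
    ((isImmersedAt_iff_gramDet_pos hc he' hy hℓ.contMDiffAt hye g).1 himm)
    (lagrangian_chartRep hc he hy hℓ.contMDiffAt hye hlag) b, pairingDensity,
    inducedMetric_eq_gram hc he' hy hℓ.contMDiffAt hye]
  congr 2
  · funext k
    exact (formComp_deformForm hL hc he hε hy hye k).symm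
  · funext k
    exact (formComp_meanForm hℓ hc he hy hye himm k).symm

end FirstVariationForms

/-! ## Families of cutoff functions -/

section CutoffFamily

theorem IsCutoff.mono {C : ℝ} {b : S} {O O' : Set S} {r : ℝ}
    {χ : S → ℝ} (h : IsCutoff C c b O r χ) (hO : O ⊆ O') : IsCutoff C c b O' r χ :=
  { h with subset := h.subset.trans hO }

theorem IsCutoff.mem {C : ℝ} {b : S} {O : Set S} {r : ℝ}
    {χ : S → ℝ} (h : IsCutoff C c b O r χ) : b ∈ O :=
  h.subset (subset_tsupport _ (by
    rw [Function.mem_support, h.eventually_eq_one.self_of_nhds]; exact one_ne_zero))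

theorem IsCutoff.eventually_diffForm {C : ℝ} {b : S}
    {O : Set S} {r : ℝ} {χ : S → ℝ} (h : IsCutoff C c b O r χ) : ∀ᶠ q in 𝓝 b, diffForm χ q = 0 := by
  filter_upwards [h.eventually_eq_one.eventually_nhds] with q hq
  rw [diffForm_congr hq, diffForm_const]

theorem eventually_diffForm_eq_zero {χ : S → ℝ} {q : S} (h : q ∉ tsupport χ) :
    ∀ᶠ x in 𝓝 q, diffForm χ x = 0 := by
  filter_upwards [(notMem_tsupport_iff_eventuallyEq.1 h).eventually_nhds] with x hx
  rw [diffForm_congr (f' := fun _ => 0) hx, diffForm_const]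

theorem eventually_of_punctured_chart {b : S}
    (hb : b ∈ c.source) {P : Plane → Prop} (h : ∀ᶠ y in 𝓝[≠] (c b), P y) :
    ∀ᶠ q in 𝓝 b, q ≠ b → P (c q) := by
  filter_upwards [(c.continuousAt hb).eventually (eventually_nhdsWithin_iff.1 h),
    c.open_source.mem_nhds hb] with q h1 h2 h3
  exact h1 fun h4 => h3 (c.injOn h2 hb h4)

/-- The function `1 - ∑ χ_b`. -/
def cutoffCompl (B : Finset S) (χ : S → S → ℝ) (q : S) : ℝ := 1 - ∑ b ∈ B, χ b q

variable {B : Finset S} {C : S → ℝ} {c : S → OpenPartialHomeomorph S Plane} {O : S → Set S}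
  {r : S → ℝ} {χ : S → S → ℝ} (hχ : ∀ b ∈ B, IsCutoff (C b) (c b) b (O b) (r b) (χ b))
  (hO : (B : Set S).PairwiseDisjoint O)
include hχ hO

theorem notMem_tsupport_cutoff {b b' q : S} (hb : b ∈ B) (hb' : b' ∈ B) (hq : q ∈ O b)
    (hne : b' ≠ b) : q ∉ tsupport (χ b') := fun h =>
  (hO hb' hb hne).le_bot ⟨(hχ b' hb').subset h, hq⟩

theorem cutoffCompl_eq {b q : S} (hb : b ∈ B) (hq : q ∈ O b) : cutoffCompl B χ q = 1 - χ b q := by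
  rw [cutoffCompl, Finset.sum_eq_single_of_mem b hb fun b' hb' hne =>
    image_eq_zero_of_notMem_tsupport (notMem_tsupport_cutoff hχ hO hb hb' hq hne)]

theorem cutoffCompl_eq_one {q : S} (hq : ∀ b ∈ B, q ∉ O b) : cutoffCompl B χ q = 1 := by
  rw [cutoffCompl, Finset.sum_eq_zero fun b hb => image_eq_zero_of_notMem_tsupport fun h =>
    hq b hb ((hχ b hb).subset h), sub_zero]

theorem cutoffCompl_mem_Icc (q : S) : cutoffCompl B χ q ∈ Icc (0 : ℝ) 1 := by
  by_cases h : ∃ b ∈ B, q ∈ O b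
  · obtain ⟨b, hb, hq⟩ := h
    rw [cutoffCompl_eq hχ hO hb hq]
    obtain ⟨h1, h2⟩ := (hχ b hb).mem_Icc q
    constructor <;> linarith
  · rw [cutoffCompl_eq_one hχ hO fun b hb hq => h ⟨b, hb, hq⟩]
    simp

theorem eventually_cutoffCompl_eq_zero (hOo : ∀ b ∈ B, IsOpen (O b)) {b : S} (hb : b ∈ B) :
    ∀ᶠ q in 𝓝 b, cutoffCompl B χ q = 0 := by
  filter_upwards [(hOo b hb).mem_nhds (hχ b hb).mem, (hχ b hb).eventually_eq_one] with q h1 h2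
  rw [cutoffCompl_eq hχ hO hb h1, h2, sub_self]

omit hO

theorem contMDiff_cutoffCompl : ContMDiff (𝓡 2) 𝓘(ℝ, ℝ) ∞ (cutoffCompl B χ) :=
  contMDiff_const.sub (contMDiff_finsetSum fun b hb => (hχ b hb).smooth)

theorem formComp_diffForm_cutoffCompl {c' : OpenPartialHomeomorph S Plane}
    (hc : IsChart c') (hy : y ∈ c'.target) (k : Fin 2) :
    formComp (diffForm (cutoffCompl B χ)) c' y k = -∑ b ∈ B, formComp (diffForm (χ b)) c' y k := by
  rw [formComp_diffForm hc hy ((contMDiff_cutoffCompl hχ).contMDiffAt.mdifferentiableAt (by simp))]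
  have h1 : cutoffCompl B χ ∘ c'.symm = fun z => 1 - ∑ b ∈ B, (χ b ∘ c'.symm) z := rfl
  rw [h1, fderiv_const_sub, fderiv_fun_sum fun b hb =>
    (contDiffAt_comp_symm (hχ b hb).smooth hc hy).differentiableAt (by simp), neg_apply, sum_apply]
  congr 1
  refine Finset.sum_congr rfl fun b hb => ?_
  rw [formComp_diffForm hc hy ((hχ b hb).smooth.contMDiffAt.mdifferentiableAt (by simp))]

end CutoffFamily

/-! ### Passing to the limit in integrals against cutoff functions -/

section CutoffIntegrals

variable [T2Space S] [CompactSpace S]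

theorem surfaceIntegral_congr {w w' : OpenPartialHomeomorph S Plane → Plane → ℝ}
    (h : ∀ c ∈ IsManifold.maximalAtlas (𝓡 2) ∞ S, ∀ y ∈ c.target, w c y = w' c y) :
    surfaceIntegral w = surfaceIntegral w' := by
  refine finsum_congr fun p => setIntegral_congr_fun (chartAt Plane p).open_target.measurableSet
    fun y hy => ?_
  simp only [h _ (isChart_chartAt p) y hy]

theorem surfaceIntegral_neg (w : OpenPartialHomeomorph S Plane → Plane → ℝ) :
    surfaceIntegral (fun c y => -w c y) = -surfaceIntegral w := by
  simp only [surfaceIntegral, mul_neg, integral_neg, finsum_neg_distrib]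

/-- A density whose integrals against cutoff functions are arbitrarily small has integral zero. -/
theorem surfaceIntegral_eq_zero_of_cutoff {w : OpenPartialHomeomorph S Plane → Plane → ℝ}
    (hw : ∀ p : S, IntegrableOn (fun y => chartPartition S p ((chartAt Plane p).symm y) *
      w (chartAt Plane p) y) (chartAt Plane p).target) {B : Finset S}
    {c : S → OpenPartialHomeomorph S Plane} (hc : ∀ b ∈ B, b ∈ (c b).source)
    (h : ∀ δ > 0, ∃ φ : S → ℝ, Continuous φ ∧ (∀ q, φ q ∈ Icc (0 : ℝ) 1) ∧
      (∀ q, φ q ≠ 1 → ∃ b ∈ B, q ∈ (c b).source ∧ dist (c b q) (c b b) ≤ δ) ∧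
      |surfaceIntegral (fun c y => φ (c.symm y) * w c y)| ≤ δ) : surfaceIntegral w = 0 := by
  choose φ hφc hφI hφ1 hφ using fun n : ℕ => h (1 / ((n : ℝ) + 1)) (by positivity)
  have hlim := tendsto_one_div_add_atTop_nhds_zero_nat (𝕜 := ℝ)
  have h0 : Tendsto (fun n => surfaceIntegral (fun c y => φ n (c.symm y) * w c y)) atTop (𝓝 0) :=
    squeeze_zero_norm hφ hlim
  refine tendsto_nhds_unique ?_ h0
  obtain ⟨T, hT, -⟩ := exists_finset_chartPartition S
  simp only [surfaceIntegral_eq_sum hT]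
  refine tendsto_finsetSum T fun p _ => ?_
  have hcont : ∀ n, ContinuousOn (fun y => φ n ((chartAt Plane p).symm y))
      (chartAt Plane p).target := fun n =>
    (hφc n).comp_continuousOn (chartAt Plane p).continuousOn_symm
  have hm := (chartAt Plane p).open_target.measurableSet
  refine (tendsto_integral_of_dominated_convergence (fun y =>
    ‖chartPartition S p ((chartAt Plane p).symm y) * w (chartAt Plane p) y‖) (fun n => ?_)
    (hw p).norm (fun n => ae_of_all _ fun y => ?_) ?_)
  · refine (((hcont n).aestronglyMeasurable hm).mul (hw p).aestronglyMeasurable).congr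
      (ae_of_all _ fun y => ?_)
    simp only [Pi.mul_apply]
    ring
  · rw [mul_left_comm, norm_mul]
    refine mul_le_of_le_one_left (norm_nonneg _) ?_
    rw [Real.norm_eq_abs, abs_of_nonneg (hφI n _).1]
    exact (hφI n _).2
  -- The functions `φ n` differ from `1` only in discs of radius `1 / (n + 1)` about the finitely
  -- many points of `B`, so they are eventually `1` at every other point.
  · have hae : ∀ᵐ y ∂volume, y ∉ chartAt Plane p '' (B : Set S) :=
      ((B.countable_toSet).image _).ae_notMem volume
    filter_upwards [ae_restrict_of_ae hae, ae_restrict_mem hm] with y hyB hy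
    refine tendsto_const_nhds.congr' ?_
    have h1 : ∀ᶠ n : ℕ in atTop, ∀ b ∈ B, ¬((chartAt Plane p).symm y ∈ (c b).source ∧
        dist (c b ((chartAt Plane p).symm y)) (c b b) ≤ 1 / ((n : ℝ) + 1)) := by
      refine (Filter.eventually_all_finset B).2 fun b hb => ?_
      by_cases hs : (chartAt Plane p).symm y ∈ (c b).source
      · have h2 : 0 < dist (c b ((chartAt Plane p).symm y)) (c b b) := dist_pos.2 fun h3 =>
          hyB ⟨b, hb, by
            rw [← (c b).injOn hs (hc b hb) h3, (chartAt Plane p).right_inv hy]⟩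
        filter_upwards [hlim.eventually (gt_mem_nhds h2)] with n hn h4
        exact absurd h4.2 (not_le.2 hn)
      · exact Eventually.of_forall fun n h2 => hs h2.1
    filter_upwards [h1] with n hn
    have h2 : φ n ((chartAt Plane p).symm y) = 1 := by
      by_contra h3
      obtain ⟨b, hb, h4⟩ := hφ1 n _ h3
      exact hn b hb h4
    rw [h2, one_mul]

end CutoffIntegrals

/-! ## Branch points have zero capacity -/

section Capacity

theorem abs_pairing_le {h : Fin 2 → Fin 2 → ℝ} {M : ℝ}
    (hM : ∀ x i, |flux h x i| ≤ M * (|x 0| + |x 1|)) (α β : Fin 2 → ℝ) :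
    |pairing h α β| ≤ (|α 0| + |α 1|) * (M * (|β 0| + |β 1|)) := by
  rw [pairing, add_mul]
  refine (abs_add_le _ _).trans (add_le_add ?_ ?_)
  · rw [abs_mul]
    exact mul_le_mul_of_nonneg_left (hM β 0) (abs_nonneg _)
  · rw [abs_mul]
    exact mul_le_mul_of_nonneg_left (hM β 1) (abs_nonneg _)

variable [T2Space S] [CompactSpace S]

/-- Integrals of forms supported in small discs around a branch point. -/
theorem abs_surfaceIntegral_pairing_le (hℓ : ContMDiff (𝓡 2) 𝓘(ℝ, E) ∞ ℓ) {C : ℝ}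
    (hc : IsChart c) {b : S}
    (hb : b ∈ c.source) {O : Set S} {r : ℝ} {χ : S → ℝ} (hχ : IsCutoff C c b O r χ) {M A A' : ℝ}
    (hM : ∀ q ∈ O, q ∈ c.source → q ≠ b → ∀ x i,
      |flux (inducedMetric g ℓ c (c q)) x i| ≤ M * (|x 0| + |x 1|)) (hM0 : 0 ≤ M)
    {α β : OneForm S} (hα0 : ∀ q, diffForm χ q = 0 → α q = 0)
    (hα : ∀ q ∈ O, q ∈ c.source → q ≠ b → ∀ k, |formComp α c (c q) k| ≤ A)
    (hβ : ∀ q ∈ O, q ∈ c.source → q ≠ b → ∀ k, |formComp β c (c q) k| ≤ A')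
    (hA : 0 ≤ A) (hA' : 0 ≤ A') (hcont : IsContinuousDensity (pairingDensity g ℓ α β)) :
    |surfaceIntegral (pairingDensity g ℓ α β)| ≤
      4 * M * A * A' * (r ^ 2 * volume.real (Metric.ball (0 : Plane) 1)) := by
  have hzero : ∀ c' y, diffForm χ (c'.symm y) = 0 → pairingDensity g ℓ α β c' y = 0 := by
    intro c' y h
    simp [pairingDensity, pairing, formComp, hα0 _ h]
  refine (isDensity_pairingDensity hℓ α β).abs_surfaceIntegral_le hcont hc hχ.pos.le
    hχ.subset_target (fun c' y h => hχ.support _ ?_) fun y hy => ?_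
  · by_contra hq
    exact h (hzero c' y (eventually_diffForm_eq_zero hq).self_of_nhds)
  · have hyt := hχ.subset_target hy
    by_cases h : diffForm χ (c.symm y) = 0
    · rw [hzero c y h, abs_zero]
      positivity
    · have hqO : c.symm y ∈ O := hχ.subset (by
        by_contra hq
        exact h (eventually_diffForm_eq_zero hq).self_of_nhds)
      have hqb : c.symm y ≠ b := fun hq => h (by rw [hq]; exact hχ.eventually_diffForm.self_of_nhds)
      have hqs := c.map_target hyt
      have h1 := hM _ hqO hqs hqb
      have h2 := hα _ hqO hqs hqb
      have h3 := hβ _ hqO hqs hqb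
      rw [c.right_inv hyt] at h1 h2 h3
      refine (abs_pairing_le h1 _ _).trans ?_
      have h4 : |formComp α c y 0| + |formComp α c y 1| ≤ 2 * A := by linarith [h2 0, h2 1]
      have h5 : M * (|formComp β c y 0| + |formComp β c y 1|) ≤ M * (2 * A') :=
        mul_le_mul_of_nonneg_left (by linarith [h3 0, h3 1]) hM0
      calc _ ≤ (2 * A) * (M * (2 * A')) := mul_le_mul h4 h5 (by positivity) (by positivity)
        _ = 4 * M * A * A' := by ring

variable (hℓ : ContMDiff (𝓡 2) 𝓘(ℝ, E) ∞ ℓ)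
    (hc : IsChart c) {b : S}
    (hb : b ∈ c.source) {O : Set S} (hO : O ∈ 𝓝 b)
    (himm : ∀ q ∈ O, q ≠ b → IsImmersedAt (E := E) ℓ q) {M : ℝ} (hM0 : 0 ≤ M)
    (hM : ∀ᶠ y in 𝓝[≠] (c b), ∀ x i, |flux (inducedMetric g ℓ c y) x i| ≤ M * (|x 0| + |x 1|))
include hℓ hc hb hO himm hM0 hM

/-- The gradient is of order `1 / r`, the disc has area of order `r²` and `ξ` is bounded, so the
integral is at most `K r`. -/
theorem exists_cutoff_pairing_le {ξ : OneForm S} (hξ : ∀ q, IsSmoothForm ξ q) {δ : ℝ}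
    (hδ : 0 < δ) : ∃ C r χ, IsCutoff C c b O r χ ∧ r ≤ δ ∧
      IsContinuousDensity (pairingDensity g ℓ (diffForm χ) ξ) ∧
      |surfaceIntegral (pairingDensity g ℓ (diffForm χ) ξ)| ≤ δ := by
  obtain ⟨C, hC, hcut⟩ := exists_isCutoff (S := S)
  set A' := |formComp ξ c (c b) 0| + |formComp ξ c (c b) 1| + 1 with hA'
  have hA'0 : 0 ≤ A' := by positivity
  have hξb : ∀ᶠ y in 𝓝 (c b), ∀ k, |formComp ξ c y k| ≤ A' := by
    have h1 : ∀ k, ∀ᶠ y in 𝓝 (c b), |formComp ξ c y k| < |formComp ξ c (c b) k| + 1 := fun k =>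
      ((hξ _ c hc _ (c.map_source hb) rfl k).continuousAt.abs).eventually
        (gt_mem_nhds (lt_add_one _))
    filter_upwards [h1 0, h1 1] with y h2 h3 k
    fin_cases k
    · exact h2.le.trans (by rw [hA']; linarith [abs_nonneg (formComp ξ c (c b) 1)])
    · exact h3.le.trans (by rw [hA']; linarith [abs_nonneg (formComp ξ c (c b) 0)])
  set ν := volume.real (Metric.ball (0 : Plane) 1)
  have hν : 0 ≤ ν := measureReal_nonneg
  set K := 4 * M * C * A' * ν with hK
  have hK0 : 0 ≤ K := by positivity
  obtain ⟨r, hr, χ, hχ⟩ := hcut c hc b hb (O ∩ {q | (q ≠ b → ∀ x i,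
      |flux (inducedMetric g ℓ c (c q)) x i| ≤ M * (|x 0| + |x 1|)) ∧
      ∀ k, |formComp ξ c (c q) k| ≤ A'})
    (inter_mem hO ((eventually_of_punctured_chart hb hM).and ((c.continuousAt hb).eventually hξb)))
    (min δ (δ / (K + 1))) (lt_min hδ (by positivity))
  have hcont : IsContinuousDensity (pairingDensity g ℓ (diffForm χ) ξ) := by
    refine isContinuousDensity_pairing hℓ fun q => ?_
    by_cases hq : q ∈ tsupport χ
    · rcases eq_or_ne q b with rfl | hqb
      · exact Or.inl hχ.eventually_diffForm
      · exact Or.inr ⟨himm q (hχ.subset hq).1 hqb,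
          isSmoothForm_diffForm (Eventually.of_forall fun x => hχ.smooth.contMDiffAt), hξ q⟩
    · exact Or.inl (eventually_diffForm_eq_zero hq)
  refine ⟨C, r, χ, hχ.mono inter_subset_left, hr.trans (min_le_left _ _), hcont, ?_⟩
  have hrp := hχ.pos
  refine (abs_surfaceIntegral_pairing_le hℓ hc hb hχ (fun q hq _ hqb => hq.2.1 hqb) hM0
    (A := C / r) (A' := A') (fun q h => h) (fun q _ hqs _ k => ?_) (fun q hq _ _ => hq.2.2)
    (by positivity) hA'0 hcont).trans ?_
  · exact hχ.bound _ (c.map_source hqs) k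
  · have h1 : 4 * M * (C / r) * A' * (r ^ 2 * ν) = K * r := by
      rw [hK]; field_simp
    rw [h1]
    have h2 : r ≤ δ / (K + 1) := hr.trans (min_le_right _ _)
    rw [le_div_iff₀ (by positivity)] at h2
    nlinarith

/-- The energy of `χ` is scale invariant in dimension two: bounded, but not small as the radius
shrinks. The smallness comes from `|β| ≤ ε` on the support, which gives `K ε²`. -/
theorem exists_cutoff_smul_pairing_le {β : S → ℝ}
    (hβ : ∀ q ∈ O, q ≠ b → ∀ᶠ x in 𝓝 q, ContMDiffAt (𝓡 2) 𝓘(ℝ, ℝ) ∞ β x)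
    (hβ0 : Tendsto β (𝓝[≠] b) (𝓝 0)) {δ : ℝ} (hδ : 0 < δ) : ∃ C r χ, IsCutoff C c b O r χ ∧
      IsContinuousDensity (pairingDensity g ℓ (fun q => β q • diffForm χ q)
        (fun q => β q • diffForm χ q)) ∧
      |surfaceIntegral (pairingDensity g ℓ (fun q => β q • diffForm χ q)
        (fun q => β q • diffForm χ q))| ≤ δ := by
  obtain ⟨C, hC, hcut⟩ := exists_isCutoff (S := S)
  set ν := volume.real (Metric.ball (0 : Plane) 1)
  have hν : 0 ≤ ν := measureReal_nonneg
  set K := 4 * M * C ^ 2 * ν with hK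
  have hK0 : 0 ≤ K := by positivity
  set ε := min 1 (δ / (K + 1)) with hε
  have hε0 : 0 < ε := lt_min one_pos (by positivity)
  have hβε : ∀ᶠ q in 𝓝 b, q ≠ b → |β q| ≤ ε := by
    have h1 : ∀ᶠ q in 𝓝[≠] b, |β q| ≤ ε := by
      have h2 := hβ0.abs
      rw [abs_zero] at h2
      exact (h2.eventually (gt_mem_nhds hε0)).mono fun q hq => hq.le
    exact eventually_nhdsWithin_iff.1 h1
  obtain ⟨r, -, χ, hχ⟩ := hcut c hc b hb (O ∩ {q | (q ≠ b → ∀ x i,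
      |flux (inducedMetric g ℓ c (c q)) x i| ≤ M * (|x 0| + |x 1|)) ∧ (q ≠ b → |β q| ≤ ε)})
    (inter_mem hO ((eventually_of_punctured_chart hb hM).and hβε)) 1 one_pos
  have hcont : IsContinuousDensity (pairingDensity g ℓ (fun q => β q • diffForm χ q)
      (fun q => β q • diffForm χ q)) := by
    refine isContinuousDensity_pairing hℓ fun q => ?_
    by_cases hq : q ∈ tsupport χ
    · rcases eq_or_ne q b with rfl | hqb
      · exact Or.inl (hχ.eventually_diffForm.mono fun x hx => by rw [hx, smul_zero])
      · have h1 : IsSmoothForm (fun q => β q • diffForm χ q) q :=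
          (isSmoothForm_diffForm (Eventually.of_forall fun x => hχ.smooth.contMDiffAt)).smul
            (hβ q (hχ.subset hq).1 hqb).self_of_nhds
        exact Or.inr ⟨himm q (hχ.subset hq).1 hqb, h1, h1⟩
    · exact Or.inl ((eventually_diffForm_eq_zero hq).mono fun x hx => by rw [hx, smul_zero])
  refine ⟨C, r, χ, hχ.mono inter_subset_left, hcont, ?_⟩
  have hrp := hχ.pos
  have hbd : ∀ q ∈ O ∩ {q | (q ≠ b → ∀ x i,
      |flux (inducedMetric g ℓ c (c q)) x i| ≤ M * (|x 0| + |x 1|)) ∧ (q ≠ b → |β q| ≤ ε)},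
      q ∈ c.source → q ≠ b → ∀ k,
        |formComp (fun q => β q • diffForm χ q) c (c q) k| ≤ ε * (C / r) := by
    intro q hq hqs hqb k
    have h1 : formComp (fun q => β q • diffForm χ q) c (c q) k =
        β (c.symm (c q)) * formComp (diffForm χ) c (c q) k := rfl
    rw [h1, c.left_inv hqs, abs_mul]
    exact mul_le_mul (hq.2.2 hqb) (hχ.bound _ (c.map_source hqs) k) (abs_nonneg _) hε0.le
  refine (abs_surfaceIntegral_pairing_le hℓ hc hb hχ (fun q hq _ hqb => hq.2.1 hqb) hM0
    (fun q h => by rw [h, smul_zero]) hbd hbd (by positivity) (by positivity) hcont).trans ?_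
  have h1 : 4 * M * (ε * (C / r)) * (ε * (C / r)) * (r ^ 2 * ν) = K * (ε * ε) := by
    rw [hK]; field_simp
  rw [h1]
  have h2 : ε ≤ δ / (K + 1) := min_le_right _ _
  have h3 : ε ≤ 1 := min_le_left _ _
  rw [le_div_iff₀ (by positivity)] at h2
  nlinarith [mul_nonneg hK0 (mul_nonneg hε0.le (sub_nonneg.2 h3))]

end Capacity

/-! ## Minimal surfaces are stationary -/

section Minimal

variable [T2Space S] [CompactSpace S]

/-- With `H = 0` the derivative of the density is the divergence of the tangential velocity.
Integrating by parts against the complement of small discs about the branch points leaves only terms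
supported in these discs. -/
theorem isStationary_of_minimal (hKahler : IsKahler g) (hEinstein : IsEinstein g)
    (b₀ : Module.Basis (Fin 2) ℂ E) (hℓ : IsBranchedLagrangianImmersion g ℓ)
    (hmin : ∀ p : S, IsImmersedAt (E := E) ℓ p → meanCurvature g ℓ p = 0) : IsStationary g ℓ := by
  rintro ε L ⟨hε, hL0, hL⟩
  subst hL0
  have hs := hℓ.branched.smooth
  have hfin := finite_not_immersed hKahler hEinstein b₀ hℓ
  obtain ⟨hint, hder⟩ := hasDerivAt_area (g := g) hL hε hfin.countable
  set B : Finset S := hfin.toFinset with hBdef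
  have hB : ∀ p, p ∈ B ↔ ¬IsImmersedAt (E := E) (L 0) p := fun p => hfin.mem_toFinset
  obtain ⟨O, hO, hOd⟩ := hfin.t2_separation
  have hOd' : (B : Set S).PairwiseDisjoint O := by rwa [hfin.coe_toFinset]
  have himm : ∀ b ∈ B, ∀ q ∈ O b, q ≠ b → IsImmersedAt (E := E) (L 0) q := by
    intro b hb q hq hqb
    by_contra h
    exact (hOd ((hB b).1 hb) h (Ne.symm hqb)).le_bot ⟨hq, (hO q).1⟩
  have hbr : ∀ b, ∃ (c : OpenPartialHomeomorph S Plane) (M : ℝ), b ∈ B →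
      IsChart c ∧ b ∈ c.source ∧ 0 ≤ M ∧
      ∀ᶠ y in 𝓝[≠] (c b), ∀ x i,
        |flux (inducedMetric g (L 0) c y) x i| ≤ M * (|x 0| + |x 1|) := by
    intro b
    by_cases hb : b ∈ B
    · obtain ⟨c, hc, hbc, -, ⟨M, hM, hflux⟩, -⟩ :=
        exists_branch_chart hKahler hEinstein b₀ hℓ ((hB b).1 hb)
      exact ⟨c, M, fun _ => ⟨hc, hbc, hM, hflux⟩⟩
    · exact ⟨chartAt Plane b, 0, fun h => absurd h hb⟩
  choose c M hcM using hbr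
  set ξ := velocityForm g L with hξ
  have hξs : ∀ q, IsSmoothForm ξ q := isSmoothForm_velocityForm hL hε
  suffices h : surfaceIntegral (areaVariation g L) = 0 by
    rwa [h] at hder
  refine surfaceIntegral_eq_zero_of_cutoff hint (B := B) (c := c) (fun b hb => (hcM b hb).2.1)
    fun δ hδ => ?_
  -- The error is shared among the branch points. The `1` avoids a zero denominator when there are
  -- none.
  have hδ' : 0 < δ / ((B.card : ℝ) + 1) := by positivity
  have hcut : ∀ b, ∃ C r χ, b ∈ B → IsCutoff C (c b) b (O b) r χ ∧
      r ≤ δ / ((B.card : ℝ) + 1) ∧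
      IsContinuousDensity (pairingDensity g (L 0) (diffForm χ) ξ) ∧
      |surfaceIntegral (pairingDensity g (L 0) (diffForm χ) ξ)| ≤ δ / ((B.card : ℝ) + 1) := by
    intro b
    by_cases hb : b ∈ B
    · obtain ⟨hc, hbc, hM, hflux⟩ := hcM b hb
      obtain ⟨C, r, χ, h⟩ := exists_cutoff_pairing_le hs hc hbc ((hO b).2.mem_nhds (hO b).1)
        (himm b hb) hM hflux hξs hδ'
      exact ⟨C, r, χ, fun _ => h⟩
    · exact ⟨0, 0, fun _ => 0, fun h => absurd h hb⟩
  choose C r χ hχ' using hcut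
  have hχ : ∀ b ∈ B, IsCutoff (C b) (c b) b (O b) (r b) (χ b) := fun b hb => (hχ' b hb).1
  set φ := cutoffCompl B χ with hφ
  have hφs : ContMDiff (𝓡 2) 𝓘(ℝ, ℝ) ∞ φ := contMDiff_cutoffCompl hχ
  have hφ0 : ∀ b ∈ B, ∀ᶠ q in 𝓝 b, φ q = 0 := fun b hb =>
    eventually_cutoffCompl_eq_zero hχ hOd' (fun b _ => (hO b).2) hb
  refine ⟨φ, hφs.continuous, cutoffCompl_mem_Icc hχ hOd', fun q hq => ?_, ?_⟩
  · by_contra! h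
    refine hq ?_
    rw [hφ, cutoffCompl, Finset.sum_eq_zero fun b hb => ?_, sub_zero]
    refine image_eq_zero_of_notMem_tsupport fun hqt => ?_
    obtain ⟨h1, h2⟩ := (hχ b hb).support q hqt
    have h3 : δ / ((B.card : ℝ) + 1) ≤ δ := div_le_self hδ.le (by
      have : (0 : ℝ) ≤ B.card := by positivity
      linarith)
    exact (h b hb h1).not_ge ((Metric.mem_closedBall.1 h2).trans ((hχ' b hb).2.1.trans h3))
  · have himmφ : ∀ q, ¬(φ =ᶠ[𝓝 q] fun _ => 0) → IsImmersedAt (E := E) (L 0) q := by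
      intro q hq
      by_contra h
      exact hq (hφ0 q ((hB q).2 h))
    -- At the branch points the divergence formula is not available, but `φ` vanishes there.
    -- Elsewhere the mean curvature term is zero.
    have h1 : surfaceIntegral (fun c y => φ (c.symm y) * areaVariation g L c y) =
        surfaceIntegral (fun c y => φ (c.symm y) *
          (fderiv ℝ (fluxDensity g (L 0) ξ c 0) y (basisVec 0)
          + fderiv ℝ (fluxDensity g (L 0) ξ c 1) y (basisVec 1))) := by
      refine surfaceIntegral_congr fun c hc y hy => ?_
      by_cases hq : φ =ᶠ[𝓝 (c.symm y)] fun _ => 0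
      · simp [hq.self_of_nhds]
      · have hi := himmφ _ hq
        rw [areaVariation_eq hL hε hKahler b₀ hℓ.lagrangian hc hy hi]
        have h2 : meanForm g (L 0) (c.symm y) = 0 := by
          rw [meanForm, hmin _ hi]
          exact (congrArg (fun A : E →L[ℝ] ℝ => A.comp (mfderiv (𝓡 2) 𝓘(ℝ, E) (L 0) (c.symm y)))
            (map_zero (fundamentalForm g (L 0 (c.symm y))))).trans
            (ContinuousLinearMap.zero_comp _)
        have h3 : pairingDensity g (L 0) (deformForm g L) (meanForm g (L 0)) c y = 0 := by
          simp [pairingDensity, pairing, flux, formComp, h2]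
        rw [h3, sub_zero]
    have h4 : surfaceIntegral (pairingDensity g (L 0) (diffForm φ) ξ) =
        -∑ b ∈ B, surfaceIntegral (pairingDensity g (L 0) (diffForm (χ b)) ξ) := by
      rw [← surfaceIntegral_sum B fun b hb => (hχ' b hb).2.2.1, ← surfaceIntegral_neg]
      refine surfaceIntegral_congr fun c hc y hy => ?_
      simp only [pairingDensity, pairing, hφ, formComp_diffForm_cutoffCompl hχ hc hy,
        Finset.sum_add_distrib, ← Finset.sum_mul]
      ring
    rw [h1, surfaceIntegral_divergence hs hφs (fun c hc y hy hq i => ?_), h4, neg_neg]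
    · calc |∑ b ∈ B, surfaceIntegral (pairingDensity g (L 0) (diffForm (χ b)) ξ)|
          ≤ ∑ b ∈ B, |surfaceIntegral (pairingDensity g (L 0) (diffForm (χ b)) ξ)| :=
            Finset.abs_sum_le_sum_abs _ _
        _ ≤ ∑ b ∈ B, δ / ((B.card : ℝ) + 1) := Finset.sum_le_sum fun b hb => (hχ' b hb).2.2.2
        _ ≤ δ := by
            rw [Finset.sum_const, nsmul_eq_mul, mul_div_assoc', div_le_iff₀ (by positivity)]
            nlinarith
    · refine (contDiffAt_fluxDensity hs hc hy (himmφ _ fun h => ?_) (hξs _ c hc y hy rfl) i).of_le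
        (by exact_mod_cast le_top)
      exact notMem_tsupport_iff_eventuallyEq.2 h hq

end Minimal

/-! ## Testing lagrangian stationarity -/

section LagrangianTest

variable [T2Space N] [SigmaCompactSpace N]
  [T2Space S] [CompactSpace S]

theorem form_eq_of_formComp {α α' : OneForm S} (hc : IsChart c) {q : S} (hq : q ∈ c.source)
    (h : ∀ k, formComp α c (c q) k = formComp α' c (c q) k) : α q = α' q := by
  have hl : c.symm (c q) = q := c.left_inv hq
  have h1 : ∀ v : TangentSpace (𝓡 2) q, ∃ w : Plane, ∀ γ : OneForm S,
      γ q v = w 0 * formComp γ c (c q) 0 + w 1 * formComp γ c (c q) 1 := by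
    intro v
    refine ⟨mfderiv (𝓡 2) (𝓡 2) c q v, fun γ => ?_⟩
    have h2 := mfderiv_symm_mfderiv hc hq v
    have h3 := map_eq_sum_basisVec (F := ℝ)
      ((γ (c.symm (c q))).comp (mfderiv (𝓡 2) (𝓡 2) c.symm (c q)) : Plane →L[ℝ] ℝ)
      (mfderiv (𝓡 2) (𝓡 2) c q v)
    simp only [smul_eq_mul] at h3
    refine Eq.trans ?_ h3
    have h4 : ∀ (x : S) (_ : x = q) (w : Plane), w = v → γ q v = (γ x : Plane →L[ℝ] ℝ) w := by
      rintro x rfl w rfl; rfl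
    exact h4 _ hl _ h2
  refine ContinuousLinearMap.ext fun v => ?_
  obtain ⟨w, hw⟩ := h1 v
  rw [hw α, hw α', h, h]

/-- Local primitives in a chart give local primitives on the surface. -/
theorem eq_diffForm_of_chart {α : OneForm S}
    (hc : IsChart c) {q : S} (hq : q ∈ c.source) {β : Plane → ℝ}
    (hβ : ContDiffAt ℝ ∞ β (c q)) (h : ∀ k, formComp α c (c q) k = fderiv ℝ β (c q) (basisVec k)) :
    ContMDiffAt (𝓡 2) 𝓘(ℝ, ℝ) ∞ (fun x => β (c x)) q ∧ α q = diffForm (fun x => β (c x)) q := by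
  have h1 : ContMDiffAt (𝓡 2) 𝓘(ℝ, ℝ) ∞ (fun x => β (c x)) q :=
    hβ.contMDiffAt.comp q (chart_contMDiffAt hc hq)
  refine ⟨h1, form_eq_of_formComp hc hq fun k => ?_⟩
  have hy := c.map_source hq
  rw [h k, formComp_diffForm hc hy
    (by rw [c.left_inv hq]; exact h1.mdifferentiableAt (by simp))]
  have h2 : (fun x => β (c x)) ∘ c.symm =ᶠ[𝓝 (c q)] β := by
    filter_upwards [c.open_target.mem_nhds hy] with z hz
    rw [Function.comp_apply, c.right_inv hz]
  rw [h2.fderiv_eq]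

/-- The primitive of the test form near a branch point. The square of `1 - χ` is what makes the
resulting form fit the completed square. -/
theorem diffForm_sq_mul {χ β : S → ℝ} {q : S} (hχ : ContMDiffAt (𝓡 2) 𝓘(ℝ, ℝ) ∞ χ q)
    (hβ : ContMDiffAt (𝓡 2) 𝓘(ℝ, ℝ) ∞ β q) : diffForm (fun x => (1 - χ x) ^ 2 / 2 * β x) q =
      ((1 - χ q) ^ 2 / 2) • diffForm β q - ((1 - χ q) * β q) • diffForm χ q := by
  set c := chartAt Plane q
  have hc : IsChart c := isChart_chartAt q
  have hq : q ∈ c.source := mem_chart_source Plane q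
  have hy := c.map_source hq
  have hl : c.symm (c q) = q := c.left_inv hq
  have hm : ∀ {f : S → ℝ}, ContMDiffAt (𝓡 2) 𝓘(ℝ, ℝ) ∞ f q →
      ContMDiffAt (𝓡 2) 𝓘(ℝ, ℝ) ∞ f (c.symm (c q)) := fun hf => by rwa [hl]
  have hd : ∀ {f : S → ℝ}, ContMDiffAt (𝓡 2) 𝓘(ℝ, ℝ) ∞ f q →
      HasFDerivAt (f ∘ c.symm) (fderiv ℝ (f ∘ c.symm) (c q)) (c q) := fun hf =>
    ((ContMDiffAt.comp _ (hm hf) (chart_symm_contMDiffAt hc hy)).contDiffAt.differentiableAt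
      (by simp)).hasFDerivAt
  have hF : ContMDiffAt (𝓡 2) 𝓘(ℝ, ℝ) ∞ (fun x => (1 - χ x) ^ 2 / 2 * β x) q := by
    have h1 : ContDiff ℝ ∞ fun z : ℝ × ℝ => (1 - z.1) ^ 2 / 2 * z.2 := by fun_prop
    exact h1.contMDiff.contMDiffAt.comp q (hχ.prodMk_space hβ)
  have key := (((((hd hχ).const_sub 1).pow 2).mul_const (1 / 2 : ℝ)).mul (hd hβ)).fderiv
  let α' : OneForm S := fun x => ((1 - χ x) ^ 2 / 2) • diffForm β x -
    ((1 - χ x) * β x) • diffForm χ x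
  refine form_eq_of_formComp (α' := α') hc hq fun k => ?_
  have h2 : formComp α' c (c q) k =
      ((1 - χ (c.symm (c q))) ^ 2 / 2) * formComp (diffForm β) c (c q) k -
      ((1 - χ (c.symm (c q))) * β (c.symm (c q))) * formComp (diffForm χ) c (c q) k := rfl
  rw [h2, formComp_diffForm hc hy ((hm hF).mdifferentiableAt (by simp)),
    formComp_diffForm hc hy ((hm hβ).mdifferentiableAt (by simp)),
    formComp_diffForm hc hy ((hm hχ).mdifferentiableAt (by simp))]
  have h3 : (fun x => (1 - χ x) ^ 2 / 2 * β x) ∘ c.symm =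
      (fun y => (1 - (χ ∘ c.symm) y) ^ 2 * (1 / 2 : ℝ)) * (β ∘ c.symm) := by
    funext y
    simp only [Function.comp_apply, Pi.mul_apply]
    ring
  rw [h3]
  refine (DFunLike.congr_fun key (basisVec k)).trans ?_
  simp
  ring

/-- The variation realising `η` has zero derivative of area. Its velocity vanishes near the branch
points, so the flux of its tangential part is `C¹` on the whole closed surface and its divergence
integrates to zero. What is left is the integral of `⟨η, σ⟩`. -/
theorem surfaceIntegral_pairing_eq_zero (hKahler : IsKahler g) (hEinstein : IsEinstein g)
    (b₀ : Module.Basis (Fin 2) ℂ E) (hℓ : IsBranchedLagrangianImmersion g ℓ)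
    (hstat : IsLagrangianStationary g ℓ) {η : OneForm S} {f : S → S → ℝ}
    (hf : ∀ p, ∀ᶠ q in 𝓝 p, ContMDiffAt (𝓡 2) 𝓘(ℝ, ℝ) ∞ (f p) q ∧ η q = diffForm (f p) q)
    (hη : ∀ p, ¬IsImmersedAt (E := E) ℓ p → ∀ᶠ q in 𝓝 p, η q = 0)
    (hcont : IsContinuousDensity (pairingDensity g ℓ η (meanForm g ℓ))) :
    surfaceIntegral (pairingDensity g ℓ η (meanForm g ℓ)) = 0 := by
  have hfin := finite_not_immersed hKahler hEinstein b₀ hℓ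
  obtain ⟨ε, L, hvar, hlagr, hconst, hω⟩ := exists_lagrangian_variation hKahler hℓ
    (isOpen_immersed g hℓ.branched.smooth) hf hη
  have hder := hstat ε L hvar hlagr
  obtain ⟨hε, hL0, hL⟩ := hvar
  subst hL0
  have hs := hℓ.branched.smooth
  have hA : surfaceIntegral (areaVariation g L) = 0 :=
    (hasDerivAt_area (g := g) hL hε hfin.countable).2.unique hder
  have hdef : deformForm g L = η := by
    funext q
    exact ContinuousLinearMap.ext fun v => hω q v
  set ξ := velocityForm g L with hξ
  have hξs : ∀ q, IsSmoothForm ξ q := isSmoothForm_velocityForm hL hε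
  have hξ0 : ∀ p, ¬IsImmersedAt (E := E) (L 0) p → ∀ᶠ q in 𝓝 p, ξ q = 0 := by
    intro p hp
    have h1 : Tendsto (fun q : S => ((0 : ℝ), q)) (𝓝 p) (𝓝 (0, p)) :=
      (Continuous.prodMk continuous_const continuous_id).tendsto p
    filter_upwards [h1.eventually (hconst p hp).eventually_nhds] with q hq
    have h2 : Tendsto (fun t : ℝ => (t, q)) (𝓝 0) (𝓝 (0, q)) :=
      (Continuous.prodMk continuous_id continuous_const).tendsto 0
    have h3 : (fun t => L t q) =ᶠ[𝓝 0] fun _ => L 0 q := h2.eventually hq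
    have h4 : velocity (E := E) L q = 0 := by
      rw [velocity, h3.mfderiv_eq, mfderiv_const]
      rfl
    rw [hξ, velocityForm, h4, map_zero]
    exact ContinuousLinearMap.zero_comp _
  have hV : ∀ c ∈ IsManifold.maximalAtlas (𝓡 2) ∞ S, ∀ y ∈ c.target, ∀ i,
      ContDiffAt ℝ 1 (fluxDensity g (L 0) ξ c i) y ∧ (¬IsImmersedAt (E := E) (L 0) (c.symm y) →
        fderiv ℝ (fluxDensity g (L 0) ξ c i) y = 0) := by
    intro c hc y hy i
    by_cases hi : IsImmersedAt (E := E) (L 0) (c.symm y)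
    · exact ⟨(contDiffAt_fluxDensity hs hc hy hi (hξs _ c hc y hy rfl) i).of_le
        (by exact_mod_cast le_top), fun h => absurd hi h⟩
    · have h1 : fluxDensity g (L 0) ξ c i =ᶠ[𝓝 y] fun _ => 0 := by
        filter_upwards [(c.continuousAt_symm hy).eventually (hξ0 _ hi)] with z hz
        fin_cases i <;> simp [fluxDensity, flux, formComp, hz]
      exact ⟨contDiffAt_const.congr_of_eventuallyEq h1, fun _ => by
        rw [h1.fderiv_eq, fderiv_const_apply]⟩
  set D : OpenPartialHomeomorph S Plane → Plane → ℝ := fun c y =>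
    fderiv ℝ (fluxDensity g (L 0) ξ c 0) y (basisVec 0)
      + fderiv ℝ (fluxDensity g (L 0) ξ c 1) y (basisVec 1) with hD
  have hDc : IsContinuousDensity D := by
    intro c hc y hy
    have h1 : ∀ i, ContinuousAt (fun z => fderiv ℝ (fluxDensity g (L 0) ξ c i) z (basisVec i)) y :=
      fun i => (((hV c hc y hy i).1.fderiv_right (m := 0) (by simp)).continuousAt).clm_apply
        continuousAt_const
    exact ((h1 0).add (h1 1)).continuousWithinAt
  have hDint : surfaceIntegral D = 0 := by
    have h1 := surfaceIntegral_divergence (g := g) hs (ξ := ξ) (θ := fun _ => 1) contMDiff_const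
      fun c hc y hy _ i => (hV c hc y hy i).1
    have h2 : surfaceIntegral (pairingDensity g (L 0) (diffForm fun _ : S => (1 : ℝ)) ξ) = 0 := by
      have h3 : ∀ c y, pairingDensity g (L 0) (diffForm fun _ : S => (1 : ℝ)) ξ c y = 0 := by
        intro c y
        simp [pairingDensity, pairing, formComp, diffForm_const]
      simp [surfaceIntegral, h3]
    rw [h2, neg_zero] at h1
    simpa only [one_mul] using h1
  have hsplit : surfaceIntegral (areaVariation g L) = surfaceIntegral (fun c y => D c y -
      pairingDensity g (L 0) η (meanForm g (L 0)) c y) := by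
    refine surfaceIntegral_congr fun c hc y hy => ?_
    by_cases hi : IsImmersedAt (E := E) (L 0) (c.symm y)
    · rw [areaVariation_eq hL hε hKahler b₀ hℓ.lagrangian hc hy hi, hdef]
    -- At a branch point all three terms are zero: the first because of the quotient by zero, the
    -- others because `η` and the flux vanish nearby.
    · have h1 : areaVariation g L c y = 0 := by
        have h2 : areaSq g L c (0, y) ≤ 0 := by
          rw [inducedMetric_det_pos (g := g) hs hc hy, not_lt] at hi
          exact hi
        rw [areaVariation, Real.sqrt_eq_zero_of_nonpos h2, mul_zero, div_zero]
      have h3 : pairingDensity g (L 0) η (meanForm g (L 0)) c y = 0 := by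
        simp [pairingDensity, pairing, formComp, (hη _ hi).self_of_nhds]
      simp only [h1, h3, hD, (hV c hc y hy _).2 hi]
      simp
  rw [hA, surfaceIntegral_sub hDc hcont, hDint] at hsplit
  linarith

end LagrangianTest

/-! ## Lagrangian stationary surfaces are minimal -/

section LagrangianStationary

theorem IsDensity.eq_zero_of_surfaceIntegral_nonpos [T2Space S] [CompactSpace S]
    {w : OpenPartialHomeomorph S Plane → Plane → ℝ} (hw : IsDensity w) (hwc : IsContinuousDensity w)
    (hc : IsChart c) {K : Set S} (hK : IsCompact K)
    (hKc : K ⊆ c.source) (hsupp : ∀ c' y, c'.symm y ∉ K → w c' y = 0) (hpos : ∀ y, 0 ≤ w c y)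
    (h : surfaceIntegral w ≤ 0) : ∀ y ∈ c.target, w c y = 0 := by
  have hint := integrableOn_target_of_compact (hwc c hc) hK hKc fun y _ hy => hsupp c y hy
  rw [hw.surfaceIntegral_eq hc (fun c' _ y _ hy => hsupp c' y fun h => hy (hKc h)) hint] at h
  have h1 := (setIntegral_eq_zero_iff_of_nonneg_ae (ae_of_all _ hpos) hint).1
    (le_antisymm h (integral_nonneg hpos))
  exact fun y hy => Measure.eqOn_open_of_ae_eq h1 c.open_target (hwc c hc) continuousOn_const hy

variable [T2Space N] [SigmaCompactSpace N]
  [T2Space S] [CompactSpace S]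

/-- The mean curvature form has a primitive near every point, in the complement of the branch
points, and this primitive tends to zero at the branch points. -/
theorem exists_meanForm_primitive (hKahler : IsKahler g) (hEinstein : IsEinstein g)
    (b₀ : Module.Basis (Fin 2) ℂ E) (hℓ : IsBranchedLagrangianImmersion g ℓ) (p : S) :
    ∃ β : S → ℝ, (∀ᶠ q in 𝓝 p, IsImmersedAt (E := E) ℓ p ∨ q ≠ p →
      ContMDiffAt (𝓡 2) 𝓘(ℝ, ℝ) ∞ β q ∧ meanForm g ℓ q = diffForm β q) ∧
      (¬IsImmersedAt (E := E) ℓ p → Tendsto β (𝓝[≠] p) (𝓝 0) ∧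
        ∃ c ∈ IsManifold.maximalAtlas (𝓡 2) ∞ S, p ∈ c.source ∧ ∃ M, 0 ≤ M ∧
          ∀ᶠ y in 𝓝[≠] (c p), ∀ x i, |flux (inducedMetric g ℓ c y) x i| ≤ M * (|x 0| + |x 1|)) := by
  by_cases hp : IsImmersedAt (E := E) ℓ p
  · obtain ⟨β, hβ⟩ := exists_primitive_meanForm hKahler hEinstein b₀ hℓ hp
    have hps := mem_chart_source Plane p
    refine ⟨fun q => β (chartAt Plane p q), ?_, fun h => absurd hp h⟩
    filter_upwards [((chartAt Plane p).continuousAt hps).eventually hβ,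
      (chartAt Plane p).open_source.mem_nhds hps] with q h1 h2 _
    exact eq_diffForm_of_chart (isChart_chartAt p) h2 h1.1 h1.2
  · obtain ⟨c, hc, hps, -, ⟨M, hM, hflux⟩, β, hβ0, hβ⟩ :=
      exists_branch_chart hKahler hEinstein b₀ hℓ hp
    refine ⟨fun q => β (c q), ?_, fun _ => ⟨hβ0.comp ?_, c, hc, hps, M, hM, hflux⟩⟩
    · filter_upwards [eventually_of_punctured_chart hps hβ, c.open_source.mem_nhds hps]
        with q h1 h2 h3
      have h4 := h1 (h3.resolve_left hp)
      exact eq_diffForm_of_chart hc h2 h4.1 h4.2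
    · exact tendsto_nhdsWithin_of_tendsto_nhds_of_eventually_within _
        ((c.continuousAt hps).tendsto.mono_left nhdsWithin_le_nhds)
        (eventually_nhdsWithin_iff.2
          (eventually_of_punctured_chart (P := (· ∈ ({c p}ᶜ : Set Plane))) hps
            self_mem_nhdsWithin))

/-- The test form depends on the accuracy `δ` through the cutoffs. Hence the quantity shown to have
nonpositive integral is a fixed one, `|σ|² / 4` localised near `q₀`, compared pointwise with `⟨η,
σ⟩` and the errors `|β dχ|²` for every `δ`. -/
theorem minimal_of_isLagrangianStationary (hKahler : IsKahler g) (hEinstein : IsEinstein g)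
    (b₀ : Module.Basis (Fin 2) ℂ E) (hℓ : IsBranchedLagrangianImmersion g ℓ)
    (hstat : IsLagrangianStationary g ℓ) {q₀ : S} (hq₀ : IsImmersedAt (E := E) ℓ q₀) :
    meanCurvature g ℓ q₀ = 0 := by
  have hs := hℓ.branched.smooth
  have hfin := finite_not_immersed hKahler hEinstein b₀ hℓ
  set B : Finset S := hfin.toFinset with hBdef
  have hB : ∀ p, p ∈ B ↔ ¬IsImmersedAt (E := E) ℓ p := fun p => hfin.mem_toFinset
  have hcoe : (B : Set S) = {p | ¬IsImmersedAt (E := E) ℓ p} := hfin.coe_toFinset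
  set σ := meanForm g ℓ with hσ
  choose β hβ hβ' using exists_meanForm_primitive hKahler hEinstein b₀ hℓ
  -- `q₀` is separated together with the branch points, so that the cutoffs at the latter do not
  -- reach the neighbourhood of `q₀`.
  obtain ⟨U, hU, hUd⟩ := (hfin.insert q₀).t2_separation
  have hUB : ∀ p ∈ insert q₀ (B : Set S), ∀ q ∈ U p, q ≠ p → q ∉ B := by
    intro p hp q hq hqp hqB
    rw [hcoe] at hp
    exact (hUd hp (mem_insert_of_mem _ ((hB q).1 hqB)) (Ne.symm hqp)).le_bot ⟨hq, (hU q).1⟩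
  have hqB : q₀ ∉ B := fun h => (hB q₀).1 h hq₀
  have hσs : ∀ q, IsImmersedAt (E := E) ℓ q → IsSmoothForm σ q := fun q hq =>
    (isSmoothForm_diffForm ((hβ q).mono fun x hx => (hx (Or.inl hq)).1)).congr
      ((hβ q).mono fun x hx => (hx (Or.inl hq)).2)
  -- The neighbourhoods are shrunk until the primitive `β b` is valid on each of them, except at `b`
  -- itself.
  set O : S → Set S := fun b => U b ∩ {q | ∀ᶠ x in 𝓝 q, IsImmersedAt (E := E) ℓ b ∨ x ≠ b →
    ContMDiffAt (𝓡 2) 𝓘(ℝ, ℝ) ∞ (β b) x ∧ σ x = diffForm (β b) x} with hOdef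
  have hOo : ∀ b, IsOpen (O b) := fun b => (hU b).2.inter isOpen_setOfPred_eventually_nhds
  have hOb : ∀ b, b ∈ O b := fun b => ⟨(hU b).1, hβ b⟩
  have hOd : (B : Set S).PairwiseDisjoint O := by
    rw [hcoe]
    exact (hUd.subset (subset_insert _ _)).mono fun b => inter_subset_left
  have hOβ : ∀ b ∈ B, ∀ q ∈ O b, q ≠ b → IsImmersedAt (E := E) ℓ q ∧
      ∀ᶠ x in 𝓝 q, ContMDiffAt (𝓡 2) 𝓘(ℝ, ℝ) ∞ (β b) x ∧ σ x = diffForm (β b) x := by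
    intro b hb q hq hqb
    refine ⟨not_not.1 fun h => hUB b (mem_insert_of_mem _ hb) q hq.1 hqb ((hB q).2 h), ?_⟩
    filter_upwards [hq.2, isOpen_ne.mem_nhds hqb] with x h1 h2 using h1 (Or.inr h2)
  -- a cutoff function around the point `q₀`
  obtain ⟨C₀, -, hcut₀⟩ := exists_isCutoff (S := S)
  set c₀ := chartAt Plane q₀
  have hc₀ : IsChart c₀ := isChart_chartAt q₀
  have hq₀s : q₀ ∈ c₀.source := mem_chart_source Plane q₀
  obtain ⟨r₀, -, χ₀, hχ₀⟩ := hcut₀ c₀ hc₀ q₀ hq₀s (U q₀) ((hU q₀).2.mem_nhds (hU q₀).1) 1 one_pos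
  have hUq : ∀ q ∈ U q₀, IsImmersedAt (E := E) ℓ q ∧ ∀ b ∈ B, q ∉ O b := by
    intro q hq
    refine ⟨?_, fun b hb hqb => ?_⟩
    · rcases eq_or_ne q q₀ with rfl | hne
      · exact hq₀
      · exact not_not.1 fun h => hUB q₀ (mem_insert _ _) q hq hne ((hB q).2 h)
    · have hne : q₀ ≠ b := fun h => hqB (h ▸ hb)
      exact (hUd (mem_insert _ _) (mem_insert_of_mem _ ((hB b).1 hb)) hne).le_bot ⟨hq, hqb.1⟩
  -- The factor `1 / 4` is the coefficient of `|σ|²` in the completed square.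
  set w : OpenPartialHomeomorph S Plane → Plane → ℝ :=
    pairingDensity g ℓ (fun q => (χ₀ q / 4) • σ q) σ with hw
  have hwapp : ∀ c y, w c y = χ₀ (c.symm y) / 4 * pairingDensity g ℓ σ σ c y := by
    intro c y
    have h1 : ∀ k, formComp (fun q => (χ₀ q / 4) • σ q) c y k =
        χ₀ (c.symm y) / 4 * formComp σ c y k := fun k => rfl
    simp only [hw, pairingDensity, pairing, h1]
    ring
  have hwc : IsContinuousDensity w := by
    refine isContinuousDensity_pairing hs fun q => ?_
    by_cases hq : q ∈ tsupport χ₀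
    · have hi := (hUq q (hχ₀.subset hq)).1
      exact Or.inr ⟨hi, (hσs q hi).smul (hχ₀.smooth.contMDiffAt.div_const 4), hσs q hi⟩
    · refine Or.inl ((notMem_tsupport_iff_eventuallyEq.1 hq).mono fun x hx => ?_)
      simp only [hx, Pi.zero_apply, zero_div, zero_smul]
  have hPnn : ∀ α c y, 0 ≤ pairingDensity g ℓ α α c y := fun α c y =>
    pairing_self_nonneg (inducedMetric_self_nonneg g ℓ c y 0) (inducedMetric_self_nonneg g ℓ c y 1) _
  have hwint : surfaceIntegral w ≤ 0 := by
    refine le_of_forall_pos_le_add fun δ hδ => ?_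
    rw [zero_add]
    have hδ' : 0 < δ / ((B.card : ℝ) + 1) := by positivity
    have hcut : ∀ b, ∃ c C r χ, b ∈ B → IsCutoff C c b (O b) r χ ∧
        IsContinuousDensity (pairingDensity g ℓ (fun q => β b q • diffForm χ q)
          (fun q => β b q • diffForm χ q)) ∧
        |surfaceIntegral (pairingDensity g ℓ (fun q => β b q • diffForm χ q)
          (fun q => β b q • diffForm χ q))| ≤ δ / ((B.card : ℝ) + 1) := by
      intro b
      by_cases hb : b ∈ B
      · obtain ⟨h0, c, hc, hbc, M, hM, hflux⟩ := hβ' b ((hB b).1 hb)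
        obtain ⟨C, r, χ, h⟩ := exists_cutoff_smul_pairing_le hs hc hbc ((hOo b).mem_nhds (hOb b))
          (fun q hq hqb => (hOβ b hb q hq hqb).1) hM hflux
          (fun q hq hqb => (hOβ b hb q hq hqb).2.mono fun x hx => hx.1) h0 hδ'
        exact ⟨c, C, r, χ, fun _ => h⟩
      · exact ⟨chartAt Plane b, 0, 0, fun _ => 0, fun h => absurd h hb⟩
    choose c C r χ hχ' using hcut
    have hχ : ∀ b ∈ B, IsCutoff (C b) (c b) b (O b) (r b) (χ b) := fun b hb => (hχ' b hb).1
    set φ := cutoffCompl B χ with hφ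
    set τ : S → OneForm S := fun b q => β b q • diffForm (χ b) q with hτ
    -- Near a branch point `b` this is `d((1 - χ b)² β b / 2)`, and away from the discs it is `σ /
    -- 2`. It is locally exact although a global primitive of `σ` need not exist.
    set η : OneForm S := fun q => (φ q ^ 2 / 2) • σ q - φ q • ∑ b ∈ B, τ b q with hη
    have hφ0 : ∀ b ∈ B, ∀ᶠ q in 𝓝 b, φ q = 0 := fun b hb =>
      eventually_cutoffCompl_eq_zero hχ hOd (fun b _ => hOo b) hb
    have hη0 : ∀ p, ¬IsImmersedAt (E := E) ℓ p → ∀ᶠ q in 𝓝 p, η q = 0 := by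
      intro p hp
      filter_upwards [hφ0 p ((hB p).2 hp)] with q hq
      simp only [hη, hq]
      simp
    have hτ0 : ∀ b ∈ B, ∀ b' ∈ B, b' ≠ b → ∀ q ∈ O b, τ b' q = 0 := by
      intro b hb b' hb' hne q hq
      simp only [hτ]
      rw [(eventually_diffForm_eq_zero
        (notMem_tsupport_cutoff hχ hOd hb hb' hq hne)).self_of_nhds, smul_zero]
    have hτ1 : ∀ q, (∀ b ∈ B, q ∉ O b) → ∀ b ∈ B, τ b q = 0 := by
      intro q hq b hb
      simp only [hτ]
      rw [(eventually_diffForm_eq_zero fun h => hq b hb ((hχ b hb).subset h)).self_of_nhds,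
        smul_zero]
    have hηO : ∀ b ∈ B, ∀ q ∈ O b, η q = ((1 - χ b q) ^ 2 / 2) • σ q -
        ((1 - χ b q) * β b q) • diffForm (χ b) q := by
      intro b hb q hq
      simp only [hη]
      rw [hφ, cutoffCompl_eq hχ hOd hb hq, Finset.sum_eq_single_of_mem b hb
        fun b' hb' hne => hτ0 b hb b' hb' hne q hq, mul_smul]
    have hex : ∀ p, ∃ f : S → ℝ, ∀ᶠ q in 𝓝 p,
        ContMDiffAt (𝓡 2) 𝓘(ℝ, ℝ) ∞ f q ∧ η q = diffForm f q := by
      intro p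
      have hsm : ∀ {χ' β' : S → ℝ} {q : S}, ContMDiffAt (𝓡 2) 𝓘(ℝ, ℝ) ∞ χ' q →
          ContMDiffAt (𝓡 2) 𝓘(ℝ, ℝ) ∞ β' q →
          ContMDiffAt (𝓡 2) 𝓘(ℝ, ℝ) ∞ (fun x => (1 - χ' x) ^ 2 / 2 * β' x) q := by
        intro χ' β' q h1 h2
        have h3 : ContDiff ℝ ∞ fun z : ℝ × ℝ => (1 - z.1) ^ 2 / 2 * z.2 := by fun_prop
        exact h3.contMDiff.contMDiffAt.comp q (h1.prodMk_space h2)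
      by_cases hp : p ∈ B
      · refine ⟨fun _ => 0, (hη0 p ((hB p).1 hp)).mono fun q hq => ⟨contMDiffAt_const, ?_⟩⟩
        rw [hq, diffForm_const]
      by_cases hpO : ∃ b ∈ B, p ∈ O b
      · obtain ⟨b, hb, hpb⟩ := hpO
        have hne : p ≠ b := fun h => hp (h ▸ hb)
        refine ⟨fun x => (1 - χ b x) ^ 2 / 2 * β b x, ?_⟩
        filter_upwards [(hOβ b hb p hpb hne).2, (hOo b).mem_nhds hpb] with q h1 h2
        have h3 := (hχ b hb).smooth.contMDiffAt (x := q)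
        exact ⟨hsm h3 h1.1, by rw [hηO b hb q h2, h1.2, diffForm_sq_mul h3 h1.1]⟩
      · have h1 : ∀ᶠ q in 𝓝 p, ∀ b ∈ B, χ b q = 0 ∧ diffForm (χ b) q = 0 := by
          refine (Filter.eventually_all_finset B).2 fun b hb => ?_
          have h2 : p ∉ tsupport (χ b) := fun h => hpO ⟨b, hb, (hχ b hb).subset h⟩
          exact (notMem_tsupport_iff_eventuallyEq.1 h2).and (eventually_diffForm_eq_zero h2)
        -- Outside the discs the primitive is `β p / 2`, written with the zero cutoff so that the
        -- same formula for the differential applies.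
        refine ⟨fun x => (1 - (fun _ => 0 : S → ℝ) x) ^ 2 / 2 * β p x, ?_⟩
        filter_upwards [hβ p, h1] with q h2 h3
        have h4 := h2 (Or.inl (not_not.1 fun h => hp ((hB p).2 h)))
        refine ⟨hsm contMDiffAt_const h4.1, ?_⟩
        rw [diffForm_sq_mul contMDiffAt_const h4.1, diffForm_const, smul_zero, ← h4.2]
        simp only [hη]
        rw [Finset.sum_eq_zero fun b hb => by simp only [hτ, (h3 b hb).2, smul_zero], hφ,
          cutoffCompl, Finset.sum_eq_zero fun b hb => (h3 b hb).1, smul_zero]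
    choose f hf using hex
    have hηc : IsContinuousDensity (pairingDensity g ℓ η σ) := by
      refine isContinuousDensity_pairing hs fun q => ?_
      by_cases hq : IsImmersedAt (E := E) ℓ q
      · exact Or.inr ⟨hq, (isSmoothForm_diffForm ((hf q).mono fun x hx => hx.1)).congr
          ((hf q).mono fun x hx => hx.2), hσs q hq⟩
      · exact Or.inl (hη0 q hq)
    have hzero := surfaceIntegral_pairing_eq_zero hKahler hEinstein b₀ hℓ hstat hf hη0 hηc
    have hτc : ∀ b ∈ B, IsContinuousDensity (pairingDensity g ℓ (τ b) (τ b)) := fun b hb =>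
      (hχ' b hb).2.1
    -- The completed square holds at each point. The neighbourhoods `O b` are disjoint, so at most
    -- one `τ b` is nonzero and the square of the sum has no cross terms; on the support of `χ₀` the
    -- complement `φ` equals `1`.
    have hpt : ∀ c ∈ IsManifold.maximalAtlas (𝓡 2) ∞ S, ∀ y ∈ c.target,
        w c y - pairingDensity g ℓ η σ c y ≤ ∑ b ∈ B, pairingDensity g ℓ (τ b) (τ b) c y := by
      intro c hc y hy
      set q := c.symm y with hq
      let T : OneForm S := fun q => ∑ b ∈ B, τ b q
      have h1 := pairing_ge_of_complete_square (inducedMetric_self_nonneg g ℓ c y 0)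
        (inducedMetric_self_nonneg g ℓ c y 1) (φ q) (formComp σ c y) (formComp T c y)
      have h2 : pairingDensity g ℓ η σ c y = pairing (inducedMetric g ℓ c y)
          (fun k => φ q ^ 2 / 2 * formComp σ c y k - φ q * formComp T c y k)
          (formComp σ c y) := rfl
      have h3 : w c y ≤ φ q ^ 2 / 4 * pairing (inducedMetric g ℓ c y) (formComp σ c y)
          (formComp σ c y) := by
        rw [hwapp]
        refine mul_le_mul_of_nonneg_right ?_ (hPnn σ c y)
        by_cases hqU : q ∈ U q₀
        · rw [hφ, cutoffCompl_eq_one hχ hOd (hUq q hqU).2]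
          linarith [(hχ₀.mem_Icc q).2]
        · rw [image_eq_zero_of_notMem_tsupport fun h => hqU (hχ₀.subset h), zero_div]
          positivity
      have h4 : pairing (inducedMetric g ℓ c y) (formComp T c y) (formComp T c y) =
          ∑ b ∈ B, pairingDensity g ℓ (τ b) (τ b) c y := by
        have h5 : ∀ b, τ b q = 0 → pairingDensity g ℓ (τ b) (τ b) c y = 0 := fun b hb => by
          have hb' : τ b (c.symm y) = 0 := hb
          simp only [pairingDensity, pairing, formComp, hb', zero_apply, zero_mul, add_zero]
        by_cases hqO : ∃ b ∈ B, q ∈ O b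
        · obtain ⟨b, hb, hqb⟩ := hqO
          have h6 := fun b' hb' hne => hτ0 b hb b' hb' hne q hqb
          have h7 : T q = τ b q := Finset.sum_eq_single_of_mem b hb h6
          rw [Finset.sum_eq_single_of_mem b hb fun b' hb' hne => h5 b' (h6 b' hb' hne)]
          have h8 : formComp T c y = formComp (τ b) c y := by
            funext k
            rw [formComp, formComp, ← hq, h7]
          rw [h8]
          rfl
        · have h6 := hτ1 q fun b hb hqb => hqO ⟨b, hb, hqb⟩
          have h7 : T q = 0 := Finset.sum_eq_zero h6
          rw [Finset.sum_eq_zero fun b hb => h5 b (h6 b hb)]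
          have h8 : T (c.symm y) = 0 := h7
          simp only [pairing, formComp, h8, zero_apply, zero_mul, add_zero]
      linarith
    have hmono := surfaceIntegral_mono (w := fun c y => w c y - pairingDensity g ℓ η σ c y)
      (w' := fun c y => ∑ b ∈ B, pairingDensity g ℓ (τ b) (τ b) c y)
      (fun c hc => (hwc c hc).sub (hηc c hc))
      (fun c hc => continuousOn_finsetSum B fun b hb => hτc b hb c hc) hpt
    rw [surfaceIntegral_sub hwc hηc, hzero, sub_zero, surfaceIntegral_sum B hτc] at hmono
    calc surfaceIntegral w ≤ ∑ b ∈ B, surfaceIntegral (pairingDensity g ℓ (τ b) (τ b)) := hmono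
      _ ≤ ∑ b ∈ B, δ / ((B.card : ℝ) + 1) :=
          Finset.sum_le_sum fun b hb => (le_abs_self _).trans (hχ' b hb).2.2
      _ ≤ δ := by
          rw [Finset.sum_const, nsmul_eq_mul, mul_div_assoc', div_le_iff₀ (by positivity)]
          nlinarith
  -- A continuous nonnegative density with nonpositive integral vanishes. At `q₀`, where `χ₀ = 1`
  -- and the induced metric is nondegenerate, this gives `σ = 0`.
  have hw0 := (isDensity_pairingDensity hs _ _).eq_zero_of_surfaceIntegral_nonpos hwc hc₀
    (isClosed_tsupport χ₀).isCompact (fun q hq => (hχ₀.support q hq).1)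
    (fun c' y hy => by
      change w c' y = 0
      rw [hwapp, image_eq_zero_of_notMem_tsupport hy, zero_div, zero_mul])
    (fun y => by
      change 0 ≤ w c₀ y
      rw [hwapp]
      exact mul_nonneg (div_nonneg (hχ₀.mem_Icc _).1 (by norm_num)) (hPnn σ c₀ y)) hwint
    (c₀ q₀) (c₀.map_source hq₀s)
  have hl : c₀.symm (c₀ q₀) = q₀ := c₀.left_inv hq₀s
  change w c₀ (c₀ q₀) = 0 at hw0
  rw [hwapp, hl, hχ₀.eventually_eq_one.self_of_nhds] at hw0
  have hi : IsImmersedAt (E := E) ℓ (c₀.symm (c₀ q₀)) := by rwa [hl]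
  have hy₀ := c₀.map_source hq₀s
  have hσ0 := eq_zero_of_pairing_self_eq_zero (inducedMetric_self_nonneg g ℓ c₀ (c₀ q₀) 1)
    ((inducedMetric_det_pos (g := g) hs hc₀ hy₀).1 hi) (α := formComp σ c₀ (c₀ q₀))
    (by simpa [pairingDensity] using hw0)
  have he : chartAt E (ℓ q₀) ∈ atlas E N := chart_mem_atlas E _
  have hye : ℓ (c₀.symm (c₀ q₀)) ∈ (chartAt E (ℓ q₀)).source := by
    rw [hl]; exact mem_chart_source E _
  rw [meanCurvature_eq_meanCurv hs q₀]
  exact meanCurv_eq_zero (isKahlerOn_inChart hKahler he) ((chartAt E (ℓ q₀)).map_source hye)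
    ((isImmersedAt_iff_gramDet_pos hc₀ (isChart_of_mem_atlas he) hy₀ hs.contMDiffAt
      hye g).1 hi).ne'
    (lagrangian_chartRep hc₀ he hy₀ hs.contMDiffAt hye hℓ.lagrangian) b₀ fun k =>
      (formComp_meanForm hs hc₀ he hy₀ hye hi k).symm.trans (hσ0 k)

end LagrangianStationary

end

end KESurface

theorem lemma8p2
    {E : Type*} [NormedAddCommGroup E] [NormedSpace ℂ E] (hE : Module.finrank ℂ E = 2)
    {N : Type*} [TopologicalSpace N] [T2Space N] [SecondCountableTopology N]
    [ChartedSpace E N] [IsManifold 𝓘(ℂ, E) ω N]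
    (g : KESurface.Metric (E := E) N)
    (hKahler : KESurface.IsKahler g) (hEinstein : KESurface.IsEinstein g)
    {S : Type*} [TopologicalSpace S] [T2Space S] [CompactSpace S]
    [ChartedSpace KESurface.Plane S] [IsManifold (𝓡 2) ∞ S]
    (ℓ : S → N) (hℓ : KESurface.IsBranchedLagrangianImmersion g ℓ) :
    (KESurface.IsStationary g ℓ ↔ KESurface.IsLagrangianStationary g ℓ) ∧
    (KESurface.IsStationary g ℓ ↔
      ∀ p : S, KESurface.IsImmersedAt (E := E) ℓ p → KESurface.meanCurvature g ℓ p = 0) := by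
  haveI : FiniteDimensional ℂ E := Module.finite_of_finrank_pos (by omega)
  haveI : FiniteDimensional ℝ E := FiniteDimensional.complexToReal E
  -- With second countability this makes `N` σ-compact, which the bump coverings behind the
  -- Euclidean immersion require.
  haveI : LocallyCompactSpace N := ChartedSpace.locallyCompactSpace E N
  have b : Module.Basis (Fin 2) ℂ E := Module.finBasisOfFinrankEq ℂ E hE
  have hmin : KESurface.IsLagrangianStationary g ℓ →
      ∀ p : S, KESurface.IsImmersedAt (E := E) ℓ p → KESurface.meanCurvature g ℓ p = 0 :=
    fun h _ hp => KESurface.minimal_of_isLagrangianStationary hKahler hEinstein b hℓ h hp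
  have hstat := KESurface.isStationary_of_minimal hKahler hEinstein b hℓ
  have hlag : KESurface.IsStationary g ℓ → KESurface.IsLagrangianStationary g ℓ :=
    fun h ε L hL _ => h ε L hL
  exact ⟨⟨hlag, fun h => hstat (hmin h)⟩, ⟨fun h => hmin (hlag h), hstat⟩⟩
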